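/- **Notation.** Let $d\ge 0$ and $n\ge 1$ be integers. For a function $\zeta$ on $\mathbb R^d$, a real $t\neq 0$ and an integer $K\ge 0$ put $$\zeta_t(x)=\frac1{|t|^d}\,\zeta(t^{-1}x),\qquad c_K(\zeta)=\sup_{x\in\mathbb R^d}(1+|x|)^K\sup_{|\alpha|\le K}|\partial^\alpha\zeta(x)|.$$ Let $\Psi,\Phi^1,\dots,\Phi^n\in\mathcal S(\mathbb R^d)$ be complex-valued Schwartz functions such that the support of $\widehat\Psi$ is contained in a corona $\{a\le|\xi|\le b\}$ with $0<a\le b<\infty$ and the supports of the $\widehat{\Phi^i}$ are bounded. Let $L\in L^\infty(0,\infty)$ be complex-valued, $\rho=(\rho_1,\dots,\rho_n)\in(0,1]^n$ and $\lambda=(\lambda_1,\dots,\lambda_n)\in(\mathbb R\setminus\{0\})^n$. The continuous model operator is $$U_{\rho,\lambda,L}(f_1,\dots,f_n)(x)=\int_0^\infty L(t)\int_{\mathbb R^d}\Psi_t(y)\prod_{i=1}^n\big[\Phi^i_{\lambda_i t}*f_i\big](x-\rho_i\lambda_i y)\,dy\,\frac{dt}{t}.$$ **Theorem 5.1.** For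 all $d$ and $n$ there are an integer $M$ and a constant $C\ge 0$, depending only on $d$ and $n$, such that for all $\Psi,\Phi^i,L,\rho,\lambda$ as above with $$|\lambda_n|=\max\{|\lambda_i| : 1\le i\le n\}$$ the following holds. For all $f_1,\dots,f_n\in\mathcal S(\mathbb R^d)$ and $x\in\mathbb R^d$ the integral over $t$ that defines $U_{\rho,\lambda,L}(f_1,\dots,f_n)(x)$ converges absolutely, and $U_{\rho,\lambda,L}$ extends to a continuous $n$-linear operator $$T:\ (L^\infty(\mathbb R^d))^{n-1}\times L^2(\mathbb R^d)\longrightarrow L^2(\mathbb R^d),$$ that is, $T(f_1,\dots,f_n)=U_{\rho,\lambda,L}(f_1,\dots,f_n)$ almost everywhere for all $f_1,\dots,f_n\in\mathcal S(\mathbb R^d)$. For all $f_1,\dots,f_{n-1}\in L^\infty(\mathbb R^d)$ and $f_n\in L^2(\mathbb R^d)$ the extension is given by the same formula with the integral over $t$ taken as an improper integral $\lim_{\varepsilon\to0,\,R\to\infty}\int_\varepsilon^R$ in $L^2(\mathbb R^d)$. Moreover $$\|T\|\le C\,\|L\|_\infty\,c_M(\Psi)\prod_{i=1}^n c_M(\Phi^i),$$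 uniformly in $\rho\in(0,1]^n$ and in $\lambda$. -/

import Mathlib

open MeasureTheory Filter Topology Set
open scoped ENNReal SchwartzMap FourierTransform Convolution

noncomputable section

namespace ModelOperator

/-- The Euclidean space `ℝ^d`. -/
abbrev Rd (d : ℕ) : Type := EuclideanSpace ℝ (Fin d)

/-- The `L¹`-normalized dilation `ζ_t(x) = |t|^{-d} ζ(t⁻¹ x)`. -/
def dilate {d : ℕ} (ζ : Rd d → ℂ) (t : ℝ) (x : Rd d) : ℂ :=
  ((|t| ^ d)⁻¹ : ℝ) • ζ (t⁻¹ • x)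

/-- The quantity
`c_K(ζ) = sup_x (1 + |x|)^K sup_{|α| ≤ K} |∂^α ζ(x)|`.
The partial derivatives of order `k` are written as `∂_{j 0} ⋯ ∂_{j (k-1)} ζ`, where `j` runs over
all the `k`-tuples of coordinate directions. -/
def cNorm {d : ℕ} (K : ℕ) (ζ : Rd d → ℂ) : ℝ :=
  ⨆ x : Rd d, (1 + ‖x‖) ^ K *
    ⨆ k : Fin (K + 1), ⨆ j : Fin k → Fin d,
      ‖iteratedFDeriv ℝ (k : ℕ) ζ x (fun i => EuclideanSpace.single (j i) (1 : ℝ))‖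

/-- The spectrum of `ζ` (the support of its Fourier transform) is contained in a corona
`{a ≤ |ξ| ≤ b}`, `0 < a ≤ b`, around `0`. -/
def SpectrumInCorona {d : ℕ} (ζ : Rd d → ℂ) : Prop :=
  ∃ a b : ℝ, 0 < a ∧ a ≤ b ∧ tsupport (𝓕 ζ) ⊆ {ξ | a ≤ ‖ξ‖ ∧ ‖ξ‖ ≤ b}

/-- The spectrum of `ζ` is bounded. -/
def BoundedSpectrum {d : ℕ} (ζ : Rd d → ℂ) : Prop :=
  Bornology.IsBounded (tsupport (𝓕 ζ))

/-- The inner integral at scale `t`: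
`∫ Ψ_t(y) ∏_i [Φ^i_{λ_i t} ∗ f_i](x - ρ_i λ_i y) dy`. -/
def scaleAverage {d n : ℕ} (Ψ : Rd d → ℂ) (Φ : Fin n → Rd d → ℂ) (ρ lam : Fin n → ℝ)
    (f : Fin n → Rd d → ℂ) (t : ℝ) (x : Rd d) : ℂ :=
  ∫ y : Rd d, dilate Ψ t y *
    ∏ i, (dilate (Φ i) (lam i * t) ⋆[ContinuousLinearMap.mul ℂ ℂ, volume] f i)
      (x - (ρ i * lam i) • y)

/-- The integrand in `t` of the model operator, with respect to `dt`. -/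
def integrand {d n : ℕ} (Ψ : Rd d → ℂ) (Φ : Fin n → Rd d → ℂ) (L : ℝ → ℂ) (ρ lam : Fin n → ℝ)
    (f : Fin n → Rd d → ℂ) (x : Rd d) (t : ℝ) : ℂ :=
  L t * scaleAverage Ψ Φ ρ lam f t x / (t : ℂ)

/-- The model operator with the scale integral restricted to the scales `t ∈ S`. -/
def modelOpOn {d n : ℕ} (S : Set ℝ) (Ψ : Rd d → ℂ) (Φ : Fin n → Rd d → ℂ) (L : ℝ → ℂ)
    (ρ lam : Fin n → ℝ) (f : Fin n → Rd d → ℂ) (x : Rd d) : ℂ :=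
  ∫ t in S, integrand Ψ Φ L ρ lam f x t

/-- The continuous model operator
`U_{ρ,λ,L}(f)(x) = ∫_0^∞ L(t) ∫ Ψ_t(y) ∏_i [Φ^i_{λ_i t} ∗ f_i](x - ρ_i λ_i y) dy dt/t`. -/
def modelOp {d n : ℕ} (Ψ : Rd d → ℂ) (Φ : Fin n → Rd d → ℂ) (L : ℝ → ℂ)
    (ρ lam : Fin n → ℝ) (f : Fin n → Rd d → ℂ) : Rd d → ℂ :=
  modelOpOn (Ioi 0) Ψ Φ L ρ lam f

/-- The exponents of `(L^∞)^{n-1} × L²` with `n = m + 1`: `∞` in the first `m` slots and `2` in the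
last slot. -/
def expo (m : ℕ) (i : Fin (m + 1)) : ℝ≥0∞ := if i = Fin.last m then 2 else ∞

instance factOneLeExpo (m : ℕ) (i : Fin (m + 1)) : Fact (1 ≤ expo m i) :=
  ⟨by unfold expo; split_ifs <;> norm_num⟩

end ModelOperator

end

noncomputable section

namespace ModelOperator

variable {d : ℕ}

/-! ### Cauchy–Schwarz for integrals and series with values in [0, ∞]. -/

section CauchySchwarz

variable {α : Type*} [MeasurableSpace α] {μ : Measure α}

/-! The substitution y = t z turns the inner integral into ∫ Ψ(z) ∏_i (k_{i,z} ∗ f_i)(x) dz, where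
k_{i,z} is the dilate of Φ^i by λ_i t, translated by ρ_i λ_i t z. Since ρ_i ≤ 1, the translation is
at most |z| times the scale of the kernel. Up to a factor 1 + |z|, each k_{i,z} is therefore a
kernel of scale |λ_i| t, in the sense of an L¹ bound, a first moment and an L¹ modulus of continuity
(`IsKer`, `isKer_scaleKer`). Writing t = 2^(q-N) θ with 1 ≤ θ ≤ 2 reduces the integral in dt/t to
sums over q, with bounds uniform in θ (`setIntegral_div_eq_sum`).

Each convolution is compared with a dyadic average: k_{i,z} ∗ f_i = e_i + b_i with e_i = c_i avg
f_i, c_i = ∫ Φ^i, the average being taken at the comparable dyadic scale 2^(q + a_i). The operator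
f_i ↦ b_i has a kernel (`difKer`) whose rows and columns integrate to zero, and it gains
geometrically whenever a martingale difference of its input or its output lives far from the scale
of the kernel (`kerBound_dif`, `IsKer.eLpNorm_dif_kerOp_dif_le`). Hence the pieces of b_i satisfy a
square function estimate when f_i is in L² (`tsum_lintegral_dif_kerOp_sq_le`) and a Carleson
condition when f_i is bounded (`car_dif_kerOp`), both summable over the offset δ from the scale of
the kernel.

Now expand ∏ (e_i + b_i) and integrate against Ψ. The corona condition gives ∫ Ψ = 0. The term
without any b_i does not depend on z and disappears. In a term with one b_i, integrating in z first
produces the convolution of f_i with the mean zero kernel ∫ Ψ(z) k_{i,z} dz (`mixKer`), multiplied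
by dyadic averages at unrelated scales. These paraproducts need cancellation: averages at coarse
scales are absorbed into the martingale differences, averages at finer scales are removed by
summation by parts and induction on their number, with the Carleson embedding theorem as the basic
estimate (`eLpNorm_sum_mul_avgProd_sub_le`, `eLpNorm_sum_dif_mul_avgProd_le'`, `Car.embedding`).
Terms with at least two b_i are summed in absolute value as square summable sequences against
Carleson sequences (`Car.lintegral_tsum_mul_sq_le`). Their constants grow like (1 + |z|)^n, which
Minkowski's inequality and the decay of Ψ absorb. The maximality of |λ_n| means that the L² function
is averaged at the coarsest scale: when the bounded functions oscillate, its averages are no finer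
than the Carleson sequences, as the embedding theorem requires.

All this is uniform over weights σ(t) of compact support with |σ| ≤ Λ. The improper integral then
converges for a Hilbert space reason: a bounded linear function of such weights is small on weights
of remote support, by the parallelogram law (`exists_norm_le_of_remote`). On Schwartz functions the
average at scale t is O(t) for small t, because ∫ Ψ = 0, and O(1/t) for large t, because dilates
spread out. The integral thus converges absolutely, and it agrees with the L² limit along an almost
everywhere convergent subsequence. -/

theorem lintegral_mul_sq_le {f g : α → ℝ≥0∞} (hf : AEMeasurable f μ) (hg : AEMeasurable g μ) :
    (∫⁻ x, f x * g x ∂μ) ^ 2 ≤ (∫⁻ x, f x ^ 2 ∂μ) * ∫⁻ x, g x ^ 2 ∂μ := by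
  have h := ENNReal.lintegral_mul_le_Lp_mul_Lq μ Real.HolderConjugate.two_two hf hg
  calc (∫⁻ x, f x * g x ∂μ) ^ 2
      ≤ ((∫⁻ x, f x ^ (2 : ℝ) ∂μ) ^ (1 / (2 : ℝ)) * (∫⁻ x, g x ^ (2 : ℝ) ∂μ) ^ (1 / (2 : ℝ))) ^ 2 := by
        gcongr
        exact h
    _ = _ := by
        rw [mul_pow, ← ENNReal.rpow_natCast, ← ENNReal.rpow_natCast, ← ENNReal.rpow_mul,
          ← ENNReal.rpow_mul]
        norm_num

theorem lintegral_weighted_sq_le {w g : α → ℝ≥0∞} (hw : AEMeasurable w μ) (hg : AEMeasurable g μ) :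
    (∫⁻ x, w x * g x ∂μ) ^ 2 ≤ (∫⁻ x, w x ∂μ) * ∫⁻ x, w x * g x ^ 2 ∂μ := by
  have hs : ∀ a : ℝ≥0∞, (a ^ (1 / 2 : ℝ)) ^ 2 = a := fun a => by
    rw [← ENNReal.rpow_natCast, ← ENNReal.rpow_mul]; norm_num
  have h := lintegral_mul_sq_le (μ := μ) (f := fun x => w x ^ (1 / 2 : ℝ))
    (g := fun x => w x ^ (1 / 2 : ℝ) * g x) (hw.pow_const _) ((hw.pow_const _).mul hg)
  simpa only [← mul_assoc, ← sq, hs, mul_pow] using h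

theorem lintegral_sq_le {g : α → ℝ≥0∞} (hg : AEMeasurable g μ) :
    (∫⁻ x, g x ∂μ) ^ 2 ≤ μ univ * ∫⁻ x, g x ^ 2 ∂μ := by
  simpa using lintegral_weighted_sq_le (μ := μ) (w := fun _ => 1) aemeasurable_const hg

theorem tsum_weighted_sq_le {ι : Type*} (w g : ι → ℝ≥0∞) :
    (∑' i, w i * g i) ^ 2 ≤ (∑' i, w i) * ∑' i, w i * g i ^ 2 := by
  let _ : MeasurableSpace ι := ⊤
  simpa [lintegral_count] using lintegral_weighted_sq_le (μ := (Measure.count : Measure ι))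
    (w := w) (g := g) (measurable_from_top.aemeasurable) (measurable_from_top.aemeasurable)

theorem tsum_mul_sq_le {ι : Type*} (f g : ι → ℝ≥0∞) :
    (∑' i, f i * g i) ^ 2 ≤ (∑' i, f i ^ 2) * ∑' i, g i ^ 2 := by
  let _ : MeasurableSpace ι := ⊤
  simpa [lintegral_count] using lintegral_mul_sq_le (μ := (Measure.count : Measure ι))
    (f := f) (g := g) (measurable_from_top.aemeasurable) (measurable_from_top.aemeasurable)

theorem eLpNorm_two_sq {E : Type*} [NormedAddCommGroup E] (f : α → E) :
    eLpNorm f 2 μ ^ 2 = ∫⁻ x, ‖f x‖ₑ ^ 2 ∂μ := by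
  rw [eLpNorm_eq_lintegral_rpow_enorm_toReal (by norm_num) (by norm_num), ← ENNReal.rpow_natCast,
    ← ENNReal.rpow_mul]
  norm_num

theorem eLpNorm_two_le_of_sq_le {E : Type*} [NormedAddCommGroup E] {f : α → E} {C : ℝ≥0∞}
    (h : ∫⁻ x, ‖f x‖ₑ ^ 2 ∂μ ≤ C ^ 2) : eLpNorm f 2 μ ≤ C := by
  rw [← eLpNorm_two_sq] at h
  exact (ENNReal.pow_le_pow_left_iff two_ne_zero).1 h

theorem memLp_two_of_sq_lt_top {E : Type*} [NormedAddCommGroup E] {f : α → E}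
    (hf : AEStronglyMeasurable f μ) (h : ∫⁻ x, ‖f x‖ₑ ^ 2 ∂μ < ∞) : MemLp f 2 μ := by
  refine ⟨hf, ?_⟩
  rw [← eLpNorm_two_sq] at h
  exact (ENNReal.pow_lt_top_iff.1 h).resolve_right two_ne_zero

theorem lintegral_sq_lt_top {E : Type*} [NormedAddCommGroup E] {f : α → E} (hf : MemLp f 2 μ) :
    ∫⁻ x, ‖f x‖ₑ ^ 2 ∂μ < ∞ := by
  rw [← eLpNorm_two_sq]
  exact ENNReal.pow_lt_top hf.2

end CauchySchwarz

/-! ### Dyadic cubes and functions that are constant on them. -/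

section Cubes


/-- The index of the dyadic cube of side `2 ^ q` that contains `x`. -/
def idx (q : ℤ) (x : Rd d) : Fin d → ℤ := fun i => ⌊x i / (2 : ℝ) ^ q⌋

/-- The dyadic cube of side `2 ^ q` that contains `x`. -/
def cube (q : ℤ) (x : Rd d) : Set (Rd d) := {y | idx q y = idx q x}

theorem measurable_idx (q : ℤ) : Measurable (idx (d := d) q) := by
  refine measurable_pi_lambda _ fun i => ?_
  unfold idx
  fun_prop

theorem measurableSet_cube (q : ℤ) (x : Rd d) : MeasurableSet (cube q x) :=
  measurable_idx q (measurableSet_singleton (idx q x))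

theorem mem_cube_iff {q : ℤ} {x y : Rd d} : y ∈ cube q x ↔ idx q y = idx q x := Iff.rfl

theorem mem_cube_comm {q : ℤ} {x y : Rd d} : y ∈ cube q x ↔ x ∈ cube q y := eq_comm

theorem cube_eq_of_idx {q : ℤ} {x y : Rd d} (h : idx q x = idx q y) : cube q x = cube q y := by
  simp [cube, h]

theorem idx_succ (q : ℤ) (x : Rd d) (i : Fin d) : idx (q + 1) x i = idx q x i / 2 := by
  unfold idx
  rw [zpow_add₀ two_ne_zero, zpow_one, ← div_div]
  exact_mod_cast Int.floor_div_natCast (x i / (2 : ℝ) ^ q) 2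

/-- Passing to the parent cube halves the integer index. This nesting is what makes the averages a
tower of conditional expectations, coarser for larger q. -/
theorem idx_mono {q r : ℤ} (hqr : q ≤ r) {x y : Rd d} (h : idx q x = idx q y) :
    idx r x = idx r y := by
  induction r, hqr using Int.leInduction with
  | base => exact h
  | succ r _ ih => ext i; rw [idx_succ, idx_succ, ih]

theorem cube_subset {q r : ℤ} (hqr : q ≤ r) (x : Rd d) : cube q x ⊆ cube r x :=
  fun _ hy => idx_mono hqr hy

/-- The volume of a dyadic cube of side `2 ^ q`. -/
def vol (d : ℕ) (q : ℤ) : ℝ := ((2 : ℝ) ^ q) ^ d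

theorem vol_pos (q : ℤ) : 0 < vol d q := by unfold vol; positivity

theorem volume_cube (q : ℤ) (x : Rd d) : volume (cube q x) = ENNReal.ofReal (vol d q) := by
  have hp : (0 : ℝ) < 2 ^ q := by positivity
  have h : cube q x = (WithLp.ofLp : Rd d → (Fin d → ℝ)) ⁻¹' (Set.pi univ fun i =>
      Ico ((idx q x i : ℝ) * 2 ^ q) (((idx q x i : ℝ) + 1) * 2 ^ q)) := by
    ext y
    simp only [mem_cube_iff, funext_iff, mem_preimage, Set.mem_pi, mem_univ, true_imp_iff, mem_Ico]
    refine forall_congr' fun i => ?_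
    change ⌊y i / (2 : ℝ) ^ q⌋ = _ ↔ _
    rw [Int.floor_eq_iff, le_div_iff₀ hp, div_lt_iff₀ hp]
  rw [h, (PiLp.volume_preserving_ofLp (Fin d)).measure_preimage
    (MeasurableSet.univ_pi fun i => measurableSet_Ico).nullMeasurableSet, Real.volume_pi_Ico]
  have : ∀ i, ((idx q x i : ℝ) + 1) * 2 ^ q - (idx q x i : ℝ) * 2 ^ q = 2 ^ q := fun i => by ring
  simp only [this, Finset.prod_const, Finset.card_univ, Fintype.card_fin, vol,
    ENNReal.ofReal_pow hp.le]

theorem norm_sub_le_of_mem_cube {q : ℤ} {x y : Rd d} (h : y ∈ cube q x) :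
    ‖y - x‖ ≤ d * (2 : ℝ) ^ q := by
  have hp : (0 : ℝ) < 2 ^ q := by positivity
  have hc : ∀ i, ‖(y - x) i‖ ≤ 2 ^ q := fun i => by
    have hi : ⌊y i / (2 : ℝ) ^ q⌋ = ⌊x i / (2 : ℝ) ^ q⌋ := congrFun h i
    have := (Int.abs_sub_lt_one_of_floor_eq_floor hi).le
    rw [← sub_div, abs_div, abs_of_pos hp, div_le_one hp] at this
    simpa using this
  -- The ℓ¹ norm gives d in place of √d, which is enough.
  calc ‖y - x‖ ≤ ∑ i, ‖(y - x) i‖ := by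
        rw [EuclideanSpace.norm_eq]
        refine Real.sqrt_le_iff.2 ⟨Finset.sum_nonneg fun _ _ => norm_nonneg _, ?_⟩
        exact Finset.sum_sq_le_sq_sum_of_nonneg fun _ _ => norm_nonneg _
    _ ≤ ∑ _i : Fin d, (2 : ℝ) ^ q := Finset.sum_le_sum fun i _ => hc i
    _ = _ := by simp

/-- The relation of lying in the same dyadic cube of side `2 ^ q` is measurable. -/
theorem measurableSet_sameCube (q : ℤ) :
    MeasurableSet {p : Rd d × Rd d | idx q p.1 = idx q p.2} :=
  measurableSet_eq_fun ((measurable_idx q).comp measurable_fst) ((measurable_idx q).comp measurable_snd)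

/-- A function is constant on the dyadic cubes of side `2 ^ q`. -/
def CubeConst {E : Type*} (q : ℤ) (f : Rd d → E) : Prop := ∀ x y, idx q x = idx q y → f x = f y

namespace CubeConst

variable {E F G : Type*} {q r : ℤ}

theorem measurable [MeasurableSpace E] [Nonempty E] {f : Rd d → E} (hf : CubeConst q f) :
    Measurable f := by
  have : f = Function.extend (idx q) f (fun _ => Classical.arbitrary E) ∘ idx q := by
    ext x
    rw [Function.comp_apply, Function.FactorsThrough.extend_apply (fun x y h => hf x y h)]
  rw [this]
  exact (measurable_of_countable _).comp (measurable_idx q)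

theorem mono {f : Rd d → E} (hf : CubeConst r f) (h : q ≤ r) : CubeConst q f :=
  fun x y hxy => hf x y (idx_mono h hxy)

theorem map {f : Rd d → E} (hf : CubeConst q f) (φ : E → F) : CubeConst q fun x => φ (f x) :=
  fun x y hxy => congrArg φ (hf x y hxy)

theorem map₂ {f : Rd d → E} {g : Rd d → F} (hf : CubeConst q f) (hg : CubeConst q g)
    (φ : E → F → G) : CubeConst q fun x => φ (f x) (g x) :=
  fun x y hxy => by simp only [hf x y hxy, hg x y hxy]

theorem prod {ι : Type*} {s : Finset ι} {M : Type*} [CommMonoid M] {f : ι → Rd d → M}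
    (hf : ∀ i ∈ s, CubeConst q (f i)) : CubeConst q fun x => ∏ i ∈ s, f i x :=
  fun x y hxy => Finset.prod_congr rfl fun i hi => hf i hi x y hxy

end CubeConst

end Cubes

/-! ### Dyadic averages of nonnegative functions. -/

section ENNRealAverage

/-- The dyadic average of a nonnegative function. -/
def eavg (q : ℤ) (g : Rd d → ℝ≥0∞) (x : Rd d) : ℝ≥0∞ :=
  (ENNReal.ofReal (vol d q))⁻¹ * ∫⁻ y in cube q x, g y

theorem ofReal_vol_ne_zero (q : ℤ) : ENNReal.ofReal (vol d q) ≠ 0 := by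
  simpa using vol_pos q

theorem inv_vol_mul_vol (q : ℤ) :
    (ENNReal.ofReal (vol d q))⁻¹ * ENNReal.ofReal (vol d q) = 1 :=
  ENNReal.inv_mul_cancel (ofReal_vol_ne_zero q) ENNReal.ofReal_ne_top

theorem cubeConst_eavg (q : ℤ) (g : Rd d → ℝ≥0∞) : CubeConst q (eavg q g) := fun x y h => by
  rw [eavg, eavg, cube_eq_of_idx h]

theorem eavg_mono {q : ℤ} {g h : Rd d → ℝ≥0∞} (hgh : ∀ x, g x ≤ h x) (x : Rd d) :
    eavg q g x ≤ eavg q h x := by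
  unfold eavg
  gcongr
  exact hgh _

theorem eavg_const (q : ℤ) (c : ℝ≥0∞) (x : Rd d) : eavg q (fun _ => c) x = c := by
  rw [eavg, setLIntegral_const, volume_cube, mul_comm c, ← mul_assoc, inv_vol_mul_vol, one_mul]

theorem eavg_const_mul {q : ℤ} {h g : Rd d → ℝ≥0∞} (hh : CubeConst q h) (hg : Measurable g)
    (x : Rd d) : eavg q (fun y => h y * g y) x = h x * eavg q g x := by
  have : ∫⁻ y in cube q x, h y * g y = ∫⁻ y in cube q x, h x * g y :=
    setLIntegral_congr_fun (measurableSet_cube q x) fun y hy => by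
      simp only [hh y x hy]
  rw [eavg, this, lintegral_const_mul _ hg, eavg, mul_left_comm]

theorem eavg_of_cubeConst {q : ℤ} {h : Rd d → ℝ≥0∞} (hh : CubeConst q h) (x : Rd d) :
    eavg q h x = h x := by
  simpa [eavg_const] using eavg_const_mul hh (g := fun _ => 1) measurable_const x

theorem eavg_sq_le {q : ℤ} {g : Rd d → ℝ≥0∞} (hg : Measurable g) (x : Rd d) :
    eavg q g x ^ 2 ≤ eavg q (fun y => g y ^ 2) x := by
  have h := lintegral_sq_le (μ := volume.restrict (cube q x)) hg.aemeasurable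
  rw [Measure.restrict_apply_univ, volume_cube] at h
  calc eavg q g x ^ 2 = ((ENNReal.ofReal (vol d q))⁻¹) ^ 2 * (∫⁻ y in cube q x, g y) ^ 2 := by
        rw [eavg, mul_pow]
    _ ≤ ((ENNReal.ofReal (vol d q))⁻¹) ^ 2 *
        (ENNReal.ofReal (vol d q) * ∫⁻ y in cube q x, g y ^ 2) := by gcongr
    _ = (ENNReal.ofReal (vol d q))⁻¹ * ((ENNReal.ofReal (vol d q))⁻¹ * ENNReal.ofReal (vol d q)) *
        ∫⁻ y in cube q x, g y ^ 2 := by ring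
    _ = _ := by rw [inv_vol_mul_vol, mul_one, eavg]

theorem eavg_eq_lintegral_indicator (q : ℤ) (g : Rd d → ℝ≥0∞) (x : Rd d) :
    eavg q g x = ∫⁻ y, (ENNReal.ofReal (vol d q))⁻¹ * (cube q x).indicator g y := by
  rw [lintegral_const_mul' _ _ (by simpa using vol_pos q), lintegral_indicator (measurableSet_cube q x),
    eavg]

theorem indicator_cube_comm {E : Type*} [Zero E] (q : ℤ) (c : E) (x y : Rd d) :
    (cube q x).indicator (fun _ => c) y = (cube q y).indicator (fun _ => c) x := by
  classical
  simp only [indicator_apply, mem_cube_comm (x := x)]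

/-- Tonelli: lying in the same cube is a symmetric relation, so after the exchange the inner
integral averages a constant over a cube. -/
theorem lintegral_eavg {q : ℤ} {g : Rd d → ℝ≥0∞} (hg : Measurable g) :
    ∫⁻ x, eavg q g x = ∫⁻ x, g x := by
  have hm : Measurable fun p : Rd d × Rd d =>
      (ENNReal.ofReal (vol d q))⁻¹ * (cube q p.1).indicator g p.2 := by
    have : (fun p : Rd d × Rd d => (cube q p.1).indicator g p.2) =
        {p : Rd d × Rd d | idx q p.1 = idx q p.2}.indicator fun p => g p.2 := by
      classical
      ext p
      simp only [indicator_apply, mem_cube_iff, mem_ofPred_eq, eq_comm]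
    exact measurable_const.mul (this ▸ (hg.comp measurable_snd).indicator (measurableSet_sameCube q))
  simp only [eavg_eq_lintegral_indicator]
  rw [lintegral_lintegral_swap hm.aemeasurable]
  refine lintegral_congr fun y => ?_
  have : ∀ x, (cube q x).indicator g y = (cube q y).indicator (fun _ => g y) x := fun x => by
    rw [← indicator_cube_comm]
    classical
    simp only [indicator_apply]
  simp only [this]
  rw [← eavg_eq_lintegral_indicator, eavg_const]

/-- The main device of duality arguments below: against a factor constant on cubes, a function may
be exchanged for its average. -/
theorem lintegral_mul_eavg {q : ℤ} {h g : Rd d → ℝ≥0∞} (hh : CubeConst q h) (hg : Measurable g) :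
    ∫⁻ x, h x * eavg q g x = ∫⁻ x, h x * g x := by
  have := lintegral_eavg (q := q) (hh.measurable.mul hg)
  simp only [Pi.mul_apply] at this
  rw [← this]
  exact lintegral_congr fun x => (eavg_const_mul hh hg x).symm

theorem cubeConst_indicator {E : Type*} [Zero E] {q r : ℤ} (hqr : q ≤ r) (x : Rd d) (c : E) :
    CubeConst q ((cube r x).indicator fun _ => c) := fun y z h => by
  classical
  simp only [indicator_apply, mem_cube_iff, idx_mono hqr h]

theorem setLIntegral_cube_eq (q : ℤ) (g : Rd d → ℝ≥0∞) (x : Rd d) :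
    ∫⁻ y in cube q x, g y = ∫⁻ y, (cube q x).indicator (fun _ => 1) y * g y := by
  rw [← lintegral_indicator (measurableSet_cube q x)]
  refine lintegral_congr fun y => ?_
  classical
  simp [indicator_apply]

theorem eavg_eavg {q r : ℤ} (hqr : q ≤ r) {g : Rd d → ℝ≥0∞} (hg : Measurable g) (x : Rd d) :
    eavg r (eavg q g) x = eavg r g x := by
  rw [eavg, eavg, setLIntegral_cube_eq, setLIntegral_cube_eq,
    lintegral_mul_eavg (cubeConst_indicator hqr x 1) hg]

theorem setLIntegral_cube (q : ℤ) (g : Rd d → ℝ≥0∞) (x : Rd d) :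
    ∫⁻ y in cube q x, g y = ENNReal.ofReal (vol d q) * eavg q g x := by
  rw [eavg, ← mul_assoc, mul_comm (ENNReal.ofReal _), inv_vol_mul_vol, one_mul]

theorem eavg_add {q : ℤ} {g h : Rd d → ℝ≥0∞} (hg : Measurable g) (x : Rd d) :
    eavg q (fun y => g y + h y) x = eavg q g x + eavg q h x := by
  rw [eavg, lintegral_add_left hg, mul_add, eavg, eavg]

end ENNRealAverage

/-! ### Dyadic averages and martingale differences of complex functions. -/

section Average

/-- The dyadic average of a function: its conditional expectation on the dyadic cubes of side
`2 ^ q`. -/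
def avg (q : ℤ) (f : Rd d → ℂ) (x : Rd d) : ℂ := (vol d q)⁻¹ • ∫ y in cube q x, f y

/-- The dyadic martingale difference `avg (r - 1) f - avg r f`. -/
def dif (r : ℤ) (f : Rd d → ℂ) (x : Rd d) : ℂ := avg (r - 1) f x - avg r f x

/-- Integrability on all the dyadic cubes. -/
def CubeInt (f : Rd d → ℂ) : Prop := ∀ q x, IntegrableOn f (cube q x)

theorem volume_cube_lt_top (q : ℤ) (x : Rd d) : volume (cube q x) < ∞ := by
  rw [volume_cube]; exact ENNReal.ofReal_lt_top

theorem isFiniteMeasure_restrict_cube (q : ℤ) (x : Rd d) :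
    IsFiniteMeasure (volume.restrict (cube q x)) :=
  ⟨by rw [Measure.restrict_apply_univ]; exact volume_cube_lt_top q x⟩

theorem CubeInt.of_memLp {f : Rd d → ℂ} (hf : MemLp f 2) : CubeInt f := fun q x => by
  have := isFiniteMeasure_restrict_cube q x
  exact (hf.restrict (cube q x)).integrable one_le_two

theorem CubeInt.of_bound {f : Rd d → ℂ} (hf : AEStronglyMeasurable f) {c : ℝ}
    (hc : ∀ x, ‖f x‖ ≤ c) : CubeInt f := fun q x =>
  Measure.integrableOn_of_bounded (volume_cube_lt_top q x).ne hf (Eventually.of_forall hc)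

theorem cubeConst_avg (q : ℤ) (f : Rd d → ℂ) : CubeConst q (avg q f) := fun x y h => by
  rw [avg, avg, cube_eq_of_idx h]

theorem enorm_avg_le (q : ℤ) (f : Rd d → ℂ) (x : Rd d) :
    ‖avg q f x‖ₑ ≤ eavg q (fun y => ‖f y‖ₑ) x := by
  rw [avg, eavg, enorm_smul, Real.enorm_eq_ofReal (inv_nonneg.2 (vol_pos q).le),
    ENNReal.ofReal_inv_of_pos (vol_pos q)]
  gcongr
  exact enorm_integral_le_lintegral_enorm _

theorem avg_mul {q : ℤ} {h : Rd d → ℂ} (hh : CubeConst q h) (f : Rd d → ℂ) (x : Rd d) :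
    avg q (fun y => h y * f y) x = h x * avg q f x := by
  have : ∫ y in cube q x, h y * f y = ∫ y in cube q x, h x * f y :=
    setIntegral_congr_fun (measurableSet_cube q x) fun y hy => by
      simp only [hh y x hy]
  rw [avg, this, integral_const_mul, avg, mul_smul_comm]

theorem avg_of_cubeConst {q : ℤ} {h : Rd d → ℂ} (hh : CubeConst q h) (x : Rd d) :
    avg q h x = h x := by
  have h1 : ∫ y in cube q x, h y = ∫ y in cube q x, h x :=
    setIntegral_congr_fun (measurableSet_cube q x) fun y hy => hh y x hy
  rw [avg, h1, setIntegral_const, measureReal_def, volume_cube,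
    ENNReal.toReal_ofReal (vol_pos q).le, smul_smul, inv_mul_cancel₀ (vol_pos q).ne', one_smul]

theorem avg_add {q : ℤ} {f g : Rd d → ℂ} (hf : CubeInt f) (hg : CubeInt g) (x : Rd d) :
    avg q (f + g) x = avg q f x + avg q g x := by
  simp only [avg, Pi.add_apply, integral_add (hf q x) (hg q x), smul_add]

theorem avg_sub {q : ℤ} {f g : Rd d → ℂ} (hf : CubeInt f) (hg : CubeInt g) (x : Rd d) :
    avg q (f - g) x = avg q f x - avg q g x := by
  simp only [avg, Pi.sub_apply, integral_sub (hf q x) (hg q x), smul_sub]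

theorem avg_congr_ae {q : ℤ} {f g : Rd d → ℂ} (h : f =ᵐ[volume] g) (x : Rd d) :
    avg q f x = avg q g x := by
  rw [avg, avg, integral_congr_ae (ae_restrict_of_ae h)]

/-- Fubini for the symmetric kernel of the average. The hypothesis `hq` makes `C` a union of cubes
of side 2^q, so no cube straddles its boundary and integrability on `C` alone suffices. -/
theorem setIntegral_avg {q : ℤ} {f : Rd d → ℂ} {C : Set (Rd d)} (hC : MeasurableSet C)
    (hq : CubeConst q (· ∈ C)) (hf : IntegrableOn f C) :
    ∫ x in C, avg q f x = ∫ x in C, f x := by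
  have hsub : ∀ x ∈ C, cube q x ⊆ C := fun x hx y hy => by
    have := hq y x hy
    simpa only [this] using hx
  have hmeas : Measurable fun p : Rd d × Rd d => (cube q p.1).indicator (fun _ => (1 : ℂ)) p.2 := by
    have : (fun p : Rd d × Rd d => (cube q p.1).indicator (fun _ => (1 : ℂ)) p.2) =
        {p : Rd d × Rd d | idx q p.1 = idx q p.2}.indicator fun p => 1 := by
      classical
      ext p
      simp only [indicator_apply, mem_cube_iff, mem_ofPred_eq, eq_comm]
    exact this ▸ measurable_const.indicator (measurableSet_sameCube q)
  have hint : ∀ z ∈ C, ∫ x in C, ‖(cube q x).indicator (fun _ => (1 : ℂ)) z‖ = vol d q := by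
    intro z hz
    have : ∀ x, ‖(cube q x).indicator (fun _ => (1 : ℂ)) z‖ =
        (cube q z).indicator (fun _ => (1 : ℝ)) x := fun x => by
      rw [indicator_cube_comm]; classical simp [indicator_apply, apply_ite]
    simp only [this]
    rw [setIntegral_indicator (measurableSet_cube q z), inter_eq_self_of_subset_right (hsub z hz)]
    simp [measureReal_def, volume_cube, (vol_pos q).le]
  have hint' : ∀ z ∈ C, ∫ x in C, (cube q x).indicator (fun _ => (1 : ℂ)) z = vol d q := by
    intro z hz
    simp only [indicator_cube_comm q (1 : ℂ) _ z]
    rw [setIntegral_indicator (measurableSet_cube q z), inter_eq_self_of_subset_right (hsub z hz)]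
    simp [measureReal_def, volume_cube, (vol_pos q).le]
  have hI : Integrable (Function.uncurry fun x z : Rd d =>
      (cube q x).indicator (fun _ => (1 : ℂ)) z * f z)
      ((volume.restrict C).prod (volume.restrict C)) := by
    have hm : AEStronglyMeasurable (Function.uncurry fun x z : Rd d =>
        (cube q x).indicator (fun _ => (1 : ℂ)) z * f z)
        ((volume.restrict C).prod (volume.restrict C)) :=
      hmeas.aestronglyMeasurable.mul hf.1.comp_snd
    rw [integrable_prod_iff' hm]
    constructor
    · filter_upwards [ae_restrict_mem hC] with z hz
      simp only [Function.uncurry]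
      refine Integrable.mul_const ?_ _
      simp only [indicator_cube_comm q (1 : ℂ) _ z]
      exact (integrable_indicator_iff (measurableSet_cube q z)).2
        (integrableOn_const (by
          exact ((Measure.restrict_apply_le C _).trans_lt (volume_cube_lt_top q z)).ne))
    · refine (hf.norm.const_mul (vol d q)).congr ?_
      filter_upwards [ae_restrict_mem hC] with z hz
      simp only [Function.uncurry, norm_mul, integral_mul_const, hint z hz]
  have h1 : ∀ x ∈ C, avg q f x =
      (vol d q)⁻¹ • ∫ z in C, (cube q x).indicator (fun _ => (1 : ℂ)) z * f z := fun x hx => by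
    have : ∀ z, (cube q x).indicator (fun _ => (1 : ℂ)) z * f z = (cube q x).indicator f z :=
      fun z => by classical simp [indicator_apply]
    simp only [this]
    rw [setIntegral_indicator (measurableSet_cube q x), inter_eq_self_of_subset_right (hsub x hx),
      avg]
  rw [setIntegral_congr_fun hC h1, integral_smul, integral_integral_swap hI,
    setIntegral_congr_fun hC (g := fun z => (vol d q : ℂ) * f z)
      fun z hz => by simp only [integral_mul_const, hint' z hz], integral_const_mul,
    Complex.real_smul, ← mul_assoc, ← Complex.ofReal_mul, inv_mul_cancel₀ (vol_pos q).ne',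
    Complex.ofReal_one, one_mul]

theorem avg_avg {q r : ℤ} (hqr : q ≤ r) {f : Rd d → ℂ} (hf : CubeInt f) (x : Rd d) :
    avg r (avg q f) x = avg r f x := by
  rw [avg, avg, setIntegral_avg (measurableSet_cube r x) _ (hf r x)]
  exact fun y z h => by simp only [mem_cube_iff, idx_mono hqr h]

theorem lintegral_avg_sq_le (q : ℤ) {f : Rd d → ℂ} (hf : AEStronglyMeasurable f) :
    ∫⁻ x, ‖avg q f x‖ₑ ^ 2 ≤ ∫⁻ x, ‖f x‖ₑ ^ 2 := by
  have h : ∀ x, ‖avg q f x‖ₑ ^ 2 ≤ eavg q (fun y => ‖hf.mk f y‖ₑ ^ 2) x := fun x => by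
    rw [avg_congr_ae hf.ae_eq_mk]
    refine le_trans ?_ (eavg_sq_le hf.stronglyMeasurable_mk.measurable.enorm x)
    gcongr
    exact enorm_avg_le q _ x
  refine (lintegral_mono h).trans ?_
  rw [lintegral_eavg (hf.stronglyMeasurable_mk.measurable.enorm.pow_const 2)]
  refine (lintegral_congr_ae ?_).le
  filter_upwards [hf.ae_eq_mk] with x hx
  rw [hx]

theorem memLp_avg (q : ℤ) {f : Rd d → ℂ} (hf : MemLp f 2) : MemLp (avg q f) 2 :=
  memLp_two_of_sq_lt_top (cubeConst_avg q f).measurable.aestronglyMeasurable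
    ((lintegral_avg_sq_le q hf.1).trans_lt (lintegral_sq_lt_top hf))

theorem memLp_dif (q : ℤ) {f : Rd d → ℂ} (hf : MemLp f 2) : MemLp (dif q f) 2 :=
  (memLp_avg (q - 1) hf).sub (memLp_avg q hf)

theorem eavg_le_of_le {q : ℤ} {g : Rd d → ℝ≥0∞} {c : ℝ≥0∞} (h : ∀ x, g x ≤ c) (x : Rd d) :
    eavg q g x ≤ c :=
  (eavg_mono h x).trans_eq (eavg_const q c x)

theorem enorm_avg_le_of_le {q : ℤ} {f : Rd d → ℂ} {c : ℝ≥0∞} (h : ∀ x, ‖f x‖ₑ ≤ c) (x : Rd d) :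
    ‖avg q f x‖ₑ ≤ c :=
  (enorm_avg_le q f x).trans (eavg_le_of_le h x)

theorem CubeInt.of_enorm_le {f : Rd d → ℂ} (hf : AEStronglyMeasurable f) {c : ℝ≥0∞}
    (hc : c ≠ ∞) (h : ∀ x, ‖f x‖ₑ ≤ c) : CubeInt f :=
  CubeInt.of_bound hf (c := c.toReal) fun x => by
    rw [← toReal_enorm]; exact ENNReal.toReal_mono hc (h x)

/-- A cube of scale `max q r` is a union of cubes of scale q, so on it averaging |f| preserves the
integral; it also contains the given cube of scale r. -/
theorem CubeInt.avg {f : Rd d → ℂ} (q : ℤ) (hf : CubeInt f) : CubeInt (avg q f) := by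
  intro r x
  have hmeas := (cubeConst_avg q f).measurable
  refine ⟨hmeas.aestronglyMeasurable, ?_⟩
  have h2 : ∫⁻ y in cube (max q r) x, ‖f y‖ₑ < ∞ := (hf (max q r) x).2
  obtain ⟨g, hg, hfg⟩ := (hf (max q r) x).1.enorm
  refine lt_of_le_of_lt ?_ h2
  calc ∫⁻ y in cube r x, ‖ModelOperator.avg q f y‖ₑ
      ≤ ∫⁻ y in cube (max q r) x, ‖ModelOperator.avg q f y‖ₑ :=
        lintegral_mono_set (cube_subset (le_max_right _ _) x)
    _ ≤ ∫⁻ y in cube (max q r) x, eavg q (fun z => g z) y := by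
        refine setLIntegral_mono' (measurableSet_cube _ _) fun y hy => ?_
        refine (enorm_avg_le q f y).trans_eq ?_
        have hs : cube q y ⊆ cube (max q r) x := by
          rw [cube_eq_of_idx (hy : idx _ y = idx _ x).symm]
          exact cube_subset (le_max_left _ _) y
        rw [eavg, eavg, lintegral_congr_ae (ae_restrict_of_ae_restrict_of_subset hs hfg)]
    _ = ∫⁻ y in cube (max q r) x, g y := by
        rw [setLIntegral_cube_eq, lintegral_mul_eavg (cubeConst_indicator (le_max_left _ _) x 1) hg,
          ← setLIntegral_cube_eq]
    _ = ∫⁻ y in cube (max q r) x, ‖f y‖ₑ := (lintegral_congr_ae hfg).symm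

theorem cubeConst_dif (r : ℤ) (f : Rd d → ℂ) : CubeConst (r - 1) (dif r f) :=
  (cubeConst_avg (r - 1) f).map₂ ((cubeConst_avg r f).mono (by omega)) (· - ·)

theorem avg_dif_of_le {q r : ℤ} (h : r ≤ q) {f : Rd d → ℂ} (hf : CubeInt f) (x : Rd d) :
    avg q (dif r f) x = 0 := by
  have := avg_sub (q := q) (hf.avg (r - 1)) (hf.avg r) x
  rw [avg_avg (by omega) hf, avg_avg h hf, sub_self] at this
  exact this

/-- Orthogonality: on each cube of scale r the first factor is constant and the second has mean
zero. -/
theorem integral_mul_eq_zero {r : ℤ} {u v : Rd d → ℂ} (hu : MemLp u 2) (hv : MemLp v 2)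
    (hur : CubeConst r u) (hvr : ∀ x, avg r v x = 0) :
    ∫ x, (starRingEnd ℂ) (u x) * v x = 0 := by
  have hi : Integrable (fun x => (starRingEnd ℂ) (u x) * v x) := hu.star.integrable_mul hv
  have := setIntegral_avg (q := r) MeasurableSet.univ (fun _ _ _ => rfl) hi.integrableOn
  rw [setIntegral_univ, setIntegral_univ] at this
  rw [← this]
  simp [avg_mul (hur.map (starRingEnd ℂ)), hvr]

theorem lintegral_sq_eq_ofReal {f : Rd d → ℂ} (hf : MemLp f 2) :
    ∫⁻ x, ‖f x‖ₑ ^ 2 = ENNReal.ofReal (∫ x, ‖f x‖ ^ 2) := by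
  rw [ofReal_integral_eq_lintegral_ofReal hf.norm.integrable_sq
    (Eventually.of_forall fun x => by positivity)]
  refine lintegral_congr fun x => ?_
  rw [ENNReal.ofReal_pow (norm_nonneg _), ofReal_norm]

theorem lintegral_add_sq {r : ℤ} {u v : Rd d → ℂ} (hu : MemLp u 2) (hv : MemLp v 2)
    (hur : CubeConst r u) (hvr : ∀ x, avg r v x = 0) :
    ∫⁻ x, ‖u x + v x‖ₑ ^ 2 = (∫⁻ x, ‖u x‖ₑ ^ 2) + ∫⁻ x, ‖v x‖ₑ ^ 2 := by
  have h0 := integral_mul_eq_zero hu hv hur hvr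
  have hi : Integrable (fun x => (starRingEnd ℂ) (u x) * v x) := hu.star.integrable_mul hv
  have hre : ∫ x, ((starRingEnd ℂ) (u x) * v x).re = 0 := by
    have := integral_re hi
    simp only [RCLike.re_eq_complex_re] at this
    rw [this, h0, Complex.zero_re]
  have h1 : ∀ x, ‖u x + v x‖ ^ 2 =
      ‖u x‖ ^ 2 + ‖v x‖ ^ 2 + 2 * ((starRingEnd ℂ) (u x) * v x).re := fun x => by
    simp only [← Complex.normSq_eq_norm_sq, Complex.normSq_add]
    simp only [Complex.mul_re, Complex.conj_re, Complex.conj_im]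
    ring
  have h2 := lintegral_sq_eq_ofReal (hu.add hv)
  simp only [Pi.add_apply] at h2
  rw [h2, lintegral_sq_eq_ofReal hu, lintegral_sq_eq_ofReal hv,
    ← ENNReal.ofReal_add (by positivity) (by positivity)]
  congr 1
  simp only [h1]
  have hi' : Integrable fun x => 2 * ((starRingEnd ℂ) (u x) * v x).re := hi.re.const_mul 2
  have hs : Integrable fun x => ‖u x‖ ^ 2 + ‖v x‖ ^ 2 :=
    hu.norm.integrable_sq.add hv.norm.integrable_sq
  rw [integral_add hs hi', integral_add hu.norm.integrable_sq hv.norm.integrable_sq,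
    integral_const_mul, hre]
  ring

theorem lintegral_avg_sub_one_sq (r : ℤ) {f : Rd d → ℂ} (hf : MemLp f 2) :
    ∫⁻ x, ‖avg (r - 1) f x‖ₑ ^ 2 = (∫⁻ x, ‖avg r f x‖ₑ ^ 2) + ∫⁻ x, ‖dif r f x‖ₑ ^ 2 := by
  rw [← lintegral_add_sq (memLp_avg r hf) (memLp_dif r hf) (cubeConst_avg r f)
    (avg_dif_of_le le_rfl (CubeInt.of_memLp hf))]
  simp [dif]

theorem sum_lintegral_dif_sq_add (a : ℤ) (n : ℕ) {f : Rd d → ℂ} (hf : MemLp f 2) :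
    (∑ i ∈ Finset.range n, ∫⁻ x, ‖dif (a - i) f x‖ₑ ^ 2) + ∫⁻ x, ‖avg a f x‖ₑ ^ 2
      = ∫⁻ x, ‖avg (a - n) f x‖ₑ ^ 2 := by
  induction n with
  | zero => simp
  | succ n ih =>
    rw [Finset.sum_range_succ, add_right_comm, ih]
    push_cast
    rw [← sub_sub, lintegral_avg_sub_one_sq _ hf]

/-- Bessel's inequality for martingale differences. Pythagoras, applied from one scale to the next,
telescopes, and every finite set of scales sits in an interval of scales. -/
theorem tsum_lintegral_dif_sq_le {f : Rd d → ℂ} (hf : MemLp f 2) :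
    ∑' r : ℤ, ∫⁻ x, ‖dif r f x‖ₑ ^ 2 ≤ ∫⁻ x, ‖f x‖ₑ ^ 2 := by
  rw [ENNReal.tsum_eq_iSup_sum]
  refine iSup_le fun s => ?_
  obtain ⟨N, hN⟩ : ∃ N : ℕ, ∀ r ∈ s, |r| ≤ N := by
    refine ⟨∑ r ∈ s, r.natAbs, fun r hr => ?_⟩
    have := Finset.single_le_sum (f := fun r : ℤ => r.natAbs) (fun _ _ => Nat.zero_le _) hr
    rw [Int.abs_eq_natAbs]
    exact_mod_cast this
  have hs : s ⊆ (Finset.range (2 * N + 1)).image fun i : ℕ => (N : ℤ) - i := fun r hr => by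
    have := abs_le.1 (hN r hr)
    exact Finset.mem_image.2 ⟨(N - r).toNat, Finset.mem_range.2 (by omega), by omega⟩
  calc ∑ r ∈ s, ∫⁻ x, ‖dif r f x‖ₑ ^ 2
      ≤ ∑ r ∈ (Finset.range (2 * N + 1)).image fun i : ℕ => (N : ℤ) - i,
        ∫⁻ x, ‖dif r f x‖ₑ ^ 2 := Finset.sum_le_sum_of_subset hs
    _ = ∑ i ∈ Finset.range (2 * N + 1), ∫⁻ x, ‖dif ((N : ℤ) - i) f x‖ₑ ^ 2 :=
        Finset.sum_image fun i _ j _ h => by simpa using h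
    _ ≤ _ := le_self_add.trans (sum_lintegral_dif_sq_add N _ hf).le
    _ ≤ _ := lintegral_avg_sq_le _ hf.1

end Average

/-! ### Carleson sequences and the Carleson embedding theorem. -/

section Embedding

/-- The Carleson condition on a sequence of functions `v m`, thought of as living at the scales
`2 ^ (m + β)`. -/
def Car (κ : ℝ≥0∞) (β : ℤ) (v : ℕ → Rd d → ℝ≥0∞) : Prop :=
  ∀ (p : ℤ) (x : Rd d),
    ∑' m : ℕ, (if (m : ℤ) + β ≤ p then eavg p (fun y => v m y ^ 2) x else 0) ≤ κ

theorem Car.sum_le {κ : ℝ≥0∞} {β : ℤ} {v : ℕ → Rd d → ℝ≥0∞} (hv : Car κ β v) (s : Finset ℕ)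
    (p : ℤ) (x : Rd d) :
    ∑ m ∈ s, (if (m : ℤ) + β ≤ p then eavg p (fun y => v m y ^ 2) x else 0) ≤ κ :=
  (ENNReal.sum_le_tsum s).trans (hv p x)

theorem Car.mono {κ κ' : ℝ≥0∞} {β : ℤ} {v : ℕ → Rd d → ℝ≥0∞} (hv : Car κ β v) (h : κ ≤ κ') :
    Car κ' β v :=
  fun p x => (hv p x).trans h

/-- Lowering the scales of a Carleson sequence costs the supremum of the functions. -/
theorem Car.lower {κ c : ℝ≥0∞} {β : ℤ} {v : ℕ → Rd d → ℝ≥0∞} (hv : Car κ β v)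
    (hc : ∀ m x, v m x ^ 2 ≤ c) (k : ℕ) : Car (κ + k * c) (β - k) v := by
  induction k with
  | zero => simpa using hv
  | succ k ih =>
    intro p x
    -- Lowering the scales by one more step admits, for given p, at most the single new index m with
    -- m + β - k = p + 1, and its average costs at most c.
    have hle : ∀ m : ℕ, (if (m : ℤ) + (β - (k + 1 : ℕ)) ≤ p then eavg p (fun y => v m y ^ 2) x
        else 0) ≤ (if (m : ℤ) + (β - k) ≤ p then eavg p (fun y => v m y ^ 2) x else 0) +
          if (m : ℤ) + (β - k) = p + 1 then c else 0 := by
      intro m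
      have := eavg_le_of_le (q := p) (hc m) x
      by_cases h1 : (m : ℤ) + (β - k) ≤ p
      · rw [if_pos h1]
        refine le_trans ?_ le_self_add
        split_ifs <;> simp
      · by_cases h2 : (m : ℤ) + (β - k) = p + 1
        · rw [if_pos h2, if_neg h1, zero_add]
          split_ifs; exacts [this, zero_le]
        · rw [if_neg (by push_cast; omega)]
          exact zero_le
    have hs : ∑' m : ℕ, (if (m : ℤ) + (β - k) = p + 1 then c else 0) ≤ c := by
      by_cases h : ∃ m : ℕ, (m : ℤ) + (β - k) = p + 1
      · obtain ⟨m, hm⟩ := h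
        rw [tsum_eq_single m fun m' hm' => if_neg (by omega)]
        split_ifs <;> simp
      · have h0 : ∀ m : ℕ, (if (m : ℤ) + (β - k) = p + 1 then c else 0) = 0 :=
          fun m => if_neg fun hm => h ⟨m, hm⟩
        simp [h0]
    calc _ ≤ _ := ENNReal.tsum_le_tsum hle
      _ ≤ (κ + k * c) + c := by
        rw [ENNReal.tsum_add]
        exact add_le_add (ih p x) hs
      _ = κ + (k + 1 : ℕ) * c := by push_cast; ring

/-- Keep one term of the Carleson sum and test it on cubes of its own scale, where averaging changes
nothing. -/
theorem Car.sq_le {κ : ℝ≥0∞} {β : ℤ} {v : ℕ → Rd d → ℝ≥0∞} (hv : Car κ β v) {m : ℕ}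
    (hm : CubeConst (m + β) (v m)) (x : Rd d) : v m x ^ 2 ≤ κ := by
  have h := (ENNReal.le_tsum m).trans (hv (m + β) x)
  rw [if_pos le_rfl, eavg_of_cubeConst (hm.map (· ^ 2))] at h
  exact h

/-- The weak type form of the embedding theorem. The set where some average exceeds c is covered by
disjoint maximal dyadic cubes; on each of them the Carleson condition bounds the sum by κ times the
volume, and c times the volume is at most the integral of h. -/
theorem mul_sum_lintegral_le_of_car {κ : ℝ≥0∞} {β γ : ℤ} (hβγ : β ≤ γ) {v : ℕ → Rd d → ℝ≥0∞}
    (hvm : ∀ m, Measurable (v m)) (hv : Car κ β v) {h : Rd d → ℝ≥0∞} (hh : Measurable h)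
    (c : ℝ≥0∞) (s : Finset ℕ) :
    c * ∑ m ∈ s, ∫⁻ x, (if c < eavg (m + γ) h x then v m x ^ 2 else 0) ≤ κ * ∫⁻ x, h x := by
  classical
  obtain ⟨N, hN⟩ : ∃ N : ℕ, ∀ m ∈ s, m ≤ N := ⟨s.sup id, fun m hm => Finset.le_sup (f := id) hm⟩
  set Q : ℤ := N + γ with hQ
  -- `w p` is the indicator of the maximal cubes of scale p. The cap Q on the scales, available
  -- because s is finite, ensures that maximal cubes exist.
  set w : ℤ → Rd d → ℝ≥0∞ := fun p x =>
    if p ≤ Q ∧ c < eavg p h x ∧ ∀ q, p < q → q ≤ Q → eavg q h x ≤ c then 1 else 0 with hw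
  have hwc : ∀ p, CubeConst p (w p) := by
    intro p x y hxy
    have : ∀ q, p ≤ q → eavg q h x = eavg q h y := fun q hq =>
      cubeConst_eavg q h x y (idx_mono hq hxy)
    simp only [hw]
    refine if_congr (and_congr_right fun _ => and_congr (by rw [this p le_rfl])
      (forall_congr' fun q => forall_congr' fun hq => by rw [this q hq.le])) rfl rfl
  have hw1 : ∀ x, ∑' p, w p x ≤ 1 := by
    intro x
    by_cases hx : ∃ p, w p x ≠ 0
    · obtain ⟨p, hp⟩ := hx
      have hp' : p ≤ Q ∧ c < eavg p h x ∧ ∀ q, p < q → q ≤ Q → eavg q h x ≤ c := by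
        by_contra hcon; exact hp (if_neg hcon)
      rw [tsum_eq_single p]
      · simp only [hw]; split_ifs; simp
      · intro q hq
        refine if_neg fun hq' => ?_
        rcases lt_or_gt_of_ne hq with hlt | hgt
        · exact absurd (hq'.2.2 p hlt hp'.1) (not_le.2 hp'.2.1)
        · exact absurd (hp'.2.2 q hgt hq'.1) (not_le.2 hq'.2.1)
    · push Not at hx
      simp [hx]
  -- The maximal cube has scale p ≥ m + γ ≥ m + β, so the index m is counted in the Carleson
  -- condition at p; this is where `β ≤ γ` is needed.
  have hcover : ∀ m ∈ s, ∀ x, (if c < eavg (m + γ) h x then v m x ^ 2 else 0) ≤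
      ∑' p, w p x * (if (m : ℤ) + β ≤ p then v m x ^ 2 else 0) := by
    intro m hm x
    split_ifs with hx
    · have hmQ : (m : ℤ) + γ ≤ Q := by have := hN m hm; omega
      obtain ⟨p, ⟨hp1, hp2, hp3⟩, hpmax⟩ := Int.exists_greatest_of_bdd
        (P := fun p => (m : ℤ) + γ ≤ p ∧ p ≤ Q ∧ c < eavg p h x) ⟨Q, fun z hz => hz.2.1⟩
        ⟨m + γ, le_rfl, hmQ, hx⟩
      refine le_trans ?_ (ENNReal.le_tsum p)
      have hwp : w p x = 1 := if_pos ⟨hp2, hp3, fun q hpq hqQ => by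
        by_contra hcon
        have := hpmax q ⟨by omega, hqQ, not_le.1 hcon⟩
        omega⟩
      rw [hwp, one_mul, if_pos (by omega)]
    · exact zero_le
  calc c * ∑ m ∈ s, ∫⁻ x, (if c < eavg (m + γ) h x then v m x ^ 2 else 0)
      ≤ c * ∑ m ∈ s, ∫⁻ x, ∑' p, w p x * (if (m : ℤ) + β ≤ p then v m x ^ 2 else 0) := by
        gcongr with m hm x
        exact hcover m hm x
    _ = c * ∑ m ∈ s, ∑' p, ∫⁻ x, w p x * (if (m : ℤ) + β ≤ p then v m x ^ 2 else 0) := by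
        congr 1
        refine Finset.sum_congr rfl fun m _ => lintegral_tsum fun p => ?_
        refine ((hwc p).measurable.mul ?_).aemeasurable
        split_ifs
        exacts [(hvm m).pow_const 2, measurable_const]
    _ = c * ∑ m ∈ s, ∑' p, ∫⁻ x, w p x *
          (if (m : ℤ) + β ≤ p then eavg p (fun y => v m y ^ 2) x else 0) := by
        congr 1
        refine Finset.sum_congr rfl fun m _ => tsum_congr fun p => ?_
        split_ifs
        · exact (lintegral_mul_eavg (hwc p) ((hvm m).pow_const 2)).symm
        · rfl
    _ = ∑' p, ∫⁻ x, c * (w p x * ∑ m ∈ s,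
          (if (m : ℤ) + β ≤ p then eavg p (fun y => v m y ^ 2) x else 0)) := by
        have hm : ∀ (m : ℕ) (p : ℤ), Measurable fun x : Rd d =>
            (if (m : ℤ) + β ≤ p then eavg p (fun y => v m y ^ 2) x else 0) := fun m p => by
          split_ifs
          exacts [(cubeConst_eavg _ _).measurable, measurable_const]
        rw [← Summable.tsum_finsetSum fun _ _ => ENNReal.summable, ← ENNReal.tsum_mul_left]
        refine tsum_congr fun p => ?_
        rw [lintegral_const_mul _ ((hwc p).measurable.fun_mul (Finset.measurable_fun_sum _ fun m _ => hm m p)),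
          ← lintegral_finsetSum _ fun m _ => (hwc p).measurable.fun_mul (hm m p)]
        simp only [Finset.mul_sum]
    _ ≤ ∑' p, ∫⁻ x, κ * (w p x * eavg p h x) := by
        refine ENNReal.tsum_le_tsum fun p => lintegral_mono fun x => ?_
        by_cases hp : p ≤ Q ∧ c < eavg p h x ∧ ∀ q, p < q → q ≤ Q → eavg q h x ≤ c
        · simp only [hw, if_pos hp, one_mul]
          rw [mul_comm]
          gcongr
          exacts [hv.sum_le s p x, hp.2.1.le]
        · simp [hw, if_neg hp]
    _ = ∑' p, ∫⁻ x, κ * (w p x * h x) := by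
        refine tsum_congr fun p => ?_
        rw [lintegral_const_mul _ ((hwc p).measurable.fun_mul (cubeConst_eavg p h).measurable),
          lintegral_const_mul _ ((hwc p).measurable.fun_mul hh), lintegral_mul_eavg (hwc p) hh]
    _ = κ * ∫⁻ x, (∑' p, w p x) * h x := by
        rw [← lintegral_tsum fun p => ((hwc p).measurable.fun_mul hh).const_mul κ |>.aemeasurable]
        simp only [ENNReal.tsum_mul_left, ENNReal.tsum_mul_right]
        rw [lintegral_const_mul]
        exact (Measurable.tsum fun p => (hwc p).measurable).fun_mul hh
    _ ≤ κ * ∫⁻ x, h x := by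
        gcongr with x
        exact (mul_le_mul_left (hw1 x) _).trans_eq (one_mul _)

theorem lintegral_Ioo_two_mul (b : NNReal) :
    ∫⁻ t in Ioo (0 : ℝ) b, ENNReal.ofReal (2 * t) = (b : ℝ≥0∞) ^ 2 := by
  have hi : IntegrableOn (fun t : ℝ => 2 * t) (Ioc 0 b) :=
    (continuous_const.mul continuous_id).integrableOn_Ioc
  rw [setLIntegral_congr Ioo_ae_eq_Ioc, ← ofReal_integral_eq_lintegral_ofReal hi
    ((ae_restrict_iff' measurableSet_Ioc).2 (Eventually.of_forall fun t ht => by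
      have := ht.1.le; simpa using this)),
    ← intervalIntegral.integral_of_le b.coe_nonneg, intervalIntegral.integral_const_mul, integral_id]
  rw [show (2 : ℝ) * (((b : ℝ) ^ 2 - 0 ^ 2) / 2) = (b : ℝ) ^ 2 by ring,
    ENNReal.ofReal_pow b.coe_nonneg, ENNReal.ofReal_coe_nnreal]

/-- The layer cake formula a² = ∫ 2t 1_{t < a} dt. Comparison with finite numbers below a² covers a
= ∞ too. -/
theorem sq_le_lintegral_layer (a : ℝ≥0∞) :
    a ^ 2 ≤ ∫⁻ t in Ioi (0 : ℝ), if ENNReal.ofReal t < a then ENNReal.ofReal (2 * t) else 0 := by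
  refine ENNReal.le_of_forall_nnreal_lt fun r hr => ?_
  set b := NNReal.sqrt r
  have hb : (b : ℝ≥0∞) ^ 2 = r := by
    rw [← ENNReal.coe_pow, NNReal.sq_sqrt]
  have hba : (b : ℝ≥0∞) < a := by
    rw [← hb] at hr
    exact (ENNReal.pow_lt_pow_left_iff two_ne_zero).1 hr
  rw [← hb, ← lintegral_Ioo_two_mul]
  refine le_trans ?_ (lintegral_mono_set (s := Ioo (0 : ℝ) b) Ioo_subset_Ioi_self)
  refine setLIntegral_mono' measurableSet_Ioo fun t ht => ?_
  rw [if_pos]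
  refine lt_of_le_of_lt ?_ hba
  rw [← ENNReal.ofReal_coe_nnreal]
  exact ENNReal.ofReal_le_ofReal ht.2.le

theorem lintegral_layer_const_le (a : ℝ≥0∞) :
    ∫⁻ t in Ioi (0 : ℝ), (if ENNReal.ofReal t < a then (1 : ℝ≥0∞) else 0) ≤ a := by
  by_cases ha : a = ∞
  · simp [ha]
  calc ∫⁻ t in Ioi (0 : ℝ), (if ENNReal.ofReal t < a then (1 : ℝ≥0∞) else 0)
      ≤ ∫⁻ t in Ioi (0 : ℝ), (Iio a.toReal).indicator (fun _ => 1) t := by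
        refine setLIntegral_mono' measurableSet_Ioi fun t ht => ?_
        by_cases h : ENNReal.ofReal t < a
        · rw [if_pos h, indicator_of_mem]
          exact (ENNReal.ofReal_lt_iff_lt_toReal (le_of_lt ht) ha).1 h
        · simp [h]
    _ = a := by
        rw [setLIntegral_indicator measurableSet_Iio, setLIntegral_const, one_mul, Iio_inter_Ioi,
          Real.volume_Ioo, sub_zero, ENNReal.ofReal_toReal ha]

theorem sum_lintegral_le_lintegral_sum {ι α : Type*} [MeasurableSpace α] {μ : Measure α}
    (s : Finset ι) (u : ι → α → ℝ≥0∞) :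
    ∑ m ∈ s, ∫⁻ x, u m x ∂μ ≤ ∫⁻ x, ∑ m ∈ s, u m x ∂μ := by
  classical
  induction s using Finset.induction_on with
  | empty => simp
  | insert m s hm ih =>
    simp only [Finset.sum_insert hm]
    exact (add_le_add_right ih _).trans (le_lintegral_add _ _)

/-- The Carleson embedding theorem for dyadic averages. -/
theorem Car.embedding {κ : ℝ≥0∞} {β γ : ℤ} (hβγ : β ≤ γ) {v : ℕ → Rd d → ℝ≥0∞}
    (hvm : ∀ m, Measurable (v m)) (hv : Car κ β v) {g : Rd d → ℝ≥0∞} (hg : Measurable g) :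
    ∑' m : ℕ, ∫⁻ x, v m x ^ 2 * eavg (m + γ) g x ^ 2 ≤ 8 * κ * ∫⁻ x, g x ^ 2 := by
  rw [ENNReal.tsum_eq_iSup_sum]
  refine iSup_le fun s => ?_
  -- Marcinkiewicz truncation at height t/2: the discarded part has averages at most t/2, so an
  -- average of g above t forces an average of `gt t` above t/2. The layers of `gt` integrate to
  -- 2g², which with the factor 4 from 2t = 4 · (t/2) gives 8.
  set gt : ℝ → Rd d → ℝ≥0∞ := fun t x => if ENNReal.ofReal t < 2 * g x then g x else 0 with hgt
  have hgtm2 : Measurable fun p : ℝ × Rd d => gt p.1 p.2 :=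
    Measurable.ite (measurableSet_lt (by fun_prop) (by fun_prop)) (by fun_prop) (by fun_prop)
  have hgtm : ∀ t, Measurable (gt t) := fun t => hgtm2.comp (measurable_const.prodMk measurable_id)
  have hkey : ∀ t ∈ Ioi (0 : ℝ), ∀ (q : ℤ) x, ENNReal.ofReal t < eavg q g x →
      ENNReal.ofReal (t / 2) < eavg q (gt t) x := by
    intro t ht q x hx
    have h1 : ∀ y, g y ≤ gt t y + ENNReal.ofReal (t / 2) := by
      intro y
      simp only [hgt]
      split_ifs with h
      · exact le_self_add
      · rw [zero_add, ENNReal.ofReal_div_of_pos two_pos, ENNReal.ofReal_ofNat,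
          ENNReal.le_div_iff_mul_le (by simp) (by simp), mul_comm]
        exact not_lt.1 h
    have h2 : eavg q g x ≤ eavg q (gt t) x + ENNReal.ofReal (t / 2) := by
      refine (eavg_mono h1 x).trans_eq ?_
      rw [eavg_add (hgtm t), eavg_const]
    by_contra hcon
    have h3 := (hx.trans_le h2).trans_le (add_le_add_left (not_lt.1 hcon) _)
    rw [← ENNReal.ofReal_add (by linarith [mem_Ioi.1 ht]) (by linarith [mem_Ioi.1 ht])] at h3
    simp at h3
  have hlt : ∀ (c : ℝ≥0∞) (q : ℤ) (h : Rd d → ℝ≥0∞), MeasurableSet {x | c < eavg q h x} :=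
    fun c q h => measurableSet_lt measurable_const (cubeConst_eavg q h).measurable
  calc ∑ m ∈ s, ∫⁻ x, v m x ^ 2 * eavg (m + γ) g x ^ 2
      ≤ ∑ m ∈ s, ∫⁻ x, ∫⁻ t in Ioi (0 : ℝ), v m x ^ 2 *
          (if ENNReal.ofReal t < eavg (m + γ) g x then ENNReal.ofReal (2 * t) else 0) := by
        refine Finset.sum_le_sum fun m _ => lintegral_mono fun x => ?_
        rw [lintegral_const_mul _ (Measurable.ite (measurableSet_lt (by fun_prop) (by fun_prop))
          (by fun_prop) (by fun_prop))]
        gcongr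
        exact sq_le_lintegral_layer _
    _ = ∑ m ∈ s, ∫⁻ t in Ioi (0 : ℝ), ∫⁻ x, v m x ^ 2 *
          (if ENNReal.ofReal t < eavg (m + γ) g x then ENNReal.ofReal (2 * t) else 0) := by
        refine Finset.sum_congr rfl fun m _ => lintegral_lintegral_swap ?_
        have h1 := (cubeConst_eavg (m + γ) g).measurable
        have h2 := hvm m
        refine Measurable.aemeasurable (Measurable.fun_mul (by fun_prop) (Measurable.ite
          (measurableSet_lt (by fun_prop) (by fun_prop)) (by fun_prop) (by fun_prop)))
    _ ≤ ∑ m ∈ s, ∫⁻ t in Ioi (0 : ℝ), ∫⁻ x, 4 * (ENNReal.ofReal (t / 2) *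
          (if ENNReal.ofReal (t / 2) < eavg (m + γ) (gt t) x then v m x ^ 2 else 0)) := by
        refine Finset.sum_le_sum fun m _ => setLIntegral_mono' measurableSet_Ioi fun t ht =>
          lintegral_mono fun x => ?_
        by_cases h : ENNReal.ofReal t < eavg (m + γ) g x
        · rw [if_pos h, if_pos (hkey t ht _ x h), ← mul_assoc, mul_comm]
          gcongr
          rw [show (2 : ℝ) * t = 4 * (t / 2) by ring, ENNReal.ofReal_mul (by norm_num)]
          simp
        · simp [h]
    _ = ∑ m ∈ s, ∫⁻ t in Ioi (0 : ℝ), 4 * (ENNReal.ofReal (t / 2) * ∫⁻ x,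
          (if ENNReal.ofReal (t / 2) < eavg (m + γ) (gt t) x then v m x ^ 2 else 0)) := by
        refine Finset.sum_congr rfl fun m _ => lintegral_congr fun t => ?_
        have h1 : Measurable fun x =>
            (if ENNReal.ofReal (t / 2) < eavg (m + γ) (gt t) x then v m x ^ 2 else 0) :=
          Measurable.ite (hlt _ _ _) ((hvm m).pow_const 2) measurable_const
        rw [lintegral_const_mul _ (h1.const_mul _), lintegral_const_mul _ h1]
    _ ≤ ∫⁻ t in Ioi (0 : ℝ), ∑ m ∈ s, 4 * (ENNReal.ofReal (t / 2) * ∫⁻ x,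
          (if ENNReal.ofReal (t / 2) < eavg (m + γ) (gt t) x then v m x ^ 2 else 0)) := by
        exact sum_lintegral_le_lintegral_sum s _
    _ ≤ ∫⁻ t in Ioi (0 : ℝ), 4 * (κ * ∫⁻ x, gt t x) := by
        refine lintegral_mono fun t => ?_
        rw [← Finset.mul_sum, ← Finset.mul_sum]
        exact mul_le_mul_right (mul_sum_lintegral_le_of_car hβγ hvm hv (hgtm t) _ s) _
    _ = 4 * (κ * ∫⁻ x, ∫⁻ t in Ioi (0 : ℝ), gt t x) := by
        rw [lintegral_const_mul _ (Measurable.const_mul hgtm2.lintegral_prod_right' _),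
          lintegral_const_mul _ hgtm2.lintegral_prod_right',
          lintegral_lintegral_swap hgtm2.aemeasurable]
    _ ≤ 4 * (κ * ∫⁻ x, 2 * g x ^ 2) := by
        gcongr with x
        calc ∫⁻ t in Ioi (0 : ℝ), gt t x
            = ∫⁻ t in Ioi (0 : ℝ), g x * (if ENNReal.ofReal t < 2 * g x then 1 else 0) := by
              refine lintegral_congr fun t => ?_
              simp [hgt]
          _ = g x * ∫⁻ t in Ioi (0 : ℝ), (if ENNReal.ofReal t < 2 * g x then 1 else 0) :=
              lintegral_const_mul _ (Measurable.ite (measurableSet_lt (by fun_prop) (by fun_prop))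
                (by fun_prop) (by fun_prop))
          _ ≤ g x * (2 * g x) := by gcongr; exact lintegral_layer_const_le _
          _ = 2 * g x ^ 2 := by ring
    _ = 8 * κ * ∫⁻ x, g x ^ 2 := by
        rw [lintegral_const_mul _ (hg.pow_const 2)]
        ring

/-- An a priori finiteness: it allows division by ∫ S² in the duality argument of
`Car.lintegral_tsum_mul_sq_le`. -/
theorem lintegral_finsetSum_sq_lt_top {ι : Type*} (s : Finset ι) {u : ι → Rd d → ℝ≥0∞}
    (hum : ∀ m, Measurable (u m)) (hu : ∀ m ∈ s, ∫⁻ x, u m x ^ 2 < ∞) :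
    ∫⁻ x, (∑ m ∈ s, u m x) ^ 2 < ∞ := by
  classical
  induction s using Finset.induction_on with
  | empty => simp
  | insert m s hm ih =>
    have h : ∀ a b : ℝ≥0∞, (a + b) ^ 2 ≤ 4 * (a ^ 2 + b ^ 2) := fun a b => by
      rcases le_total a b with hab | hab
      · calc (a + b) ^ 2 ≤ (b + b) ^ 2 := by gcongr
          _ = 4 * b ^ 2 := by ring
          _ ≤ _ := by gcongr; exact le_add_self
      · calc (a + b) ^ 2 ≤ (a + a) ^ 2 := by gcongr
          _ = 4 * a ^ 2 := by ring
          _ ≤ _ := by gcongr; exact le_self_add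
    simp only [Finset.sum_insert hm]
    refine (lintegral_mono fun x => h _ _).trans_lt ?_
    rw [lintegral_const_mul' _ _ (by norm_num), lintegral_add_left ((hum m).pow_const 2)]
    exact ENNReal.mul_lt_top (by norm_num) (ENNReal.add_lt_top.2
      ⟨hu m (Finset.mem_insert_self _ _), ih fun i hi => hu i (Finset.mem_insert_of_mem hi)⟩)

theorem sum_lintegral_mul_sq_le {ι α : Type*} [MeasurableSpace α] {μ : Measure α} (s : Finset ι)
    {u w : ι → α → ℝ≥0∞} (hu : ∀ m, Measurable (u m)) (hw : ∀ m, Measurable (w m)) :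
    (∑ m ∈ s, ∫⁻ x, u m x * w m x ∂μ) ^ 2 ≤
      (∑ m ∈ s, ∫⁻ x, u m x ^ 2 ∂μ) * ∑ m ∈ s, ∫⁻ x, w m x ^ 2 ∂μ := by
  have hs : ∀ a : ℝ≥0∞, (a ^ (1 / 2 : ℝ)) ^ 2 = a := fun a => by
    rw [← ENNReal.rpow_natCast, ← ENNReal.rpow_mul]; norm_num
  have h1 : ∀ m, ∫⁻ x, u m x * w m x ∂μ ≤
      (∫⁻ x, u m x ^ 2 ∂μ) ^ (1 / 2 : ℝ) * (∫⁻ x, w m x ^ 2 ∂μ) ^ (1 / 2 : ℝ) := fun m => by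
    refine (ENNReal.pow_le_pow_left_iff two_ne_zero).1 ?_
    rw [mul_pow, hs, hs]
    exact lintegral_mul_sq_le (hu m).aemeasurable (hw m).aemeasurable
  have h2 := tsum_mul_sq_le (fun m : s => (∫⁻ x, u m x ^ 2 ∂μ) ^ (1 / 2 : ℝ))
    (fun m : s => (∫⁻ x, w m x ^ 2 ∂μ) ^ (1 / 2 : ℝ))
  simp only [hs] at h2
  rw [tsum_fintype, tsum_fintype, tsum_fintype, Finset.sum_coe_sort s fun m =>
    (∫⁻ x, u m x ^ 2 ∂μ) ^ (1 / 2 : ℝ) * (∫⁻ x, w m x ^ 2 ∂μ) ^ (1 / 2 : ℝ),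
    Finset.sum_coe_sort s fun m => ∫⁻ x, u m x ^ 2 ∂μ,
    Finset.sum_coe_sort s fun m => ∫⁻ x, w m x ^ 2 ∂μ] at h2
  refine le_trans ?_ h2
  gcongr with m _
  exact h1 m

/-- A sum of products of a square summable sequence and a Carleson sequence. -/
theorem Car.lintegral_tsum_mul_sq_le {κ : ℝ≥0∞} (hκ : κ ≠ ∞) {β : ℤ} {u v : ℕ → Rd d → ℝ≥0∞}
    (hu : ∀ m : ℕ, CubeConst (m + β) (u m)) (hv : ∀ m : ℕ, CubeConst (m + β) (v m)) (hc : Car κ β v)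
    (hU : ∑' m, ∫⁻ x, u m x ^ 2 ≠ ∞) :
    ∫⁻ x, (∑' m, u m x * v m x) ^ 2 ≤ 8 * κ * ∑' m, ∫⁻ x, u m x ^ 2 := by
  have hum := fun m => (hu m).measurable
  have hvm := fun m => (hv m).measurable
  have huvm : ∀ m, Measurable fun x => u m x * v m x := fun m => (hum m).fun_mul (hvm m)
  have hfin : ∀ n, ∫⁻ x, (∑ m ∈ Finset.range n, u m x * v m x) ^ 2 ≤
      8 * κ * ∑' m, ∫⁻ x, u m x ^ 2 := by
    intro n
    set S : Rd d → ℝ≥0∞ := fun x => ∑ m ∈ Finset.range n, u m x * v m x with hS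
    have hSm : Measurable S := Finset.measurable_fun_sum _ fun m _ => huvm m
    have htop : ∫⁻ x, S x ^ 2 < ∞ := by
      refine lintegral_finsetSum_sq_lt_top _ huvm fun m _ => ?_
      calc ∫⁻ x, (u m x * v m x) ^ 2 ≤ ∫⁻ x, u m x ^ 2 * κ := by
            refine lintegral_mono fun x => ?_
            rw [mul_pow]
            gcongr
            exact hc.sq_le (hv m) x
        _ = (∫⁻ x, u m x ^ 2) * κ := lintegral_mul_const _ ((hum m).pow_const 2)
        _ < ∞ := ENNReal.mul_lt_top ((ENNReal.le_tsum m).trans_lt hU.lt_top) hκ.lt_top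
    -- Duality with S itself. As u v is constant on the cubes of scale m + β, one factor S may be
    -- averaged; Cauchy–Schwarz and the embedding theorem applied to S then bound (∫ S²)² by a
    -- constant times ∫ S².
    have h1 : ∫⁻ x, S x ^ 2 = ∑ m ∈ Finset.range n, ∫⁻ x, u m x * (v m x * eavg (m + β) S x) := by
      calc ∫⁻ x, S x ^ 2 = ∫⁻ x, ∑ m ∈ Finset.range n, (u m x * v m x) * S x := by
            refine lintegral_congr fun x => ?_
            rw [sq, ← Finset.sum_mul]
        _ = ∑ m ∈ Finset.range n, ∫⁻ x, (u m x * v m x) * S x :=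
            lintegral_finsetSum _ fun m _ => (huvm m).fun_mul hSm
        _ = _ := by
            refine Finset.sum_congr rfl fun m _ => ?_
            rw [← lintegral_mul_eavg ((hu m).map₂ (hv m) (· * ·)) hSm]
            simp only [mul_assoc]
    have h2 : (∫⁻ x, S x ^ 2) ^ 2 ≤ (8 * κ * ∑' m, ∫⁻ x, u m x ^ 2) * ∫⁻ x, S x ^ 2 := by
      calc (∫⁻ x, S x ^ 2) ^ 2
          ≤ (∑ m ∈ Finset.range n, ∫⁻ x, u m x ^ 2) *
            ∑ m ∈ Finset.range n, ∫⁻ x, (v m x * eavg (m + β) S x) ^ 2 := by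
              rw [h1]
              exact sum_lintegral_mul_sq_le _ hum fun m =>
                (hvm m).fun_mul (cubeConst_eavg _ _).measurable
        _ ≤ (∑' m, ∫⁻ x, u m x ^ 2) * (8 * κ * ∫⁻ x, S x ^ 2) := by
              gcongr
              · exact ENNReal.sum_le_tsum _
              · simp only [mul_pow]
                exact (ENNReal.sum_le_tsum _).trans (hc.embedding le_rfl hvm hSm)
        _ = _ := by ring
    rcases eq_or_ne (∫⁻ x, S x ^ 2) 0 with h0 | h0
    · rw [h0]; exact zero_le
    · rw [sq] at h2
      exact (ENNReal.mul_le_mul_iff_left h0 htop.ne).1 h2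
  have hlim : ∀ x, Tendsto (fun n => (∑ m ∈ Finset.range n, u m x * v m x) ^ 2) atTop
      (𝓝 ((∑' m, u m x * v m x) ^ 2)) := fun x =>
    ((ENNReal.continuous_pow 2).tendsto _).comp (ENNReal.tendsto_nat_tsum _)
  calc ∫⁻ x, (∑' m, u m x * v m x) ^ 2
      = ∫⁻ x, liminf (fun n => (∑ m ∈ Finset.range n, u m x * v m x) ^ 2) atTop :=
        lintegral_congr fun x => (hlim x).liminf_eq.symm
    _ ≤ liminf (fun n => ∫⁻ x, (∑ m ∈ Finset.range n, u m x * v m x) ^ 2) atTop :=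
        lintegral_liminf_le fun n =>
          (Finset.measurable_fun_sum _ fun m _ => huvm m).pow_const 2
    _ ≤ _ := liminf_le_of_le (by isBoundedDefault) fun b hb => by
        obtain ⟨n, hn⟩ := hb.exists
        exact hn.trans (hfin n)

end Embedding

/-! ### Localization of martingale differences to a cube. -/

section LocalMartingale

theorem Car.embedding_avg {κ : ℝ≥0∞} {β γ : ℤ} (hβγ : β ≤ γ) {v : ℕ → Rd d → ℝ≥0∞}
    (hvm : ∀ m, Measurable (v m)) (hv : Car κ β v) {f : Rd d → ℂ} (hf : AEStronglyMeasurable f) :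
    ∑' m : ℕ, ∫⁻ x, v m x ^ 2 * ‖avg (m + γ) f x‖ₑ ^ 2 ≤ 8 * κ * ∫⁻ x, ‖f x‖ₑ ^ 2 := by
  have h := hv.embedding hβγ hvm hf.stronglyMeasurable_mk.measurable.enorm
  have h2 : ∫⁻ x, ‖hf.mk f x‖ₑ ^ 2 = ∫⁻ x, ‖f x‖ₑ ^ 2 := lintegral_congr_ae (by
    filter_upwards [hf.ae_eq_mk] with x hx
    rw [hx])
  rw [h2] at h
  refine le_trans (ENNReal.tsum_le_tsum fun m => lintegral_mono fun x => ?_) h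
  gcongr
  rw [avg_congr_ae hf.ae_eq_mk]
  exact enorm_avg_le _ _ _

theorem avg_indicator_cube {q p : ℤ} (hqp : q ≤ p) (f : Rd d → ℂ) {x y : Rd d} (hy : y ∈ cube p x) :
    avg q ((cube p x).indicator f) y = avg q f y := by
  have hs : cube q y ⊆ cube p x := by
    rw [cube_eq_of_idx (hy : idx _ y = idx _ x).symm]
    exact cube_subset hqp y
  rw [avg, avg, setIntegral_indicator (measurableSet_cube p x), inter_eq_self_of_subset_left hs]

theorem dif_indicator_cube {q p : ℤ} (hqp : q ≤ p) (f : Rd d → ℂ) {x y : Rd d} (hy : y ∈ cube p x) :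
    dif q ((cube p x).indicator f) y = dif q f y := by
  rw [dif, dif, avg_indicator_cube hqp f hy, avg_indicator_cube (by omega) f hy]

theorem lintegral_indicator_cube_sq_le {f : Rd d → ℂ} {c : ℝ≥0∞} (hf : ∀ x, ‖f x‖ₑ ≤ c) (p : ℤ)
    (x : Rd d) :
    ∫⁻ y, ‖(cube p x).indicator f y‖ₑ ^ 2 ≤ c ^ 2 * ENNReal.ofReal (vol d p) := by
  classical
  calc ∫⁻ y, ‖(cube p x).indicator f y‖ₑ ^ 2 ≤ ∫⁻ y, (cube p x).indicator (fun _ => c ^ 2) y := by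
        refine lintegral_mono fun y => ?_
        by_cases hy : y ∈ cube p x
        · simp only [indicator_of_mem hy]
          gcongr
          exact hf y
        · simp [indicator_of_notMem hy]
    _ = _ := by rw [lintegral_indicator_const (measurableSet_cube p x), volume_cube]

theorem memLp_indicator_cube {f : Rd d → ℂ} (hfm : AEStronglyMeasurable f) {c : ℝ≥0∞} (hc : c ≠ ∞)
    (hf : ∀ x, ‖f x‖ₑ ≤ c) (p : ℤ) (x : Rd d) : MemLp ((cube p x).indicator f) 2 :=
  memLp_two_of_sq_lt_top (hfm.indicator (measurableSet_cube p x))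
    ((lintegral_indicator_cube_sq_le hf p x).trans_lt
      (ENNReal.mul_lt_top (ENNReal.pow_lt_top hc.lt_top) ENNReal.ofReal_lt_top))

/-- The martingale differences of a bounded function form a Carleson sequence. -/
theorem car_dif {f : Rd d → ℂ} (hfm : AEStronglyMeasurable f) (hf : ∀ x, ‖f x‖ₑ ≤ 1) (a : ℤ) :
    Car 1 a fun m x => ‖dif (m + a) f x‖ₑ := by
  intro p x
  have hL := memLp_indicator_cube hfm ENNReal.one_ne_top hf p x
  -- Inside the test cube, differences of scale at most p only see f restricted to that cube, whose
  -- squared L² norm is at most the volume; Bessel finishes.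
  calc ∑' m : ℕ, (if (m : ℤ) + a ≤ p then eavg p (fun y => ‖dif (m + a) f y‖ₑ ^ 2) x else 0)
      ≤ ∑' m : ℕ, (ENNReal.ofReal (vol d p))⁻¹ *
          ∫⁻ y, ‖dif (m + a) ((cube p x).indicator f) y‖ₑ ^ 2 := by
        refine ENNReal.tsum_le_tsum fun m => ?_
        split_ifs with h
        · rw [eavg]
          refine mul_le_mul_right (le_trans (setLIntegral_mono' (measurableSet_cube p x)
            fun y hy => ?_) (setLIntegral_le_lintegral (cube p x) _)) _
          rw [dif_indicator_cube h f hy]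
        · exact zero_le
    _ ≤ (ENNReal.ofReal (vol d p))⁻¹ *
          ∑' r : ℤ, ∫⁻ y, ‖dif r ((cube p x).indicator f) y‖ₑ ^ 2 := by
        rw [ENNReal.tsum_mul_left]
        gcongr
        exact ENNReal.tsum_comp_le_tsum_of_injective
          (f := fun m : ℕ => (m : ℤ) + a) (fun m n h => by simpa using h)
          fun r => ∫⁻ y, ‖dif r ((cube p x).indicator f) y‖ₑ ^ 2
    _ ≤ (ENNReal.ofReal (vol d p))⁻¹ * (1 ^ 2 * ENNReal.ofReal (vol d p)) := by
        gcongr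
        exact (tsum_lintegral_dif_sq_le hL).trans (lintegral_indicator_cube_sq_le hf p x)
    _ = 1 := by rw [one_pow, one_mul, inv_vol_mul_vol]

end LocalMartingale

/-! ### Multilinear dyadic paraproducts by summation by parts. -/

section DyadicParaproduct

theorem avg_finsetSum {ι : Type*} (s : Finset ι) {f : ι → Rd d → ℂ} {q : ℤ}
    (hf : ∀ i ∈ s, CubeInt (f i)) (x : Rd d) :
    avg q (fun x => ∑ i ∈ s, f i x) x = ∑ i ∈ s, avg q (f i) x := by
  simp only [avg]
  rw [integral_finsetSum s fun i hi => hf i hi q x, Finset.smul_sum]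

/-- The product of the dyadic averages at the scales `2 ^ (m + a j)`. -/
def avgProd {ι : Type*} (s : Finset ι) (a : ι → ℤ) (f : ι → Rd d → ℂ) (m : ℕ) (x : Rd d) : ℂ :=
  ∏ j ∈ s, avg (m + a j) (f j) x

theorem enorm_avgProd_le_one {ι : Type*} {s : Finset ι} {a : ι → ℤ} {f : ι → Rd d → ℂ}
    (hf : ∀ j ∈ s, ∀ x, ‖f j x‖ₑ ≤ 1) (m : ℕ) (x : Rd d) : ‖avgProd s a f m x‖ₑ ≤ 1 := by
  have h : ‖avgProd s a f m x‖ₑ = ∏ j ∈ s, ‖avg (m + a j) (f j) x‖ₑ := by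
    simp only [avgProd, enorm_eq_nnnorm, nnnorm_prod, ENNReal.ofNNReal_finsetProd]
  rw [h]
  exact Finset.prod_le_one' fun j hj => enorm_avg_le_of_le (hf j hj) x

theorem measurable_avgProd {ι : Type*} (s : Finset ι) (a : ι → ℤ) (f : ι → Rd d → ℂ) (m : ℕ) :
    Measurable (avgProd s a f m) :=
  Finset.measurable_fun_prod s fun _ _ => (cubeConst_avg _ _).measurable

/-- The constants in the estimates for sums with products of `k` dyadic averages. -/
def abelConst : ℕ → ℝ≥0∞
  | 0 => 0
  | k + 1 => 3 * (1 + abelConst k) + abelConst k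

theorem abelConst_ne_top (k : ℕ) : abelConst k ≠ ∞ := by
  induction k with
  | zero => simp [abelConst]
  | succ k ih =>
    rw [abelConst]
    exact ENNReal.add_ne_top.2 ⟨ENNReal.mul_ne_top (by norm_num)
      (ENNReal.add_ne_top.2 ⟨by norm_num, ih⟩), ih⟩

/-- Averaging truncates the series: the terms with q ≥ m are constant on cubes of scale m + β - 1,
the others have mean zero on the cubes of the scale q + β ≤ m + β - 1. -/
theorem avg_martingaleSum {β : ℤ} {D : ℕ → Rd d → ℂ} (hD : ∀ m, MemLp (D m) 2)
    (hDc : ∀ m : ℕ, CubeConst (m + β - 1) (D m)) (hD0 : ∀ (m : ℕ) x, avg (m + β) (D m) x = 0)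
    (m K : ℕ) (x : Rd d) :
    avg (m + β - 1) (fun x => ∑ q ∈ Finset.range K, D q x) x =
      ∑ q ∈ Finset.range K, if m ≤ q then D q x else 0 := by
  rw [avg_finsetSum _ fun i _ => CubeInt.of_memLp (hD i)]
  refine Finset.sum_congr rfl fun q _ => ?_
  split_ifs with h
  · exact avg_of_cubeConst ((hDc q).mono (by omega)) x
  · rw [← avg_avg (q := q + β) (by omega) (CubeInt.of_memLp (hD q)), funext (hD0 q)]
    simp [avg]

theorem lintegral_martingaleSum_sq {β : ℤ} {D : ℕ → Rd d → ℂ} (hD : ∀ m, MemLp (D m) 2)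
    (hDc : ∀ m : ℕ, CubeConst (m + β - 1) (D m)) (hD0 : ∀ (m : ℕ) x, avg (m + β) (D m) x = 0)
    (K : ℕ) :
    ∫⁻ x, ‖∑ q ∈ Finset.range K, D q x‖ₑ ^ 2 = ∑ q ∈ Finset.range K, ∫⁻ x, ‖D q x‖ₑ ^ 2 := by
  induction K with
  | zero => simp
  | succ K ih =>
    simp only [Finset.sum_range_succ]
    rw [← ih, add_comm, ← lintegral_add_sq (hD K) (memLp_finsetSum _ fun q _ => hD q) (hDc K)]
    · simp only [add_comm]
    · intro x
      rw [avg_martingaleSum hD hDc hD0]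
      exact Finset.sum_eq_zero fun q hq => if_neg (by simpa using hq)

theorem sum_range_mul_sub (T P : ℕ → ℂ) (K : ℕ) :
    ∑ m ∈ Finset.range K, (T m - T (m + 1)) * P m =
      T 0 * P 0 - T K * P K - ∑ m ∈ Finset.range K, T (m + 1) * (P m - P (m + 1)) := by
  induction K with
  | zero => simp
  | succ K ih => rw [Finset.sum_range_succ, Finset.sum_range_succ, ih]; ring

/-- Summation by parts: the bound for sums of martingale differences times `avgProd`, given the
bound for the differences of `avgProd`. -/
theorem eLpNorm_sum_dif_mul_avgProd_le_of {ι : Type*} {s : Finset ι} {a : ι → ℤ}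
    {f : ι → Rd d → ℂ} (hf1 : ∀ j ∈ s, ∀ x, ‖f j x‖ₑ ≤ 1) {C : ℝ≥0∞} {β : ℤ} {K : ℕ}
    (hC : ∀ T : Rd d → ℂ, MemLp T 2 → eLpNorm (fun x => ∑ m ∈ Finset.range K,
      avg (m + β) T x * (avgProd s a f m x - avgProd s a f (m + 1) x)) 2 ≤ C * eLpNorm T 2)
    {D : ℕ → Rd d → ℂ} (hD : ∀ m, MemLp (D m) 2)
    (hDc : ∀ m : ℕ, CubeConst (m + β - 1) (D m)) (hD0 : ∀ (m : ℕ) x, avg (m + β) (D m) x = 0)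
    {A : ℝ≥0∞} (hA : ∑ m ∈ Finset.range K, ∫⁻ x, ‖D m x‖ₑ ^ 2 ≤ A ^ 2) :
    eLpNorm (fun x => ∑ m ∈ Finset.range K, D m x * avgProd s a f m x) 2 ≤ (1 + C) * A := by
  set T : Rd d → ℂ := fun x => ∑ q ∈ Finset.range K, D q x with hTdef
  have hT : MemLp T 2 := memLp_finsetSum _ fun q _ => hD q
  have hTA : eLpNorm T 2 ≤ A := by
    refine eLpNorm_two_le_of_sq_le ?_
    rw [lintegral_martingaleSum_sq hD hDc hD0]
    exact hA
  have hav := fun m x => avg_martingaleSum hD hDc hD0 m K x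
  -- Each `D m` is recovered as a difference of consecutive averages of the full sum T. Abel
  -- summation then moves the difference onto the product; at m = 0 the average is T itself and at m
  -- = K it vanishes.
  have hstep : ∀ x, ∀ m ∈ Finset.range K,
      D m x = avg (m + β - 1) T x - avg ((m + 1 : ℕ) + β - 1) T x := by
    intro x m hm
    rw [hav, hav, ← Finset.sum_sub_distrib, Finset.sum_eq_single m]
    · simp
    · intro q _ hq
      by_cases h : m ≤ q
      · rw [if_pos h, if_pos (by omega), sub_self]
      · rw [if_neg h, if_neg (by omega), sub_self]
    · exact fun h => absurd hm h
  have h0 : ∀ x, avg ((0 : ℕ) + β - 1) T x = T x := fun x => by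
    rw [hav]; simp [hTdef]
  have hK : ∀ x, avg (K + β - 1) T x = 0 := fun x => by
    rw [hav]
    exact Finset.sum_eq_zero fun q hq => if_neg (by simpa using hq)
  have heq : (fun x => ∑ m ∈ Finset.range K, D m x * avgProd s a f m x) =
      (fun x => T x * avgProd s a f 0 x) - fun x => ∑ m ∈ Finset.range K,
        avg (m + β) T x * (avgProd s a f m x - avgProd s a f (m + 1) x) := by
    ext x
    rw [Finset.sum_congr rfl fun m hm => by rw [hstep x m hm],
      sum_range_mul_sub (fun m => avg (m + β - 1) T x) (fun m => avgProd s a f m x), h0, hK, zero_mul,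
      sub_zero, Pi.sub_apply]
    congr 1
    refine Finset.sum_congr rfl fun m _ => ?_
    rw [show ((m + 1 : ℕ) : ℤ) + β - 1 = m + β by push_cast; ring]
  rw [heq]
  refine (eLpNorm_sub_le ?_ ?_ one_le_two).trans ?_
  · exact hT.1.mul (measurable_avgProd _ _ _ _).aestronglyMeasurable
  · exact (Finset.measurable_fun_sum _ fun m _ => (cubeConst_avg _ _).measurable.mul
      ((measurable_avgProd _ _ _ _).sub (measurable_avgProd _ _ _ _))).aestronglyMeasurable
  · rw [add_mul, one_mul]
    refine add_le_add (le_trans ?_ hTA) ((hC T hT).trans (by gcongr))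
    refine eLpNorm_mono_enorm fun x => ?_
    rw [enorm_mul]
    exact (mul_le_mul_right (enorm_avgProd_le_one hf1 0 x) _).trans_eq (mul_one _)

/-- Induction on the number of factors, removing the factor j of the coarsest scale by the discrete
Leibniz rule. If the difference falls on the other factors, the average of `f j` joins the bounded
weight w. If it falls on `f j`, the product w · avg T · dif (f j) is again a martingale difference
sequence, because w and avg T live at coarser scales; the Carleson embedding bounds its square sum,
and summation by parts returns to the remaining factors. -/
theorem eLpNorm_sum_mul_avgProd_sub_le {ι : Type*} (a : ι → ℤ) (f : ι → Rd d → ℂ)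
    (hfm : ∀ j, AEStronglyMeasurable (f j)) (s : Finset ι) (hf1 : ∀ j ∈ s, ∀ x, ‖f j x‖ₑ ≤ 1)
    {γ γ' : ℤ} (hγ : ∀ j ∈ s, a j < γ) (hγγ' : γ ≤ γ') {T : Rd d → ℂ} (hT : MemLp T 2)
    {w : ℕ → Rd d → ℂ} (hw : ∀ m : ℕ, CubeConst (m + γ) (w m)) (hw1 : ∀ m x, ‖w m x‖ₑ ≤ 1)
    (K : ℕ) :
    eLpNorm (fun x => ∑ m ∈ Finset.range K, w m x * avg (m + γ') T x *
      (avgProd s a f m x - avgProd s a f (m + 1) x)) 2 ≤ abelConst s.card * eLpNorm T 2 := by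
  classical
  induction s using Finset.induction_on_max_value a generalizing γ γ' T w with
  | empty => simp [avgProd]
  | insert j s hj hmax ih =>
    have hf1s : ∀ i ∈ s, ∀ x, ‖f i x‖ₑ ≤ 1 := fun i hi => hf1 i (Finset.mem_insert_of_mem hi)
    have hfj := hf1 j (Finset.mem_insert_self _ _)
    have hγj : a j + 1 ≤ γ := hγ j (Finset.mem_insert_self _ _)
    have hfjI : CubeInt (f j) := CubeInt.of_enorm_le (hfm j) ENNReal.one_ne_top hfj
    set D : ℕ → Rd d → ℂ := fun m x =>
      w m x * avg (m + γ') T x * dif (m + (a j + 1)) (f j) x with hDdef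
    have hpre : ∀ m : ℕ, CubeConst (m + (a j + 1)) fun x => w m x * avg (m + γ') T x := fun m =>
      ((hw m).mono (by omega)).map₂ ((cubeConst_avg _ _).mono (by omega)) (· * ·)
    have hDc : ∀ m : ℕ, CubeConst (m + (a j + 1) - 1) (D m) := fun m =>
      ((hpre m).mono (by omega)).map₂ (cubeConst_dif _ _) (· * ·)
    have hD0 : ∀ (m : ℕ) x, avg (m + (a j + 1)) (D m) x = 0 := fun m x => by
      rw [avg_mul (hpre m), avg_dif_of_le le_rfl hfjI, mul_zero]
    have hDle : ∑' m : ℕ, ∫⁻ x, ‖D m x‖ₑ ^ 2 ≤ 8 * 1 * ∫⁻ x, ‖T x‖ₑ ^ 2 := by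
      refine le_trans (ENNReal.tsum_le_tsum fun m => lintegral_mono fun x => ?_)
        ((car_dif (hfm j) hfj (a j + 1)).embedding_avg (γ := γ') (by omega)
          (fun m => (cubeConst_dif _ _).measurable.enorm) hT.1)
      simp only [hDdef, enorm_mul, mul_pow]
      rw [mul_comm]
      gcongr
      refine (mul_le_mul_left (pow_le_one' (hw1 m x) 2) _).trans_eq (one_mul _)
    have hD : ∀ m, MemLp (D m) 2 := fun m =>
      memLp_two_of_sq_lt_top (hDc m).measurable.aestronglyMeasurable
        (((ENNReal.le_tsum m).trans hDle).trans_lt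
          (ENNReal.mul_lt_top (by norm_num) (lintegral_sq_lt_top hT)))
    -- The 3 in `abelConst` is the integer above √8, with 8 from the embedding theorem.
    have hA : ∑ m ∈ Finset.range K, ∫⁻ x, ‖D m x‖ₑ ^ 2 ≤ (3 * eLpNorm T 2) ^ 2 := by
      refine (ENNReal.sum_le_tsum _).trans (hDle.trans ?_)
      rw [mul_pow, eLpNorm_two_sq]
      gcongr
      norm_num
    have h1 := eLpNorm_sum_dif_mul_avgProd_le_of (a := a) (K := K) hf1s (C := abelConst s.card)
      (fun T hT => by
        simpa using ih hf1s (γ := a j + 1) (γ' := a j + 1)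
          (fun i hi => by have := hmax i hi; omega) le_rfl hT
          (w := fun _ _ => 1) (fun m _ _ _ => rfl) (fun m x => by simp)) hD hDc hD0 hA
    have h2 := ih hf1s (γ := a j + 1) (γ' := γ') (fun i hi => by have := hmax i hi; omega)
      (by omega) hT (w := fun m x => w m x * avg (m + (a j + 1)) (f j) x)
      (fun m => ((hw m).mono (by omega)).map₂ (cubeConst_avg _ _) (· * ·)) (fun m x => by
        rw [enorm_mul]
        exact mul_le_one' (hw1 m x) (enorm_avg_le_of_le hfj x))
    have heq : (fun x => ∑ m ∈ Finset.range K, w m x * avg (m + γ') T x *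
        (avgProd (insert j s) a f m x - avgProd (insert j s) a f (m + 1) x)) =
        (fun x => ∑ m ∈ Finset.range K, D m x * avgProd s a f m x) +
        fun x => ∑ m ∈ Finset.range K, w m x * avg (m + (a j + 1)) (f j) x * avg (m + γ') T x *
          (avgProd s a f m x - avgProd s a f (m + 1) x) := by
      ext x
      rw [Pi.add_apply, ← Finset.sum_add_distrib]
      refine Finset.sum_congr rfl fun m _ => ?_
      simp only [avgProd, Finset.prod_insert hj, hDdef, dif]
      rw [show ((m + 1 : ℕ) : ℤ) + a j = m + (a j + 1) by push_cast; ring,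
        show (m : ℤ) + (a j + 1) - 1 = m + a j by ring]
      ring
    rw [heq, Finset.card_insert_of_notMem hj, abelConst, add_mul]
    refine (eLpNorm_add_le ?_ ?_ one_le_two).trans (add_le_add (h1.trans_eq (by ring)) h2)
    · exact (Finset.measurable_fun_sum _ fun m _ => (hDc m).measurable.mul
        (measurable_avgProd _ _ _ _)).aestronglyMeasurable
    · exact (Finset.measurable_fun_sum _ fun m _ =>
        (((hw m).measurable.mul (cubeConst_avg _ _).measurable).mul
          (cubeConst_avg _ _).measurable).mul ((measurable_avgProd _ _ _ _).sub
            (measurable_avgProd _ _ _ _))).aestronglyMeasurable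

/-- Sums of martingale differences times products of averages at finer scales. -/
theorem eLpNorm_sum_dif_mul_avgProd_le {ι : Type*} {a : ι → ℤ} {f : ι → Rd d → ℂ}
    (hfm : ∀ j, AEStronglyMeasurable (f j)) {s : Finset ι} (hf1 : ∀ j ∈ s, ∀ x, ‖f j x‖ₑ ≤ 1)
    {β : ℤ} (hβ : ∀ j ∈ s, a j < β) {D : ℕ → Rd d → ℂ} (hD : ∀ m, MemLp (D m) 2)
    (hDc : ∀ m : ℕ, CubeConst (m + β - 1) (D m)) (hD0 : ∀ (m : ℕ) x, avg (m + β) (D m) x = 0)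
    (K : ℕ) {A : ℝ≥0∞} (hA : ∑ m ∈ Finset.range K, ∫⁻ x, ‖D m x‖ₑ ^ 2 ≤ A ^ 2) :
    eLpNorm (fun x => ∑ m ∈ Finset.range K, D m x * avgProd s a f m x) 2 ≤
      (1 + abelConst s.card) * A :=
  eLpNorm_sum_dif_mul_avgProd_le_of hf1
    (fun T hT => by
      simpa using eLpNorm_sum_mul_avgProd_sub_le a f hfm s hf1 hβ le_rfl hT
        (w := fun _ _ => 1) (fun m _ _ _ => rfl) (fun m x => by simp) K) hD hDc hD0 hA

end DyadicParaproduct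

/-! ### Integral operators with kernels bounded in the sense of Schur. -/

section Kernels

/-- A measurable kernel with uniform bounds on the integrals of the rows and of the columns. -/
structure KerBound (K : Rd d → Rd d → ℂ) (a b : ℝ≥0∞) : Prop where
  meas : Measurable (Function.uncurry K)
  row : ∀ x, ∫⁻ y, ‖K x y‖ₑ ≤ a
  col : ∀ y, ∫⁻ x, ‖K x y‖ₑ ≤ b

/-- The integral operator with kernel `K`. -/
def kerOp (K : Rd d → Rd d → ℂ) (f : Rd d → ℂ) (x : Rd d) : ℂ := ∫ y, K x y * f y

/-- The kernel `K` averaged in the first variable. -/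
def kerAvg (q : ℤ) (K : Rd d → Rd d → ℂ) (x y : Rd d) : ℂ := avg q (fun x' => K x' y) x

namespace KerBound

variable {K K' : Rd d → Rd d → ℂ} {a b a' b' : ℝ≥0∞}

theorem measurable_left (h : KerBound K a b) (y : Rd d) : Measurable fun x => K x y :=
  h.meas.comp (measurable_id.prodMk measurable_const)

theorem measurable_right (h : KerBound K a b) (x : Rd d) : Measurable fun y => K x y :=
  h.meas.comp (measurable_const.prodMk measurable_id)

theorem mono (h : KerBound K a b) (ha : a ≤ a') (hb : b ≤ b') : KerBound K a' b' :=
  ⟨h.meas, fun x => (h.row x).trans ha, fun y => (h.col y).trans hb⟩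

theorem swap (h : KerBound K a b) : KerBound (fun x y => K y x) b a :=
  ⟨h.meas.comp measurable_swap, h.col, h.row⟩

theorem sub (h : KerBound K a b) (h' : KerBound K' a' b') :
    KerBound (fun x y => K x y - K' x y) (a + a') (b + b') := by
  refine ⟨h.meas.sub h'.meas, fun x => ?_, fun y => ?_⟩
  · calc ∫⁻ y, ‖K x y - K' x y‖ₑ ≤ ∫⁻ y, (‖K x y‖ₑ + ‖K' x y‖ₑ) :=
          lintegral_mono fun y => enorm_sub_le
      _ = (∫⁻ y, ‖K x y‖ₑ) + ∫⁻ y, ‖K' x y‖ₑ := lintegral_add_left (h.measurable_right x).enorm _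
      _ ≤ _ := add_le_add (h.row x) (h'.row x)
  · calc ∫⁻ x, ‖K x y - K' x y‖ₑ ≤ ∫⁻ x, (‖K x y‖ₑ + ‖K' x y‖ₑ) :=
          lintegral_mono fun x => enorm_sub_le
      _ = (∫⁻ x, ‖K x y‖ₑ) + ∫⁻ x, ‖K' x y‖ₑ := lintegral_add_left (h.measurable_left y).enorm _
      _ ≤ _ := add_le_add (h.col y) (h'.col y)

theorem enorm_kerOp_le (h : KerBound K a b) {f : Rd d → ℂ} {c : ℝ≥0∞} (hc : ∀ x, ‖f x‖ₑ ≤ c)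
    (x : Rd d) : ‖kerOp K f x‖ₑ ≤ a * c := by
  calc ‖kerOp K f x‖ₑ ≤ ∫⁻ y, ‖K x y * f y‖ₑ := enorm_integral_le_lintegral_enorm _
    _ ≤ ∫⁻ y, ‖K x y‖ₑ * c := by
        refine lintegral_mono fun y => ?_
        rw [enorm_mul]
        gcongr
        exact hc y
    _ = (∫⁻ y, ‖K x y‖ₑ) * c := lintegral_mul_const _ (h.measurable_right x).enorm
    _ ≤ _ := by gcongr; exact h.row x

/-- Schur's test. -/
theorem lintegral_lintegral_sq_le (h : KerBound K a b) {g : Rd d → ℝ≥0∞} (hg : Measurable g) :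
    ∫⁻ x, (∫⁻ y, ‖K x y‖ₑ * g y) ^ 2 ≤ a * b * ∫⁻ y, g y ^ 2 := by
  have hm : Measurable fun p : Rd d × Rd d => ‖K p.1 p.2‖ₑ := h.meas.enorm
  have hm2 : Measurable fun p : Rd d × Rd d => ‖K p.1 p.2‖ₑ * g p.2 ^ 2 :=
    hm.mul ((hg.comp measurable_snd).pow_const 2)
  calc ∫⁻ x, (∫⁻ y, ‖K x y‖ₑ * g y) ^ 2
      ≤ ∫⁻ x, a * ∫⁻ y, ‖K x y‖ₑ * g y ^ 2 := by
        refine lintegral_mono fun x => ?_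
        refine (lintegral_weighted_sq_le (h.measurable_right x).enorm.aemeasurable
          hg.aemeasurable).trans ?_
        gcongr
        exact h.row x
    _ = a * ∫⁻ x, ∫⁻ y, ‖K x y‖ₑ * g y ^ 2 := lintegral_const_mul _ hm2.lintegral_prod_right'
    _ = a * ∫⁻ y, ∫⁻ x, ‖K x y‖ₑ * g y ^ 2 := by
        rw [lintegral_lintegral_swap hm2.aemeasurable]
    _ = a * ∫⁻ y, (∫⁻ x, ‖K x y‖ₑ) * g y ^ 2 := by
        congr 1
        exact lintegral_congr fun y => lintegral_mul_const _ (h.measurable_left y).enorm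
    _ ≤ a * ∫⁻ y, b * g y ^ 2 := by
        gcongr with y
        exact h.col y
    _ = _ := by rw [lintegral_const_mul _ (hg.pow_const 2), mul_assoc]

theorem lintegral_kerOp_sq_le (h : KerBound K a b) {f : Rd d → ℂ} (hf : Measurable f) :
    ∫⁻ x, ‖kerOp K f x‖ₑ ^ 2 ≤ a * b * ∫⁻ y, ‖f y‖ₑ ^ 2 := by
  refine le_trans (lintegral_mono fun x => ?_) (h.lintegral_lintegral_sq_le hf.enorm)
  gcongr
  exact (enorm_integral_le_lintegral_enorm _).trans_eq (by simp only [enorm_mul])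

theorem measurable_kerOp (h : KerBound K a b) {f : Rd d → ℂ} (hf : Measurable f) :
    Measurable (kerOp K f) := by
  have : StronglyMeasurable fun p : Rd d × Rd d => K p.1 p.2 * f p.2 :=
    (h.meas.mul (hf.comp measurable_snd)).stronglyMeasurable
  exact this.integral_prod_right.measurable

theorem memLp_kerOp (h : KerBound K a b) (ha : a ≠ ∞) (hb : b ≠ ∞) {f : Rd d → ℂ}
    (hf : Measurable f) (hf2 : MemLp f 2) : MemLp (kerOp K f) 2 :=
  memLp_two_of_sq_lt_top (h.measurable_kerOp hf).aestronglyMeasurable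
    ((h.lintegral_kerOp_sq_le hf).trans_lt
      (ENNReal.mul_lt_top (ENNReal.mul_lt_top ha.lt_top hb.lt_top) (lintegral_sq_lt_top hf2)))

end KerBound

/-- The function `f` can be integrated against the kernel `K`, locally uniformly. -/
def Adm (K : Rd d → Rd d → ℂ) (f : Rd d → ℂ) : Prop :=
  ∀ q x, ∫⁻ x' in cube q x, ∫⁻ y, ‖K x' y‖ₑ * ‖f y‖ₑ < ∞

/-- Schur's test puts the absolute integral in L², and Cauchy–Schwarz on a cube of finite volume
turns this into local integrability. -/
theorem KerBound.adm_of_memLp {K : Rd d → Rd d → ℂ} {a b : ℝ≥0∞} (h : KerBound K a b) (ha : a ≠ ∞)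
    (hb : b ≠ ∞) {f : Rd d → ℂ} (hf : Measurable f) (hf2 : MemLp f 2) : Adm K f := by
  intro q x
  have hm : Measurable fun x' => ∫⁻ y, ‖K x' y‖ₑ * ‖f y‖ₑ :=
    Measurable.lintegral_prod_right' (f := fun p : Rd d × Rd d => ‖K p.1 p.2‖ₑ * ‖f p.2‖ₑ)
      (h.meas.enorm.mul (hf.comp measurable_snd).enorm)
  have h1 := lintegral_sq_le (μ := volume.restrict (cube q x)) hm.aemeasurable
  have h2 := (setLIntegral_le_lintegral (cube q x) fun x' =>
    (∫⁻ y, ‖K x' y‖ₑ * ‖f y‖ₑ) ^ 2).trans (h.lintegral_lintegral_sq_le hf.enorm)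
  have h3 : (∫⁻ x' in cube q x, ∫⁻ y, ‖K x' y‖ₑ * ‖f y‖ₑ) ^ 2 < ∞ := by
    refine h1.trans_lt (ENNReal.mul_lt_top ?_ (h2.trans_lt ?_))
    · rw [Measure.restrict_apply_univ]; exact volume_cube_lt_top q x
    · exact ENNReal.mul_lt_top (ENNReal.mul_lt_top ha.lt_top hb.lt_top) (lintegral_sq_lt_top hf2)
  exact (ENNReal.pow_lt_top_iff.1 h3).resolve_right two_ne_zero

theorem KerBound.adm_of_bound {K : Rd d → Rd d → ℂ} {a b : ℝ≥0∞} (h : KerBound K a b) (ha : a ≠ ∞)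
    {f : Rd d → ℂ} {c : ℝ≥0∞} (hc : c ≠ ∞) (hfc : ∀ x, ‖f x‖ₑ ≤ c) :
    Adm K f := by
  intro q x
  calc ∫⁻ x' in cube q x, ∫⁻ y, ‖K x' y‖ₑ * ‖f y‖ₑ ≤ ∫⁻ _ in cube q x, a * c := by
        refine lintegral_mono fun x' => ?_
        calc ∫⁻ y, ‖K x' y‖ₑ * ‖f y‖ₑ ≤ ∫⁻ y, ‖K x' y‖ₑ * c := by
              gcongr with y
              exact hfc y
          _ = (∫⁻ y, ‖K x' y‖ₑ) * c := lintegral_mul_const _ (h.measurable_right x').enorm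
          _ ≤ a * c := by gcongr; exact h.row x'
    _ < ∞ := by
        rw [setLIntegral_const]
        exact ENNReal.mul_lt_top (ENNReal.mul_lt_top ha.lt_top hc.lt_top) (volume_cube_lt_top q x)

theorem Adm.integrable {K : Rd d → Rd d → ℂ} (hK : Measurable (Function.uncurry K)) {f : Rd d → ℂ}
    (hf : Measurable f) (h : Adm K f) (q : ℤ) (x : Rd d) :
    Integrable (Function.uncurry fun x' y => K x' y * f y)
      ((volume.restrict (cube q x)).prod volume) := by
  have hm : Measurable (Function.uncurry fun x' y => K x' y * f y) :=
    hK.mul (hf.comp measurable_snd)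
  refine ⟨hm.aestronglyMeasurable, ?_⟩
  rw [hasFiniteIntegral_iff_enorm, lintegral_prod _ hm.enorm.aemeasurable]
  simpa only [Function.uncurry, enorm_mul] using h q x

theorem Adm.cubeInt {K : Rd d → Rd d → ℂ} (hK : Measurable (Function.uncurry K)) {f : Rd d → ℂ}
    (hf : Measurable f) (h : Adm K f) : CubeInt (kerOp K f) :=
  fun q x => (h.integrable hK hf q x).integral_prod_left

theorem Adm.ae_integrable {K : Rd d → Rd d → ℂ} (hK : Measurable (Function.uncurry K))
    {f : Rd d → ℂ} (hf : Measurable f) (h : Adm K f) (q : ℤ) (x : Rd d) :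
    ∀ᵐ x' ∂(volume.restrict (cube q x)), Integrable fun y => K x' y * f y :=
  (h.integrable hK hf q x).prod_right_ae

theorem measurable_kerAvg {K : Rd d → Rd d → ℂ} (hK : Measurable (Function.uncurry K)) (q : ℤ) :
    Measurable (Function.uncurry (kerAvg q K)) := by
  have h1 : (Function.uncurry (kerAvg q K)) = fun p : Rd d × Rd d => (vol d q)⁻¹ •
      ∫ x', {r : Rd d × Rd d | idx q r.1 = idx q r.2}.indicator (fun r => K r.2 p.2) (p.1, x') := by
    ext ⟨x, y⟩
    simp only [Function.uncurry, kerAvg, avg]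
    rw [← integral_indicator (measurableSet_cube q x)]
    congr 2
    ext x'
    classical
    simp only [indicator_apply, mem_cube_iff, mem_ofPred_eq, eq_comm]
  rw [h1]
  suffices hm : Measurable fun p : Rd d × Rd d =>
      ∫ x', {r : Rd d × Rd d | idx q r.1 = idx q r.2}.indicator (fun r => K r.2 p.2) (p.1, x') from
    hm.const_smul (vol d q)⁻¹
  refine (StronglyMeasurable.integral_prod_right (f := fun (p : Rd d × Rd d) (x' : Rd d) =>
    {r : Rd d × Rd d | idx q r.1 = idx q r.2}.indicator (fun r => K r.2 p.2) (p.1, x'))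
    (Measurable.stronglyMeasurable ?_)).measurable
  have h2 : (Function.uncurry fun (p : Rd d × Rd d) (x' : Rd d) =>
      {r : Rd d × Rd d | idx q r.1 = idx q r.2}.indicator (fun r => K r.2 p.2) (p.1, x')) =
      {r : (Rd d × Rd d) × Rd d | idx q r.1.1 = idx q r.2}.indicator
        (fun r => K r.2 r.1.2) := by
    ext r
    classical
    simp only [Function.uncurry, indicator_apply, mem_ofPred_eq]
  rw [h2]
  refine Measurable.indicator ?_ ?_
  · exact hK.comp (measurable_snd.prodMk (measurable_snd.comp measurable_fst))
  · exact measurableSet_eq_fun ((measurable_idx q).comp (measurable_fst.comp measurable_fst))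
      ((measurable_idx q).comp measurable_snd)

theorem avg_kerOp {K : Rd d → Rd d → ℂ} (hK : Measurable (Function.uncurry K)) {f : Rd d → ℂ}
    (hf : Measurable f) (h : Adm K f) (q : ℤ) (x : Rd d) :
    avg q (kerOp K f) x = kerOp (kerAvg q K) f x := by
  simp only [avg, kerOp, kerAvg]
  rw [integral_integral_swap (h.integrable hK hf q x), ← integral_smul]
  refine integral_congr_ae (Eventually.of_forall fun y => ?_)
  simp only [integral_mul_const, smul_mul_assoc]

theorem KerBound.kerAvg {K : Rd d → Rd d → ℂ} {a b : ℝ≥0∞} (h : KerBound K a b) (q : ℤ) :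
    KerBound (kerAvg q K) a b := by
  refine ⟨measurable_kerAvg h.meas q, fun x => ?_, fun y => ?_⟩
  · have hm : Measurable fun p : Rd d × Rd d => ‖K p.2 p.1‖ₑ := h.swap.meas.enorm
    calc ∫⁻ y, ‖ModelOperator.kerAvg q K x y‖ₑ
        ≤ ∫⁻ y, (ENNReal.ofReal (vol d q))⁻¹ * ∫⁻ x' in cube q x, ‖K x' y‖ₑ :=
          lintegral_mono fun y => enorm_avg_le q _ x
      _ = (ENNReal.ofReal (vol d q))⁻¹ * ∫⁻ y, ∫⁻ x' in cube q x, ‖K x' y‖ₑ :=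
          lintegral_const_mul _ hm.lintegral_prod_right'
      _ = (ENNReal.ofReal (vol d q))⁻¹ * ∫⁻ x' in cube q x, ∫⁻ y, ‖K x' y‖ₑ := by
          rw [lintegral_lintegral_swap hm.aemeasurable]
      _ ≤ (ENNReal.ofReal (vol d q))⁻¹ * ∫⁻ _ in cube q x, a := by
          gcongr with x'
          exact h.row x'
      _ = a := eavg_const q a x
  · calc ∫⁻ x, ‖ModelOperator.kerAvg q K x y‖ₑ ≤ ∫⁻ x, eavg q (fun x' => ‖K x' y‖ₑ) x :=
          lintegral_mono fun x => enorm_avg_le q _ x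
      _ = ∫⁻ x, ‖K x y‖ₑ := lintegral_eavg (h.measurable_left y).enorm
      _ ≤ b := h.col y

theorem kerOp_sub {K K' : Rd d → Rd d → ℂ} {f : Rd d → ℂ} {x : Rd d}
    (h : Integrable fun y => K x y * f y) (h' : Integrable fun y => K' x y * f y) :
    kerOp (fun x y => K x y - K' x y) f x = kerOp K f x - kerOp K' f x := by
  simp only [kerOp, sub_mul]
  exact integral_sub h h'

/-- The dyadic averages are self-adjoint. -/
theorem integral_mul_avg {q : ℤ} {f g : Rd d → ℂ} (hf : Measurable f) (hg : Measurable g)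
    (h : ∫⁻ x, ‖g x‖ₑ * eavg q (fun y => ‖f y‖ₑ) x < ∞) :
    ∫ x, g x * avg q f x = ∫ x, avg q g x * f x := by
  have hm : Measurable fun p : Rd d × Rd d =>
      {r : Rd d × Rd d | idx q r.1 = idx q r.2}.indicator (fun r => g r.1 * f r.2) p :=
    ((hg.comp measurable_fst).mul (hf.comp measurable_snd)).indicator (measurableSet_sameCube q)
  have he : ∀ x y, {r : Rd d × Rd d | idx q r.1 = idx q r.2}.indicator
      (fun r => g r.1 * f r.2) (x, y) = g x * (cube q x).indicator f y := fun x y => by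
    classical
    simp only [indicator_apply, mem_ofPred_eq, mem_cube_iff, mul_ite, mul_zero, eq_comm]
  have he' : ∀ x y, {r : Rd d × Rd d | idx q r.1 = idx q r.2}.indicator
      (fun r => g r.1 * f r.2) (x, y) = (cube q y).indicator g x * f y := fun x y => by
    classical
    simp only [indicator_apply, mem_ofPred_eq, mem_cube_iff, ite_mul, zero_mul]
  have hI : Integrable (Function.uncurry fun x y => {r : Rd d × Rd d | idx q r.1 = idx q r.2}.indicator
      (fun r => g r.1 * f r.2) (x, y)) (volume.prod volume) := by
    refine ⟨hm.aestronglyMeasurable, ?_⟩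
    have hm' : Measurable (Function.uncurry fun x y => {r : Rd d × Rd d |
        idx q r.1 = idx q r.2}.indicator (fun r => g r.1 * f r.2) (x, y)) := hm
    rw [hasFiniteIntegral_iff_enorm, lintegral_prod _ hm'.enorm.aemeasurable]
    have h1 : ∀ x, ∫⁻ y, ‖{r : Rd d × Rd d | idx q r.1 = idx q r.2}.indicator
        (fun r => g r.1 * f r.2) (x, y)‖ₑ =
        ENNReal.ofReal (vol d q) * (‖g x‖ₑ * eavg q (fun y => ‖f y‖ₑ) x) := fun x => by
      simp only [he, enorm_mul]
      rw [lintegral_const_mul _ (hf.indicator (measurableSet_cube q x)).enorm, mul_left_comm,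
        ← setLIntegral_cube, ← lintegral_indicator (measurableSet_cube q x)]
      simp only [enorm_indicator_eq_indicator_enorm]
    simp only [Function.uncurry, h1]
    rw [lintegral_const_mul _ (hg.enorm.fun_mul (cubeConst_eavg _ _).measurable)]
    exact ENNReal.mul_lt_top ENNReal.ofReal_lt_top h
  have hs := integral_integral_swap hI
  simp only [he] at hs
  have hl : ∀ x, g x * avg q f x = (vol d q)⁻¹ • ∫ y, g x * (cube q x).indicator f y := fun x => by
    rw [integral_const_mul, integral_indicator (measurableSet_cube q x), avg, mul_smul_comm]
  have hr : ∀ y, avg q g y * f y = (vol d q)⁻¹ • ∫ x, g x * (cube q x).indicator f y := fun y => by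
    simp only [← he, he', integral_mul_const]
    rw [integral_indicator (measurableSet_cube q y), avg, smul_mul_assoc]
  simp only [hl, hr, integral_smul]
  rw [hs]

end Kernels

/-! ### Convolution kernels at a dyadic scale, and their interaction with a cube. -/

section ConvolutionKernels

/-- The power `2 ^ q` as an extended nonnegative real. -/
def p2 (q : ℤ) : ℝ≥0∞ := ENNReal.ofReal ((2 : ℝ) ^ q)

theorem p2_add (q r : ℤ) : p2 (q + r) = p2 q * p2 r := by
  rw [p2, zpow_add₀ two_ne_zero, ENNReal.ofReal_mul (by positivity), p2, p2]

theorem p2_zero : p2 0 = 1 := by simp [p2]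

theorem p2_neg_natCast (j : ℕ) : p2 (-(j : ℤ)) = 2⁻¹ ^ j := by
  rw [p2, zpow_neg, zpow_natCast, ENNReal.ofReal_inv_of_pos (by positivity),
    ENNReal.ofReal_pow (by norm_num), ENNReal.inv_pow]
  norm_num

theorem p2_mul_neg (q : ℤ) : p2 q * p2 (-q) = 1 := by
  rw [← p2_add, add_neg_cancel, p2_zero]

/-- The integral bounds for a convolution kernel that lives at the scale `2 ^ s`. -/
structure IsKer (s : ℤ) (B : ℝ≥0∞) (k : Rd d → ℂ) : Prop where
  meas : Measurable k
  lint : ∫⁻ w, ‖k w‖ₑ ≤ B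
  moment : ∫⁻ w, ‖k w‖ₑ * ‖w‖ₑ ≤ B * p2 s
  shift : ∀ h, ∫⁻ w, ‖k (w + h) - k w‖ₑ ≤ B * p2 (-s) * ‖h‖ₑ

variable {s q : ℤ} {B : ℝ≥0∞} {k : Rd d → ℂ}

theorem IsKer.comp_neg (hk : IsKer s B k) : IsKer s B fun w => k (-w) := by
  refine ⟨hk.meas.comp measurable_neg, ?_, ?_, fun h => ?_⟩
  · rw [lintegral_neg_eq_self (fun w => ‖k w‖ₑ)]
    exact hk.lint
  · have := lintegral_neg_eq_self (fun w => ‖k w‖ₑ * ‖w‖ₑ) (μ := (volume : Measure (Rd d)))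
    simp only [enorm_neg] at this
    rw [this]
    exact hk.moment
  · have := lintegral_neg_eq_self (fun w => ‖k (w + -h) - k w‖ₑ) (μ := (volume : Measure (Rd d)))
    have h2 := hk.shift (-h)
    rw [enorm_neg, ← this] at h2
    simpa only [neg_add] using h2

theorem integral_comp_neg_ker (k : Rd d → ℂ) : ∫ w, k (-w) = ∫ w, k w := integral_neg_eq_self k volume

theorem IsKer.enorm_integral_le (hk : IsKer s B k) : ‖∫ w, k w‖ₑ ≤ B :=
  (enorm_integral_le_lintegral_enorm _).trans hk.lint

theorem IsKer.integrable (hk : IsKer s B k) (hB : B ≠ ∞) : Integrable k :=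
  ⟨hk.meas.aestronglyMeasurable, hk.lint.trans_lt hB.lt_top⟩

theorem IsKer.kerBound_conv (hk : IsKer s B k) : KerBound (fun x y => k (x - y)) B B := by
  refine ⟨hk.meas.comp (measurable_fst.sub measurable_snd), fun x => ?_, fun y => ?_⟩
  · rw [lintegral_sub_left_eq_self (fun w => ‖k w‖ₑ) x]
    exact hk.lint
  · rw [lintegral_sub_right_eq_self (fun w => ‖k w‖ₑ) y]
    exact hk.lint

/-- The kernel of the dyadic average. -/
def avgKer (s : ℤ) (x y : Rd d) : ℂ := (cube s x).indicator (fun _ => ((vol d s)⁻¹ : ℂ)) y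

theorem avgKer_comm (s : ℤ) (x y : Rd d) : avgKer s x y = avgKer s y x := indicator_cube_comm _ _ _ _

theorem kerOp_const_mul_avgKer (c : ℂ) (f : Rd d → ℂ) (x : Rd d) :
    kerOp (fun x y => c * avgKer s x y) f x = c * avg s f x := by
  have : ∀ y, c * avgKer s x y * f y =
      c * ((vol d s)⁻¹ • (cube s x).indicator f y) := fun y => by
    classical
    simp only [avgKer, indicator_apply]
    split_ifs <;> simp [mul_assoc]
  simp only [kerOp, this]
  rw [integral_const_mul, integral_smul, integral_indicator (measurableSet_cube s x), avg]

theorem kerBound_avgKer (c : ℂ) : KerBound (fun x y : Rd d => c * avgKer s x y) ‖c‖ₑ ‖c‖ₑ := by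
  have hr : ∀ x : Rd d, ∫⁻ y, ‖c * avgKer s x y‖ₑ ≤ ‖c‖ₑ := by
    intro x
    have : ∀ y, ‖c * avgKer s x y‖ₑ =
        (cube s x).indicator (fun _ => ‖c‖ₑ * (ENNReal.ofReal (vol d s))⁻¹) y := fun y => by
      classical
      simp only [avgKer, indicator_apply]
      split_ifs
      · rw [enorm_mul, ← Complex.ofReal_inv, enorm_eq_nnnorm ((_ : ℝ) : ℂ), Complex.nnnorm_real,
          ← enorm_eq_nnnorm, Real.enorm_eq_ofReal (inv_nonneg.2 (vol_pos s).le),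
          ENNReal.ofReal_inv_of_pos (vol_pos s)]
      · simp
    simp only [this]
    rw [lintegral_indicator_const (measurableSet_cube s x), volume_cube, mul_assoc, inv_vol_mul_vol,
      mul_one]
  refine ⟨?_, hr, fun y => ?_⟩
  · have : (Function.uncurry fun x y : Rd d => c * avgKer s x y) =
        {p : Rd d × Rd d | idx s p.1 = idx s p.2}.indicator fun _ => c * ((vol d s)⁻¹ : ℂ) := by
      classical
      ext p
      simp only [Function.uncurry, avgKer, indicator_apply, mem_cube_iff, mem_ofPred_eq, eq_comm,
        mul_ite, mul_zero]
    rw [this]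
    exact measurable_const.indicator (measurableSet_sameCube s)
  · simp only [avgKer_comm s _ y]
    exact hr y

/-- The kernel of the difference between a convolution operator and a multiple of the dyadic
average that has the same integral. -/
def difKer (s : ℤ) (k : Rd d → ℂ) (x y : Rd d) : ℂ := k (x - y) - (∫ w, k w) * avgKer s x y

theorem difKer_swap (s : ℤ) (k : Rd d → ℂ) (x y : Rd d) :
    difKer s k y x = difKer s (fun w => k (-w)) x y := by
  rw [difKer, difKer, integral_comp_neg_ker, avgKer_comm, neg_sub]

theorem IsKer.kerBound_difKer (hk : IsKer s B k) : KerBound (difKer s k) (2 * B) (2 * B) := by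
  have h := hk.kerBound_conv.sub (kerBound_avgKer (s := s) (∫ w, k w))
  rw [two_mul]
  exact h.mono (by gcongr; exact hk.enorm_integral_le) (by gcongr; exact hk.enorm_integral_le)

/-- A dyadic cube and its translate by `h` differ by little. -/
theorem volume_cube_shift_le (q : ℤ) (x h : Rd d) :
    volume {y | y ∈ cube q x ∧ y + h ∉ cube q x} ≤
      ENNReal.ofReal (vol d q) * (d * (p2 (-q) * ‖h‖ₑ)) := by
  classical
  have hp : (0 : ℝ) < 2 ^ q := by positivity
  -- A point that leaves the cube under translation by h leaves it in some coordinate i. `J i` is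
  -- the interval of length |h i| next to the face that is crossed, and `t i` the sides of the
  -- corresponding slab in the cube.
  set J : Fin d → Set ℝ := fun i => if 0 ≤ h i then
      Ico (((idx q x i : ℝ) + 1) * 2 ^ q - h i) (((idx q x i : ℝ) + 1) * 2 ^ q)
    else Ico ((idx q x i : ℝ) * 2 ^ q) ((idx q x i : ℝ) * 2 ^ q - h i) with hJ
  set t : Fin d → Fin d → Set ℝ := fun i j => if j = i then J i else
      Ico ((idx q x j : ℝ) * 2 ^ q) (((idx q x j : ℝ) + 1) * 2 ^ q) with ht
  have hJm : ∀ i, MeasurableSet (J i) := fun i => by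
    simp only [hJ]; split_ifs <;> exact measurableSet_Ico
  have htm : ∀ i, MeasurableSet (Set.pi univ (t i)) := fun i => MeasurableSet.univ_pi fun j => by
    simp only [ht]; split_ifs
    exacts [hJm i, measurableSet_Ico]
  have hcube : ∀ y, y ∈ cube q x ↔ ∀ j,
      y j ∈ Ico ((idx q x j : ℝ) * 2 ^ q) (((idx q x j : ℝ) + 1) * 2 ^ q) := by
    intro y
    simp only [mem_cube_iff, funext_iff, mem_Ico]
    refine forall_congr' fun i => ?_
    change ⌊y i / (2 : ℝ) ^ q⌋ = _ ↔ _
    rw [Int.floor_eq_iff, le_div_iff₀ hp, div_lt_iff₀ hp]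
  have hsub : {y | y ∈ cube q x ∧ y + h ∉ cube q x} ⊆
      ⋃ i, (WithLp.ofLp : Rd d → (Fin d → ℝ)) ⁻¹' (Set.pi univ (t i)) := by
    rintro y ⟨hy, hyh⟩
    rw [hcube] at hy hyh
    push Not at hyh
    obtain ⟨i, hi⟩ := hyh
    refine mem_iUnion.2 ⟨i, fun j _ => ?_⟩
    simp only [ht]
    split_ifs with hji
    · subst hji
      have h1 := hy j
      simp only [PiLp.add_apply, mem_Ico, not_and_or, not_le, not_lt] at hi h1
      simp only [hJ]
      split_ifs with h0
      · refine ⟨?_, h1.2⟩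
        rcases hi with hi | hi
        · linarith
        · linarith
      · refine ⟨h1.1, ?_⟩
        rcases hi with hi | hi
        · linarith
        · linarith
    · exact hy j
  have hvol : ∀ i, volume ((WithLp.ofLp : Rd d → (Fin d → ℝ)) ⁻¹' (Set.pi univ (t i))) ≤
      ENNReal.ofReal (vol d q) * (p2 (-q) * ‖h‖ₑ) := by
    intro i
    rw [(PiLp.volume_preserving_ofLp (Fin d)).measure_preimage (htm i).nullMeasurableSet,
      volume_pi_pi, ← Finset.mul_prod_erase _ _ (Finset.mem_univ i)]
    have h1 : volume (t i i) ≤ ‖h‖ₑ := by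
      have h2 : volume (t i i) = ENNReal.ofReal |h i| := by
        simp only [ht, hJ, if_true]
        split_ifs with h0
        · rw [Real.volume_Ico, abs_of_nonneg h0]; congr 1; ring
        · rw [Real.volume_Ico, abs_of_neg (not_le.1 h0)]; congr 1; ring
      rw [h2, ← ofReal_norm]
      exact ENNReal.ofReal_le_ofReal (PiLp.norm_apply_le h i)
    have h3 : ∏ j ∈ Finset.univ.erase i, volume (t i j) = p2 q ^ (d - 1) := by
      rw [Finset.prod_congr rfl (g := fun _ => p2 q), Finset.prod_const,
        Finset.card_erase_of_mem (Finset.mem_univ i), Finset.card_univ, Fintype.card_fin]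
      intro j hj
      simp only [ht, if_neg (Finset.ne_of_mem_erase hj), Real.volume_Ico, p2]
      congr 1
      ring
    rw [h3]
    have hd : d = (d - 1) + 1 := by have := i.2; omega
    have h4 : ENNReal.ofReal (vol d q) = p2 q ^ (d - 1) * p2 q := by
      rw [← pow_succ, ← hd, vol, ENNReal.ofReal_pow hp.le, p2]
    calc volume (t i i) * p2 q ^ (d - 1) ≤ ‖h‖ₑ * p2 q ^ (d - 1) := by gcongr
      _ = p2 q ^ (d - 1) * (p2 q * p2 (-q)) * ‖h‖ₑ := by rw [p2_mul_neg, mul_one, mul_comm]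
      _ = _ := by rw [h4]; ring
  calc volume {y | y ∈ cube q x ∧ y + h ∉ cube q x}
      ≤ ∑ i, volume ((WithLp.ofLp : Rd d → (Fin d → ℝ)) ⁻¹' (Set.pi univ (t i))) :=
        (measure_mono hsub).trans (measure_iUnion_fintype_le _ _)
    _ ≤ ∑ _i : Fin d, ENNReal.ofReal (vol d q) * (p2 (-q) * ‖h‖ₑ) :=
        Finset.sum_le_sum fun i _ => hvol i
    _ = _ := by
        rw [Finset.sum_const, Finset.card_univ, Fintype.card_fin, nsmul_eq_mul]
        ring

/-- The interaction of a cube and its complement through a kernel at a smaller scale. -/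
theorem IsKer.lintegral_cube_compl_le (hk : IsKer s B k) (q : ℤ) (x : Rd d) :
    ∫⁻ y in cube q x, ∫⁻ z in (cube q x)ᶜ, ‖k (y - z)‖ₑ ≤
      ENNReal.ofReal (vol d q) * (d * (B * p2 (s - q))) := by
  classical
  have hm : Measurable fun p : Rd d × Rd d =>
      ((cube q x)ᶜ).indicator (fun _ => ‖k p.2‖ₑ) (p.1 - p.2) := by
    have : (fun p : Rd d × Rd d => ((cube q x)ᶜ).indicator (fun _ => ‖k p.2‖ₑ) (p.1 - p.2)) =
        ((fun p : Rd d × Rd d => p.1 - p.2) ⁻¹' (cube q x)ᶜ).indicator fun p => ‖k p.2‖ₑ := by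
      ext p
      simp only [indicator_apply, mem_preimage]
    rw [this]
    exact (hk.meas.comp measurable_snd).enorm.indicator
      ((measurable_fst.sub measurable_snd) (measurableSet_cube q x).compl)
  calc ∫⁻ y in cube q x, ∫⁻ z in (cube q x)ᶜ, ‖k (y - z)‖ₑ
      = ∫⁻ y in cube q x, ∫⁻ w, ((cube q x)ᶜ).indicator (fun _ => ‖k w‖ₑ) (y - w) := by
        refine lintegral_congr fun y => ?_
        rw [← lintegral_indicator (measurableSet_cube q x).compl,
          ← lintegral_sub_left_eq_self _ y]
        simp only [indicator_apply, sub_sub_cancel]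
    _ = ∫⁻ w, ∫⁻ y in cube q x, ((cube q x)ᶜ).indicator (fun _ => ‖k w‖ₑ) (y - w) :=
        lintegral_lintegral_swap hm.aemeasurable
    -- A shift by w pushes out of the cube a volume linear in |w|, so the first moment of the kernel
    -- controls the total interaction.
    _ ≤ ∫⁻ w, ‖k w‖ₑ * (ENNReal.ofReal (vol d q) * (d * (p2 (-q) * ‖w‖ₑ))) := by
        refine lintegral_mono fun w => ?_
        have hms : MeasurableSet {y | y - w ∈ (cube q x)ᶜ} :=
          (measurable_id.sub_const w) (measurableSet_cube q x).compl
        have h1 : ∀ y, ((cube q x)ᶜ).indicator (fun _ => ‖k w‖ₑ) (y - w) =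
            {y | y - w ∈ (cube q x)ᶜ}.indicator (fun _ => ‖k w‖ₑ) y := fun y => by
          simp only [indicator_apply, mem_ofPred_eq]
        simp only [h1]
        rw [lintegral_indicator_const hms, Measure.restrict_apply hms]
        gcongr
        have h2 := volume_cube_shift_le q x (-w)
        rw [enorm_neg] at h2
        refine le_trans (measure_mono fun y hy => ?_) h2
        exact ⟨hy.2, by simpa [sub_eq_add_neg] using hy.1⟩
    _ = ENNReal.ofReal (vol d q) * d * p2 (-q) * ∫⁻ w, ‖k w‖ₑ * ‖w‖ₑ := by
        rw [← lintegral_const_mul _ (hk.meas.enorm.fun_mul measurable_enorm)]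
        exact lintegral_congr fun w => by ring
    _ ≤ ENNReal.ofReal (vol d q) * d * p2 (-q) * (B * p2 s) := by gcongr; exact hk.moment
    _ = _ := by rw [sub_eq_add_neg, p2_add]; ring

end ConvolutionKernels

/-! ### Convolution minus dyadic average: decay away from the scale of the kernel. -/

section DifKernels

variable {s : ℤ} {B : ℝ≥0∞} {k : Rd d → ℂ}

theorem avg_avgKer {q : ℤ} (h : s ≤ q) (x y : Rd d) :
    avg q (fun x' => avgKer s x' y) x = avgKer q x y := by
  have h1 : (fun x' => avgKer s x' y) = (cube s y).indicator fun _ => ((vol d s)⁻¹ : ℂ) := by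
    ext x'
    rw [avgKer_comm]; rfl
  rw [avg, h1, setIntegral_indicator (measurableSet_cube s y), avgKer]
  by_cases hy : y ∈ cube q x
  · have hs : cube s y ⊆ cube q x := by
      rw [cube_eq_of_idx (mem_cube_iff.1 hy).symm]
      exact cube_subset h y
    rw [inter_eq_self_of_subset_right hs, setIntegral_const, indicator_of_mem hy, measureReal_def,
      volume_cube, ENNReal.toReal_ofReal (vol_pos s).le, Complex.real_smul, Complex.real_smul,
      ← Complex.ofReal_inv, ← Complex.ofReal_mul, mul_inv_cancel₀ (vol_pos s).ne',
      ← Complex.ofReal_inv]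
    simp
  · have hd : cube q x ∩ cube s y = ∅ := by
      ext z
      simp only [mem_inter_iff, mem_cube_iff, mem_empty_iff_false, iff_false, not_and]
      intro hz hz'
      exact hy ((idx_mono h hz'.symm).trans hz)
    rw [hd, indicator_of_notMem hy]
    simp

theorem avg_sub_const_mul {q : ℤ} {f g : Rd d → ℂ} (c : ℂ) (hf : CubeInt f) (hg : CubeInt g)
    (x : Rd d) : avg q (fun y => f y - c * g y) x = avg q f x - c * avg q g x := by
  have h := avg_sub (q := q) hf (g := fun y => c * g y) (fun q x => (hg q x).const_mul c) x
  simp only [avg] at h ⊢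
  rw [mul_smul_comm, ← integral_const_mul]
  exact h

theorem IsKer.cubeInt_left (hk : IsKer s B k) (hB : B ≠ ∞) (y : Rd d) :
    CubeInt fun x => k (x - y) :=
  fun _ _ => ((hk.integrable hB).comp_sub_right y).integrableOn

theorem cubeInt_avgKer (s : ℤ) (y : Rd d) : CubeInt fun x => avgKer s x y := by
  have h1 : (fun x' => avgKer s x' y) = (cube s y).indicator fun _ => ((vol d s)⁻¹ : ℂ) := by
    ext x'
    rw [avgKer_comm]; rfl
  rw [h1]
  refine fun q x => Integrable.integrableOn ?_
  exact (integrable_indicator_iff (measurableSet_cube s y)).2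
    (integrableOn_const (volume_cube_lt_top s y).ne)

theorem kerAvg_difKer {q : ℤ} (hk : IsKer s B k) (hB : B ≠ ∞) (x y : Rd d) :
    kerAvg q (difKer s k) x y = avg q (fun x' => k (x' - y)) x -
      (∫ w, k w) * avg q (fun x' => avgKer s x' y) x :=
  avg_sub_const_mul _ (hk.cubeInt_left hB y) (cubeInt_avgKer s y) x

/-- On a cube much larger than 2^s, averaging makes the convolution and the multiple of the dyadic
average cancel up to the mass that crosses the boundary. For y inside, the part of ∫ k that lands
outside is missing; for y outside, only what leaks in is seen. Both are of relative size 2^(s - q).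
-/
theorem IsKer.lintegral_kerAvg_coarse_le (hk : IsKer s B k) (hB : B ≠ ∞) (j : ℕ) (x : Rd d) :
    ∫⁻ y, ‖kerAvg (s + j) (difKer s k) x y‖ₑ ≤ 2 * d * B * 2⁻¹ ^ j := by
  classical
  set q := s + j with hq
  set V := ENNReal.ofReal (vol d q)
  set I := cube q x
  have hI : MeasurableSet I := measurableSet_cube q x
  have hm : Measurable fun p : Rd d × Rd d => ‖k (p.2 - p.1)‖ₑ :=
    (hk.meas.comp (measurable_snd.sub measurable_fst)).enorm
  have hpt : ∀ y, ‖kerAvg q (difKer s k) x y‖ₑ ≤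
      V⁻¹ * (I.indicator (fun y => ∫⁻ z in Iᶜ, ‖k (-(y - z))‖ₑ) y +
        Iᶜ.indicator (fun y => ∫⁻ z in I, ‖k (z - y)‖ₑ) y) := by
    intro y
    have hV : ‖(vol d q)⁻¹‖ₑ = V⁻¹ := by
      rw [Real.enorm_eq_ofReal (inv_nonneg.2 (vol_pos q).le), ENNReal.ofReal_inv_of_pos (vol_pos q)]
    rw [kerAvg_difKer hk hB, avg_avgKer (by omega), avgKer]
    by_cases hy : y ∈ I
    · rw [indicator_of_mem hy, indicator_of_mem hy, indicator_of_notMem (by simpa using hy), add_zero]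
      have h1 : ∫ w, k w = (∫ z in I, k (z - y)) + ∫ z in Iᶜ, k (z - y) := by
        rw [integral_add_compl hI ((hk.integrable hB).comp_sub_right y),
          integral_sub_right_eq_self k y]
      have h2 : avg q (fun x' => k (x' - y)) x - (∫ w, k w) * ((vol d q)⁻¹ : ℂ) =
          -((vol d q)⁻¹ • ∫ z in Iᶜ, k (z - y)) := by
        rw [avg, h1, Complex.real_smul, Complex.real_smul, Complex.ofReal_inv]
        ring
      rw [h2, enorm_neg, enorm_smul, hV]
      gcongr
      simp only [neg_sub]
      exact enorm_integral_le_lintegral_enorm _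
    · rw [indicator_of_notMem hy, indicator_of_notMem hy, indicator_of_mem (by simpa using hy),
        mul_zero, sub_zero, zero_add, avg, enorm_smul, hV]
      gcongr
      exact enorm_integral_le_lintegral_enorm _
  have hm1 : Measurable fun y => ∫⁻ z in Iᶜ, ‖k (-(y - z))‖ₑ := by
    simp only [neg_sub]
    exact hm.lintegral_prod_right'
  have hm2 : Measurable fun y => ∫⁻ z in I, ‖k (z - y)‖ₑ := hm.lintegral_prod_right'
  have hp : p2 (s - q) = 2⁻¹ ^ j := by rw [hq, ← p2_neg_natCast]; congr 1; ring
  calc ∫⁻ y, ‖kerAvg q (difKer s k) x y‖ₑ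
      ≤ V⁻¹ * ((∫⁻ y in I, ∫⁻ z in Iᶜ, ‖k (-(y - z))‖ₑ) +
          ∫⁻ y in Iᶜ, ∫⁻ z in I, ‖k (z - y)‖ₑ) := by
        refine (lintegral_mono hpt).trans_eq ?_
        rw [lintegral_const_mul _ ((hm1.indicator hI).fun_add (hm2.indicator hI.compl)),
          lintegral_add_left (hm1.indicator hI), lintegral_indicator hI,
          lintegral_indicator hI.compl]
    _ ≤ V⁻¹ * (V * (d * (B * p2 (s - q))) + V * (d * (B * p2 (s - q)))) := by
        gcongr
        · exact hk.comp_neg.lintegral_cube_compl_le q x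
        · rw [lintegral_lintegral_swap hm.aemeasurable]
          exact hk.lintegral_cube_compl_le q x
    _ = V⁻¹ * V * (2 * d * B * 2⁻¹ ^ j) := by rw [hp]; ring
    _ = _ := by rw [inv_vol_mul_vol, one_mul]

/-- The constant in the bounds for the kernels of martingale differences. -/
def kerConst (d : ℕ) : ℝ≥0∞ :=
  8 + 8 * d + 8 * (d * (ENNReal.ofReal ((d : ℝ) ^ d) * volume (Metric.closedBall (0 : Rd d) 1)))

theorem kerConst_ne_top (d : ℕ) : kerConst d ≠ ∞ := by
  have := (isCompact_closedBall (0 : Rd d) 1).measure_lt_top (μ := volume)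
  unfold kerConst
  finiteness

/-- On cubes of side at most 2^s the kernel of the dyadic average is constant and drops out. What
remains is the oscillation of k over distances at most d 2^(s - j), controlled by the L¹ modulus of
continuity. -/
theorem kerBound_fine (hk : IsKer s B k) (hB : B ≠ ∞) (j : ℕ) :
    KerBound (fun x y => difKer s k x y - kerAvg (s - j) (difKer s k) x y)
      (d * B * 2⁻¹ ^ j)
      (d * (ENNReal.ofReal ((d : ℝ) ^ d) * volume (Metric.closedBall (0 : Rd d) 1)) * B *
        2⁻¹ ^ j) := by
  classical
  set q := s - j with hq
  set V := ENNReal.ofReal (vol d q) with hVdef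
  have hmeas := hk.kerBound_difKer.meas
  have hpj : p2 (-s) * p2 q = 2⁻¹ ^ j := by
    rw [← p2_add, ← p2_neg_natCast, hq]; congr 1; ring
  have heq : ∀ x y, ‖difKer s k x y - kerAvg q (difKer s k) x y‖ₑ ≤
      V⁻¹ * ∫⁻ x' in cube q x, ‖k (x - y) - k (x' - y)‖ₑ := by
    intro x y
    have hc : CubeConst q fun x' => avgKer s x' y := fun x₁ x₂ h => by
      simp only [avgKer, cube_eq_of_idx (idx_mono (show q ≤ s by omega) h)]
    rw [kerAvg_difKer hk hB, avg_of_cubeConst hc, difKer]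
    have h1 : k (x - y) - (∫ w, k w) * avgKer s x y -
        (avg q (fun x' => k (x' - y)) x - (∫ w, k w) * avgKer s x y) =
        avg q (fun x' => k (x - y) - 1 * k (x' - y)) x := by
      rw [avg_sub_const_mul 1 (CubeInt.of_bound (f := fun _ => k (x - y)) (by fun_prop)
        fun _ => le_rfl) (hk.cubeInt_left hB y),
        avg_of_cubeConst (h := fun _ => k (x - y)) fun _ _ _ => rfl]
      ring
    rw [h1]
    have h2 := enorm_avg_le q (fun x' => k (x - y) - 1 * k (x' - y)) x
    simp only [one_mul] at h2 ⊢
    exact h2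
  have hdist : ∀ x : Rd d, ∀ x' ∈ cube q x, ‖x' - x‖ₑ ≤ d * p2 q := by
    intro x x' hx'
    rw [← ofReal_norm, p2, ← ENNReal.ofReal_natCast, ← ENNReal.ofReal_mul (by positivity)]
    exact ENNReal.ofReal_le_ofReal (norm_sub_le_of_mem_cube hx')
  refine ⟨hmeas.sub (measurable_kerAvg hmeas q), fun x => ?_, fun y => ?_⟩
  · have hm : Measurable fun p : Rd d × Rd d => ‖k (x - p.1) - k (p.2 - p.1)‖ₑ :=
      ((hk.meas.comp (measurable_const.sub measurable_fst)).sub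
        (hk.meas.comp (measurable_snd.sub measurable_fst))).enorm
    calc ∫⁻ y, ‖difKer s k x y - kerAvg q (difKer s k) x y‖ₑ
        ≤ ∫⁻ y, V⁻¹ * ∫⁻ x' in cube q x, ‖k (x - y) - k (x' - y)‖ₑ := lintegral_mono (heq x)
      _ = V⁻¹ * ∫⁻ x' in cube q x, ∫⁻ y, ‖k (x - y) - k (x' - y)‖ₑ := by
          rw [lintegral_const_mul _ hm.lintegral_prod_right',
            lintegral_lintegral_swap hm.aemeasurable]
      _ ≤ V⁻¹ * ∫⁻ _ in cube q x, B * p2 (-s) * (d * p2 q) := by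
          refine mul_le_mul_right (setLIntegral_mono' (measurableSet_cube q x) fun x' hx' => ?_) _
          have h1 : ∫⁻ y, ‖k (x - y) - k (x' - y)‖ₑ = ∫⁻ w, ‖k (w + (x - x')) - k w‖ₑ := by
            rw [← lintegral_sub_left_eq_self (fun w => ‖k (w + (x - x')) - k w‖ₑ) x']
            refine lintegral_congr fun y => ?_
            rw [show x' - y + (x - x') = x - y by abel]
          rw [h1]
          refine (hk.shift _).trans ?_
          gcongr
          rw [← enorm_neg, neg_sub]
          exact hdist x x' hx'
      _ = B * p2 (-s) * (d * p2 q) := eavg_const q _ x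
      _ = d * B * (p2 (-s) * p2 q) := by ring
      _ = _ := by rw [hpj]
  -- In a column integral the cube varies with x, so the difference x' - x is allowed to range over
  -- a ball. The ratio of the volumes of ball and cube gives the factor d^d |B(0,1)|.
  · set R : ℝ := d * (2 : ℝ) ^ q with hR
    have hR0 : 0 ≤ R := by positivity
    have hRe : ENNReal.ofReal R = d * p2 q := by
      rw [hR, ENNReal.ofReal_mul (by positivity), ENNReal.ofReal_natCast, p2]
    have hball : MeasurableSet (Metric.closedBall (0 : Rd d) R) := Metric.isClosed_closedBall.measurableSet
    have hm : Measurable fun p : Rd d × Rd d => ‖k (p.1 + p.2 - y) - k (p.1 - y)‖ₑ :=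
      ((hk.meas.comp ((measurable_fst.add measurable_snd).sub_const y)).sub
        (hk.meas.comp (measurable_fst.sub_const y))).enorm
    calc ∫⁻ x, ‖difKer s k x y - kerAvg q (difKer s k) x y‖ₑ
        ≤ ∫⁻ x, V⁻¹ * ∫⁻ h in Metric.closedBall (0 : Rd d) R,
            ‖k (x + h - y) - k (x - y)‖ₑ := by
          refine lintegral_mono fun x => (heq x y).trans (mul_le_mul_right ?_ _)
          rw [← lintegral_indicator (measurableSet_cube q x), ← lintegral_indicator hball,
            ← lintegral_add_left_eq_self _ x]
          refine lintegral_mono fun h => ?_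
          by_cases hh : x + h ∈ cube q x
          · have : h ∈ Metric.closedBall (0 : Rd d) R := by
              have := norm_sub_le_of_mem_cube hh
              rw [add_sub_cancel_left] at this
              simpa using this
            simp only [indicator_of_mem hh, indicator_of_mem this]
            rw [← enorm_neg, neg_sub]
          · simp [indicator_of_notMem hh]
      _ = V⁻¹ * ∫⁻ h in Metric.closedBall (0 : Rd d) R, ∫⁻ x,
            ‖k (x + h - y) - k (x - y)‖ₑ := by
          rw [lintegral_const_mul _ hm.lintegral_prod_right',
            lintegral_lintegral_swap hm.aemeasurable]
      _ ≤ V⁻¹ * ∫⁻ _ in Metric.closedBall (0 : Rd d) R, B * p2 (-s) * (d * p2 q) := by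
          refine mul_le_mul_right (setLIntegral_mono' hball fun h hh => ?_) _
          have h1 : ∫⁻ x, ‖k (x + h - y) - k (x - y)‖ₑ = ∫⁻ w, ‖k (w + h) - k w‖ₑ := by
            rw [← lintegral_sub_right_eq_self (fun w => ‖k (w + h) - k w‖ₑ) y]
            refine lintegral_congr fun x => ?_
            rw [show x - y + h = x + h - y by abel]
          rw [h1]
          refine (hk.shift h).trans ?_
          gcongr
          rw [← hRe, ← ofReal_norm]
          exact ENNReal.ofReal_le_ofReal (by simpa using hh)
      _ = V⁻¹ * (B * p2 (-s) * (d * p2 q) * (ENNReal.ofReal ((d : ℝ) ^ d) * V *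
            volume (Metric.closedBall (0 : Rd d) 1))) := by
          rw [setLIntegral_const, Measure.addHaar_closedBall' _ _ hR0, finrank_euclideanSpace,
            Fintype.card_fin, hR, mul_pow, ENNReal.ofReal_mul (by positivity), hVdef, vol]
      _ = V⁻¹ * V * (d * (ENNReal.ofReal ((d : ℝ) ^ d) * volume (Metric.closedBall (0 : Rd d) 1)) *
            B * (p2 (-s) * p2 q)) := by ring
      _ = _ := by rw [inv_vol_mul_vol, one_mul, hpj]

theorem two_mul_half_pow_succ (j : ℕ) : 2 * (2⁻¹ : ℝ≥0∞) ^ (j + 1) = 2⁻¹ ^ j := by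
  rw [pow_succ, mul_comm, mul_assoc, ENNReal.inv_mul_cancel (by norm_num) (by norm_num), mul_one]

theorem half_pow_le_one (j : ℕ) : (2⁻¹ : ℝ≥0∞) ^ j ≤ 1 :=
  pow_le_one' (ENNReal.inv_le_one.2 one_le_two) j

/-- The kernels of the martingale differences of `kerOp (difKer s k) f`. -/
theorem kerBound_dif (hk : IsKer s B k) (hB : B ≠ ∞) (δ : ℤ) :
    KerBound (fun x y => kerAvg (s + δ - 1) (difKer s k) x y - kerAvg (s + δ) (difKer s k) x y)
      (kerConst d * B * 2⁻¹ ^ δ.natAbs) (kerConst d * B) := by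
  set G := ENNReal.ofReal ((d : ℝ) ^ d) * volume (Metric.closedBall (0 : Rd d) 1) with hG
  have hc : kerConst d = 8 + 8 * d + 8 * (d * G) := rfl
  -- For δ > 0 both averages have small rows by the boundary estimate, while the columns are bounded
  -- trivially; for δ ≤ 0 the kernel is a difference of two errors of fine averaging. The decay of
  -- the rows alone suffices, since Schur's test multiplies rows and columns.
  rcases lt_or_ge 0 δ with h | h
  · obtain ⟨j, rfl⟩ : ∃ j : ℕ, δ = j + 1 := ⟨(δ - 1).toNat, by omega⟩
    have hcol := ((hk.kerBound_difKer.kerAvg (s + (j + 1) - 1)).sub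
      (hk.kerBound_difKer.kerAvg (s + (j + 1))))
    refine ⟨hcol.meas, fun x => ?_, fun y => (hcol.col y).trans ?_⟩
    · have hK := hk.kerBound_difKer
      have h1 := hk.lintegral_kerAvg_coarse_le hB j x
      have h2 := hk.lintegral_kerAvg_coarse_le hB (j + 1) x
      rw [show ((j : ℤ) + 1).natAbs = j + 1 by omega, show s + ((j : ℤ) + 1) - 1 = s + j by ring]
      push_cast at h2
      calc ∫⁻ y, ‖kerAvg (s + j) (difKer s k) x y - kerAvg (s + (j + 1)) (difKer s k) x y‖ₑ
          ≤ ∫⁻ y, (‖kerAvg (s + j) (difKer s k) x y‖ₑ +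
              ‖kerAvg (s + (j + 1)) (difKer s k) x y‖ₑ) := lintegral_mono fun y => enorm_sub_le
        _ ≤ 2 * d * B * 2⁻¹ ^ j + 2 * d * B * 2⁻¹ ^ (j + 1) := by
            rw [lintegral_add_left ((hK.kerAvg _).measurable_right x).enorm]
            exact add_le_add h1 h2
        _ = (6 * d) * B * 2⁻¹ ^ (j + 1) := by rw [← two_mul_half_pow_succ j]; ring
        _ ≤ _ := by
            gcongr
            rw [hc]
            refine le_trans ?_ (le_self_add (a := _) (b := 8 * (d * G)))
            refine le_trans ?_ le_add_self
            gcongr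
            norm_num
    · rw [← add_mul]
      gcongr
      rw [hc, add_assoc]
      exact le_trans (by norm_num) le_self_add
  · obtain ⟨j, rfl⟩ : ∃ j : ℕ, δ = -j := ⟨(-δ).toNat, by omega⟩
    have h3 := (kerBound_fine hk hB j).sub (kerBound_fine hk hB (j + 1))
    have h4 : (fun x y => kerAvg (s + -(j : ℤ) - 1) (difKer s k) x y -
        kerAvg (s + -(j : ℤ)) (difKer s k) x y) = fun x y =>
        (difKer s k x y - kerAvg (s - j) (difKer s k) x y) -
          (difKer s k x y - kerAvg (s - (j + 1 : ℕ)) (difKer s k) x y) := by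
      ext x y
      push_cast
      rw [show s + -(j : ℤ) - 1 = s - (j + 1) by ring, show s + -(j : ℤ) = s - j by ring]
      ring
    rw [h4, show (-(j : ℤ)).natAbs = j by simp]
    have h5 : (2⁻¹ : ℝ≥0∞) ^ (j + 1) ≤ 2⁻¹ ^ j :=
      pow_le_pow_right_of_le_one' (ENNReal.inv_le_one.2 one_le_two) (Nat.le_succ j)
    refine h3.mono ?_ ?_
    · calc d * B * 2⁻¹ ^ j + d * B * 2⁻¹ ^ (j + 1) ≤ d * B * 2⁻¹ ^ j + d * B * 2⁻¹ ^ j := by gcongr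
        _ = (2 * d) * B * 2⁻¹ ^ j := by ring
        _ ≤ _ := by
          gcongr
          rw [hc]
          refine le_trans ?_ (le_self_add (a := _) (b := 8 * (d * G)))
          refine le_trans ?_ le_add_self
          gcongr
          norm_num
    · calc d * G * B * 2⁻¹ ^ j + d * G * B * 2⁻¹ ^ (j + 1) ≤ d * G * B * 1 + d * G * B * 1 := by
            gcongr <;> exact half_pow_le_one _
        _ = (2 * (d * G)) * B := by ring
        _ ≤ _ := by
          gcongr
          rw [hc]
          refine le_trans ?_ le_add_self
          gcongr
          norm_num

theorem Adm.integrable_kerAvg {K : Rd d → Rd d → ℂ} (hK : Measurable (Function.uncurry K))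
    {f : Rd d → ℂ} (hf : Measurable f) (h : Adm K f) (q : ℤ) (x : Rd d) :
    Integrable fun y => kerAvg q K x y * f y := by
  have h1 := (h.integrable hK hf q x).integral_prod_right.smul (vol d q)⁻¹
  refine h1.congr (Eventually.of_forall fun y => ?_)
  simp only [Pi.smul_apply, Function.uncurry, kerAvg, avg, integral_mul_const, smul_mul_assoc]

theorem dif_kerOp {K : Rd d → Rd d → ℂ} (hK : Measurable (Function.uncurry K))
    {f : Rd d → ℂ} (hf : Measurable f) (h : Adm K f) (q : ℤ) (x : Rd d) :
    dif q (kerOp K f) x = kerOp (fun x y => kerAvg (q - 1) K x y - kerAvg q K x y) f x := by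
  rw [kerOp_sub (h.integrable_kerAvg hK hf _ x) (h.integrable_kerAvg hK hf _ x), dif,
    avg_kerOp hK hf h, avg_kerOp hK hf h]

/-- There are only countably many cubes of a given scale. -/
theorem ae_of_forall_cube {P : Rd d → Prop} (q : ℤ)
    (h : ∀ x, ∀ᵐ x' ∂(volume.restrict (cube q x)), P x') : ∀ᵐ x', P x' := by
  have hall : ∀ n : Fin d → ℤ, ∀ᵐ x', idx q x' = n → P x' := by
    intro n
    by_cases hn : ∃ x : Rd d, idx q x = n
    · obtain ⟨x, rfl⟩ := hn
      exact (ae_restrict_iff' (measurableSet_cube q x)).1 (h x)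
    · exact Eventually.of_forall fun x' hx' => absurd ⟨x', hx'⟩ hn
  filter_upwards [ae_all_iff.2 hall] with x hx
  exact hx _ rfl

theorem Adm.ae_integrable_univ {K : Rd d → Rd d → ℂ} (hK : Measurable (Function.uncurry K))
    {f : Rd d → ℂ} (hf : Measurable f) (h : Adm K f) : ∀ᵐ x, Integrable fun y => K x y * f y :=
  ae_of_forall_cube 0 fun x => h.ae_integrable hK hf 0 x

/-- Transposition. By self-adjointness the average moves from the function to the kernel in its
second variable, and the transposed `difKer` is that of the reflected kernel. Thus the bounds for
averaged outputs become bounds for averaged inputs. -/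
theorem IsKer.kerOp_avg_ae_eq (hk : IsKer s B k) (hB : B ≠ ∞) (q : ℤ) {g : Rd d → ℂ}
    (hgm : Measurable g) (hg2 : MemLp g 2) :
    ∀ᵐ x, kerOp (difKer s k) (avg q g) x =
      kerOp (fun x y => kerAvg q (difKer s fun w => k (-w)) y x) g x := by
  have hK := hk.kerBound_difKer
  have hsq := hK.lintegral_lintegral_sq_le (cubeConst_eavg q (fun y => ‖g y‖ₑ)).measurable
  have hfin : ∫⁻ x, eavg q (fun y => ‖g y‖ₑ) x ^ 2 < ∞ := by
    refine (lintegral_mono fun x => eavg_sq_le hgm.enorm x).trans_lt ?_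
    rw [lintegral_eavg (hgm.enorm.pow_const 2)]
    exact lintegral_sq_lt_top hg2
  have hae := ae_lt_top (Measurable.pow_const (Measurable.lintegral_prod_right'
    (f := fun p : Rd d × Rd d => ‖difKer s k p.1 p.2‖ₑ * eavg q (fun y => ‖g y‖ₑ) p.2)
    (hK.meas.enorm.mul ((cubeConst_eavg q _).measurable.comp measurable_snd))) 2)
    (hsq.trans_lt (ENNReal.mul_lt_top (by finiteness) hfin)).ne
  filter_upwards [hae] with x hx
  have hx' := (ENNReal.pow_lt_top_iff.1 hx).resolve_right two_ne_zero
  rw [kerOp, integral_mul_avg hgm (hK.measurable_right x) hx', kerOp]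
  simp only [kerAvg, ← difKer_swap]

/-- The operator is small on functions of much coarser dyadic scales. -/
theorem lintegral_kerOp_avg_sq_le (hk : IsKer s B k) (hB : B ≠ ∞) (j : ℕ) {f : Rd d → ℂ}
    (hfm : Measurable f) (hf2 : MemLp f 2) :
    ∫⁻ x, ‖kerOp (difKer s k) (avg (s + j) f) x‖ₑ ^ 2 ≤
      4 * d * B ^ 2 * 2⁻¹ ^ j * ∫⁻ x, ‖f x‖ₑ ^ 2 := by
  have hk' := hk.comp_neg
  have hKB : KerBound (fun x y => kerAvg (s + j) (difKer s fun w => k (-w)) y x) (2 * B)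
      (2 * d * B * 2⁻¹ ^ j) := by
    have := (hk'.kerBound_difKer.kerAvg (s + j)).swap
    exact ⟨this.meas, this.row, fun y => hk'.lintegral_kerAvg_coarse_le hB j y⟩
  rw [lintegral_congr_ae (g := fun x => ‖kerOp (fun x y =>
    kerAvg (s + j) (difKer s fun w => k (-w)) y x) f x‖ₑ ^ 2)
    (by filter_upwards [hk.kerOp_avg_ae_eq hB (s + j) hfm hf2] with x hx; rw [hx])]
  refine (hKB.lintegral_kerOp_sq_le hfm).trans_eq ?_
  ring

/-- The operator is small on functions of much finer dyadic scales. -/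
theorem lintegral_kerOp_sub_avg_sq_le (hk : IsKer s B k) (hB : B ≠ ∞) (j : ℕ) {f : Rd d → ℂ}
    (hfm : Measurable f) (hf2 : MemLp f 2) :
    ∫⁻ x, ‖kerOp (difKer s k) (f - avg (s - j) f) x‖ₑ ^ 2 ≤
      (kerConst d * B) ^ 2 * 2⁻¹ ^ j * ∫⁻ x, ‖f x‖ₑ ^ 2 := by
  set G := ENNReal.ofReal ((d : ℝ) ^ d) * volume (Metric.closedBall (0 : Rd d) 1) with hG
  have hc : kerConst d = 8 + 8 * d + 8 * (d * G) := rfl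
  have hcd : (d : ℝ≥0∞) ≤ kerConst d := by
    rw [hc]
    exact (le_mul_of_one_le_left' (by norm_num)).trans (le_add_self.trans le_self_add)
  have hcG : d * G ≤ kerConst d := by
    rw [hc]; exact (le_mul_of_one_le_left' (by norm_num)).trans le_add_self
  have hk' := hk.comp_neg
  set k' : Rd d → ℂ := fun w => k (-w) with hk'def
  have hK := hk.kerBound_difKer
  have hKB := (kerBound_fine hk' hB j).swap
  have hA := (hK.adm_of_memLp (by finiteness) (by finiteness) hfm hf2).ae_integrable_univ
    hK.meas hfm
  have havm : Measurable (avg (s - j) f) := (cubeConst_avg _ _).measurable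
  have hA1 := (hK.adm_of_memLp (by finiteness) (by finiteness) havm
    (memLp_avg (s - j) hf2)).ae_integrable_univ hK.meas havm
  have hKB' := hk'.kerBound_difKer.kerAvg (s - j)
  have hA' := (hKB'.swap.adm_of_memLp (by finiteness) (by finiteness) hfm
    hf2).ae_integrable_univ hKB'.swap.meas hfm
  calc ∫⁻ x, ‖kerOp (difKer s k) (f - avg (s - j) f) x‖ₑ ^ 2
      = ∫⁻ x, ‖kerOp (fun x y => difKer s k' y x - kerAvg (s - j) (difKer s k') y x) f x‖ₑ ^ 2 := by
        refine lintegral_congr_ae ?_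
        filter_upwards [hk.kerOp_avg_ae_eq hB (s - j) hfm hf2, hA, hA1, hA'] with x hx hi hi1 hi'
        have hsw : difKer s k x = fun y => difKer s k' y x := by
          ext y; rw [hk'def, ← difKer_swap]
        have h3 := kerOp_sub (K := difKer s k)
          (K' := fun x y => kerAvg (s - j) (difKer s k') y x) hi hi'
        have h4 : kerOp (difKer s k) (f - avg (s - j) f) x =
            kerOp (difKer s k) f x - kerOp (difKer s k) (avg (s - j) f) x := by
          simp only [kerOp, Pi.sub_apply, mul_sub]
          exact integral_sub hi hi1
        rw [h4, hx, ← h3]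
        simp only [kerOp, hsw]
    _ ≤ _ := hKB.lintegral_kerOp_sq_le hfm
    _ = ((d * G) * d) * (B * B * (2⁻¹ ^ j * 2⁻¹ ^ j)) * ∫⁻ x, ‖f x‖ₑ ^ 2 := by rw [hG]; ring
    _ ≤ (kerConst d * kerConst d) * (B * B * (2⁻¹ ^ j * 1)) * ∫⁻ x, ‖f x‖ₑ ^ 2 := by
        gcongr
        exact half_pow_le_one j
    _ = _ := by ring

/-- The transposed estimate: the operator is small on functions of much coarser or much finer
dyadic scales. -/
theorem lintegral_kerOp_dif_sq_le (hk : IsKer s B k) (hB : B ≠ ∞) (r : ℤ) {f : Rd d → ℂ}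
    (hf2 : MemLp f 2) :
    ∫⁻ x, ‖kerOp (difKer s k) (dif (s + r) f) x‖ₑ ^ 2 ≤
      (kerConst d * B) ^ 2 * 2⁻¹ ^ r.natAbs * ∫⁻ x, ‖dif (s + r) f x‖ₑ ^ 2 := by
  set G := ENNReal.ofReal ((d : ℝ) ^ d) * volume (Metric.closedBall (0 : Rd d) 1) with hG
  have hc : kerConst d = 8 + 8 * d + 8 * (d * G) := rfl
  have hc8 : 8 ≤ kerConst d := by rw [hc, add_assoc]; exact le_self_add
  have hcd : 8 * (d : ℝ≥0∞) ≤ kerConst d := by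
    rw [hc]; exact le_add_self.trans le_self_add
  set g := dif (s + r) f with hg
  have hgm : Measurable g := (cubeConst_dif _ _).measurable
  have hg2 : MemLp g 2 := memLp_dif _ hf2
  -- A difference at scale s + r equals its own average at scale s + r - 1, which is used for r > 0,
  -- and has average zero at scale s + r, which is used for r ≤ 0.
  rcases lt_or_ge 0 r with h | h
  · obtain ⟨j, rfl⟩ : ∃ j : ℕ, r = j + 1 := ⟨(r - 1).toNat, by omega⟩
    have hself : avg (s + j) g = g := funext fun x =>
      avg_of_cubeConst ((cubeConst_dif _ _).mono (by omega)) x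
    have h1 := lintegral_kerOp_avg_sq_le hk hB j hgm hg2
    rw [hself] at h1
    calc ∫⁻ x, ‖kerOp (difKer s k) g x‖ₑ ^ 2
        ≤ 4 * d * B ^ 2 * 2⁻¹ ^ j * ∫⁻ x, ‖g x‖ₑ ^ 2 := h1
      _ = (8 * (d : ℝ≥0∞)) * B * B * 2⁻¹ ^ (j + 1) * ∫⁻ x, ‖g x‖ₑ ^ 2 := by
          rw [← two_mul_half_pow_succ j]; ring
      _ ≤ (kerConst d * kerConst d) * B * B * 2⁻¹ ^ (j + 1) * ∫⁻ x, ‖g x‖ₑ ^ 2 := by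
          refine mul_le_mul_left (mul_le_mul_left (mul_le_mul_left (mul_le_mul_left ?_ _) _) _) _
          calc 8 * (d : ℝ≥0∞) ≤ kerConst d := hcd
            _ = 1 * kerConst d := (one_mul _).symm
            _ ≤ kerConst d * kerConst d := by
              gcongr
              exact le_trans (by norm_num) hc8
      _ = _ := by rw [show ((j : ℤ) + 1).natAbs = j + 1 by omega]; ring
  · obtain ⟨j, rfl⟩ : ∃ j : ℕ, r = -j := ⟨(-r).toNat, by omega⟩
    have hzero : avg (s - j) g = 0 := funext fun x => by
      rw [hg, ← sub_eq_add_neg]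
      exact avg_dif_of_le le_rfl (CubeInt.of_memLp hf2) x
    have h1 := lintegral_kerOp_sub_avg_sq_le hk hB j hgm hg2
    rw [hzero, sub_zero] at h1
    rwa [show (-(j : ℤ)).natAbs = j by simp]

end DifKernels

/-! ### The geometric weights for the interaction of scales. -/

section Decay

/-- The geometric decay rate `2 ^ (-1/4)` of the frequency interactions. -/
def decay : ℝ≥0∞ := ENNReal.ofReal (√(√(1 / 2)))

theorem decay_pow_four : decay ^ 4 = 2⁻¹ := by
  have h : √(√(1 / 2 : ℝ)) ^ 4 = 1 / 2 := by
    rw [show (4 : ℕ) = 2 * 2 by norm_num, pow_mul, Real.sq_sqrt (Real.sqrt_nonneg _),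
      Real.sq_sqrt (by norm_num)]
  rw [decay, ← ENNReal.ofReal_pow (Real.sqrt_nonneg _), h, one_div,
    ENNReal.ofReal_inv_of_pos two_pos, ENNReal.ofReal_ofNat]

theorem sqrt_sqrt_half_lt_one : √(√(1 / 2 : ℝ)) < 1 := by
  rw [Real.sqrt_lt' one_pos, one_pow, Real.sqrt_lt' one_pos]
  norm_num

theorem decay_le_one : decay ≤ 1 := by
  rw [decay, ← ENNReal.ofReal_one]
  exact ENNReal.ofReal_le_ofReal sqrt_sqrt_half_lt_one.le

theorem decay_ne_top : decay ≠ ∞ := ENNReal.ofReal_ne_top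

theorem decay_ne_zero : decay ≠ 0 := by
  rw [decay, Ne, ENNReal.ofReal_eq_zero, not_le]
  positivity

theorem half_pow_eq_decay (n : ℕ) : (2⁻¹ : ℝ≥0∞) ^ n = (decay ^ n) ^ 4 := by
  rw [← decay_pow_four, ← pow_mul, ← pow_mul, mul_comm]

theorem decay_pow_le_one (n : ℕ) : decay ^ n ≤ 1 := pow_le_one' decay_le_one n

/-- The sum of the interactions over all pairs of scales. -/
def decaySum : ℝ≥0∞ := ∑' δ : ℤ, (2 + δ.natAbs) ^ 2 * decay ^ δ.natAbs

theorem decaySum_ne_top : decaySum ≠ ∞ := by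
  set x := √(√(1 / 2 : ℝ))
  have hx0 : 0 ≤ x := Real.sqrt_nonneg _
  have hx1 : ‖x‖ < 1 := by rw [Real.norm_of_nonneg hx0]; exact sqrt_sqrt_half_lt_one
  have hs : Summable fun n : ℕ => (2 + (n : ℝ)) ^ 2 * x ^ n := by
    have h0 := (summable_geometric_of_norm_lt_one hx1).mul_left 4
    have h1 := (summable_pow_mul_geometric_of_norm_lt_one 1 hx1).mul_left 4
    have h2 := summable_pow_mul_geometric_of_norm_lt_one 2 hx1
    refine ((h0.add h1).add h2).congr fun n => ?_
    ring
  have hz : Summable fun δ : ℤ => (2 + (δ.natAbs : ℝ)) ^ 2 * x ^ δ.natAbs := by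
    refine Summable.of_nat_of_neg ?_ ?_ <;> simpa using hs
  have := hz.tsum_ofReal_ne_top
  rw [decaySum]
  convert this using 3 with δ
  rw [ENNReal.ofReal_mul (by positivity), ENNReal.ofReal_pow (by positivity),
    ENNReal.ofReal_pow hx0, ENNReal.ofReal_add (by norm_num) (by positivity),
    ENNReal.ofReal_natCast, ENNReal.ofReal_ofNat, decay]

theorem tsum_decay_le : ∑' δ : ℤ, decay ^ δ.natAbs ≤ decaySum := by
  refine ENNReal.tsum_le_tsum fun δ => le_mul_of_one_le_left' ?_
  exact one_le_pow₀ (le_trans (by norm_num) (le_self_add (a := (2 : ℝ≥0∞))))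

theorem tsum_comp_add_le (g : ℤ → ℝ≥0∞) (a : ℤ) : ∑' m : ℕ, g (m + a) ≤ ∑' r, g r :=
  ENNReal.tsum_comp_le_tsum_of_injective (f := fun m : ℕ => (m : ℤ) + a)
    (fun m n h => by simpa using h) g

/-- The `2 N` scales around `0`. -/
def window (N : ℕ) : Finset ℤ :=
  (Finset.range (2 * N)).image fun i : ℕ => (N : ℤ) - i

theorem sum_window {M : Type*} [AddCommMonoid M] (N : ℕ) (g : ℤ → M) :
    ∑ δ ∈ window N, g δ = ∑ i ∈ Finset.range (2 * N), g (N - i) :=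
  Finset.sum_image fun i _ j _ h => by simpa using h

end Decay


/-! ### Square function and Carleson estimates for the oscillating part. -/

section FrequencyInteraction

variable {s : ℤ} {B : ℝ≥0∞} {k : Rd d → ℂ}

theorem sum_window_dif (s : ℤ) (N : ℕ) (g : Rd d → ℂ) (x : Rd d) :
    ∑ δ ∈ window N, dif (s + δ) g x = avg (s - N) g x - avg (s + N) g x := by
  have h := Finset.sum_range_sub (fun i : ℕ => avg (s + (N - i)) g x) (2 * N)
  rw [sum_window]
  push_cast at h
  rw [show s + ((N : ℤ) - 2 * N) = s - N by ring, sub_zero] at h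
  rw [← h]
  refine Finset.sum_congr rfl fun i _ => ?_
  simp only [dif]
  rw [show s + ((N : ℤ) - i) - 1 = s + (N - (i + 1)) by ring]

theorem eLpNorm_dif_le (q : ℤ) {f : Rd d → ℂ} (hf : MemLp f 2) :
    eLpNorm (dif q f) 2 ≤ eLpNorm f 2 := by
  refine eLpNorm_two_le_of_sq_le ?_
  rw [eLpNorm_two_sq]
  exact (le_add_self.trans (lintegral_avg_sub_one_sq q hf).ge).trans
    (lintegral_avg_sq_le _ hf.1)

theorem KerBound.kerOp_add_ae {K : Rd d → Rd d → ℂ} {a b : ℝ≥0∞} (hK : KerBound K a b)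
    (ha : a ≠ ∞) (hb : b ≠ ∞) {g h : Rd d → ℂ} (hgm : Measurable g) (hg : MemLp g 2)
    (hhm : Measurable h) (hh : MemLp h 2) :
    kerOp K (g + h) =ᵐ[volume] kerOp K g + kerOp K h := by
  filter_upwards [(hK.adm_of_memLp ha hb hgm hg).ae_integrable_univ hK.meas hgm,
    (hK.adm_of_memLp ha hb hhm hh).ae_integrable_univ hK.meas hhm] with x h1 h2
  simp only [kerOp, Pi.add_apply, mul_add]
  exact integral_add h1 h2

theorem KerBound.eLpNorm_dif_kerOp_add_le {K : Rd d → Rd d → ℂ} {a b : ℝ≥0∞}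
    (hK : KerBound K a b) (ha : a ≠ ∞) (hb : b ≠ ∞) (q : ℤ) {g h : Rd d → ℂ}
    (hgm : Measurable g) (hg : MemLp g 2) (hhm : Measurable h) (hh : MemLp h 2) :
    eLpNorm (dif q (kerOp K (g + h))) 2 ≤
      eLpNorm (dif q (kerOp K g)) 2 + eLpNorm (dif q (kerOp K h)) 2 := by
  have h1 : dif q (kerOp K (g + h)) = dif q (kerOp K g) + dif q (kerOp K h) := by
    ext x
    have hgc := (hK.adm_of_memLp ha hb hgm hg).cubeInt hK.meas hgm
    have hhc := (hK.adm_of_memLp ha hb hhm hh).cubeInt hK.meas hhm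
    simp only [dif, Pi.add_apply, avg_congr_ae (hK.kerOp_add_ae ha hb hgm hg hhm hh),
      avg_add hgc hhc]
    ring
  rw [h1]
  exact eLpNorm_add_le (memLp_dif _ (hK.memLp_kerOp ha hb hgm hg)).1
    (memLp_dif _ (hK.memLp_kerOp ha hb hhm hh)).1 one_le_two

/-- The squared norm gains 2^(-|δ|) from the output difference and 2^(-|r|) from the input
difference. The geometric mean of the two bounds gains from both, which is why the norm decays at
the rate 2^(-1/4) in each variable. -/
theorem IsKer.eLpNorm_dif_kerOp_dif_le (hk : IsKer s B k) (hB : B ≠ ∞) (δ r : ℤ) {f : Rd d → ℂ}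
    (hf : MemLp f 2) :
    eLpNorm (dif (s + δ) (kerOp (difKer s k) (dif (s + r) f))) 2 ≤
      kerConst d * B * decay ^ δ.natAbs * (decay ^ r.natAbs * eLpNorm (dif (s + r) f) 2) := by
  have hκ := kerConst_ne_top d
  have hK := hk.kerBound_difKer
  set g := dif (s + r) f with hg
  have hgm : Measurable g := (cubeConst_dif _ _).measurable
  have hg2 : MemLp g 2 := memLp_dif _ hf
  set x := decay ^ δ.natAbs
  set y := decay ^ r.natAbs
  have h1 : ∫⁻ z, ‖dif (s + δ) (kerOp (difKer s k) g) z‖ₑ ^ 2 ≤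
      (kerConst d * B) ^ 2 * x ^ 4 * ∫⁻ z, ‖g z‖ₑ ^ 2 := by
    have := (kerBound_dif hk hB δ).lintegral_kerOp_sq_le hgm
    rw [half_pow_eq_decay] at this
    refine le_of_eq_of_le ?_ (this.trans_eq (by ring))
    exact lintegral_congr fun z => by
      rw [dif_kerOp hK.meas hgm (hK.adm_of_memLp (by finiteness) (by finiteness) hgm hg2)]
  have h2 : ∫⁻ z, ‖dif (s + δ) (kerOp (difKer s k) g) z‖ₑ ^ 2 ≤
      (kerConst d * B) ^ 2 * y ^ 4 * ∫⁻ z, ‖g z‖ₑ ^ 2 := by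
    have h3 := lintegral_kerOp_dif_sq_le hk hB r hf
    rw [half_pow_eq_decay] at h3
    refine le_trans ?_ h3
    rw [← eLpNorm_two_sq, ← eLpNorm_two_sq]
    gcongr
    exact eLpNorm_dif_le _ (hK.memLp_kerOp (by finiteness) (by finiteness) hgm hg2)
  refine eLpNorm_two_le_of_sq_le ?_
  rw [mul_pow, mul_pow, mul_pow y, eLpNorm_two_sq]
  rcases le_total x y with hxy | hxy
  · calc _ ≤ (kerConst d * B) ^ 2 * x ^ 4 * ∫⁻ z, ‖g z‖ₑ ^ 2 := h1
      _ = (kerConst d * B) ^ 2 * (x ^ 2 * x ^ 2) * ∫⁻ z, ‖g z‖ₑ ^ 2 := by ring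
      _ ≤ (kerConst d * B) ^ 2 * (x ^ 2 * y ^ 2) * ∫⁻ z, ‖g z‖ₑ ^ 2 := by gcongr
      _ = _ := by ring
  · calc _ ≤ (kerConst d * B) ^ 2 * y ^ 4 * ∫⁻ z, ‖g z‖ₑ ^ 2 := h2
      _ = (kerConst d * B) ^ 2 * (y ^ 2 * y ^ 2) * ∫⁻ z, ‖g z‖ₑ ^ 2 := by ring
      _ ≤ (kerConst d * B) ^ 2 * (x ^ 2 * y ^ 2) * ∫⁻ z, ‖g z‖ₑ ^ 2 := by gcongr
      _ = _ := by ring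

theorem IsKer.eLpNorm_dif_kerOp_le_sum (hk : IsKer s B k) (hB : B ≠ ∞) (q : ℤ) {f : Rd d → ℂ}
    (hf : MemLp f 2) (b : ℤ) (n : ℕ) :
    eLpNorm (dif q (kerOp (difKer s k) (avg (b - n) f))) 2 ≤
      (∑ i ∈ Finset.range n, eLpNorm (dif q (kerOp (difKer s k) (dif (b - i) f))) 2) +
        eLpNorm (dif q (kerOp (difKer s k) (avg b f))) 2 := by
  have hK := hk.kerBound_difKer
  induction n with
  | zero => simp
  | succ n ih =>
    have h1 : avg (b - (n + 1 : ℕ)) f = dif (b - n) f + avg (b - n) f := by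
      ext x
      simp only [dif, Pi.add_apply]
      push_cast
      rw [show b - ((n : ℤ) + 1) = b - n - 1 by ring]
      ring
    rw [h1, Finset.sum_range_succ]
    refine (hK.eLpNorm_dif_kerOp_add_le (by finiteness) (by finiteness) q
      (cubeConst_dif _ _).measurable (memLp_dif _ hf) (cubeConst_avg _ _).measurable
      (memLp_avg _ hf)).trans ?_
    rw [add_comm (∑ i ∈ _, _), add_assoc]
    gcongr

theorem tendsto_const_mul_decay_pow {c : ℝ≥0∞} (hc : c ≠ ∞) :
    Tendsto (fun n : ℕ => c * decay ^ n) atTop (𝓝 0) := by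
  have h : decay < 1 := by
    rw [decay, ← ENNReal.ofReal_one]
    exact (ENNReal.ofReal_lt_ofReal_iff one_pos).2 sqrt_sqrt_half_lt_one
  simpa using ENNReal.Tendsto.const_mul (ENNReal.tendsto_pow_atTop_nhds_zero_of_lt_one h)
    (Or.inr hc)

/-- Resolve f into the differences of the scales within n of s and two tails, f - avg (s - n) f and
avg (s + n) f. The operator maps both tails to functions of norm O(`decay` ^ n), so they vanish in
the limit. -/
theorem IsKer.eLpNorm_dif_kerOp_le_tsum (hk : IsKer s B k) (hB : B ≠ ∞) (δ : ℤ) {f : Rd d → ℂ}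
    (hfm : Measurable f) (hf : MemLp f 2) :
    eLpNorm (dif (s + δ) (kerOp (difKer s k) f)) 2 ≤ kerConst d * B * decay ^ δ.natAbs *
      ∑' r : ℤ, decay ^ r.natAbs * eLpNorm (dif (s + r) f) 2 := by
  have hκ := kerConst_ne_top d
  have hK := hk.kerBound_difKer
  have hB2 : 2 * B ≠ ∞ := by finiteness
  set A := kerConst d * B with hA
  set X := kerConst d * B * decay ^ δ.natAbs *
      ∑' r : ℤ, decay ^ r.natAbs * eLpNorm (dif (s + r) f) 2 with hX
  set E := eLpNorm f 2 volume with hE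
  have hEt : E ≠ ∞ := hf.2.ne
  have hd : 4 * (d : ℝ≥0∞) ≤ kerConst d ^ 2 := by
    have h1 : 4 * (d : ℝ≥0∞) ≤ kerConst d := by
      refine le_trans ?_ (le_self_add (a := _) (b := _))
      refine le_trans ?_ le_add_self
      gcongr
      norm_num
    have h2 : 1 ≤ kerConst d := by
      rw [kerConst, add_assoc]; exact le_trans (by norm_num) le_self_add
    calc 4 * (d : ℝ≥0∞) ≤ kerConst d * 1 := by rwa [mul_one]
      _ ≤ kerConst d ^ 2 := by rw [sq]; gcongr
  have hbound : ∀ n : ℕ, eLpNorm (dif (s + δ) (kerOp (difKer s k) f)) 2 ≤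
      X + 2 * A * E * decay ^ n := by
    intro n
    have hsplit : f = (f - avg (s - n) f) + avg (s - n) f := by simp
    have hm1 : Measurable (f - avg (s - n) f) := hfm.sub (cubeConst_avg _ _).measurable
    have h1 := hK.eLpNorm_dif_kerOp_add_le hB2 hB2 (s + δ) hm1 (hf.sub (memLp_avg (s - n) hf))
      (cubeConst_avg _ _).measurable (memLp_avg (s - n) hf)
    rw [← hsplit] at h1
    have hp : (2⁻¹ : ℝ≥0∞) ^ n ≤ (decay ^ n) ^ 2 := by
      rw [half_pow_eq_decay]
      exact pow_le_pow_right_of_le_one' (decay_pow_le_one n) (by norm_num)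
    have h2 : eLpNorm (dif (s + δ) (kerOp (difKer s k) (f - avg (s - n) f))) 2 ≤
        A * E * decay ^ n := by
      refine (eLpNorm_dif_le _ (hK.memLp_kerOp hB2 hB2 hm1 (hf.sub (memLp_avg _ hf)))).trans ?_
      refine eLpNorm_two_le_of_sq_le ((lintegral_kerOp_sub_avg_sq_le hk hB n hfm hf).trans ?_)
      rw [← eLpNorm_two_sq, mul_pow (A * E), mul_pow A E, mul_right_comm]
      gcongr
    have h3 : eLpNorm (dif (s + δ) (kerOp (difKer s k) (avg (s + n) f))) 2 ≤
        A * E * decay ^ n := by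
      refine (eLpNorm_dif_le _ (hK.memLp_kerOp hB2 hB2 (cubeConst_avg _ _).measurable
        (memLp_avg _ hf))).trans ?_
      refine eLpNorm_two_le_of_sq_le ((lintegral_kerOp_avg_sq_le hk hB n hfm hf).trans ?_)
      rw [← eLpNorm_two_sq, mul_pow, mul_pow, mul_right_comm, hA, mul_pow]
      gcongr
    have h4 := hk.eLpNorm_dif_kerOp_le_sum hB (s + δ) hf (s + n) (2 * n)
    have h5 : ∑ i ∈ Finset.range (2 * n),
        eLpNorm (dif (s + δ) (kerOp (difKer s k) (dif (s + n - i) f))) 2 ≤ X := by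
      rw [hX, ← ENNReal.tsum_mul_left]
      refine le_trans ?_ (ENNReal.sum_le_tsum (window n))
      rw [sum_window]
      refine Finset.sum_le_sum fun i _ => ?_
      have := hk.eLpNorm_dif_kerOp_dif_le hB δ (n - i) hf
      rw [← add_sub_assoc] at this
      simpa only [add_sub_assoc] using this
    rw [show s + (n : ℤ) - (2 * n : ℕ) = s - n by push_cast; ring] at h4
    calc _ ≤ _ := h1
      _ ≤ A * E * decay ^ n + (X + A * E * decay ^ n) :=
          add_le_add h2 (h4.trans (add_le_add h5 h3))
      _ = _ := by ring
  have hlim : Tendsto (fun n : ℕ => X + 2 * A * E * decay ^ n) atTop (𝓝 (X + 0)) :=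
    tendsto_const_nhds.add (tendsto_const_mul_decay_pow (by finiteness))
  rw [add_zero] at hlim
  exact ge_of_tendsto' hlim hbound

/-- The constant in the square function estimates. -/
def opConst (d : ℕ) : ℝ≥0∞ := kerConst d ^ 2 * (2 * decaySum ^ 2 + 4)

theorem opConst_ne_top (d : ℕ) : opConst d ≠ ∞ := by
  have := kerConst_ne_top d
  have := decaySum_ne_top
  unfold opConst
  finiteness

/-- Almost orthogonality: Cauchy–Schwarz with the weights `decay` ^ |r| and an exchange of sums
reduce to a fixed r, where Bessel's inequality sums over m. -/
theorem tsum_lintegral_dif_kerOp_sq_le' {a : ℤ} {k : ℕ → Rd d → ℂ}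
    (hk : ∀ m : ℕ, IsKer (m + a) B (k m)) (hB : B ≠ ∞) (δ : ℤ) {f : Rd d → ℂ}
    (hfm : Measurable f) (hf : MemLp f 2) :
    ∑' m : ℕ, ∫⁻ x, ‖dif (m + a + δ) (kerOp (difKer (m + a) (k m)) f) x‖ₑ ^ 2 ≤
      kerConst d ^ 2 * decaySum ^ 2 * B ^ 2 * (decay ^ δ.natAbs) ^ 2 * ∫⁻ x, ‖f x‖ₑ ^ 2 := by
  calc ∑' m : ℕ, ∫⁻ x, ‖dif (m + a + δ) (kerOp (difKer (m + a) (k m)) f) x‖ₑ ^ 2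
      ≤ ∑' m : ℕ, (kerConst d * B * decay ^ δ.natAbs) ^ 2 * (decaySum *
          ∑' r : ℤ, decay ^ r.natAbs * ∫⁻ x, ‖dif (m + (a + r)) f x‖ₑ ^ 2) := by
        refine ENNReal.tsum_le_tsum fun m => ?_
        rw [← eLpNorm_two_sq]
        refine (pow_le_pow_left₀ zero_le
          ((hk m).eLpNorm_dif_kerOp_le_tsum hB δ hfm hf) 2).trans ?_
        rw [mul_pow]
        gcongr
        refine (tsum_weighted_sq_le _ _).trans ?_
        gcongr
        · exact tsum_decay_le
        · rw [eLpNorm_two_sq, add_assoc]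
    _ = (kerConst d * B * decay ^ δ.natAbs) ^ 2 * (decaySum *
          ∑' r : ℤ, decay ^ r.natAbs * ∑' m : ℕ, ∫⁻ x, ‖dif (m + (a + r)) f x‖ₑ ^ 2) := by
        rw [ENNReal.tsum_mul_left, ENNReal.tsum_mul_left, ENNReal.tsum_comm]
        simp only [ENNReal.tsum_mul_left]
    _ ≤ (kerConst d * B * decay ^ δ.natAbs) ^ 2 * (decaySum *
          ∑' r : ℤ, decay ^ r.natAbs * ∫⁻ x, ‖f x‖ₑ ^ 2) := by
        gcongr with r
        exact (tsum_comp_add_le (fun q => ∫⁻ x, ‖dif q f x‖ₑ ^ 2) _).trans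
          (tsum_lintegral_dif_sq_le hf)
    _ ≤ (kerConst d * B * decay ^ δ.natAbs) ^ 2 * (decaySum * (decaySum * ∫⁻ x, ‖f x‖ₑ ^ 2)) := by
        rw [ENNReal.tsum_mul_right]
        gcongr
        exact tsum_decay_le
    _ = _ := by ring

theorem tsum_lintegral_dif_kerOp_sq_le {a : ℤ} {k : ℕ → Rd d → ℂ}
    (hk : ∀ m : ℕ, IsKer (m + a) B (k m)) (hB : B ≠ ∞) (δ : ℤ) {f : Rd d → ℂ}
    (hfm : Measurable f) (hf : MemLp f 2) :
    ∑' m : ℕ, ∫⁻ x, ‖dif (m + a + δ) (kerOp (difKer (m + a) (k m)) f) x‖ₑ ^ 2 ≤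
      opConst d * B ^ 2 * (decay ^ δ.natAbs) ^ 2 * ∫⁻ x, ‖f x‖ₑ ^ 2 := by
  refine (tsum_lintegral_dif_kerOp_sq_le' hk hB δ hfm hf).trans ?_
  rw [opConst]
  gcongr
  exact (le_mul_of_one_le_left' (by norm_num)).trans le_self_add

theorem IsKer.enorm_dif_kerOp_le (hk : IsKer s B k) (hB : B ≠ ∞) (δ : ℤ) {f : Rd d → ℂ}
    (hfm : Measurable f) (hf : ∀ x, ‖f x‖ₑ ≤ 1) (x : Rd d) :
    ‖dif (s + δ) (kerOp (difKer s k) f) x‖ₑ ≤ kerConst d * B * 2⁻¹ ^ δ.natAbs := by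
  have hK := hk.kerBound_difKer
  rw [dif_kerOp hK.meas hfm (hK.adm_of_bound (by finiteness) ENNReal.one_ne_top hf)]
  simpa using (kerBound_dif hk hB δ).enorm_kerOp_le hf x

theorem KerBound.kerOp_add {K : Rd d → Rd d → ℂ} {a b : ℝ≥0∞} (hK : KerBound K a b)
    (ha : a ≠ ∞) {g h : Rd d → ℂ} (hgm : Measurable g) (hg : ∀ x, ‖g x‖ₑ ≤ 1)
    (hhm : Measurable h) (hh : ∀ x, ‖h x‖ₑ ≤ 1) (x : Rd d) :
    kerOp K (g + h) x = kerOp K g x + kerOp K h x := by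
  have hint : ∀ {g : Rd d → ℂ}, Measurable g → (∀ x, ‖g x‖ₑ ≤ 1) →
      Integrable fun y => K x y * g y := by
    intro g hgm hg
    refine ⟨((hK.measurable_right x).mul hgm).aestronglyMeasurable, ?_⟩
    refine lt_of_le_of_lt (lintegral_mono fun y => ?_) ((hK.row x).trans_lt ha.lt_top)
    rw [enorm_mul]
    exact mul_le_of_le_one_right' (hg y)
  simp only [kerOp, Pi.add_apply, mul_add]
  exact integral_add (hint hgm hg) (hint hhm hh)

/-- The contribution of the complement of a cube to the averages over that cube. -/
theorem IsKer.eavg_dif_kerOp_compl_le (hk : IsKer s B k) (hB : B ≠ ∞) (δ : ℤ) {f : Rd d → ℂ}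
    (hfm : Measurable f) (hf : ∀ x, ‖f x‖ₑ ≤ 1) {p : ℤ} (hsp : s ≤ p) (x : Rd d) :
    eavg p (fun y => ‖dif (s + δ) (kerOp (difKer s k) ((cube p x)ᶜ.indicator f)) y‖ₑ ^ 2) x ≤
      (kerConst d * B) ^ 2 * 2⁻¹ ^ δ.natAbs * p2 (s - p) := by
  classical
  have hK := hk.kerBound_difKer
  have hB2 : 2 * B ≠ ∞ := by finiteness
  set I := cube p x with hI
  have hIm : MeasurableSet I := measurableSet_cube p x
  set g := Iᶜ.indicator f with hg
  have hgm : Measurable g := hfm.indicator hIm.compl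
  have hg1 : ∀ y, ‖g y‖ₑ ≤ 1 := fun y => (enorm_indicator_le_enorm_self _ _).trans (hf y)
  have hAd := hK.adm_of_bound (f := g) hB2 ENNReal.one_ne_top hg1
  have h3 := hk.enorm_dif_kerOp_le hB δ hgm hg1
  have hmeas : Measurable fun y => ‖dif (s + δ) (kerOp (difKer s k) g) y‖ₑ :=
    (cubeConst_dif _ _).measurable.enorm
  -- One copy of the difference is estimated uniformly, the other on average. If s + δ ≤ p,
  -- averaging over the cube reduces to the mass leaking through its boundary, the dyadic average
  -- contributing nothing since s ≤ p. If s + δ > p, then |δ| ≥ p - s and the uniform bound already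
  -- has the required decay.
  have h4 : eavg p (fun y => ‖dif (s + δ) (kerOp (difKer s k) g) y‖ₑ) x ≤
      kerConst d * B * p2 (s - p) := by
    rcases le_or_gt (s + δ) p with h | h
    · have hu : Measurable (kerOp (difKer s k) g) := hK.measurable_kerOp hgm
      have hc : CubeInt (kerOp (difKer s k) g) := hAd.cubeInt hK.meas hgm
      have h5 : ∀ y, ‖dif (s + δ) (kerOp (difKer s k) g) y‖ₑ ≤
          eavg (s + δ - 1) (fun y => ‖kerOp (difKer s k) g y‖ₑ) y +
            eavg (s + δ) (fun y => ‖kerOp (difKer s k) g y‖ₑ) y := fun y =>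
        enorm_sub_le.trans (add_le_add (enorm_avg_le _ _ _) (enorm_avg_le _ _ _))
      have h6 : eavg p (fun y => ‖kerOp (difKer s k) g y‖ₑ) x ≤ d * (B * p2 (s - p)) := by
        have h7 : ∫⁻ y in I, ‖kerOp (difKer s k) g y‖ₑ ≤
            ENNReal.ofReal (vol d p) * (d * (B * p2 (s - p))) := by
          refine le_trans (setLIntegral_mono' hIm fun y hy => ?_)
            (hk.lintegral_cube_compl_le p x)
          refine (enorm_integral_le_lintegral_enorm _).trans ?_
          rw [← lintegral_indicator hIm.compl]
          refine lintegral_mono fun z => ?_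
          by_cases hz : z ∈ Iᶜ
          · have : avgKer s y z = 0 := by
              rw [avgKer, indicator_of_notMem]
              intro hz'
              refine hz ?_
              rw [hI, cube_eq_of_idx (mem_cube_iff.1 hy).symm]
              exact cube_subset hsp y hz'
            rw [difKer, this, mul_zero, sub_zero, enorm_mul, indicator_of_mem hz]
            exact mul_le_of_le_one_right' (hg1 z)
          · simp [hg, indicator_of_notMem hz]
        rw [eavg]
        calc _ ≤ (ENNReal.ofReal (vol d p))⁻¹ *
              (ENNReal.ofReal (vol d p) * (d * (B * p2 (s - p)))) := by gcongr
          _ = _ := by rw [← mul_assoc, inv_vol_mul_vol, one_mul]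
      calc _ ≤ eavg p (fun y => eavg (s + δ - 1) (fun y => ‖kerOp (difKer s k) g y‖ₑ) y +
            eavg (s + δ) (fun y => ‖kerOp (difKer s k) g y‖ₑ) y) x := eavg_mono h5 x
        _ = eavg p (fun y => ‖kerOp (difKer s k) g y‖ₑ) x +
            eavg p (fun y => ‖kerOp (difKer s k) g y‖ₑ) x := by
          rw [eavg_add (cubeConst_eavg _ _).measurable, eavg_eavg (by omega) hu.enorm,
            eavg_eavg h hu.enorm]
        _ ≤ d * (B * p2 (s - p)) + d * (B * p2 (s - p)) := add_le_add h6 h6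
        _ = (2 * d) * B * p2 (s - p) := by ring
        _ ≤ _ := by
          gcongr
          refine le_trans ?_ (le_self_add (a := _) (b := _))
          refine le_trans ?_ le_add_self
          gcongr
          norm_num
    · refine eavg_le_of_le (fun y => (h3 y).trans ?_) x
      gcongr
      have : s - p = -((p - s).toNat : ℤ) := by omega
      rw [this, p2_neg_natCast]
      exact pow_le_pow_right_of_le_one' (ENNReal.inv_le_one.2 one_le_two) (by omega)
  calc eavg p (fun y => ‖dif (s + δ) (kerOp (difKer s k) g) y‖ₑ ^ 2) x
      ≤ eavg p (fun y => kerConst d * B * 2⁻¹ ^ δ.natAbs *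
          ‖dif (s + δ) (kerOp (difKer s k) g) y‖ₑ) x := by
        refine eavg_mono (fun y => ?_) x
        rw [sq]
        gcongr
        exact h3 y
    _ = kerConst d * B * 2⁻¹ ^ δ.natAbs *
          eavg p (fun y => ‖dif (s + δ) (kerOp (difKer s k) g) y‖ₑ) x :=
        eavg_const_mul (h := fun _ => kerConst d * B * 2⁻¹ ^ δ.natAbs) (fun _ _ _ => rfl) hmeas x
    _ ≤ kerConst d * B * 2⁻¹ ^ δ.natAbs * (kerConst d * B * p2 (s - p)) := by gcongr
    _ = _ := by ring

theorem tsum_p2_le (a p : ℤ) : ∑' m : ℕ, (if (m : ℤ) + a ≤ p then p2 (m + a - p) else 0) ≤ 2 := by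
  rcases lt_or_ge p a with h | h
  · have : ∀ m : ℕ, (if (m : ℤ) + a ≤ p then p2 (m + a - p) else 0) = 0 := fun m =>
      if_neg (by omega)
    simp [this]
  · obtain ⟨n, rfl⟩ : ∃ n : ℕ, p = n + a := ⟨(p - a).toNat, by omega⟩
    have hz : ∀ m ∉ Finset.range (n + 1),
        (if (m : ℤ) + a ≤ n + a then p2 (m + a - (n + a)) else 0) = 0 := fun m hm =>
      if_neg (by simp at hm; omega)
    rw [tsum_eq_sum hz, ← Finset.sum_range_reflect]
    have : ∑' j : ℕ, (2⁻¹ : ℝ≥0∞) ^ j = 2 := by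
      rw [ENNReal.tsum_geometric, ENNReal.one_sub_inv_two, inv_inv]
    rw [← this]
    refine le_trans (Finset.sum_le_sum fun j hj => ?_) (ENNReal.sum_le_tsum (Finset.range (n + 1)))
    have hj' := Finset.mem_range.1 hj
    split_ifs
    · rw [← p2_neg_natCast]
      refine le_of_eq ?_
      congr 1
      omega
    · exact zero_le

/-- The frequency-localized pieces of `kerOp (difKer (m + a) (k m)) f` satisfy a Carleson
condition when `f` is bounded. -/
theorem car_dif_kerOp {a : ℤ} {k : ℕ → Rd d → ℂ} (hk : ∀ m : ℕ, IsKer (m + a) B (k m))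
    (hB : B ≠ ∞) (δ : ℤ) {f : Rd d → ℂ} (hfm : Measurable f) (hf : ∀ x, ‖f x‖ₑ ≤ 1) (j : ℕ) :
    Car (opConst d * (1 + j) * B ^ 2 * (decay ^ δ.natAbs) ^ 2) (a - j)
      fun m x => ‖dif (m + a + δ) (kerOp (difKer (m + a) (k m)) f) x‖ₑ := by
  classical
  have hB2 : 2 * B ≠ ∞ := by finiteness
  have hp : (2⁻¹ : ℝ≥0∞) ^ δ.natAbs ≤ (decay ^ δ.natAbs) ^ 2 := by
    rw [half_pow_eq_decay]
    exact pow_le_pow_right_of_le_one' (decay_pow_le_one _) (by norm_num)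
  -- Split f at the boundary of the test cube. The part inside has squared L² norm at most the
  -- volume, so the square function estimate applies; the part outside contributes a geometric
  -- series in p - m - a.
  have hbase : Car (opConst d * B ^ 2 * (decay ^ δ.natAbs) ^ 2) a
      fun m x => ‖dif (m + a + δ) (kerOp (difKer (m + a) (k m)) f) x‖ₑ := by
    intro p x
    set I := cube p x with hI
    have hIm : MeasurableSet I := measurableSet_cube p x
    set g := I.indicator f with hg
    set h := Iᶜ.indicator f with hh
    have hgm : Measurable g := hfm.indicator hIm
    have hhm : Measurable h := hfm.indicator hIm.compl
    have hg1 : ∀ y, ‖g y‖ₑ ≤ 1 := fun y => (enorm_indicator_le_enorm_self _ _).trans (hf y)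
    have hh1 : ∀ y, ‖h y‖ₑ ≤ 1 := fun y => (enorm_indicator_le_enorm_self _ _).trans (hf y)
    have hg2 : MemLp g 2 := memLp_indicator_cube hfm.aestronglyMeasurable ENNReal.one_ne_top hf p x
    have hfgh : f = g + h := (indicator_self_add_compl I f).symm
    set u : ℕ → (Rd d → ℂ) → Rd d → ℝ≥0∞ := fun m f y =>
      ‖dif (m + a + δ) (kerOp (difKer (m + a) (k m)) f) y‖ₑ with hu
    have hum : ∀ m f, Measurable (u m f) := fun m f => (cubeConst_dif _ _).measurable.enorm
    have hle : ∀ (m : ℕ) y, u m f y ^ 2 ≤ 2 * u m g y ^ 2 + 2 * u m h y ^ 2 := by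
      intro m y
      have hK := (hk m).kerBound_difKer
      have hadd : dif (m + a + δ) (kerOp (difKer (m + a) (k m)) f) y =
          dif (m + a + δ) (kerOp (difKer (m + a) (k m)) g) y +
            dif (m + a + δ) (kerOp (difKer (m + a) (k m)) h) y := by
        have h1 : kerOp (difKer (m + a) (k m)) f =
            kerOp (difKer (m + a) (k m)) g + kerOp (difKer (m + a) (k m)) h := by
          ext z
          rw [hfgh]
          exact hK.kerOp_add hB2 hgm hg1 hhm hh1 z
        have hgc := (hK.adm_of_bound (f := g) hB2 ENNReal.one_ne_top hg1).cubeInt hK.meas hgm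
        have hhc := (hK.adm_of_bound (f := h) hB2 ENNReal.one_ne_top hh1).cubeInt hK.meas hhm
        simp only [dif, h1, avg_add hgc hhc]
        ring
      calc u m f y ^ 2 ≤ (u m g y + u m h y) ^ 2 := by
            simp only [hu]
            rw [hadd]
            gcongr
            exact enorm_add_le _ _
        _ ≤ 2 * (u m g y ^ 2 + u m h y ^ 2) := by
            have := ENNReal.rpow_add_le_mul_rpow_add_rpow (u m g y) (u m h y) (p := 2) (by norm_num)
            norm_num at this
            exact this
        _ = _ := by ring
    have hfar : ∀ m : ℕ, (m : ℤ) + a ≤ p → eavg p (fun y => u m h y ^ 2) x ≤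
        (kerConst d * B) ^ 2 * 2⁻¹ ^ δ.natAbs * p2 (m + a - p) := fun m hm =>
      (hk m).eavg_dif_kerOp_compl_le hB δ hfm hf hm x
    have hnear : ∑' m : ℕ, eavg p (fun y => u m g y ^ 2) x ≤
        kerConst d ^ 2 * decaySum ^ 2 * B ^ 2 * (decay ^ δ.natAbs) ^ 2 := by
      have h1 := tsum_lintegral_dif_kerOp_sq_le' hk hB δ hgm hg2
      simp only [eavg]
      rw [ENNReal.tsum_mul_left]
      calc _ ≤ (ENNReal.ofReal (vol d p))⁻¹ *
            (kerConst d ^ 2 * decaySum ^ 2 * B ^ 2 * (decay ^ δ.natAbs) ^ 2 *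
              ENNReal.ofReal (vol d p)) := by
            gcongr
            refine le_trans (ENNReal.tsum_le_tsum fun m => setLIntegral_le_lintegral _ _)
              (h1.trans ?_)
            gcongr
            simpa using lintegral_indicator_cube_sq_le hf p x
        _ = (ENNReal.ofReal (vol d p))⁻¹ * ENNReal.ofReal (vol d p) *
            (kerConst d ^ 2 * decaySum ^ 2 * B ^ 2 * (decay ^ δ.natAbs) ^ 2) := by ring
        _ = _ := by rw [inv_vol_mul_vol, one_mul]
    calc ∑' m : ℕ, (if (m : ℤ) + a ≤ p then eavg p (fun y => u m f y ^ 2) x else 0)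
        ≤ ∑' m : ℕ, (2 * eavg p (fun y => u m g y ^ 2) x +
            2 * ((kerConst d * B) ^ 2 * 2⁻¹ ^ δ.natAbs *
              (if (m : ℤ) + a ≤ p then p2 (m + a - p) else 0))) := by
          refine ENNReal.tsum_le_tsum fun m => ?_
          split_ifs with hm
          · calc eavg p (fun y => u m f y ^ 2) x
                ≤ eavg p (fun y => 2 * u m g y ^ 2 + 2 * u m h y ^ 2) x := eavg_mono (hle m) x
              _ = 2 * eavg p (fun y => u m g y ^ 2) x + 2 * eavg p (fun y => u m h y ^ 2) x := by
                rw [eavg_add (((hum m g).pow_const 2).const_mul 2),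
                  eavg_const_mul (h := fun _ => 2) (fun _ _ _ => rfl) ((hum m g).pow_const 2),
                  eavg_const_mul (h := fun _ => 2) (fun _ _ _ => rfl) ((hum m h).pow_const 2)]
              _ ≤ _ := by
                gcongr
                exact hfar m hm
          · exact zero_le
      _ = 2 * ∑' m : ℕ, eavg p (fun y => u m g y ^ 2) x +
            2 * ((kerConst d * B) ^ 2 * 2⁻¹ ^ δ.natAbs *
              ∑' m : ℕ, (if (m : ℤ) + a ≤ p then p2 (m + a - p) else 0)) := by
          rw [ENNReal.tsum_add]
          simp only [ENNReal.tsum_mul_left]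
      _ ≤ 2 * (kerConst d ^ 2 * decaySum ^ 2 * B ^ 2 * (decay ^ δ.natAbs) ^ 2) +
            2 * ((kerConst d * B) ^ 2 * (decay ^ δ.natAbs) ^ 2 * 2) := by
          gcongr
          exact tsum_p2_le a p
      _ = _ := by rw [opConst]; ring
  -- The j lowered scales cost j times the uniform bound for the squares, which obeys the same bound
  -- as the Carleson constant.
  refine (hbase.lower (c := opConst d * B ^ 2 * (decay ^ δ.natAbs) ^ 2) (fun m x => ?_) j).mono
    (le_of_eq (by ring))
  refine (pow_le_pow_left₀ zero_le ((hk m).enorm_dif_kerOp_le hB δ hfm hf x) 2).trans ?_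
  calc (kerConst d * B * 2⁻¹ ^ δ.natAbs) ^ 2
      ≤ (kerConst d * B) ^ 2 * ((decay ^ δ.natAbs) ^ 2 * 1) := by
        rw [mul_pow, sq (2⁻¹ ^ _)]
        gcongr
        exact half_pow_le_one _
    _ = kerConst d ^ 2 * 1 * B ^ 2 * (decay ^ δ.natAbs) ^ 2 := by ring
    _ ≤ _ := by
      rw [opConst]
      gcongr
      exact le_trans (by norm_num) le_add_self

/-- The decomposition of `kerOp (difKer s k) f` into its martingale differences, for bounded `f`. -/
theorem IsKer.tendsto_sum_window_of_bound (hk : IsKer s B k) (hB : B ≠ ∞) {f : Rd d → ℂ}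
    (hfm : Measurable f) (hf : ∀ x, ‖f x‖ₑ ≤ 1) (x : Rd d) :
    Tendsto (fun N => ∑ δ ∈ window N, dif (s + δ) (kerOp (difKer s k) f) x) atTop
      (𝓝 (kerOp (difKer s k) f x)) := by
  have hK := hk.kerBound_difKer
  have hB2 : 2 * B ≠ ∞ := by finiteness
  have hAd := hK.adm_of_bound (f := f) hB2 ENNReal.one_ne_top hf
  have h0 : Tendsto (fun N : ℕ => (2⁻¹ : ℝ≥0∞) ^ N) atTop (𝓝 0) :=
    ENNReal.tendsto_pow_atTop_nhds_zero_of_lt_one (ENNReal.inv_lt_one.2 ENNReal.one_lt_two)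
  have hint : ∀ {K : Rd d → Rd d → ℂ} {a b : ℝ≥0∞}, KerBound K a b → a ≠ ∞ →
      Integrable fun y => K x y * f y := by
    intro K a b hK ha
    refine ⟨((hK.measurable_right x).mul hfm).aestronglyMeasurable, ?_⟩
    refine lt_of_le_of_lt (lintegral_mono fun y => ?_) ((hK.row x).trans_lt ha.lt_top)
    rw [enorm_mul]
    exact mul_le_of_le_one_right' (hf y)
  simp only [sum_window_dif]
  have h1 : Tendsto (fun N : ℕ => avg (s - N) (kerOp (difKer s k) f) x) atTop
      (𝓝 (kerOp (difKer s k) f x)) := by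
    rw [tendsto_iff_edist_tendsto_0]
    refine tendsto_of_tendsto_of_tendsto_of_le_of_le tendsto_const_nhds
      (show Tendsto (fun N : ℕ => d * B * (2⁻¹ : ℝ≥0∞) ^ N) atTop (𝓝 0) by
        simpa using ENNReal.Tendsto.const_mul h0 (Or.inr (by finiteness)))
      (fun _ => zero_le) fun N => ?_
    rw [edist_comm, edist_eq_enorm_sub, avg_kerOp hK.meas hfm hAd,
      ← kerOp_sub (hint hK hB2) (hint (hK.kerAvg _) hB2)]
    simpa using (kerBound_fine hk hB N).enorm_kerOp_le hf x
  have h2 : Tendsto (fun N : ℕ => avg (s + N) (kerOp (difKer s k) f) x) atTop (𝓝 0) := by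
    rw [tendsto_iff_edist_tendsto_0]
    refine tendsto_of_tendsto_of_tendsto_of_le_of_le tendsto_const_nhds
      (show Tendsto (fun N : ℕ => 2 * d * B * (2⁻¹ : ℝ≥0∞) ^ N) atTop (𝓝 0) by
        simpa using ENNReal.Tendsto.const_mul h0 (Or.inr (by finiteness)))
      (fun _ => zero_le) fun N => ?_
    rw [edist_zero_right, avg_kerOp hK.meas hfm hAd]
    refine (enorm_integral_le_lintegral_enorm _).trans (le_trans (lintegral_mono fun y => ?_)
      (hk.lintegral_kerAvg_coarse_le hB N x))
    rw [enorm_mul]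
    exact mul_le_of_le_one_right' (hf y)
  simpa using h1.sub h2

/-- The series of the squares is integrable, hence finite almost everywhere, so its terms tend to
zero there. -/
theorem ae_tendsto_zero_of_tsum_lintegral_sq {u : ℕ → Rd d → ℂ} (hu : ∀ n, Measurable (u n))
    (h : ∑' n, ∫⁻ x, ‖u n x‖ₑ ^ 2 ≠ ∞) : ∀ᵐ x, Tendsto (fun n => u n x) atTop (𝓝 0) := by
  rw [← lintegral_tsum fun n => ((hu n).enorm.pow_const 2).aemeasurable] at h
  filter_upwards [ae_lt_top (Measurable.tsum fun n => (hu n).enorm.pow_const 2) h]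
    with x hx
  have h1 := ENNReal.tendsto_atTop_zero_of_tsum_ne_top hx.ne
  rw [tendsto_iff_edist_tendsto_0]
  simp only [edist_zero_right]
  have h2 := (ENNReal.continuous_rpow_const (y := 1 / 2)).tendsto _ |>.comp h1
  simp only [Function.comp_def] at h2
  convert h2 using 1
  · ext n
    rw [← ENNReal.rpow_natCast, ← ENNReal.rpow_mul]
    norm_num
  · rw [ENNReal.zero_rpow_of_pos (by norm_num)]

/-- The decomposition of `kerOp (difKer s k) f` into its martingale differences, for `f ∈ L²`. -/
theorem IsKer.ae_tendsto_sum_window (hk : IsKer s B k) (hB : B ≠ ∞) {f : Rd d → ℂ}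
    (hfm : Measurable f) (hf : MemLp f 2) :
    ∀ᵐ x, Tendsto (fun N => ∑ δ ∈ window N, dif (s + δ) (kerOp (difKer s k) f) x) atTop
      (𝓝 (kerOp (difKer s k) f x)) := by
  have hK := hk.kerBound_difKer
  have hκ := kerConst_ne_top d
  have hB2 : 2 * B ≠ ∞ := by finiteness
  have hAd := hK.adm_of_memLp hB2 hB2 hfm hf
  have hgeo : ∑' N : ℕ, (2⁻¹ : ℝ≥0∞) ^ N ≠ ∞ := by
    rw [ENNReal.tsum_geometric, ENNReal.one_sub_inv_two, inv_inv]
    exact ENNReal.ofNat_ne_top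
  have hE := (lintegral_sq_lt_top hf).ne
  have hum := hK.measurable_kerOp hfm
  have h1 : ∀ᵐ x, Tendsto (fun N : ℕ => (fun x => kerOp (difKer s k) f x -
      avg (s - N) (kerOp (difKer s k) f) x) x) atTop (𝓝 0) := by
    refine ae_tendsto_zero_of_tsum_lintegral_sq
      (fun N => hum.sub (cubeConst_avg _ _).measurable) (ne_top_of_le_ne_top ?_
        (ENNReal.tsum_le_tsum (g := fun N => (d * B) * (d * (ENNReal.ofReal ((d : ℝ) ^ d) *
          volume (Metric.closedBall (0 : Rd d) 1)) * B) * (∫⁻ x, ‖f x‖ₑ ^ 2) * 2⁻¹ ^ N)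
          fun N => ?_))
    · rw [ENNReal.tsum_mul_left]
      have := (isCompact_closedBall (0 : Rd d) 1).measure_lt_top (μ := volume)
      finiteness
    · have hAe := hAd.ae_integrable_univ hK.meas hfm
      have hAe' := ((hK.kerAvg (s - N)).adm_of_memLp hB2 hB2 hfm hf).ae_integrable_univ
        (hK.kerAvg (s - N)).meas hfm
      rw [lintegral_congr_ae (g := fun x => ‖kerOp (fun x y => difKer s k x y -
        kerAvg (s - N) (difKer s k) x y) f x‖ₑ ^ 2) (by
          filter_upwards [hAe, hAe'] with x h h'
          rw [avg_kerOp hK.meas hfm hAd, kerOp_sub h h'])]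
      refine ((kerBound_fine hk hB N).lintegral_kerOp_sq_le hfm).trans ?_
      calc _ = (d * B) * (d * (ENNReal.ofReal ((d : ℝ) ^ d) *
            volume (Metric.closedBall (0 : Rd d) 1)) * B) * (∫⁻ x, ‖f x‖ₑ ^ 2) *
              (2⁻¹ ^ N * 2⁻¹ ^ N) := by ring
        _ ≤ (d * B) * (d * (ENNReal.ofReal ((d : ℝ) ^ d) *
            volume (Metric.closedBall (0 : Rd d) 1)) * B) * (∫⁻ x, ‖f x‖ₑ ^ 2) *
              (2⁻¹ ^ N * 1) := by
            gcongr
            exact half_pow_le_one _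
        _ = _ := by rw [mul_one]
  have h2 : ∀ᵐ x, Tendsto (fun N : ℕ => avg (s + N) (kerOp (difKer s k) f) x) atTop (𝓝 0) := by
    refine ae_tendsto_zero_of_tsum_lintegral_sq
      (fun N => (cubeConst_avg _ _).measurable) (ne_top_of_le_ne_top ?_
        (ENNReal.tsum_le_tsum (g := fun N => (2 * d * B) * (2 * B) * (∫⁻ x, ‖f x‖ₑ ^ 2) * 2⁻¹ ^ N)
          fun N => ?_))
    · rw [ENNReal.tsum_mul_left]
      finiteness
    · have hKB : KerBound (kerAvg (s + N) (difKer s k)) (2 * d * B * 2⁻¹ ^ N) (2 * B) :=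
        ⟨(hK.kerAvg _).meas, fun x => hk.lintegral_kerAvg_coarse_le hB N x, (hK.kerAvg _).col⟩
      simp only [avg_kerOp hK.meas hfm hAd]
      refine (hKB.lintegral_kerOp_sq_le hfm).trans_eq ?_
      ring
  filter_upwards [h1, h2] with x h1 h2
  simp only [sum_window_dif]
  have h3 := (tendsto_const_nhds (x := kerOp (difKer s k) f x)).sub h1
  simpa using h3.sub h2

end FrequencyInteraction

/-! ### Summation over offsets, and paraproducts without restriction on the scales. -/

section Summation

/-- Minkowski's inequality for L² norms at most w i · √A, obtained from Cauchy–Schwarz with the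
weights w i so that no square roots of integrals appear. -/
theorem lintegral_tsum_sq_le {κ : Type*} [Countable κ] {h : κ → Rd d → ℝ≥0∞}
    (hm : ∀ i, Measurable (h i)) {w : κ → ℝ≥0∞} (hw0 : ∀ i, w i ≠ 0) (hw : ∀ i, w i ≠ ∞)
    {A : ℝ≥0∞} (hA : ∀ i, ∫⁻ x, h i x ^ 2 ≤ w i ^ 2 * A) :
    ∫⁻ x, (∑' i, h i x) ^ 2 ≤ (∑' i, w i) ^ 2 * A := by
  have h1 : ∀ i, (w i)⁻¹ * w i = 1 := fun i => ENNReal.inv_mul_cancel (hw0 i) (hw i)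
  calc ∫⁻ x, (∑' i, h i x) ^ 2
      = ∫⁻ x, (∑' i, w i * ((w i)⁻¹ * h i x)) ^ 2 := by
        refine lintegral_congr fun x => ?_
        congr 2 with i
        rw [← mul_assoc, mul_comm (w i), h1, one_mul]
    _ ≤ ∫⁻ x, (∑' i, w i) * ∑' i, w i * ((w i)⁻¹ * h i x) ^ 2 :=
        lintegral_mono fun x => tsum_weighted_sq_le _ _
    _ = (∑' i, w i) * ∑' i, w i * ((w i)⁻¹ ^ 2 * ∫⁻ x, h i x ^ 2) := by
        have hmi : ∀ i, Measurable fun x => w i * ((w i)⁻¹ * h i x) ^ 2 := fun i =>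
          (((hm i).const_mul _).pow_const 2).const_mul _
        rw [lintegral_const_mul _ (Measurable.tsum hmi),
          lintegral_tsum fun i => (hmi i).aemeasurable]
        congr 2 with i
        rw [lintegral_const_mul _ (((hm i).const_mul _).pow_const 2)]
        simp only [mul_pow]
        rw [lintegral_const_mul _ ((hm i).pow_const 2)]
    _ ≤ (∑' i, w i) * ∑' i, w i * A := by
        gcongr with i
        calc (w i)⁻¹ ^ 2 * ∫⁻ x, h i x ^ 2 ≤ (w i)⁻¹ ^ 2 * (w i ^ 2 * A) := by gcongr; exact hA i
          _ = ((w i)⁻¹ * w i) ^ 2 * A := by ring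
          _ = A := by rw [h1, one_pow, one_mul]
    _ = _ := by rw [ENNReal.tsum_mul_right]; ring

/-- Fatou along the windows of scales and the triangle inequality on each window. -/
theorem eLpNorm_le_of_ae_tendsto_sum_window {F : Rd d → ℂ} {G : ℤ → Rd d → ℂ}
    (hG : ∀ δ, Measurable (G δ)) {w : ℤ → ℝ≥0∞} (hw : ∀ δ, eLpNorm (G δ) 2 ≤ w δ)
    (hF : ∀ᵐ x, Tendsto (fun N => ∑ δ ∈ window N, G δ x) atTop (𝓝 (F x))) :
    eLpNorm F 2 ≤ ∑' δ, w δ := by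
  refine (Lp.eLpNorm_lim_le_liminf_eLpNorm
    (f := fun N x => ∑ δ ∈ window N, G δ x)
    (fun N => (Finset.measurable_fun_sum _ fun δ _ => hG δ).aestronglyMeasurable) F hF).trans ?_
  refine liminf_le_of_le (by isBoundedDefault) fun b hb => ?_
  obtain ⟨N, hN⟩ := hb.exists
  refine hN.trans ?_
  have := eLpNorm_sum_le (s := window N) (f := G) (p := 2) (μ := volume)
    (fun δ _ => (hG δ).aestronglyMeasurable) one_le_two
  have heq : (fun x => ∑ δ ∈ window N, G δ x) = ∑ δ ∈ window N, G δ := by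
    ext x; rw [Finset.sum_apply]
  rw [heq]
  exact (this.trans (Finset.sum_le_sum fun δ _ => hw δ)).trans (ENNReal.sum_le_tsum _)

theorem one_le_kerConst (d : ℕ) : 1 ≤ kerConst d := by
  rw [kerConst, add_assoc]; exact le_trans (by norm_num) le_self_add

theorem one_le_opConst (d : ℕ) : 1 ≤ opConst d := by
  rw [opConst]
  exact one_le_mul (one_le_pow₀ (one_le_kerConst d)) (le_trans (by norm_num) le_add_self)

theorem le_sq_of_one_le {c : ℝ≥0∞} (hc : 1 ≤ c) : c ≤ c ^ 2 := by
  rw [sq]; exact le_mul_of_one_le_left' hc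

/-- `eLpNorm_sum_dif_mul_avgProd_le` without a restriction on the scales of the averages. -/
theorem eLpNorm_sum_dif_mul_avgProd_le' {ι : Type*} {a : ι → ℤ} {f : ι → Rd d → ℂ}
    (hfm : ∀ j, AEStronglyMeasurable (f j)) {s : Finset ι} (hf1 : ∀ j ∈ s, ∀ x, ‖f j x‖ₑ ≤ 1)
    {β : ℤ} {D : ℕ → Rd d → ℂ} (hD : ∀ m, MemLp (D m) 2)
    (hDc : ∀ m : ℕ, CubeConst (m + β - 1) (D m)) (hD0 : ∀ (m : ℕ) x, avg (m + β) (D m) x = 0)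
    (K : ℕ) {A : ℝ≥0∞} (hA : ∑ m ∈ Finset.range K, ∫⁻ x, ‖D m x‖ₑ ^ 2 ≤ A ^ 2) :
    eLpNorm (fun x => ∑ m ∈ Finset.range K, D m x * avgProd s a f m x) 2 ≤
      (1 + abelConst s.card) * A := by
  classical
  -- Averages at scales not below β are constant on the cubes on which `D m` has mean zero. They are
  -- absorbed into `D m`, which remains a martingale difference, and only the finer averages need
  -- summation by parts.
  set s₁ := s.filter fun j => a j < β
  set s₂ := s.filter fun j => ¬ a j < β with hs₂
  have hsplit : ∀ m x, avgProd s a f m x = avgProd s₂ a f m x * avgProd s₁ a f m x := by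
    intro m x
    rw [mul_comm]
    exact (Finset.prod_filter_mul_prod_filter_not s _ _).symm
  have hW1 : ∀ m x, ‖avgProd s₂ a f m x‖ₑ ≤ 1 := fun m x =>
    enorm_avgProd_le_one (fun j hj => hf1 j (Finset.mem_filter.1 hj).1) m x
  have hWc : ∀ m : ℕ, CubeConst (m + β) (avgProd s₂ a f m) := fun m =>
    CubeConst.prod fun j hj => (cubeConst_avg _ _).mono (by
      have := (Finset.mem_filter.1 hj).2
      omega)
  have hle : ∀ m x, ‖avgProd s₂ a f m x * D m x‖ₑ ≤ ‖D m x‖ₑ := fun m x => by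
    rw [enorm_mul]
    exact mul_le_of_le_one_left' (hW1 m x)
  have hmain := eLpNorm_sum_dif_mul_avgProd_le (a := a) (s := s₁) hfm
    (fun j hj => hf1 j (Finset.mem_filter.1 hj).1) (β := β)
    (fun j hj => (Finset.mem_filter.1 hj).2) (D := fun m x => avgProd s₂ a f m x * D m x)
    (fun m => memLp_two_of_sq_lt_top
      ((measurable_avgProd s₂ a f m).aestronglyMeasurable.mul (hD m).1)
      (lt_of_le_of_lt (lintegral_mono fun x => pow_le_pow_left₀ zero_le (hle m x) 2)
        (lintegral_sq_lt_top (hD m))))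
    (fun m => ((hWc m).mono (by omega)).map₂ (hDc m) (· * ·))
    (fun m x => by rw [avg_mul (hWc m), hD0, mul_zero]) K (A := A)
    ((Finset.sum_le_sum fun m _ => lintegral_mono fun x =>
      pow_le_pow_left₀ zero_le (hle m x) 2).trans hA)
  have habel : abelConst s₁.card ≤ abelConst s.card := by
    have hmono : Monotone abelConst := monotone_nat_of_le_succ fun n => le_add_self
    exact hmono (Finset.card_filter_le _ _)
  refine le_trans (le_of_eq ?_) (hmain.trans (by gcongr))
  congr 1
  ext x
  refine Finset.sum_congr rfl fun m _ => ?_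
  rw [hsplit]
  ring

end Summation

/-! ### Terms with one oscillating factor. -/

section SingleTerms

variable {ι : Type*} {a : ι → ℤ} {f : ι → Rd d → ℂ} {s : Finset ι} {B Λ : ℝ≥0∞}

/-- The constant in the bounds for the terms with one oscillating factor. -/
def mainConst (d c : ℕ) : ℝ≥0∞ := (2 + abelConst c) * (8 * opConst d) * decaySum

theorem mainConst_ne_top (d c : ℕ) : mainConst d c ≠ ∞ := by
  have := abelConst_ne_top c
  have := opConst_ne_top d
  have := decaySum_ne_top
  unfold mainConst
  finiteness

theorem tsum_decay_le_mainConst (c : ℕ) (Λ B E : ℝ≥0∞) :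
    ∑' δ : ℤ, (1 + abelConst c) * (Λ * opConst d * B * decay ^ δ.natAbs * E) ≤
      mainConst d c * (Λ * B * E) := by
  have hfac : ∀ δ : ℤ, (1 + abelConst c) * (Λ * opConst d * B * decay ^ δ.natAbs * E) =
      (1 + abelConst c) * (1 * opConst d) * decay ^ δ.natAbs * (Λ * B * E) := fun δ => by ring
  rw [tsum_congr hfac, ENNReal.tsum_mul_right, ENNReal.tsum_mul_left, mainConst]
  exact mul_le_mul_left (mul_le_mul' (mul_le_mul' (add_le_add_left one_le_two _)
    (mul_le_mul_left Nat.one_le_ofNat _)) tsum_decay_le) _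

/-- The terms in which the function in `L²` carries the oscillation. -/
theorem eLpNorm_sum_kerOp_mul_avgProd_le (hfm : ∀ j, Measurable (f j))
    (hf1 : ∀ j ∈ s, ∀ x, ‖f j x‖ₑ ≤ 1) {α : ℤ} {g : Rd d → ℂ} (hgm : Measurable g)
    (hg : MemLp g 2) {k : ℕ → Rd d → ℂ} (hk : ∀ m : ℕ, IsKer (m + α) B (k m)) (hB : B ≠ ∞)
    {l : ℕ → ℂ} (hl : ∀ m, ‖l m‖ₑ ≤ Λ) (K : ℕ) :
    eLpNorm (fun x => ∑ m ∈ Finset.range K, l m * kerOp (difKer (m + α) (k m)) g x *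
      avgProd s a f m x) 2 ≤ mainConst d s.card * (Λ * B * eLpNorm g 2) := by
  have hK := fun m => (hk m).kerBound_difKer
  have hB2 : 2 * B ≠ ∞ := by finiteness
  set T : ℕ → Rd d → ℂ := fun m => kerOp (difKer (m + α) (k m)) g with hT
  have hT2 : ∀ m, MemLp (T m) 2 := fun m => (hK m).memLp_kerOp hB2 hB2 hgm hg
  -- Sort the martingale differences by their offset δ from the scale of the kernel: for fixed δ
  -- they form one martingale difference sequence in m, with a square sum that decays in |δ|.
  set G : ℤ → Rd d → ℂ := fun δ x => ∑ m ∈ Finset.range K,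
    (l m * dif (m + α + δ) (T m) x) * avgProd s a f m x with hG
  have hGm : ∀ δ, Measurable (G δ) := fun δ => Finset.measurable_fun_sum _ fun m _ =>
    ((cubeConst_dif _ _).measurable.const_mul _).mul (measurable_avgProd _ _ _ _)
  have hGn : ∀ δ, eLpNorm (G δ) 2 ≤ (1 + abelConst s.card) *
      (Λ * opConst d * B * decay ^ δ.natAbs * eLpNorm g 2) := by
    intro δ
    refine eLpNorm_sum_dif_mul_avgProd_le' (fun j => (hfm j).aestronglyMeasurable) hf1
      (β := α + δ) (D := fun m x => l m * dif (m + α + δ) (T m) x)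
      (fun m => (memLp_dif _ (hT2 m)).const_mul _)
      (fun m => ((cubeConst_dif _ _).mono (by omega)).map (l m * ·)) (fun m x => ?_) K ?_
    · rw [avg_mul (h := fun _ => l m) (fun _ _ _ => rfl), avg_dif_of_le (by omega)
        (CubeInt.of_memLp (hT2 m)), mul_zero]
    · calc ∑ m ∈ Finset.range K, ∫⁻ x, ‖l m * dif (m + α + δ) (T m) x‖ₑ ^ 2
          ≤ ∑ m ∈ Finset.range K, Λ ^ 2 * ∫⁻ x, ‖dif (m + α + δ) (T m) x‖ₑ ^ 2 := by
            refine Finset.sum_le_sum fun m _ => ?_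
            rw [← lintegral_const_mul _ ((cubeConst_dif _ _).measurable.enorm.pow_const 2)]
            refine lintegral_mono fun x => ?_
            rw [enorm_mul, mul_pow]
            gcongr
            exact hl m
        _ ≤ Λ ^ 2 * (opConst d * B ^ 2 * (decay ^ δ.natAbs) ^ 2 * ∫⁻ x, ‖g x‖ₑ ^ 2) := by
            rw [← Finset.mul_sum]
            gcongr
            exact (ENNReal.sum_le_tsum _).trans (tsum_lintegral_dif_kerOp_sq_le hk hB δ hgm hg)
        _ ≤ Λ ^ 2 * (opConst d ^ 2 * B ^ 2 * (decay ^ δ.natAbs) ^ 2 * ∫⁻ x, ‖g x‖ₑ ^ 2) := by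
            gcongr
            exact le_sq_of_one_le (one_le_opConst d)
        _ = _ := by rw [← eLpNorm_two_sq]; ring
  have hlim : ∀ᵐ x, Tendsto (fun N => ∑ δ ∈ window N, G δ x) atTop
      (𝓝 (∑ m ∈ Finset.range K, l m * T m x * avgProd s a f m x)) := by
    filter_upwards [ae_all_iff.2 fun m => (hk m).ae_tendsto_sum_window hB hgm hg] with x hx
    have : ∀ N, ∑ δ ∈ window N, G δ x = ∑ m ∈ Finset.range K,
        l m * (∑ δ ∈ window N, dif (m + α + δ) (T m) x) * avgProd s a f m x := by
      intro N
      rw [Finset.sum_comm]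
      refine Finset.sum_congr rfl fun m _ => ?_
      rw [Finset.mul_sum, Finset.sum_mul]
    simp only [this]
    exact tendsto_finsetSum _ fun m _ => ((hx m).const_mul _).mul_const _
  refine (eLpNorm_le_of_ae_tendsto_sum_window hGm hGn hlim).trans ?_
  exact tsum_decay_le_mainConst _ _ _ _

theorem sum_range_dif (q : ℤ) (n : ℕ) (g : Rd d → ℂ) (x : Rd d) :
    ∑ r ∈ Finset.range n, dif (q + (r + 1)) g x = avg q g x - avg (q + n) g x := by
  have h := Finset.sum_range_sub' (fun i : ℕ => avg (q + i) g x) n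
  push_cast at h
  rw [add_zero] at h
  rw [← h]
  refine Finset.sum_congr rfl fun i _ => ?_
  rw [dif, show q + ((i : ℤ) + 1) - 1 = q + i by ring]

theorem tsum_eq_mainConst (c : ℕ) (X : ℝ≥0∞) :
    ∑' δ : ℤ, (2 + abelConst c) * (8 * opConst d) * X * ((2 + δ.natAbs) ^ 2 * decay ^ δ.natAbs) =
      mainConst d c * X := by
  rw [ENNReal.tsum_mul_left, mainConst, decaySum, mul_right_comm]

theorem const_mul_add_le (c X : ℝ≥0∞) (n : ℕ) :
    c * X + n * ((2 + n) * X) ≤ (1 + c) * X * (2 + n) ^ 2 := by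
  have hn2 : (n : ℝ≥0∞) * (2 + n) ≤ (2 + n) ^ 2 := by
    rw [sq]; gcongr; exact le_add_self
  have hn1 : (1 : ℝ≥0∞) ≤ (2 + n) ^ 2 :=
    one_le_pow₀ (le_trans (by norm_num) (le_self_add (a := (2 : ℝ≥0∞))))
  calc c * X + n * ((2 + n) * X) = X * (c * 1 + n * (2 + n)) := by ring
    _ ≤ X * (c * (2 + n) ^ 2 + (2 + n) ^ 2) := by gcongr
    _ = _ := by ring

/-- The terms in which a bounded function carries the oscillation. -/
theorem eLpNorm_sum_kerOp_mul_avg_mul_avgProd_le (hfm : ∀ j, Measurable (f j))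
    (hf1 : ∀ j ∈ s, ∀ x, ‖f j x‖ₑ ≤ 1) {α γ : ℤ} (hαγ : α ≤ γ) {g h : Rd d → ℂ}
    (hgm : Measurable g) (hg : MemLp g 2) (hhm : Measurable h) (hh : ∀ x, ‖h x‖ₑ ≤ 1)
    {k : ℕ → Rd d → ℂ} (hk : ∀ m : ℕ, IsKer (m + α) B (k m)) (hB : B ≠ ∞)
    {l : ℕ → ℂ} (hl : ∀ m, ‖l m‖ₑ ≤ Λ) (K : ℕ) :
    eLpNorm (fun x => ∑ m ∈ Finset.range K, l m * kerOp (difKer (m + α) (k m)) h x *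
      avg (m + γ) g x * avgProd s a f m x) 2 ≤ mainConst d s.card * (Λ * B * eLpNorm g 2) := by
  have hK := fun m => (hk m).kerBound_difKer
  have hB2 : 2 * B ≠ ∞ := by finiteness
  set T : ℕ → Rd d → ℂ := fun m => kerOp (difKer (m + α) (k m)) h with hT
  have hTc : ∀ m, CubeInt (T m) := fun m =>
    ((hK m).adm_of_bound (f := h) hB2 ENNReal.one_ne_top hh).cubeInt (hK m).meas hhm
  set w : ℤ → ℕ → Rd d → ℂ := fun δ m => dif (m + α + δ) (T m) with hw
  have hwm : ∀ δ m, Measurable (w δ m) := fun δ m => (cubeConst_dif _ _).measurable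
  have havm : ∀ q, Measurable (avg q g) := fun q => (cubeConst_avg q g).measurable
  set E := eLpNorm g 2 volume with hE
  have hE2 : ∫⁻ x, ‖g x‖ₑ ^ 2 = E ^ 2 := by rw [hE, eLpNorm_two_sq]
  set G : ℤ → Rd d → ℂ := fun δ x => ∑ m ∈ Finset.range K,
    l m * w δ m x * avg (m + γ) g x * avgProd s a f m x with hG
  have hGm : ∀ δ, Measurable (G δ) := fun δ => Finset.measurable_fun_sum _ fun m _ =>
    (((hwm δ m).const_mul _).mul (havm _)).mul (measurable_avgProd _ _ _ _)
  have hGn : ∀ δ, eLpNorm (G δ) 2 ≤ (2 + abelConst s.card) * (8 * opConst d) * (Λ * B * E) *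
      ((2 + δ.natAbs) ^ 2 * decay ^ δ.natAbs) := by
    intro δ
    set n := δ.natAbs with hn
    have hcar := car_dif_kerOp hk hB δ hhm hh 0
    rw [Nat.cast_zero, Nat.cast_zero, add_zero, mul_one, sub_zero] at hcar
    have hemb := hcar.embedding_avg (γ := γ + n) (by omega) (fun m => (hwm δ m).enorm)
      hgm.aestronglyMeasurable
    have hembm : ∀ m : ℕ, ∫⁻ x, ‖w δ m x‖ₑ ^ 2 * ‖avg (m + (γ + n)) g x‖ₑ ^ 2 < ∞ := fun m =>
      ((ENNReal.le_tsum m).trans hemb).trans_lt (by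
        have := opConst_ne_top d
        have := decay_ne_top
        have := (lintegral_sq_lt_top hg).ne
        finiteness)
    -- The average of g is first raised by |δ| scales. It is then constant on the cubes of scale m +
    -- α + δ, so its product with the difference of T m still has mean zero there, and the embedding
    -- theorem bounds the square sum.
    have h1 : eLpNorm (fun x => ∑ m ∈ Finset.range K,
        (l m * avg (m + (γ + n)) g x * w δ m x) * avgProd s a f m x) 2 ≤
        (1 + abelConst s.card) * (Λ * (8 * opConst d) * B * decay ^ n * E) := by
      refine eLpNorm_sum_dif_mul_avgProd_le' (fun j => (hfm j).aestronglyMeasurable) hf1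
        (β := α + δ) (D := fun m x => l m * avg (m + (γ + n)) g x * w δ m x)
        (fun m => ?_) (fun m => ?_) (fun m x => ?_) K ?_
      · refine memLp_two_of_sq_lt_top
          (((havm _).const_mul _).mul (hwm δ m)).aestronglyMeasurable ?_
        calc ∫⁻ x, ‖l m * avg (m + (γ + n)) g x * w δ m x‖ₑ ^ 2
            = ‖l m‖ₑ ^ 2 * ∫⁻ x, ‖w δ m x‖ₑ ^ 2 * ‖avg (m + (γ + n)) g x‖ₑ ^ 2 := by
              rw [← lintegral_const_mul _ (((hwm δ m).enorm.pow_const 2).fun_mul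
                ((havm _).enorm.pow_const 2))]
              refine lintegral_congr fun x => ?_
              rw [enorm_mul, enorm_mul]
              ring
          _ < ∞ := ENNReal.mul_lt_top (by finiteness) (hembm m)
      · exact (((cubeConst_avg _ g).mono (by omega)).map (l m * ·)).map₂
          ((cubeConst_dif _ _).mono (by omega)) (· * ·)
      · rw [avg_mul (((cubeConst_avg _ g).mono (by omega)).map (l m * ·)),
          avg_dif_of_le (by omega) (hTc m), mul_zero]
      · calc ∑ m ∈ Finset.range K, ∫⁻ x, ‖l m * avg (m + (γ + n)) g x * w δ m x‖ₑ ^ 2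
            ≤ ∑ m ∈ Finset.range K,
                Λ ^ 2 * ∫⁻ x, ‖w δ m x‖ₑ ^ 2 * ‖avg (m + (γ + n)) g x‖ₑ ^ 2 := by
              refine Finset.sum_le_sum fun m _ => ?_
              rw [← lintegral_const_mul _ (((hwm δ m).enorm.pow_const 2).fun_mul
                ((havm _).enorm.pow_const 2))]
              refine lintegral_mono fun x => ?_
              rw [enorm_mul, enorm_mul, mul_pow, mul_pow, mul_assoc,
                mul_comm (‖avg _ g x‖ₑ ^ 2)]
              gcongr
              exact hl m
          _ ≤ Λ ^ 2 * (8 * (opConst d * B ^ 2 * (decay ^ n) ^ 2) * ∫⁻ x, ‖g x‖ₑ ^ 2) := by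
              rw [← Finset.mul_sum]
              gcongr
              exact (ENNReal.sum_le_tsum _).trans hemb
          _ = Λ ^ 2 * ((8 * opConst d) * B ^ 2 * (decay ^ n) ^ 2 * E ^ 2) := by rw [hE2]; ring
          _ ≤ Λ ^ 2 * ((8 * opConst d) ^ 2 * B ^ 2 * (decay ^ n) ^ 2 * E ^ 2) := by
              gcongr
              exact le_sq_of_one_le (one_le_mul (by norm_num) (one_le_opConst d))
          _ = _ := by ring
    -- Raising the average of g costs |δ| martingale differences of g. Each is paired in absolute
    -- value with the Carleson sequence, lowered by |δ| + 1 scales so that both factors are constant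
    -- on common cubes. The resulting polynomial loss in |δ| is the reason for the factor (2 + |δ|)²
    -- in `decaySum`.
    set H : ℕ → Rd d → ℂ := fun r x => ∑ m ∈ Finset.range K,
      l m * w δ m x * dif (m + γ + (r + 1)) g x * avgProd s a f m x with hH
    have h2 : ∀ r : ℕ, eLpNorm (H r) 2 ≤
        Λ * ((8 * opConst d) * (2 + n) * B * decay ^ n * E) := by
      intro r
      have hcar' := car_dif_kerOp hk hB δ hhm hh (n + 1)
      have hU : ∑' m : ℕ, ∫⁻ x, ‖dif (m + γ + (r + 1)) g x‖ₑ ^ 2 ≤ E ^ 2 := by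
        rw [← hE2]
        refine le_trans (le_of_eq ?_) ((tsum_comp_add_le
          (fun q => ∫⁻ x, ‖dif q g x‖ₑ ^ 2) (γ + (r + 1))).trans (tsum_lintegral_dif_sq_le hg))
        exact tsum_congr fun m => by rw [add_assoc]
      have hdp := hcar'.lintegral_tsum_mul_sq_le
        (u := fun m x => ‖dif (m + γ + (r + 1)) g x‖ₑ)
        (by
          have := opConst_ne_top d
          have := decay_ne_top
          finiteness)
        (fun m => ((cubeConst_dif _ _).mono (by push_cast; omega)).map (‖·‖ₑ))
        (fun m => ((cubeConst_dif _ _).mono (by push_cast; omega)).map (‖·‖ₑ))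
        (ne_top_of_le_ne_top (by have := hg.2; finiteness) hU)
      refine eLpNorm_two_le_of_sq_le ?_
      calc ∫⁻ x, ‖∑ m ∈ Finset.range K,
              l m * w δ m x * dif (m + γ + (r + 1)) g x * avgProd s a f m x‖ₑ ^ 2
          ≤ ∫⁻ x, Λ ^ 2 * (∑' m : ℕ, ‖dif (m + γ + (r + 1)) g x‖ₑ * ‖w δ m x‖ₑ) ^ 2 := by
            refine lintegral_mono fun x => ?_
            rw [← mul_pow]
            gcongr
            refine (enorm_sum_le _ _).trans ?_
            rw [← ENNReal.tsum_mul_left]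
            refine le_trans (Finset.sum_le_sum fun m _ => ?_) (ENNReal.sum_le_tsum _)
            rw [enorm_mul, enorm_mul, enorm_mul]
            calc _ ≤ Λ * ‖w δ m x‖ₑ * ‖dif (m + γ + (r + 1)) g x‖ₑ * 1 := by
                  gcongr
                  · exact hl m
                  · exact enorm_avgProd_le_one hf1 m x
              _ = _ := by ring
        _ = Λ ^ 2 * ∫⁻ x, (∑' m : ℕ, ‖dif (m + γ + (r + 1)) g x‖ₑ * ‖w δ m x‖ₑ) ^ 2 :=
            lintegral_const_mul _ ((Measurable.tsum fun m =>
              (cubeConst_dif _ _).measurable.enorm.mul (hwm δ m).enorm).pow_const 2)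
        _ ≤ Λ ^ 2 * (8 * (opConst d * (1 + (n + 1 : ℕ)) * B ^ 2 * (decay ^ n) ^ 2) * E ^ 2) := by
            gcongr
            exact hdp.trans (by gcongr)
        _ = Λ ^ 2 * ((8 * opConst d) * (2 + n) * B ^ 2 * (decay ^ n) ^ 2 * E ^ 2) := by
            push_cast; ring
        _ ≤ Λ ^ 2 * ((8 * opConst d) ^ 2 * (2 + n) ^ 2 * B ^ 2 * (decay ^ n) ^ 2 * E ^ 2) := by
            gcongr
            · exact le_sq_of_one_le (one_le_mul (by norm_num) (one_le_opConst d))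
            · exact le_sq_of_one_le (le_trans (by norm_num) (le_self_add (a := (2 : ℝ≥0∞))))
        _ = _ := by ring
    have hGs : G δ = (fun x => ∑ m ∈ Finset.range K,
        (l m * avg (m + (γ + n)) g x * w δ m x) * avgProd s a f m x) +
        ∑ r ∈ Finset.range n, H r := by
      ext x
      rw [Pi.add_apply, Finset.sum_apply, Finset.sum_comm, ← Finset.sum_add_distrib]
      refine Finset.sum_congr rfl fun m _ => ?_
      have h3 := sum_range_dif (m + γ) n g x
      rw [← Finset.sum_mul, ← Finset.mul_sum, h3, add_assoc]
      ring
    have hm1 : Measurable fun x => ∑ m ∈ Finset.range K,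
        (l m * avg (m + (γ + n)) g x * w δ m x) * avgProd s a f m x :=
      Finset.measurable_fun_sum _ fun m _ =>
        (((havm _).const_mul _).mul (hwm δ m)).mul (measurable_avgProd _ _ _ _)
    have hm2 : ∀ r : ℕ, Measurable (H r) := fun r =>
      Finset.measurable_fun_sum _ fun m _ =>
        (((hwm δ m).const_mul _).mul (cubeConst_dif _ _).measurable).mul
          (measurable_avgProd _ _ _ _)
    have h3 : eLpNorm (∑ r ∈ Finset.range n, H r) 2 ≤
        ∑ r ∈ Finset.range n, Λ * ((8 * opConst d) * (2 + n) * B * decay ^ n * E) :=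
      (eLpNorm_sum_le (fun r _ => (hm2 r).aestronglyMeasurable)
        one_le_two).trans (Finset.sum_le_sum fun r _ => h2 r)
    rw [Finset.sum_const, Finset.card_range, nsmul_eq_mul] at h3
    have hmS : Measurable (∑ r ∈ Finset.range n, H r) := by
      have : ∑ r ∈ Finset.range n, H r = fun x => ∑ r ∈ Finset.range n, H r x := by
        ext x; rw [Finset.sum_apply]
      rw [this]
      exact Finset.measurable_fun_sum _ fun r _ => hm2 r
    have h4 := eLpNorm_add_le hm1.aestronglyMeasurable
      hmS.aestronglyMeasurable (p := 2) (μ := volume) one_le_two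
    rw [hGs]
    refine (h4.trans (add_le_add h1 h3)).trans ?_
    have h5 := const_mul_add_le (1 + abelConst s.card)
      ((8 * opConst d) * (Λ * B * E) * decay ^ n) n
    refine le_trans (le_of_eq ?_) (h5.trans (le_of_eq ?_)) <;> ring
  have hlim : ∀ᵐ x, Tendsto (fun N => ∑ δ ∈ window N, G δ x) atTop
      (𝓝 (∑ m ∈ Finset.range K, l m * T m x * avg (m + γ) g x * avgProd s a f m x)) := by
    refine Eventually.of_forall fun x => ?_
    have : ∀ N, ∑ δ ∈ window N, G δ x = ∑ m ∈ Finset.range K,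
        l m * (∑ δ ∈ window N, w δ m x) * avg (m + γ) g x * avgProd s a f m x := by
      intro N
      rw [Finset.sum_comm]
      refine Finset.sum_congr rfl fun m _ => ?_
      rw [Finset.mul_sum, Finset.sum_mul, Finset.sum_mul]
    simp only [this]
    exact tendsto_finsetSum _ fun m _ =>
      ((((hk m).tendsto_sum_window_of_bound hB hhm hh x).const_mul _).mul_const _).mul_const _
  exact (eLpNorm_le_of_ae_tendsto_sum_window hGm hGn hlim).trans_eq (tsum_eq_mainConst _ _)

end SingleTerms

/-! ### Terms with two oscillating factors. -/

section PairTerms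

variable {B B' : ℝ≥0∞} {a b γ : ℤ} {k k' : ℕ → Rd d → ℂ}

theorem enorm_le_tsum_of_tendsto_sum_window {z : ℂ} {u : ℤ → ℂ}
    (h : Tendsto (fun N => ∑ δ ∈ window N, u δ) atTop (𝓝 z)) : ‖z‖ₑ ≤ ∑' δ, ‖u δ‖ₑ :=
  le_of_tendsto' h.enorm fun _ => (enorm_sum_le _ _).trans (ENNReal.sum_le_tsum _)

/-- For fixed offsets δ and ε this is a square summable sequence against a Carleson sequence.
Lowering the latter by |δ| + |ε| + 1 scales makes both constant on common cubes, since a ≤ b; the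
cost is linear in the offsets and is absorbed by the weights W. A weighted Minkowski inequality sums
over the pairs of offsets. -/
theorem lintegral_tsum_pair_sq_le (hk : ∀ m : ℕ, IsKer (m + a) B (k m)) (hB : B ≠ ∞)
    {h : Rd d → ℂ} (hhm : Measurable h) (hh : ∀ x, ‖h x‖ₑ ≤ 1) (hab : a ≤ b)
    {u : ℤ → ℕ → Rd d → ℝ≥0∞} (hu : ∀ (δ : ℤ) (m : ℕ), CubeConst (m + b - δ.natAbs - 1) (u δ m))
    {U : ℝ≥0∞} (hU : U ≠ ∞)
    (huU : ∀ δ, ∑' m, ∫⁻ x, u δ m x ^ 2 ≤ U * (decay ^ δ.natAbs) ^ 2) :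
    ∫⁻ x, (∑' m : ℕ, (∑' δ, u δ m x) * ‖kerOp (difKer (m + a) (k m)) h x‖ₑ) ^ 2 ≤
      decaySum ^ 4 * (8 * opConst d * B ^ 2 * U) := by
  have hum : ∀ δ m, Measurable (u δ m) := fun δ m => (hu δ m).measurable
  set v : ℤ → ℕ → Rd d → ℝ≥0∞ := fun δ m x =>
    ‖dif (m + a + δ) (kerOp (difKer (m + a) (k m)) h) x‖ₑ with hv
  have hvm : ∀ δ m, Measurable (v δ m) := fun δ m => (cubeConst_dif _ _).measurable.enorm
  set W : ℤ → ℝ≥0∞ := fun δ => (2 + δ.natAbs) ^ 2 * decay ^ δ.natAbs with hW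
  have hW0 : ∀ δ, W δ ≠ 0 := fun δ => mul_ne_zero
    (pow_ne_zero _ (by simp)) (pow_ne_zero _ decay_ne_zero)
  have hWt : ∀ δ, W δ ≠ ∞ := fun δ => by
    have := decay_ne_top
    finiteness
  have hpair : ∀ p : ℤ × ℤ, ∫⁻ x, (∑' m, u p.1 m x * v p.2 m x) ^ 2 ≤
      (W p.1 * W p.2) ^ 2 * (8 * opConst d * B ^ 2 * U) := by
    rintro ⟨δ, ε⟩
    set n := δ.natAbs with hn
    set n' := ε.natAbs with hn'
    have hcar := car_dif_kerOp hk hB ε hhm hh (n + n' + 1)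
    have hdp := hcar.lintegral_tsum_mul_sq_le (u := u δ)
      (by
        have := opConst_ne_top d
        have := decay_ne_top
        finiteness)
      (fun m => (hu δ m).mono (by omega))
      (fun m => ((cubeConst_dif _ _).mono (by push_cast; omega)).map (‖·‖ₑ))
      (ne_top_of_le_ne_top (by have := decay_ne_top; finiteness) (huU δ))
    have hN : (1 + (n + n' + 1 : ℕ) : ℝ≥0∞) ≤ ((2 + n) ^ 2 * (2 + n') ^ 2) ^ 2 := by
      have : 1 + (n + n' + 1) ≤ ((2 + n) ^ 2 * (2 + n') ^ 2) ^ 2 := by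
        have h1 : 1 + (n + n' + 1) ≤ (2 + n) * (2 + n') := by nlinarith
        have h2 : (2 + n) * (2 + n') ≤ ((2 + n) * (2 + n')) ^ 4 := Nat.le_self_pow (by norm_num) _
        calc _ ≤ ((2 + n) * (2 + n')) ^ 4 := h1.trans h2
          _ = _ := by ring
      exact_mod_cast this
    calc ∫⁻ x, (∑' m, u δ m x * v ε m x) ^ 2
        ≤ 8 * (opConst d * (1 + (n + n' + 1 : ℕ)) * B ^ 2 * (decay ^ n') ^ 2) *
            (U * (decay ^ n) ^ 2) := hdp.trans (by gcongr; exact huU δ)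
      _ ≤ 8 * (opConst d * (((2 + n) ^ 2 * (2 + n') ^ 2) ^ 2) * B ^ 2 * (decay ^ n') ^ 2) *
            (U * (decay ^ n) ^ 2) := by gcongr
      _ = _ := by simp only [hW]; ring
  have hsum := lintegral_tsum_sq_le (fun p : ℤ × ℤ => Measurable.tsum fun m =>
    (hum p.1 m).mul (hvm p.2 m)) (fun p => mul_ne_zero (hW0 p.1) (hW0 p.2))
    (fun p => ENNReal.mul_ne_top (hWt p.1) (hWt p.2)) hpair
  have hWsum : ∑' p : ℤ × ℤ, W p.1 * W p.2 = decaySum ^ 2 := by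
    rw [ENNReal.tsum_prod']
    simp only [ENNReal.tsum_mul_left, ENNReal.tsum_mul_right]
    rw [sq, decaySum]
  rw [hWsum, ← pow_mul] at hsum
  refine le_trans (lintegral_mono fun x => pow_le_pow_left₀ zero_le ?_ 2) hsum
  rw [ENNReal.tsum_comm]
  refine ENNReal.tsum_le_tsum fun m => ?_
  rw [ENNReal.tsum_prod']
  simp only [Pi.mul_apply, ENNReal.tsum_mul_left, ENNReal.tsum_mul_right]
  gcongr
  exact enorm_le_tsum_of_tendsto_sum_window
    ((hk m).tendsto_sum_window_of_bound hB hhm hh x)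

/-- The constant in the bounds for the terms with two oscillating factors. -/
def pairConst (d : ℕ) : ℝ≥0∞ := decaySum ^ 2 * (8 * opConst d)

theorem pairConst_ne_top (d : ℕ) : pairConst d ≠ ∞ := by
  have := opConst_ne_top d
  have := decaySum_ne_top
  unfold pairConst
  finiteness

/-- Two oscillating factors, one of them in `L²`. -/
theorem lintegral_tsum_kerOp_mul_kerOp_sq_le (hab : a ≤ b)
    (hk : ∀ m : ℕ, IsKer (m + a) B (k m)) (hB : B ≠ ∞) {h : Rd d → ℂ} (hhm : Measurable h)
    (hh : ∀ x, ‖h x‖ₑ ≤ 1) (hk' : ∀ m : ℕ, IsKer (m + b) B' (k' m)) (hB' : B' ≠ ∞)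
    {g : Rd d → ℂ} (hgm : Measurable g) (hg : MemLp g 2) :
    ∫⁻ x, (∑' m : ℕ, ‖kerOp (difKer (m + b) (k' m)) g x‖ₑ *
      ‖kerOp (difKer (m + a) (k m)) h x‖ₑ) ^ 2 ≤
      (pairConst d * (B * B' * eLpNorm g 2)) ^ 2 := by
  have hE := hg.2.ne
  have hop := opConst_ne_top d
  have hmain := lintegral_tsum_pair_sq_le hk hB hhm hh hab
    (u := fun δ m x => ‖dif (m + b + δ) (kerOp (difKer (m + b) (k' m)) g) x‖ₑ)
    (fun δ m => ((cubeConst_dif _ _).mono (by omega)).map (‖·‖ₑ))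
    (U := opConst d * B' ^ 2 * eLpNorm g 2 ^ 2) (by finiteness) (fun δ => by
      refine (tsum_lintegral_dif_kerOp_sq_le hk' hB' δ hgm hg).trans_eq ?_
      rw [eLpNorm_two_sq]
      ring)
  refine (lintegral_mono_ae ?_).trans (hmain.trans ?_)
  · filter_upwards [ae_all_iff.2 fun m => (hk' m).ae_tendsto_sum_window hB' hgm hg] with x hx
    gcongr with m
    exact enorm_le_tsum_of_tendsto_sum_window (hx m)
  · calc _ = decaySum ^ 4 * ((8 * 1) * opConst d ^ 2) * (B * B' * eLpNorm g 2) ^ 2 := by ring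
      _ ≤ decaySum ^ 4 * ((8 * 8) * opConst d ^ 2) * (B * B' * eLpNorm g 2) ^ 2 := by
        gcongr
        norm_num
      _ = _ := by rw [pairConst]; ring

/-- Two oscillating factors, both bounded. -/
theorem lintegral_tsum_kerOp_mul_kerOp_mul_avg_sq_le (hab : a ≤ b) (hbγ : b ≤ γ)
    (hk : ∀ m : ℕ, IsKer (m + a) B (k m)) (hB : B ≠ ∞) {h h' : Rd d → ℂ} (hhm : Measurable h)
    (hh : ∀ x, ‖h x‖ₑ ≤ 1) (hk' : ∀ m : ℕ, IsKer (m + b) B' (k' m)) (hB' : B' ≠ ∞)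
    (hhm' : Measurable h') (hh' : ∀ x, ‖h' x‖ₑ ≤ 1)
    {g : Rd d → ℂ} (hgm : Measurable g) (hg : MemLp g 2) :
    ∫⁻ x, (∑' m : ℕ, ‖kerOp (difKer (m + b) (k' m)) h' x‖ₑ * ‖avg (m + γ) g x‖ₑ *
      ‖kerOp (difKer (m + a) (k m)) h x‖ₑ) ^ 2 ≤
      (pairConst d * (B * B' * eLpNorm g 2)) ^ 2 := by
  have hE := hg.2.ne
  have hop := opConst_ne_top d
  -- The factor h' together with the average of g plays the square summable role: the differences
  -- for h' satisfy a Carleson condition, and the embedding theorem for g applies because b ≤ γ.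
  have hmain := lintegral_tsum_pair_sq_le hk hB hhm hh hab
    (u := fun δ m x => ‖dif (m + b + δ) (kerOp (difKer (m + b) (k' m)) h') x‖ₑ *
      ‖avg (m + γ) g x‖ₑ)
    (fun δ m => (((cubeConst_dif _ _).mono (by omega)).map (‖·‖ₑ)).map₂
      (((cubeConst_avg _ _).mono (by omega)).map (‖·‖ₑ)) (· * ·))
    (U := 8 * opConst d * B' ^ 2 * eLpNorm g 2 ^ 2) (by finiteness) (fun δ => by
      have hcar := car_dif_kerOp hk' hB' δ hhm' hh' 0
      rw [Nat.cast_zero, Nat.cast_zero, add_zero, mul_one, sub_zero] at hcar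
      have hemb := hcar.embedding_avg hbγ (fun m => (cubeConst_dif _ _).measurable.enorm)
        hgm.aestronglyMeasurable
      simp only [mul_pow]
      refine hemb.trans_eq ?_
      rw [eLpNorm_two_sq]
      ring)
  refine (lintegral_mono fun x => ?_).trans (hmain.trans_eq ?_)
  · gcongr with m
    rw [ENNReal.tsum_mul_right]
    gcongr
    exact enorm_le_tsum_of_tendsto_sum_window
      ((hk' m).tendsto_sum_window_of_bound hB' hhm' hh' x)
  · rw [pairConst]; ring

end PairTerms

/-! ### Second order expansion of a product. -/

section ProductExpansion

theorem enorm_finset_prod {ι : Type*} (s : Finset ι) (e : ι → ℂ) :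
    ‖∏ i ∈ s, e i‖ₑ = ∏ i ∈ s, ‖e i‖ₑ := by
  simp only [enorm_eq_nnnorm, nnnorm_prod, ENNReal.ofNNReal_finsetProd]

/-- With R the remainder for s, adding an index a gives the remainder (e_a + b_a) R + b_a ∑ b_i ∏
e_j. Every term keeps two factors b, and the factors in excess are bounded by |e| + |b|. -/
theorem enorm_prod_add_sub_le {ι : Type*} [DecidableEq ι] (s : Finset ι) (e b : ι → ℂ) :
    ‖∏ i ∈ s, (e i + b i) - ∏ i ∈ s, e i - ∑ i ∈ s, b i * ∏ j ∈ s.erase i, e j‖ₑ ≤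
      ∑ i ∈ s, ∑ j ∈ s.erase i, ‖b i‖ₑ * ‖b j‖ₑ *
        ∏ l ∈ (s.erase i).erase j, (‖e l‖ₑ + ‖b l‖ₑ) := by
  induction s using Finset.induction_on with
  | empty => simp
  | insert a s ha ih =>
    have hne : ∀ i ∈ s, a ≠ i := fun i hi h => ha (h ▸ hi)
    set R := ∏ i ∈ s, (e i + b i) - ∏ i ∈ s, e i - ∑ i ∈ s, b i * ∏ j ∈ s.erase i, e j with hR
    have hsum : ∑ i ∈ s, b i * ∏ j ∈ (insert a s).erase i, e j =
        e a * ∑ i ∈ s, b i * ∏ j ∈ s.erase i, e j := by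
      rw [Finset.mul_sum]
      refine Finset.sum_congr rfl fun i hi => ?_
      rw [Finset.erase_insert_of_ne (hne i hi),
        Finset.prod_insert fun h => ha (Finset.mem_of_mem_erase h)]
      ring
    have heq : ∏ i ∈ insert a s, (e i + b i) - ∏ i ∈ insert a s, e i -
        ∑ i ∈ insert a s, b i * ∏ j ∈ (insert a s).erase i, e j =
        (e a + b a) * R + b a * ∑ i ∈ s, b i * ∏ j ∈ s.erase i, e j := by
      rw [Finset.prod_insert ha, Finset.prod_insert ha, Finset.sum_insert ha,
        Finset.erase_insert ha, hsum, hR]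
      ring
    rw [heq, Finset.sum_insert ha, Finset.erase_insert ha, add_comm]
    refine (enorm_add_le _ _).trans (add_le_add ?_ ?_)
    · rw [enorm_mul]
      refine (mul_le_mul_right (enorm_sum_le _ _) _).trans ?_
      rw [Finset.mul_sum]
      refine Finset.sum_le_sum fun j _ => ?_
      rw [enorm_mul, ← mul_assoc, enorm_finset_prod]
      gcongr
      exact le_self_add
    · rw [enorm_mul]
      refine (mul_le_mul' (enorm_add_le _ _) ih).trans ?_
      rw [Finset.mul_sum]
      refine Finset.sum_le_sum fun i hi => ?_
      rw [Finset.mul_sum, Finset.erase_insert_of_ne (hne i hi),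
        Finset.sum_insert fun h => ha (Finset.mem_of_mem_erase h)]
      refine le_trans (Finset.sum_le_sum fun j hj => ?_) le_add_self
      have hj' := Finset.mem_of_mem_erase hj
      rw [Finset.erase_insert_of_ne (hne j hj'), Finset.prod_insert fun h =>
        ha (Finset.mem_of_mem_erase (Finset.mem_of_mem_erase h))]
      exact le_of_eq (by ring)

end ProductExpansion

/-! ### The remainder of the expansion: at least two oscillating factors. -/

section PairBounds

variable {ι : Type*} [Fintype ι] [DecidableEq ι] {n₀ : ι} {a : ι → ℤ} {β : ι → ℝ≥0∞}
  {κ : ι → ℕ → Rd d → ℂ} {f : ι → Rd d → ℂ} {e b : ι → ℕ → Rd d → ℂ}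

theorem add_sq_le_two_mul (x y : ℝ≥0∞) : (x + y) ^ 2 ≤ 2 * (x ^ 2 + y ^ 2) := by
  have := ENNReal.rpow_add_le_mul_rpow_add_rpow x y (p := 2) (by norm_num)
  norm_num at this
  exact this

/-- The bounded factor j has the finer scale and supplies the Carleson sequence. If i is the L²
index, all other factors are bounded and the pair estimate applies. Otherwise the factor of index n₀
is split: its average is tested against the pair (i, j) of bounded functions, while its oscillating
part forms a pair with j, and b i is merely bounded. -/
theorem lintegral_tsum_pair_prod_sq_le_aux (ha : ∀ i, a i ≤ a n₀) (hβ : ∀ i, β i ≠ ∞)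
    (hκ : ∀ i (q : ℕ), IsKer (q + a i) (β i) (κ i q)) (hfm : ∀ i, Measurable (f i))
    (hf1 : ∀ i ≠ n₀, ∀ x, ‖f i x‖ₑ ≤ 1) (hf2 : MemLp (f n₀) 2)
    (he : ∀ i q x, ‖e i q x‖ₑ ≤ β i * ‖avg (q + a i) (f i) x‖ₑ)
    (hb : ∀ᵐ x, ∀ i q, b i q x = kerOp (difKer (q + a i) (κ i q)) (f i) x)
    {i j : ι} (hij : i ≠ j) (hj : j ≠ n₀) (haij : a j ≤ a i) :
    ∫⁻ x, (∑' q, ‖b i q x‖ₑ * ‖b j q x‖ₑ *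
      ∏ l ∈ (Finset.univ.erase i).erase j, (‖e l q x‖ₑ + ‖b l q x‖ₑ)) ^ 2 ≤
      (4 * 3 ^ Fintype.card ι * pairConst d * ((∏ i, β i) * eLpNorm (f n₀) 2)) ^ 2 := by
  set E := eLpNorm (f n₀) 2 volume with hE
  have hprod : ∀ {s : Finset ι} {u : ι → ℝ≥0∞}, (∀ l ∈ s, u l ≤ 3 * β l) →
      ∏ l ∈ s, u l ≤ 3 ^ Fintype.card ι * ∏ l ∈ s, β l := by
    intro s u hu
    refine (Finset.prod_le_prod' hu).trans ?_
    rw [Finset.prod_mul_distrib, Finset.prod_const]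
    gcongr
    · norm_num
    · exact Finset.card_le_univ s
  have hbl : ∀ᵐ x, ∀ l ≠ n₀, ∀ q, ‖b l q x‖ₑ ≤ 2 * β l := by
    filter_upwards [hb] with x hx l hl q
    rw [hx]
    simpa using (hκ l q).kerBound_difKer.enorm_kerOp_le (hf1 l hl) x
  have hel : ∀ x, ∀ l ≠ n₀, ∀ q, ‖e l q x‖ₑ ≤ β l := fun x l hl q =>
    (he l q x).trans (mul_le_of_le_one_right' (enorm_avg_le_of_le (hf1 l hl) x))
  have hsum : ∀ᵐ x, ∀ l ≠ n₀, ∀ q, ‖e l q x‖ₑ + ‖b l q x‖ₑ ≤ 3 * β l := by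
    filter_upwards [hbl] with x hx l hl q
    calc _ ≤ β l + 2 * β l := add_le_add (hel x l hl q) (hx l hl q)
      _ = _ := by ring
  have hP1 := lintegral_tsum_kerOp_mul_kerOp_sq_le (ha j) (hκ j) (hβ j) (hfm j) (hf1 j hj)
    (hκ n₀) (hβ n₀) (hfm n₀) hf2
  set X : Rd d → ℝ≥0∞ := fun x => ∑' q : ℕ, ‖kerOp (difKer (q + a n₀) (κ n₀ q)) (f n₀) x‖ₑ *
    ‖kerOp (difKer (q + a j) (κ j q)) (f j) x‖ₑ with hX
  have hmk : ∀ l (q : ℕ), Measurable fun x => ‖kerOp (difKer (q + a l) (κ l q)) (f l) x‖ₑ :=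
    fun l q => ((hκ l q).kerBound_difKer.measurable_kerOp (hfm l)).enorm
  have hXm : Measurable X := Measurable.tsum fun q => (hmk _ _).mul (hmk _ _)
  by_cases hi : i = n₀
  · subst hi
    set Q := ∏ l ∈ (Finset.univ.erase i).erase j, β l with hQ
    have hall : ∏ l, β l = β i * (β j * Q) := by
      rw [hQ, Finset.mul_prod_erase _ _ (Finset.mem_erase.2 ⟨hj, Finset.mem_univ j⟩),
        Finset.mul_prod_erase _ _ (Finset.mem_univ i)]
    calc _ ≤ ∫⁻ x, (3 ^ Fintype.card ι * Q) ^ 2 * X x ^ 2 := by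
          refine lintegral_mono_ae ?_
          filter_upwards [hsum, hb] with x hx hbx
          rw [← mul_pow, hX, ← ENNReal.tsum_mul_left]
          refine pow_le_pow_left₀ zero_le (ENNReal.tsum_le_tsum fun q => ?_) 2
          rw [mul_comm, hbx i q, hbx j q]
          refine mul_le_mul_left ?_ _
          exact hprod fun l hl => hx l (Finset.ne_of_mem_erase (Finset.mem_of_mem_erase hl)) q
      _ = (3 ^ Fintype.card ι * Q) ^ 2 * ∫⁻ x, X x ^ 2 :=
          lintegral_const_mul _ (hXm.pow_const 2)
      _ ≤ (3 ^ Fintype.card ι * Q) ^ 2 * (pairConst d * (β j * β i * E)) ^ 2 := by gcongr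
      _ = (1 * 3 ^ Fintype.card ι * pairConst d * ((∏ i, β i) * E)) ^ 2 := by rw [hall]; ring
      _ ≤ _ := by
          gcongr
          norm_num
  · set S := ((Finset.univ.erase i).erase j).erase n₀ with hS
    have hn : n₀ ∈ (Finset.univ.erase i).erase j := by
      simp [Ne.symm hi, Ne.symm hj]
    set Q := ∏ l ∈ S, β l with hQ
    have hall : ∏ l, β l = β i * (β j * (β n₀ * Q)) := by
      rw [hQ, hS, Finset.mul_prod_erase _ _ hn,
        Finset.mul_prod_erase _ _ (Finset.mem_erase.2 ⟨hij.symm, Finset.mem_univ j⟩),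
        Finset.mul_prod_erase _ _ (Finset.mem_univ i)]
    have hP2 := lintegral_tsum_kerOp_mul_kerOp_mul_avg_sq_le haij (ha i) (hκ j) (hβ j) (hfm j)
      (hf1 j hj) (hκ i) (hβ i) (hfm i) (hf1 i hi) (hfm n₀) hf2
    set Y : Rd d → ℝ≥0∞ := fun x => ∑' q : ℕ, ‖kerOp (difKer (q + a i) (κ i q)) (f i) x‖ₑ *
      ‖avg (q + a n₀) (f n₀) x‖ₑ * ‖kerOp (difKer (q + a j) (κ j q)) (f j) x‖ₑ with hY
    have hYm : Measurable Y := Measurable.tsum fun q =>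
      ((hmk _ _).mul (cubeConst_avg _ _).measurable.enorm).mul (hmk _ _)
    set c := 3 ^ Fintype.card ι * Q with hc
    calc _ ≤ ∫⁻ x, (c * β n₀ * Y x + c * (2 * β i) * X x) ^ 2 := by
          refine lintegral_mono_ae ?_
          filter_upwards [hsum, hb, hbl] with x hx hbx hblx
          gcongr
          rw [hX, hY, ← ENNReal.tsum_mul_left, ← ENNReal.tsum_mul_left, ← ENNReal.tsum_add]
          refine ENNReal.tsum_le_tsum fun q => ?_
          rw [← Finset.mul_prod_erase _ _ hn, ← hS]
          have h1 : ∏ l ∈ S, (‖e l q x‖ₑ + ‖b l q x‖ₑ) ≤ c :=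
            hprod fun l hl => hx l (Finset.ne_of_mem_erase hl) q
          rw [← hbx i q, ← hbx j q, ← hbx n₀ q]
          calc _ = (‖b i q x‖ₑ * ‖b j q x‖ₑ * ‖e n₀ q x‖ₑ + ‖b i q x‖ₑ * ‖b j q x‖ₑ *
                ‖b n₀ q x‖ₑ) * ∏ l ∈ S, (‖e l q x‖ₑ + ‖b l q x‖ₑ) := by ring
            _ ≤ (‖b i q x‖ₑ * ‖b j q x‖ₑ * (β n₀ * ‖avg (q + a n₀) (f n₀) x‖ₑ) +
                (2 * β i) * ‖b j q x‖ₑ * ‖b n₀ q x‖ₑ) * c := by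
                gcongr
                · exact he _ _ _
                · exact hblx i hi q
            _ = _ := by ring
      _ ≤ ∫⁻ x, (2 * (c * β n₀) ^ 2 * Y x ^ 2 + 2 * (c * (2 * β i)) ^ 2 * X x ^ 2) := by
          refine lintegral_mono fun x => (add_sq_le_two_mul _ _).trans_eq ?_
          ring
      _ = 2 * (c * β n₀) ^ 2 * (∫⁻ x, Y x ^ 2) + 2 * (c * (2 * β i)) ^ 2 * ∫⁻ x, X x ^ 2 := by
          rw [lintegral_add_left ((hYm.pow_const 2).const_mul _),
            lintegral_const_mul _ (hYm.pow_const 2), lintegral_const_mul _ (hXm.pow_const 2)]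
      _ ≤ 2 * (c * β n₀) ^ 2 * (pairConst d * (β j * β i * E)) ^ 2 +
            2 * (c * (2 * β i)) ^ 2 * (pairConst d * (β j * β n₀ * E)) ^ 2 := by gcongr
      -- Here 10 = 2 + 2 · 2², the inner 2 coming from the uniform bound 2 β i for b i; then 10 ≤
      -- 4².
      _ = 10 * (3 ^ Fintype.card ι * pairConst d * ((∏ i, β i) * E)) ^ 2 := by
          rw [hall, hc]; ring
      _ ≤ 4 ^ 2 * (3 ^ Fintype.card ι * pairConst d * ((∏ i, β i) * E)) ^ 2 := by
          gcongr
          norm_num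
      _ = _ := by ring

/-- The expression is symmetric in i and j, so they may be exchanged until the second index is
bounded and not coarser than the first. -/
theorem lintegral_tsum_pair_prod_sq_le (ha : ∀ i, a i ≤ a n₀) (hβ : ∀ i, β i ≠ ∞)
    (hκ : ∀ i (q : ℕ), IsKer (q + a i) (β i) (κ i q)) (hfm : ∀ i, Measurable (f i))
    (hf1 : ∀ i ≠ n₀, ∀ x, ‖f i x‖ₑ ≤ 1) (hf2 : MemLp (f n₀) 2)
    (he : ∀ i q x, ‖e i q x‖ₑ ≤ β i * ‖avg (q + a i) (f i) x‖ₑ)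
    (hb : ∀ᵐ x, ∀ i q, b i q x = kerOp (difKer (q + a i) (κ i q)) (f i) x)
    {i j : ι} (hij : i ≠ j) :
    ∫⁻ x, (∑' q, ‖b i q x‖ₑ * ‖b j q x‖ₑ *
      ∏ l ∈ (Finset.univ.erase i).erase j, (‖e l q x‖ₑ + ‖b l q x‖ₑ)) ^ 2 ≤
      (4 * 3 ^ Fintype.card ι * pairConst d * ((∏ i, β i) * eLpNorm (f n₀) 2)) ^ 2 := by
  have hswap := fun h h' => lintegral_tsum_pair_prod_sq_le_aux ha hβ hκ hfm hf1 hf2 he hb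
    hij.symm h h'
  have hcomm : ∀ (x : Rd d) (q : ℕ), ‖b j q x‖ₑ * ‖b i q x‖ₑ *
      ∏ l ∈ (Finset.univ.erase j).erase i, (‖e l q x‖ₑ + ‖b l q x‖ₑ) =
      ‖b i q x‖ₑ * ‖b j q x‖ₑ *
      ∏ l ∈ (Finset.univ.erase i).erase j, (‖e l q x‖ₑ + ‖b l q x‖ₑ) := fun x q => by
    rw [mul_comm ‖b j q x‖ₑ, Finset.erase_right_comm]
  simp only [hcomm] at hswap
  by_cases hj : j = n₀
  · exact hswap (hj ▸ hij) (hj ▸ ha i)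
  by_cases hi : i = n₀
  · exact lintegral_tsum_pair_prod_sq_le_aux ha hβ hκ hfm hf1 hf2 he hb hij hj (hi ▸ ha j)
  rcases le_total (a j) (a i) with h | h
  · exact lintegral_tsum_pair_prod_sq_le_aux ha hβ hκ hfm hf1 hf2 he hb hij hj h
  · exact hswap hi h

/-- The constant in the bound for the remainder of the expansion of the product. -/
def remConst (d n : ℕ) : ℝ≥0∞ := n * n * (4 * 3 ^ n * pairConst d)

theorem remConst_ne_top (d n : ℕ) : remConst d n ≠ ∞ := by
  have := pairConst_ne_top d
  unfold remConst
  finiteness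

theorem lintegral_tsum_remainder_sq_le (ha : ∀ i, a i ≤ a n₀) (hβ : ∀ i, β i ≠ ∞)
    (hκ : ∀ i (q : ℕ), IsKer (q + a i) (β i) (κ i q)) (hfm : ∀ i, Measurable (f i))
    (hf1 : ∀ i ≠ n₀, ∀ x, ‖f i x‖ₑ ≤ 1) (hf2 : MemLp (f n₀) 2)
    (he : ∀ i q x, ‖e i q x‖ₑ ≤ β i * ‖avg (q + a i) (f i) x‖ₑ)
    (hem : ∀ i q, Measurable (e i q)) (hbm : ∀ i q, Measurable (b i q))
    (hb : ∀ᵐ x, ∀ i q, b i q x = kerOp (difKer (q + a i) (κ i q)) (f i) x) :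
    ∫⁻ x, (∑' q, ‖∏ i, (e i q x + b i q x) - ∏ i, e i q x -
      ∑ i, b i q x * ∏ j ∈ Finset.univ.erase i, e j q x‖ₑ) ^ 2 ≤
      (remConst d (Fintype.card ι) * ((∏ i, β i) * eLpNorm (f n₀) 2)) ^ 2 := by
  set h : ι × ι → Rd d → ℝ≥0∞ := fun p x => if p.1 = p.2 then 0 else
    ∑' q, ‖b p.1 q x‖ₑ * ‖b p.2 q x‖ₑ *
      ∏ l ∈ (Finset.univ.erase p.1).erase p.2, (‖e l q x‖ₑ + ‖b l q x‖ₑ) with hh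
  have hhm : ∀ p, Measurable (h p) := by
    intro p
    by_cases hp : p.1 = p.2
    · simp only [hh, hp, if_true]
      exact measurable_const
    · simp only [hh, hp, if_false]
      exact Measurable.tsum fun q => ((hbm _ _).enorm.mul (hbm _ _).enorm).mul
        (Finset.measurable_fun_prod _ fun l _ => (hem _ _).enorm.add (hbm _ _).enorm)
  have h1 := lintegral_tsum_sq_le hhm (w := fun _ => 1) (fun _ => one_ne_zero)
    (fun _ => ENNReal.one_ne_top)
    (A := (4 * 3 ^ Fintype.card ι * pairConst d * ((∏ i, β i) * eLpNorm (f n₀) 2)) ^ 2) (by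
      intro p
      rw [one_pow, one_mul]
      by_cases hp : p.1 = p.2
      · simp [hh, hp]
      · simp only [hh, hp, if_false]
        exact lintegral_tsum_pair_prod_sq_le ha hβ hκ hfm hf1 hf2 he hb hp)
  refine (lintegral_mono fun x => ?_).trans (h1.trans_eq ?_)
  · gcongr
    rw [tsum_fintype (β := ι × ι), Fintype.sum_prod_type]
    calc ∑' q, ‖∏ i, (e i q x + b i q x) - ∏ i, e i q x -
          ∑ i, b i q x * ∏ j ∈ Finset.univ.erase i, e j q x‖ₑ
        ≤ ∑' q, ∑ i, ∑ j ∈ Finset.univ.erase i, ‖b i q x‖ₑ * ‖b j q x‖ₑ *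
            ∏ l ∈ (Finset.univ.erase i).erase j, (‖e l q x‖ₑ + ‖b l q x‖ₑ) :=
          ENNReal.tsum_le_tsum fun q => enorm_prod_add_sub_le _ _ _
      _ = ∑ i, ∑ j ∈ Finset.univ.erase i, ∑' q, ‖b i q x‖ₑ * ‖b j q x‖ₑ *
            ∏ l ∈ (Finset.univ.erase i).erase j, (‖e l q x‖ₑ + ‖b l q x‖ₑ) := by
          rw [Summable.tsum_finsetSum fun _ _ => ENNReal.summable]
          refine Finset.sum_congr rfl fun i _ => ?_
          rw [Summable.tsum_finsetSum fun _ _ => ENNReal.summable]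
      _ ≤ _ := by
          refine Finset.sum_le_sum fun i _ => ?_
          refine le_trans (Finset.sum_le_sum fun j hj => ?_)
            (Finset.sum_le_sum_of_subset (Finset.erase_subset i Finset.univ))
          simp only [hh]
          rw [if_neg (Finset.ne_of_mem_erase hj).symm]
  · rw [tsum_fintype, Finset.sum_const, Finset.card_univ, Fintype.card_prod, nsmul_eq_mul, mul_one,
      remConst]
    push_cast
    ring

end PairBounds

/-! ### Minkowski's integral inequality. -/

section MixedNorm

/-- Minkowski in the form needed for superpositions over z: Cauchy–Schwarz for the measure w v dz
applied to u / v, then Tonelli. The weight v carries the growth of the norms in z. -/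
theorem lintegral_lintegral_mul_sq_le {w v : Rd d → ℝ≥0∞} (hw : Measurable w) (hv : Measurable v)
    (hv0 : ∀ z, v z ≠ 0) (hvt : ∀ z, v z ≠ ∞) {u : Rd d → Rd d → ℝ≥0∞}
    (hu : Measurable (Function.uncurry u)) {A : ℝ≥0∞}
    (h : ∀ z, ∫⁻ x, u z x ^ 2 ≤ (v z * A) ^ 2) :
    ∫⁻ x, (∫⁻ z, w z * u z x) ^ 2 ≤ ((∫⁻ z, w z * v z) * A) ^ 2 := by
  have hvv : ∀ z, (v z)⁻¹ * v z = 1 := fun z => ENNReal.inv_mul_cancel (hv0 z) (hvt z)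
  have hux : ∀ x, Measurable fun z => u z x := fun x => hu.comp (measurable_id.prodMk measurable_const)
  have huz : ∀ z, Measurable fun x => u z x := fun z => hu.comp (measurable_const.prodMk measurable_id)
  set W := ∫⁻ z, w z * v z with hW
  calc ∫⁻ x, (∫⁻ z, w z * u z x) ^ 2
      = ∫⁻ x, (∫⁻ z, (w z * v z) * ((v z)⁻¹ * u z x)) ^ 2 := by
        refine lintegral_congr fun x => ?_
        congr 1
        refine lintegral_congr fun z => ?_
        rw [show w z * v z * ((v z)⁻¹ * u z x) = w z * ((v z)⁻¹ * v z) * u z x by ring, hvv, mul_one]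
    _ ≤ ∫⁻ x, W * ∫⁻ z, (w z * v z) * ((v z)⁻¹ * u z x) ^ 2 :=
        lintegral_mono fun x => lintegral_weighted_sq_le (hw.mul hv).aemeasurable
          (hv.inv.mul (hux x)).aemeasurable
    _ = W * ∫⁻ z, ∫⁻ x, (w z * v z) * ((v z)⁻¹ * u z x) ^ 2 := by
        have hm : Measurable fun p : Rd d × Rd d =>
            (w p.2 * v p.2) * ((v p.2)⁻¹ * u p.2 p.1) ^ 2 :=
          ((hw.comp measurable_snd).mul (hv.comp measurable_snd)).mul
            (((hv.inv.comp measurable_snd).mul (hu.comp measurable_swap)).pow_const 2)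
        rw [lintegral_const_mul _ hm.lintegral_prod_right', lintegral_lintegral_swap hm.aemeasurable]
    _ ≤ W * ∫⁻ z, (w z * v z) * A ^ 2 := by
        gcongr with z
        rw [lintegral_const_mul _ (((huz z).const_mul _).pow_const 2)]
        gcongr
        simp only [mul_pow]
        rw [lintegral_const_mul _ ((huz z).pow_const 2)]
        calc (v z)⁻¹ ^ 2 * ∫⁻ x, u z x ^ 2 ≤ (v z)⁻¹ ^ 2 * (v z * A) ^ 2 := by
              gcongr; exact h z
          _ = ((v z)⁻¹ * v z) ^ 2 * A ^ 2 := by ring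
          _ = A ^ 2 := by rw [hvv, one_pow, one_mul]
    _ = _ := by rw [lintegral_mul_const _ (hw.fun_mul hv)]; ring

end MixedNorm

/-! ### Convolution operators and their comparison with dyadic averages. -/

section Convolution

/-- Convolution with the kernel `k`. -/
def convOp (k f : Rd d → ℂ) (x : Rd d) : ℂ := kerOp (fun x y => k (x - y)) f x

variable {s : ℤ} {B : ℝ≥0∞} {k f : Rd d → ℂ}

theorem convOp_eq_kerOp_difKer (s : ℤ) (hk : ∫ w, k w = 0) :
    convOp k f = kerOp (difKer s k) f := by
  ext x
  simp only [convOp, kerOp, difKer, hk, zero_mul, sub_zero]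

theorem KerBound.integrable_mul_of_bound {K : Rd d → Rd d → ℂ} {a b : ℝ≥0∞} (hK : KerBound K a b)
    (ha : a ≠ ∞) (hfm : Measurable f) (hf : ∀ x, ‖f x‖ₑ ≤ 1) (x : Rd d) :
    Integrable fun y => K x y * f y := by
  refine ⟨((hK.measurable_right x).mul hfm).aestronglyMeasurable, ?_⟩
  refine lt_of_le_of_lt (lintegral_mono fun y => ?_) ((hK.row x).trans_lt ha.lt_top)
  rw [enorm_mul]
  exact mul_le_of_le_one_right' (hf y)

theorem convOp_sub_avg_of_integrable (c : ℂ) (hc : ∫ w, k w = c) {x : Rd d}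
    (h : Integrable fun y => k (x - y) * f y)
    (h' : Integrable fun y => (c * avgKer s x y) * f y) :
    convOp k f x - c * avg s f x = kerOp (difKer s k) f x := by
  subst hc
  have h1 := kerOp_sub (K := fun x y => k (x - y)) (K' := fun x y => (∫ w, k w) * avgKer s x y) h h'
  rw [kerOp_const_mul_avgKer] at h1
  rw [convOp, ← h1]
  rfl

theorem IsKer.convOp_sub_avg_of_bound (hk : IsKer s B k) (hB : B ≠ ∞) {c : ℂ}
    (hc : ∫ w, k w = c) (hfm : Measurable f) (hf : ∀ x, ‖f x‖ₑ ≤ 1) (x : Rd d) :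
    convOp k f x - c * avg s f x = kerOp (difKer s k) f x :=
  convOp_sub_avg_of_integrable c hc (hk.kerBound_conv.integrable_mul_of_bound hB hfm hf x)
    ((kerBound_avgKer c).integrable_mul_of_bound enorm_ne_top hfm hf x)

theorem IsKer.convOp_sub_avg_ae (hk : IsKer s B k) (hB : B ≠ ∞) {c : ℂ}
    (hc : ∫ w, k w = c) (hfm : Measurable f) (hf : MemLp f 2) :
    ∀ᵐ x, convOp k f x - c * avg s f x = kerOp (difKer s k) f x := by
  have h1 := hk.kerBound_conv
  have h2 := kerBound_avgKer (d := d) (s := s) c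
  filter_upwards [(h1.adm_of_memLp hB hB hfm hf).ae_integrable_univ h1.meas hfm,
    (h2.adm_of_memLp enorm_ne_top enorm_ne_top hfm hf).ae_integrable_univ h2.meas hfm] with x h h'
  exact convOp_sub_avg_of_integrable c hc h h'

variable {P : Type*} [MeasurableSpace P] {H : P → Rd d → ℂ}

theorem measurable_shiftKer (hK : Measurable (Function.uncurry H)) :
    Measurable fun p : (P × Rd d) × Rd d => H p.1.1 (p.1.2 - p.2) :=
  hK.comp ((measurable_fst.comp measurable_fst).prodMk
    ((measurable_snd.comp measurable_fst).sub measurable_snd))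

theorem measurable_convOp (hK : Measurable (Function.uncurry H)) (hfm : Measurable f) :
    Measurable (Function.uncurry fun z x => convOp (H z) f x) :=
  (StronglyMeasurable.integral_prod_right'
    (f := fun p : (P × Rd d) × Rd d => H p.1.1 (p.1.2 - p.2) * f p.2)
    ((measurable_shiftKer hK).mul (hfm.comp measurable_snd)).stronglyMeasurable).measurable

theorem measurable_absConv (hK : Measurable (Function.uncurry H)) (hfm : Measurable f) :
    Measurable (Function.uncurry fun z x => ∫⁻ y, ‖H z (x - y)‖ₑ * ‖f y‖ₑ) :=
  Measurable.lintegral_prod_right'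
    (f := fun p : (P × Rd d) × Rd d => ‖H p.1.1 (p.1.2 - p.2)‖ₑ * ‖f p.2‖ₑ)
    ((measurable_shiftKer hK).enorm.mul (hfm.comp measurable_snd).enorm)

theorem enorm_convOp_le_absConv (k f : Rd d → ℂ) (x : Rd d) :
    ‖convOp k f x‖ₑ ≤ ∫⁻ y, ‖k (x - y)‖ₑ * ‖f y‖ₑ := by
  refine (enorm_integral_le_lintegral_enorm _).trans_eq ?_
  simp only [enorm_mul]

end Convolution

/-! ### Superpositions of kernels with a mean zero weight. -/

section AveragedKernel

variable {s : ℤ} {B : ℝ≥0∞} {K : Rd d → Rd d → ℂ} {Ψ : Rd d → ℂ}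

theorem one_le_one_add_enorm (z : Rd d) : (1 : ℝ≥0∞) ≤ 1 + ‖z‖ₑ := le_self_add

/-- The superposition of the kernels `K z` with the weight `Ψ`. -/
def mixKer (Ψ : Rd d → ℂ) (K : Rd d → Rd d → ℂ) (w : Rd d) : ℂ := ∫ z, Ψ z * K z w

theorem measurable_mul_ker (hΨm : Measurable Ψ) (hKm : Measurable (Function.uncurry K)) :
    Measurable fun p : Rd d × Rd d => Ψ p.2 * K p.2 p.1 :=
  (hΨm.comp measurable_snd).mul (hKm.comp measurable_swap)

theorem lintegral_lintegral_mul_ker_le (hΨm : Measurable Ψ) (hKm : Measurable (Function.uncurry K))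
    (hK : ∀ z, IsKer s (B * (1 + ‖z‖ₑ)) (K z)) :
    ∫⁻ w, ∫⁻ z, ‖Ψ z * K z w‖ₑ ≤ B * ∫⁻ z, ‖Ψ z‖ₑ * (1 + ‖z‖ₑ) := by
  rw [lintegral_lintegral_swap (measurable_mul_ker hΨm hKm).enorm.aemeasurable,
    ← lintegral_const_mul _ (hΨm.enorm.fun_mul (measurable_enorm.const_add 1))]
  refine lintegral_mono fun z => ?_
  simp only [enorm_mul]
  rw [lintegral_const_mul' _ _ enorm_ne_top]
  calc ‖Ψ z‖ₑ * ∫⁻ w, ‖K z w‖ₑ ≤ ‖Ψ z‖ₑ * (B * (1 + ‖z‖ₑ)) := by gcongr; exact (hK z).lint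
    _ = _ := by ring

theorem integrable_uncurry_mul_ker (hΨm : Measurable Ψ) (hKm : Measurable (Function.uncurry K))
    (hK : ∀ z, IsKer s (B * (1 + ‖z‖ₑ)) (K z)) (hB : B ≠ ∞)
    (hΨ : ∫⁻ z, ‖Ψ z‖ₑ * (1 + ‖z‖ₑ) ≠ ∞) :
    Integrable (Function.uncurry fun w z => Ψ z * K z w) (volume.prod volume) := by
  refine ⟨(measurable_mul_ker hΨm hKm).aestronglyMeasurable, ?_⟩
  change ∫⁻ p : Rd d × Rd d, ‖Ψ p.2 * K p.2 p.1‖ₑ ∂(volume.prod volume) < ∞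
  rw [lintegral_prod _ (measurable_mul_ker hΨm hKm).enorm.aemeasurable]
  exact (lintegral_lintegral_mul_ker_le hΨm hKm hK).trans_lt
    (ENNReal.mul_lt_top hB.lt_top hΨ.lt_top)

/-- The defining bounds of `IsKer` are subadditive in the kernel, so a superposition inherits them;
the linear growth in z is paid for by a weighted L¹ norm of Ψ. -/
theorem isKer_mixKer (hΨm : Measurable Ψ) (hKm : Measurable (Function.uncurry K))
    (hK : ∀ z, IsKer s (B * (1 + ‖z‖ₑ)) (K z)) (hB : B ≠ ∞)
    (hΨ : ∫⁻ z, ‖Ψ z‖ₑ * (1 + ‖z‖ₑ) ≠ ∞) :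
    IsKer s (B * ∫⁻ z, ‖Ψ z‖ₑ * (1 + ‖z‖ₑ)) (mixKer Ψ K) := by
  have hm := measurable_mul_ker hΨm hKm
  have hmw : Measurable fun z => ‖Ψ z‖ₑ * (1 + ‖z‖ₑ) :=
    hΨm.enorm.fun_mul (measurable_enorm.const_add 1)
  refine ⟨(StronglyMeasurable.integral_prod_right' hm.stronglyMeasurable).measurable, ?_, ?_, ?_⟩
  · exact (lintegral_mono fun w => enorm_integral_le_lintegral_enorm _).trans
      (lintegral_lintegral_mul_ker_le hΨm hKm hK)
  · calc ∫⁻ w, ‖mixKer Ψ K w‖ₑ * ‖w‖ₑ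
        ≤ ∫⁻ w, ∫⁻ z, ‖Ψ z * K z w‖ₑ * ‖w‖ₑ := by
          refine lintegral_mono fun w => ?_
          rw [lintegral_mul_const' _ _ enorm_ne_top]
          exact mul_le_mul_left (enorm_integral_le_lintegral_enorm _) _
      _ = ∫⁻ z, ∫⁻ w, ‖Ψ z * K z w‖ₑ * ‖w‖ₑ :=
          lintegral_lintegral_swap (hm.enorm.mul measurable_fst.enorm).aemeasurable
      _ ≤ ∫⁻ z, (‖Ψ z‖ₑ * (1 + ‖z‖ₑ)) * (B * p2 s) := by
          refine lintegral_mono fun z => ?_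
          simp only [enorm_mul, mul_assoc]
          rw [lintegral_const_mul' _ _ enorm_ne_top]
          gcongr
          exact (hK z).moment.trans_eq (by ring)
      _ = _ := by rw [lintegral_mul_const _ hmw]; ring
  · intro h
    have hae : ∀ᵐ w, Integrable fun z => Ψ z * K z w :=
      (integrable_uncurry_mul_ker hΨm hKm hK hB hΨ).prod_right_ae
    have hae' : ∀ᵐ w, Integrable fun z => Ψ z * K z (w + h) :=
      (measurePreserving_add_right volume h).quasiMeasurePreserving.ae hae
    have hm2 : Measurable fun p : Rd d × Rd d => Ψ p.2 * K p.2 (p.1 + h) :=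
      hm.comp ((measurable_fst.add_const h).prodMk measurable_snd)
    calc ∫⁻ w, ‖mixKer Ψ K (w + h) - mixKer Ψ K w‖ₑ
        ≤ ∫⁻ w, ∫⁻ z, ‖Ψ z * K z (w + h) - Ψ z * K z w‖ₑ := by
          refine lintegral_mono_ae ?_
          filter_upwards [hae, hae'] with w hw hw'
          rw [mixKer, mixKer, ← integral_sub hw' hw]
          exact enorm_integral_le_lintegral_enorm _
      _ = ∫⁻ z, ∫⁻ w, ‖Ψ z * K z (w + h) - Ψ z * K z w‖ₑ :=
          lintegral_lintegral_swap (hm2.sub hm).enorm.aemeasurable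
      _ ≤ ∫⁻ z, (‖Ψ z‖ₑ * (1 + ‖z‖ₑ)) * (B * p2 (-s) * ‖h‖ₑ) := by
          refine lintegral_mono fun z => ?_
          simp only [← mul_sub, enorm_mul]
          rw [lintegral_const_mul' _ _ enorm_ne_top, mul_assoc]
          gcongr
          exact ((hK z).shift h).trans_eq (by ring)
      _ = _ := by rw [lintegral_mul_const _ hmw]; ring

/-- All K z have the same mass c, so the mass of the superposition is c ∫ Ψ. In this way the
cancellation of Ψ becomes cancellation of a kernel acting on a single function. -/
theorem integral_mixKer_eq_zero (hΨm : Measurable Ψ) (hKm : Measurable (Function.uncurry K))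
    (hK : ∀ z, IsKer s (B * (1 + ‖z‖ₑ)) (K z)) (hB : B ≠ ∞)
    (hΨ : ∫⁻ z, ‖Ψ z‖ₑ * (1 + ‖z‖ₑ) ≠ ∞) {c : ℂ} (hc : ∀ z, ∫ w, K z w = c)
    (hΨ0 : ∫ z, Ψ z = 0) : ∫ w, mixKer Ψ K w = 0 := by
  simp only [mixKer]
  rw [integral_integral_swap (integrable_uncurry_mul_ker hΨm hKm hK hB hΨ)]
  simp only [integral_const_mul, hc, integral_mul_const, hΨ0, zero_mul]

theorem integral_mul_convOp_eq (hΨm : Measurable Ψ) (hKm : Measurable (Function.uncurry K))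
    {f : Rd d → ℂ} (hfm : Measurable f) {x : Rd d}
    (h : ∫⁻ z, ‖Ψ z‖ₑ * ∫⁻ y, ‖K z (x - y)‖ₑ * ‖f y‖ₑ < ∞) :
    ∫ z, Ψ z * convOp (K z) f x = convOp (mixKer Ψ K) f x := by
  have hm : Measurable fun p : Rd d × Rd d => Ψ p.1 * (K p.1 (x - p.2) * f p.2) :=
    (hΨm.comp measurable_fst).mul ((hKm.comp (measurable_fst.prodMk
      (measurable_const.sub measurable_snd))).mul (hfm.comp measurable_snd))
  have hint : Integrable (Function.uncurry fun z y => Ψ z * (K z (x - y) * f y))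
      (volume.prod volume) := by
    refine ⟨hm.aestronglyMeasurable, ?_⟩
    change ∫⁻ p : Rd d × Rd d, ‖Ψ p.1 * (K p.1 (x - p.2) * f p.2)‖ₑ ∂(volume.prod volume) < ∞
    rw [lintegral_prod _ hm.enorm.aemeasurable]
    refine lt_of_le_of_lt (lintegral_mono fun z => ?_) h
    simp only [enorm_mul]
    rw [lintegral_const_mul' _ _ enorm_ne_top]
  have h1 : ∀ z, Ψ z * convOp (K z) f x = ∫ y, Ψ z * (K z (x - y) * f y) := fun z =>
    (integral_const_mul _ _).symm
  simp only [h1]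
  rw [integral_integral_swap hint, convOp, kerOp]
  refine integral_congr_ae (Eventually.of_forall fun y => ?_)
  simp only [mixKer, ← integral_mul_const, mul_assoc]

end AveragedKernel

/-! ### The estimate for a sum over dyadic scales. -/

section Core

/-- A family of kernels adapted to the scales `q + a i`, with parameter `z`. -/
structure KerFamily {ι : Type*} (n₀ : ι) (a : ι → ℤ) (B : ι → ℝ≥0∞) (c : ι → ℂ)
    (k : ι → ℕ → Rd d → Rd d → ℂ) : Prop where
  meas : ∀ i q, Measurable (Function.uncurry (k i q))
  isKer : ∀ i (q : ℕ) z, IsKer (q + a i) (B i * (1 + ‖z‖ₑ)) (k i q z)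
  mass : ∀ i q z, ∫ w, k i q z w = c i
  le_last : ∀ i, a i ≤ a n₀
  ne_top : ∀ i, B i ≠ ∞

/-- Measurable functions, one of them in `L²` and the others bounded by `M`. -/
structure Inputs {ι : Type*} (n₀ : ι) (M : ℝ≥0∞) (f : ι → Rd d → ℂ) : Prop where
  meas : ∀ i, Measurable (f i)
  bdd : ∀ i ≠ n₀, ∀ x, ‖f i x‖ₑ ≤ M
  memLp : MemLp (f n₀) 2

/-- The weighted `L¹` norm of `Ψ`. -/
def wt (Ψ : Rd d → ℂ) (N : ℕ) : ℝ≥0∞ := ∫⁻ z, ‖Ψ z‖ₑ * (1 + ‖z‖ₑ) ^ N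

theorem wt_mono (Ψ : Rd d → ℂ) {N N' : ℕ} (h : N ≤ N') : wt Ψ N ≤ wt Ψ N' :=
  lintegral_mono fun z => mul_le_mul_right (pow_le_pow_right₀ (one_le_one_add_enorm z) h) _

theorem wt_one (Ψ : Rd d → ℂ) : wt Ψ 1 = ∫⁻ z, ‖Ψ z‖ₑ * (1 + ‖z‖ₑ) := by simp [wt]

theorem one_add_enorm_ne_top (z : Rd d) : 1 + ‖z‖ₑ ≠ ∞ := by finiteness

theorem measurable_one_add_enorm_pow (N : ℕ) : Measurable fun z : Rd d => (1 + ‖z‖ₑ) ^ N :=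
  (measurable_enorm.const_add 1).pow_const N

variable {ι : Type*} {n₀ : ι} {a : ι → ℤ} {B : ι → ℝ≥0∞} {c : ι → ℂ}
  {k : ι → ℕ → Rd d → Rd d → ℂ} {f : ι → Rd d → ℂ} {Ψ : Rd d → ℂ}

theorem KerFamily.enorm_mass_le (hk : KerFamily n₀ a B c k) (i : ι) : ‖c i‖ₑ ≤ B i := by
  have := (hk.isKer i 0 0).enorm_integral_le
  rwa [hk.mass, enorm_zero, add_zero, mul_one] at this

theorem KerFamily.ne_top' (hk : KerFamily n₀ a B c k) (i : ι) (z : Rd d) :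
    B i * (1 + ‖z‖ₑ) ≠ ∞ := ENNReal.mul_ne_top (hk.ne_top i) (one_add_enorm_ne_top z)

/-- It justifies Fubini at almost every point. The exponent N stands for the other n - 1 factors,
each of which may grow like 1 + |z|. -/
theorem ae_lintegral_absConv_lt_top {s : ℤ} {K : Rd d → Rd d → ℂ} {b M : ℝ≥0∞} {g : Rd d → ℂ}
    (hKm : Measurable (Function.uncurry K)) (hK : ∀ z, IsKer s (b * (1 + ‖z‖ₑ)) (K z))
    (hb : b ≠ ∞) (hM : M ≠ ∞) (hg : Measurable g) (hg' : MemLp g 2 ∨ ∀ x, ‖g x‖ₑ ≤ M)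
    (hΨm : Measurable Ψ) {N : ℕ} (hΨ : wt Ψ (N + 1) ≠ ∞) :
    ∀ᵐ x, ∫⁻ z, (‖Ψ z‖ₑ * (1 + ‖z‖ₑ) ^ N) * ∫⁻ y, ‖K z (x - y)‖ₑ * ‖g y‖ₑ < ∞ := by
  have hw : Measurable fun z => ‖Ψ z‖ₑ * (1 + ‖z‖ₑ) ^ N :=
    hΨm.enorm.fun_mul (measurable_one_add_enorm_pow N)
  have hwt : ∫⁻ z, (‖Ψ z‖ₑ * (1 + ‖z‖ₑ) ^ N) * (1 + ‖z‖ₑ) = wt Ψ (N + 1) := by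
    simp only [wt, pow_succ, mul_assoc]
  rcases hg' with hg' | hg'
  · have hm := measurable_absConv hKm hg
    have hE := hg'.2.ne
    have h1 := lintegral_lintegral_mul_sq_le hw (measurable_enorm.const_add 1)
      (fun z => by simp) one_add_enorm_ne_top hm (A := b * eLpNorm g 2) (fun z => by
        refine ((hK z).kerBound_conv.lintegral_lintegral_sq_le hg.enorm).trans_eq ?_
        rw [← eLpNorm_two_sq]
        ring)
    have hm' : Measurable fun x => ∫⁻ z, (‖Ψ z‖ₑ * (1 + ‖z‖ₑ) ^ N) *
        ∫⁻ y, ‖K z (x - y)‖ₑ * ‖g y‖ₑ :=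
      Measurable.lintegral_prod_right'
        (f := fun p : Rd d × Rd d => (‖Ψ p.2‖ₑ * (1 + ‖p.2‖ₑ) ^ N) *
          ∫⁻ y, ‖K p.2 (p.1 - y)‖ₑ * ‖g y‖ₑ)
        ((hw.comp measurable_snd).mul (hm.comp measurable_swap))
    filter_upwards [ae_lt_top (hm'.pow_const 2) (h1.trans_lt (by rw [hwt]; finiteness)).ne]
      with x hx
    exact (ENNReal.pow_lt_top_iff.1 hx).resolve_right two_ne_zero
  · refine Eventually.of_forall fun x => ?_
    calc ∫⁻ z, (‖Ψ z‖ₑ * (1 + ‖z‖ₑ) ^ N) * ∫⁻ y, ‖K z (x - y)‖ₑ * ‖g y‖ₑ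
        ≤ ∫⁻ z, (‖Ψ z‖ₑ * (1 + ‖z‖ₑ) ^ N) * (1 + ‖z‖ₑ) * (b * M) := by
          refine lintegral_mono fun z => ?_
          have h2 : ∫⁻ y, ‖K z (x - y)‖ₑ * ‖g y‖ₑ ≤ b * (1 + ‖z‖ₑ) * M := by
            refine (lintegral_mono fun y => mul_le_mul_right (hg' y) _).trans ?_
            rw [lintegral_mul_const' _ _ hM]
            exact mul_le_mul_left ((hK z).kerBound_conv.row x) _
          rw [mul_assoc _ _ (b * M), ← mul_assoc (1 + ‖z‖ₑ), mul_comm _ b]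
          exact mul_le_mul_right h2 _
      _ = wt Ψ (N + 1) * (b * M) := by
          rw [lintegral_mul_const _ (hw.fun_mul (measurable_enorm.const_add 1)), hwt]
      _ < ∞ := ENNReal.mul_lt_top hΨ.lt_top (ENNReal.mul_lt_top hb.lt_top hM.lt_top)

theorem Inputs.memLp_or {M : ℝ≥0∞} (hf : Inputs n₀ M f) (i : ι) :
    MemLp (f i) 2 ∨ ∀ x, ‖f i x‖ₑ ≤ M := by
  by_cases hi : i = n₀
  · exact .inl (hi ▸ hf.memLp)
  · exact .inr (hf.bdd i hi)

/-- The integrand of a single scale is integrable at almost every point. -/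
theorem Inputs.integrable_mul_prod_convOp [Fintype ι] [DecidableEq ι] {M : ℝ≥0∞}
    (hf : Inputs n₀ M f) (hM : M ≠ ∞) {s : ι → ℤ} {κ : ι → Rd d → Rd d → ℂ}
    (hκm : ∀ i, Measurable (Function.uncurry (κ i)))
    (hκ : ∀ i z, IsKer (s i) (B i * (1 + ‖z‖ₑ)) (κ i z)) (hB : ∀ i, B i ≠ ∞)
    (hΨm : Measurable Ψ) {N : ℕ} (hN : Fintype.card ι = N + 1) {x : Rd d}
    (hx : ∫⁻ z, (‖Ψ z‖ₑ * (1 + ‖z‖ₑ) ^ N) *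
      ∫⁻ y, ‖κ n₀ z (x - y)‖ₑ * ‖f n₀ y‖ₑ < ∞) :
    Integrable fun z => Ψ z * ∏ i, convOp (κ i z) (f i) x := by
  have hcm : ∀ i, Measurable fun z => convOp (κ i z) (f i) x := fun i =>
    (measurable_convOp (hκm i) (hf.meas i)).comp (measurable_id.prodMk measurable_const)
  refine ⟨(hΨm.mul (Finset.measurable_fun_prod _ fun i _ => hcm i)).aestronglyMeasurable, ?_⟩
  have hle : ∀ z, ‖Ψ z * ∏ i, convOp (κ i z) (f i) x‖ₑ ≤
      (∏ i ∈ Finset.univ.erase n₀, B i * M) * ((‖Ψ z‖ₑ * (1 + ‖z‖ₑ) ^ N) *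
        ∫⁻ y, ‖κ n₀ z (x - y)‖ₑ * ‖f n₀ y‖ₑ) := by
    intro z
    rw [enorm_mul, enorm_finset_prod, ← Finset.mul_prod_erase _ _ (Finset.mem_univ n₀)]
    calc _ ≤ ‖Ψ z‖ₑ * ((∫⁻ y, ‖κ n₀ z (x - y)‖ₑ * ‖f n₀ y‖ₑ) *
          ∏ i ∈ Finset.univ.erase n₀, (B i * M * (1 + ‖z‖ₑ))) := by
          gcongr with i hi
          · exact enorm_convOp_le_absConv _ _ _
          · refine ((hκ i z).kerBound_conv.enorm_kerOp_le
              (hf.bdd i (Finset.ne_of_mem_erase hi)) x).trans_eq ?_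
            ring
      _ = _ := by
          rw [Finset.prod_mul_distrib, Finset.prod_const,
            Finset.card_erase_of_mem (Finset.mem_univ n₀), Finset.card_univ, hN,
            Nat.add_sub_cancel]
          ring
  have hBt : ∏ i ∈ Finset.univ.erase n₀, B i * M ≠ ∞ :=
    ENNReal.prod_ne_top fun i _ => ENNReal.mul_ne_top (hB i) hM
  refine lt_of_le_of_lt (lintegral_mono hle) ?_
  rw [lintegral_const_mul' _ _ hBt]
  exact ENNReal.mul_lt_top hBt.lt_top hx

variable [Fintype ι] [DecidableEq ι]

/-- The part of the product of the `convOp (k i q z) (f i)` with at least two oscillating factors. -/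
def remTerm (a : ι → ℤ) (c : ι → ℂ) (k : ι → ℕ → Rd d → Rd d → ℂ) (f : ι → Rd d → ℂ) (q : ℕ)
    (z x : Rd d) : ℂ :=
  ∏ i, convOp (k i q z) (f i) x - ∏ i, c i * avg (q + a i) (f i) x -
    ∑ i, (convOp (k i q z) (f i) x - c i * avg (q + a i) (f i) x) *
      ∏ j ∈ Finset.univ.erase i, c j * avg (q + a j) (f j) x

theorem KerFamily.measurable_remTerm (hk : KerFamily n₀ a B c k) (hf : Inputs n₀ 1 f) (q : ℕ) :
    Measurable (Function.uncurry (remTerm a c k f q)) := by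
  have h1 : ∀ i, Measurable fun p : Rd d × Rd d => convOp (k i q p.1) (f i) p.2 := fun i =>
    measurable_convOp (hk.meas i q) (hf.meas i)
  have h2 : ∀ i, Measurable fun p : Rd d × Rd d => c i * avg (q + a i) (f i) p.2 := fun i =>
    ((cubeConst_avg _ _).measurable.const_mul _).comp measurable_snd
  exact ((Finset.measurable_fun_prod _ fun i _ => h1 i).sub
    (Finset.measurable_fun_prod _ fun i _ => h2 i)).sub (Finset.measurable_fun_sum _ fun i _ =>
      ((h1 i).sub (h2 i)).mul (Finset.measurable_fun_prod _ fun j _ => h2 j))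

/-- For fixed z the translated kernels have constants B i (1 + |z|), and the remainder estimate is
multilinear in the constants; hence the power of 1 + |z|. -/
theorem KerFamily.lintegral_tsum_remTerm_sq_le (hk : KerFamily n₀ a B c k) (hf : Inputs n₀ 1 f)
    (z : Rd d) :
    ∫⁻ x, (∑' q, ‖remTerm a c k f q z x‖ₑ) ^ 2 ≤
      ((1 + ‖z‖ₑ) ^ Fintype.card ι *
        (remConst d (Fintype.card ι) * ((∏ i, B i) * eLpNorm (f n₀) 2))) ^ 2 := by
  have hcm : ∀ i q, Measurable fun x => convOp (k i q z) (f i) x := fun i q =>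
    (measurable_convOp (hk.meas i q) (hf.meas i)).comp (measurable_const.prodMk measurable_id)
  have hem : ∀ i (q : ℕ), Measurable fun x => c i * avg (q + a i) (f i) x := fun i q =>
    (cubeConst_avg _ _).measurable.const_mul _
  have h1 := lintegral_tsum_remainder_sq_le (n₀ := n₀) hk.le_last (fun i => hk.ne_top' i z)
    (fun i q => hk.isKer i q z) hf.meas hf.bdd hf.memLp
    (e := fun i q x => c i * avg (q + a i) (f i) x)
    (b := fun i q x => convOp (k i q z) (f i) x - c i * avg (q + a i) (f i) x)
    (fun i q x => by
      rw [enorm_mul]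
      gcongr
      exact (hk.enorm_mass_le i).trans (le_mul_of_one_le_right' (one_le_one_add_enorm z)))
    hem (fun i q => (hcm i q).sub (hem i q)) (by
      refine ae_all_iff.2 fun i => ae_all_iff.2 fun q => ?_
      by_cases hi : i = n₀
      · subst hi
        exact (hk.isKer i q z).convOp_sub_avg_ae (hk.ne_top' i z) (hk.mass i q z) (hf.meas i)
          hf.memLp
      · exact Eventually.of_forall fun x => (hk.isKer i q z).convOp_sub_avg_of_bound
          (hk.ne_top' i z) (hk.mass i q z) (hf.meas i) (hf.bdd i hi) x)
  simp only [add_sub_cancel] at h1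
  refine h1.trans_eq ?_
  rw [Finset.prod_mul_distrib, Finset.prod_const, Finset.card_univ]
  ring

/-- Integrate the expansion against Ψ. The term of order zero is independent of z and vanishes with
∫ Ψ. In a term of first order the average part vanishes for the same reason, and the convolution
part becomes convolution with the mixed kernel. -/
theorem KerFamily.ae_integral_prod_eq (hk : KerFamily n₀ a B c k) (hf : Inputs n₀ 1 f)
    (hΨm : Measurable Ψ) (hΨ : wt Ψ (Fintype.card ι) ≠ ∞) (hΨ0 : ∫ z, Ψ z = 0) (q : ℕ) :
    ∀ᵐ x, ∫ z, Ψ z * ∏ i, convOp (k i q z) (f i) x =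
      (∑ i, convOp (mixKer Ψ (k i q)) (f i) x *
        ∏ j ∈ Finset.univ.erase i, c j * avg (q + a j) (f j) x) +
      ∫ z, Ψ z * remTerm a c k f q z x := by
  obtain ⟨N, hN⟩ : ∃ N, Fintype.card ι = N + 1 :=
    Nat.exists_eq_succ_of_ne_zero (Fintype.card_pos_iff.2 ⟨n₀⟩).ne'
  rw [hN] at hΨ
  filter_upwards [ae_all_iff.2 fun i => ae_lintegral_absConv_lt_top (hk.meas i q)
    (hk.isKer i q) (hk.ne_top i) ENNReal.one_ne_top (hf.meas i) (hf.memLp_or i) hΨm hΨ] with x hx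
  have hcm : ∀ i, Measurable fun z => convOp (k i q z) (f i) x := fun i =>
    (measurable_convOp (hk.meas i q) (hf.meas i)).comp (measurable_id.prodMk measurable_const)
  have hΨint : Integrable Ψ := by
    refine ⟨hΨm.aestronglyMeasurable, lt_of_le_of_lt (lintegral_mono fun z => ?_) hΨ.lt_top⟩
    exact le_mul_of_one_le_right' (one_le_pow₀ (one_le_one_add_enorm z))
  have hx0 : ∀ i, ∫⁻ z, ‖Ψ z‖ₑ * ∫⁻ y, ‖k i q z (x - y)‖ₑ * ‖f i y‖ₑ < ∞ := fun i =>
    lt_of_le_of_lt (lintegral_mono fun z => mul_le_mul_left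
      (le_mul_of_one_le_right' (one_le_pow₀ (one_le_one_add_enorm z))) _) (hx i)
  have hFi : ∀ i, Integrable fun z => Ψ z * convOp (k i q z) (f i) x := fun i => by
    refine ⟨(hΨm.mul (hcm i)).aestronglyMeasurable, lt_of_le_of_lt (lintegral_mono fun z => ?_)
      (hx0 i)⟩
    rw [enorm_mul]
    gcongr
    exact enorm_convOp_le_absConv _ _ _
  have hprod : Integrable fun z => Ψ z * ∏ i, convOp (k i q z) (f i) x :=
    hf.integrable_mul_prod_convOp ENNReal.one_ne_top (fun i => hk.meas i q)
      (fun i => hk.isKer i q) hk.ne_top hΨm hN (hx n₀)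
  set e : ι → ℂ := fun i => c i * avg (q + a i) (f i) x with he
  have hb : ∀ i, Integrable fun z => (Ψ z * convOp (k i q z) (f i) x - Ψ z * e i) *
      ∏ j ∈ Finset.univ.erase i, e j := fun i => ((hFi i).sub (hΨint.mul_const _)).mul_const _
  have hbv : ∀ i, ∫ z, (Ψ z * convOp (k i q z) (f i) x - Ψ z * e i) *
      ∏ j ∈ Finset.univ.erase i, e j = convOp (mixKer Ψ (k i q)) (f i) x *
      ∏ j ∈ Finset.univ.erase i, e j := fun i => by
    rw [integral_mul_const, integral_sub (hFi i) (hΨint.mul_const _), integral_mul_const, hΨ0,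
      zero_mul, sub_zero, integral_mul_convOp_eq hΨm (hk.meas i q) (hf.meas i) (hx0 i)]
  have hrem : ∀ z, Ψ z * remTerm a c k f q z x = (Ψ z * ∏ i, convOp (k i q z) (f i) x -
      Ψ z * ∏ i, e i) - ∑ i, (Ψ z * convOp (k i q z) (f i) x - Ψ z * e i) *
      ∏ j ∈ Finset.univ.erase i, e j := fun z => by
    rw [remTerm, mul_sub, mul_sub, Finset.mul_sum]
    congr 1
    refine Finset.sum_congr rfl fun i _ => ?_
    rw [← mul_assoc, mul_sub]
  simp only [hrem]
  rw [integral_sub (f := fun z => Ψ z * ∏ i, convOp (k i q z) (f i) x - Ψ z * ∏ i, e i)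
    (hprod.sub (hΨint.mul_const _)) (integrable_finsetSum _ fun i _ => hb i),
    integral_sub hprod (hΨint.mul_const _), integral_mul_const, hΨ0, zero_mul, sub_zero,
    integral_finsetSum _ fun i _ => hb i, Finset.sum_congr rfl fun i _ => hbv i]
  ring

theorem mainConst_mono (d : ℕ) : Monotone (mainConst d) := fun c c' h => by
  have hmono : Monotone abelConst := monotone_nat_of_le_succ fun n => le_add_self
  have := hmono h
  unfold mainConst
  gcongr

/-- The mixed kernel has mean zero, so convolution with it equals its `difKer` operator and the
single term estimates apply, with the masses c j moved into the coefficients. The two cases are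
whether the L² function or a bounded one is convolved; in the second, the L² function must be
averaged at the coarsest scale. -/
theorem KerFamily.eLpNorm_single_le (hk : KerFamily n₀ a B c k) (hf : Inputs n₀ 1 f)
    (hΨm : Measurable Ψ) (hΨ : wt Ψ (Fintype.card ι) ≠ ∞) (hΨ0 : ∫ z, Ψ z = 0) {l : ℕ → ℂ}
    {Λ : ℝ≥0∞} (hl : ∀ q, ‖l q‖ₑ ≤ Λ) (K : ℕ) (i : ι) :
    eLpNorm (fun x => ∑ q ∈ Finset.range K, l q * (convOp (mixKer Ψ (k i q)) (f i) x *
      ∏ j ∈ Finset.univ.erase i, c j * avg (q + a j) (f j) x)) 2 ≤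
      mainConst d (Fintype.card ι) *
        (Λ * wt Ψ (Fintype.card ι) * (∏ j, B j) * eLpNorm (f n₀) 2) := by
  have hcard : 1 ≤ Fintype.card ι := Fintype.card_pos_iff.2 ⟨n₀⟩
  have hΨ1 : wt Ψ 1 ≠ ∞ := ne_top_of_le_ne_top hΨ (wt_mono Ψ hcard)
  have hΨ1' : ∫⁻ z, ‖Ψ z‖ₑ * (1 + ‖z‖ₑ) ≠ ∞ := by rwa [← wt_one]
  have hker : ∀ q : ℕ, IsKer (q + a i) (B i * wt Ψ 1) (mixKer Ψ (k i q)) := fun q => by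
    rw [wt_one]
    exact isKer_mixKer hΨm (hk.meas i q) (hk.isKer i q) (hk.ne_top i) hΨ1'
  have hBt : B i * wt Ψ 1 ≠ ∞ := ENNReal.mul_ne_top (hk.ne_top i) hΨ1
  have hconv : ∀ q : ℕ, convOp (mixKer Ψ (k i q)) (f i) =
      kerOp (difKer (q + a i) (mixKer Ψ (k i q))) (f i) := fun q =>
    convOp_eq_kerOp_difKer _ (integral_mixKer_eq_zero hΨm (hk.meas i q) (hk.isKer i q)
      (hk.ne_top i) hΨ1' (hk.mass i q) hΨ0)
  set P := ∏ j ∈ Finset.univ.erase i, c j with hP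
  have hl' : ∀ q, ‖l q * P‖ₑ ≤ Λ * ∏ j ∈ Finset.univ.erase i, B j := fun q => by
    rw [enorm_mul, hP, enorm_finset_prod]
    gcongr with j _
    · exact hl q
    · exact hk.enorm_mass_le j
  have hfin : mainConst d (Fintype.card ι) * (Λ * (∏ j ∈ Finset.univ.erase i, B j) *
      (B i * wt Ψ 1) * eLpNorm (f n₀) 2) ≤ mainConst d (Fintype.card ι) *
        (Λ * wt Ψ (Fintype.card ι) * (∏ j, B j) * eLpNorm (f n₀) 2) := by
    rw [← Finset.mul_prod_erase _ B (Finset.mem_univ i)]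
    calc _ = mainConst d (Fintype.card ι) * (Λ * wt Ψ 1 *
          (B i * ∏ j ∈ Finset.univ.erase i, B j) * eLpNorm (f n₀) 2) := by ring
      _ ≤ _ := by
        gcongr
        exact wt_mono Ψ hcard
  by_cases hi : i = n₀
  · subst hi
    have h1 := eLpNorm_sum_kerOp_mul_avgProd_le (a := a) (s := Finset.univ.erase i) hf.meas
      (fun j hj => hf.bdd j (Finset.ne_of_mem_erase hj)) (hf.meas i) hf.memLp hker hBt hl' K
    refine le_trans (le_of_eq ?_) (h1.trans ((mul_le_mul_left
      (mainConst_mono d (Finset.card_le_univ _)) _).trans hfin))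
    congr 1
    ext x
    refine Finset.sum_congr rfl fun q _ => ?_
    rw [hconv, Finset.prod_mul_distrib, avgProd]
    ring
  · have h1 := eLpNorm_sum_kerOp_mul_avg_mul_avgProd_le (a := a)
      (s := (Finset.univ.erase i).erase n₀) hf.meas
      (fun j hj => hf.bdd j (Finset.ne_of_mem_erase hj)) (hk.le_last i) (hf.meas n₀) hf.memLp
      (hf.meas i) (hf.bdd i hi) hker hBt hl' K
    refine le_trans (le_of_eq ?_) (h1.trans ((mul_le_mul_left
      (mainConst_mono d (Finset.card_le_univ _)) _).trans hfin))
    congr 1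
    ext x
    refine Finset.sum_congr rfl fun q _ => ?_
    rw [hconv, Finset.prod_mul_distrib, avgProd,
      ← Finset.mul_prod_erase (Finset.univ.erase i) (fun j => avg (q + a j) (f j) x)
        (Finset.mem_erase.2 ⟨Ne.symm hi, Finset.mem_univ n₀⟩)]
    ring

/-- The constant in the bound for the sum over the scales. -/
def coreConst (d n : ℕ) : ℝ≥0∞ := n * mainConst d n + remConst d n

theorem coreConst_ne_top (d n : ℕ) : coreConst d n ≠ ∞ := by
  have := mainConst_ne_top d n
  have := remConst_ne_top d n
  unfold coreConst
  finiteness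

theorem KerFamily.enorm_remainder_le (hk : KerFamily n₀ a B c k) (hf : Inputs n₀ 1 f)
    (hΨm : Measurable Ψ) {l : ℕ → ℂ} {Λ : ℝ≥0∞} (hl : ∀ q, ‖l q‖ₑ ≤ Λ) (K : ℕ) (x : Rd d) :
    ‖∑ q ∈ Finset.range K, l q * ∫ z, Ψ z * remTerm a c k f q z x‖ₑ ≤
      Λ * ∫⁻ z, ‖Ψ z‖ₑ * ∑' q, ‖remTerm a c k f q z x‖ₑ := by
  have hmx : ∀ q, Measurable fun z => ‖Ψ z‖ₑ * ‖remTerm a c k f q z x‖ₑ := fun q =>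
    hΨm.enorm.fun_mul
      ((hk.measurable_remTerm hf q).comp (measurable_id.prodMk measurable_const)).enorm
  have h1 : ∀ q, ‖l q * ∫ z, Ψ z * remTerm a c k f q z x‖ₑ ≤
      Λ * ∫⁻ z, ‖Ψ z‖ₑ * ‖remTerm a c k f q z x‖ₑ := fun q => by
    rw [enorm_mul]
    refine mul_le_mul' (hl q) ((enorm_integral_le_lintegral_enorm _).trans_eq ?_)
    simp only [enorm_mul]
  simp only [← ENNReal.tsum_mul_left]
  rw [lintegral_tsum fun q => (hmx q).aemeasurable, ← ENNReal.tsum_mul_left]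
  exact ((enorm_sum_le _ _).trans (Finset.sum_le_sum fun q _ => h1 q)).trans
    (ENNReal.sum_le_tsum _)

theorem KerFamily.lintegral_remainder_sq_le (hk : KerFamily n₀ a B c k) (hf : Inputs n₀ 1 f)
    (hΨm : Measurable Ψ) :
    ∫⁻ x, (∫⁻ z, ‖Ψ z‖ₑ * ∑' q, ‖remTerm a c k f q z x‖ₑ) ^ 2 ≤
      (wt Ψ (Fintype.card ι) *
        (remConst d (Fintype.card ι) * ((∏ i, B i) * eLpNorm (f n₀) 2))) ^ 2 :=
  lintegral_lintegral_mul_sq_le (u := fun z x => ∑' q, ‖remTerm a c k f q z x‖ₑ) hΨm.enorm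
    (measurable_one_add_enorm_pow (d := d) (Fintype.card ι))
    (fun z => pow_ne_zero _ (by simp)) (fun z => ENNReal.pow_ne_top (one_add_enorm_ne_top z))
    (Measurable.tsum fun q => (hk.measurable_remTerm hf q).enorm)
    (hk.lintegral_tsum_remTerm_sq_le hf)

theorem eLpNorm_two_le_mul_of_le {F : Rd d → ℂ} {u : Rd d → ℝ≥0∞} {Λ A : ℝ≥0∞} (hΛ : Λ ≠ ∞)
    (h : ∀ x, ‖F x‖ₑ ≤ Λ * u x) (hu : ∫⁻ x, u x ^ 2 ≤ A ^ 2) : eLpNorm F 2 ≤ Λ * A := by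
  refine eLpNorm_two_le_of_sq_le ?_
  calc ∫⁻ x, ‖F x‖ₑ ^ 2 ≤ ∫⁻ x, Λ ^ 2 * u x ^ 2 :=
        lintegral_mono fun x => by rw [← mul_pow]; exact pow_le_pow_left' (h x) 2
    _ = Λ ^ 2 * ∫⁻ x, u x ^ 2 := lintegral_const_mul' _ _ (ENNReal.pow_ne_top hΛ)
    _ ≤ Λ ^ 2 * A ^ 2 := mul_le_mul_right hu _
    _ = _ := (mul_pow _ _ _).symm

theorem mul_mul_assoc_le (Λ W C P E : ℝ≥0∞) : Λ * (W * (C * (P * E))) ≤ C * (Λ * W * P * E) :=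
  le_of_eq (by ring)

theorem KerFamily.eLpNorm_remainder_le (hk : KerFamily n₀ a B c k) (hf : Inputs n₀ 1 f)
    (hΨm : Measurable Ψ) {l : ℕ → ℂ} {Λ : ℝ≥0∞} (hΛ : Λ ≠ ∞) (hl : ∀ q, ‖l q‖ₑ ≤ Λ) (K : ℕ) :
    eLpNorm (fun x => ∑ q ∈ Finset.range K, l q * ∫ z, Ψ z * remTerm a c k f q z x) 2 ≤
      remConst d (Fintype.card ι) *
        (Λ * wt Ψ (Fintype.card ι) * (∏ j, B j) * eLpNorm (f n₀) 2) :=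
  (eLpNorm_two_le_mul_of_le hΛ (hk.enorm_remainder_le hf hΨm hl K)
    (hk.lintegral_remainder_sq_le hf hΨm)).trans (mul_mul_assoc_le _ _ _ _ _)

theorem eLpNorm_sum_add_le {ι : Type*} [Fintype ι] {S : ι → Rd d → ℂ} {R : Rd d → ℂ} (hS : ∀ i, Measurable (S i))
    (hR : Measurable R) {A C X : ℝ≥0∞} (hSA : ∀ i, eLpNorm (S i) 2 ≤ A * X)
    (hRC : eLpNorm R 2 ≤ C * X) :
    eLpNorm ((∑ i, S i) + R) 2 ≤ (Fintype.card ι * A + C) * X := by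
  have hSm' : Measurable (∑ i, S i) := by
    have : ∑ i, S i = fun x => ∑ i, S i x := by ext x; rw [Finset.sum_apply]
    rw [this]
    exact Finset.measurable_fun_sum _ fun i _ => hS i
  refine (eLpNorm_add_le hSm'.aestronglyMeasurable hR.aestronglyMeasurable one_le_two).trans ?_
  rw [add_mul]
  refine add_le_add ?_ hRC
  refine (eLpNorm_sum_le (fun i _ => (hS i).aestronglyMeasurable) one_le_two).trans ?_
  refine (Finset.sum_le_sum fun i _ => hSA i).trans_eq ?_
  rw [Finset.sum_const, Finset.card_univ, nsmul_eq_mul, mul_assoc]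

theorem measurable_mixKer {K : Rd d → Rd d → ℂ} (hΨm : Measurable Ψ)
    (hKm : Measurable (Function.uncurry K)) : Measurable (mixKer Ψ K) :=
  (StronglyMeasurable.integral_prod_right' (measurable_mul_ker hΨm hKm).stronglyMeasurable).measurable

theorem measurable_convOp_const {κ g : Rd d → ℂ} (hκ : Measurable κ) (hg : Measurable g) :
    Measurable (convOp κ g) := by
  have h := measurable_convOp (H := fun _ : Rd d => κ) (hκ.comp measurable_snd) hg
  exact h.comp ((measurable_const : Measurable fun _ : Rd d => (0 : Rd d)).prodMk measurable_id)

theorem measurable_prod_mul_avg {ι : Type*} (s : Finset ι) (c : ι → ℂ) (r : ι → ℤ) (f : ι → Rd d → ℂ) :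
    Measurable fun x => ∏ j ∈ s, c j * avg (r j) (f j) x :=
  Finset.measurable_fun_prod _ fun _ _ => (cubeConst_avg _ _).measurable.const_mul _

theorem KerFamily.measurable_single (hk : KerFamily n₀ a B c k) (hf : Inputs n₀ 1 f)
    (hΨm : Measurable Ψ) (l : ℕ → ℂ) (K : ℕ) (i : ι) :
    Measurable fun x => ∑ q ∈ Finset.range K, l q * (convOp (mixKer Ψ (k i q)) (f i) x *
      ∏ j ∈ Finset.univ.erase i, c j * avg (q + a j) (f j) x) := by
  have h1 := fun q => measurable_convOp_const (measurable_mixKer hΨm (hk.meas i q)) (hf.meas i)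
  have h2 := fun q : ℕ => measurable_prod_mul_avg (Finset.univ.erase i) c (fun j => q + a j) f
  exact Finset.measurable_fun_sum _ fun q _ => ((h1 q).mul (h2 q)).const_mul _

theorem KerFamily.measurable_remainder (hk : KerFamily n₀ a B c k) (hf : Inputs n₀ 1 f)
    (hΨm : Measurable Ψ) (l : ℕ → ℂ) (K : ℕ) :
    Measurable fun x => ∑ q ∈ Finset.range K, l q * ∫ z, Ψ z * remTerm a c k f q z x :=
  Finset.measurable_fun_sum _ fun q _ => Measurable.const_mul
    (StronglyMeasurable.integral_prod_right'
      (f := fun p : Rd d × Rd d => Ψ p.2 * remTerm a c k f q p.2 p.1)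
      ((hΨm.comp measurable_snd).mul
        ((hk.measurable_remTerm hf q).comp measurable_swap)).stronglyMeasurable).measurable _

/-- The bound for the sum over the scales, uniform in the number of scales. -/
theorem KerFamily.eLpNorm_sum_integral_prod_le (hk : KerFamily n₀ a B c k) (hf : Inputs n₀ 1 f)
    (hΨm : Measurable Ψ) (hΨ : wt Ψ (Fintype.card ι) ≠ ∞) (hΨ0 : ∫ z, Ψ z = 0) {l : ℕ → ℂ}
    {Λ : ℝ≥0∞} (hΛ : Λ ≠ ∞) (hl : ∀ q, ‖l q‖ₑ ≤ Λ) (K : ℕ) :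
    eLpNorm (fun x => ∑ q ∈ Finset.range K, l q *
      ∫ z, Ψ z * ∏ i, convOp (k i q z) (f i) x) 2 ≤
      coreConst d (Fintype.card ι) *
        (Λ * wt Ψ (Fintype.card ι) * (∏ j, B j) * eLpNorm (f n₀) 2) := by
  have hae : (fun x => ∑ q ∈ Finset.range K, l q * ∫ z, Ψ z * ∏ i, convOp (k i q z) (f i) x)
      =ᵐ[volume] (∑ i, fun x => ∑ q ∈ Finset.range K,
        l q * (convOp (mixKer Ψ (k i q)) (f i) x *
          ∏ j ∈ Finset.univ.erase i, c j * avg (q + a j) (f j) x)) +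
        fun x => ∑ q ∈ Finset.range K, l q * ∫ z, Ψ z * remTerm a c k f q z x := by
    filter_upwards [ae_all_iff.2 fun q => hk.ae_integral_prod_eq hf hΨm hΨ hΨ0 q] with x hx
    rw [Pi.add_apply, Finset.sum_apply]
    simp only [hx]
    rw [Finset.sum_comm, ← Finset.sum_add_distrib]
    refine Finset.sum_congr rfl fun q _ => ?_
    rw [mul_add, Finset.mul_sum]
  rw [eLpNorm_congr_ae hae]
  exact eLpNorm_sum_add_le (fun i => hk.measurable_single hf hΨm l K i)
    (hk.measurable_remainder hf hΨm l K) (fun i => hk.eLpNorm_single_le hf hΨm hΨ hΨ0 hl K i)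
    (hk.eLpNorm_remainder_le hf hΨm hΛ hl K)

end Core

/-! ### Dilated and translated kernels. -/

section Dilates

/-- The dilate of `ζ` by `τ`, translated by `ρ τ z`. -/
def scaleKer (ζ : Rd d → ℂ) (ρ τ : ℝ) (z w : Rd d) : ℂ := dilate ζ τ (w - (ρ * τ) • z)

variable {ζ : Rd d → ℂ} {ρ τ : ℝ} {B : ℝ≥0∞}

theorem measurable_dilate (hζ : Measurable ζ) :
    Measurable fun p : ℝ × Rd d => dilate ζ p.1 p.2 := by
  have h1 : Measurable fun p : ℝ × Rd d => ((|p.1| ^ d)⁻¹ : ℝ) :=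
    ((measurable_fst.abs).pow_const d).inv
  exact h1.smul (hζ.comp (measurable_fst.inv.smul measurable_snd))

theorem measurable_scaleKer (hζ : Measurable ζ) (ρ lam : ℝ) :
    Measurable fun p : (ℝ × Rd d) × Rd d => scaleKer ζ ρ (lam * p.1.1) p.1.2 p.2 := by
  have h1 : Measurable fun p : (ℝ × Rd d) × Rd d => lam * p.1.1 :=
    (measurable_fst.comp measurable_fst).const_mul lam
  exact (measurable_dilate hζ).comp (h1.prodMk
    (measurable_snd.sub ((h1.const_mul ρ).smul (measurable_snd.comp measurable_fst))))

theorem measurable_scaleKer_right (hζ : Measurable ζ) (ρ τ : ℝ) :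
    Measurable (Function.uncurry (scaleKer ζ ρ τ)) := by
  have := (measurable_scaleKer hζ ρ 1).comp
    (((measurable_const (a := τ)).prodMk measurable_fst).prodMk measurable_snd :
      Measurable fun p : Rd d × Rd d => ((τ, p.1), p.2))
  change Measurable fun p : Rd d × Rd d => scaleKer ζ ρ τ p.1 p.2
  simpa [Function.comp_def] using this

theorem enorm_dilate (ζ : Rd d → ℂ) (τ : ℝ) (w : Rd d) :
    ‖dilate ζ τ w‖ₑ = ENNReal.ofReal ((|τ| ^ d)⁻¹) * ‖ζ (τ⁻¹ • w)‖ₑ := by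
  rw [dilate, enorm_smul, Real.enorm_of_nonneg (by positivity)]

theorem lintegral_dilate_comp (hτ : τ ≠ 0) (g : Rd d → ℝ≥0∞) :
    ∫⁻ w, ENNReal.ofReal ((|τ| ^ d)⁻¹) * g (τ⁻¹ • w) = ∫⁻ w, g w := by
  have he : MeasurableEmbedding fun w : Rd d => τ⁻¹ • w :=
    (Homeomorph.smulOfNeZero τ⁻¹ (inv_ne_zero hτ)).measurableEmbedding
  have hτd : 0 < |τ| ^ d := pow_pos (abs_pos.2 hτ) d
  rw [lintegral_const_mul' _ _ ENNReal.ofReal_ne_top, ← he.lintegral_map,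
    Measure.map_addHaar_smul volume (inv_ne_zero hτ), lintegral_smul_measure, smul_eq_mul,
    ← mul_assoc, ← ENNReal.ofReal_mul (by positivity), finrank_euclideanSpace_fin, inv_pow,
    inv_inv, abs_pow, inv_mul_cancel₀ hτd.ne', ENNReal.ofReal_one, one_mul]

theorem integral_dilate (hτ : τ ≠ 0) (ζ : Rd d → ℂ) : ∫ w, dilate ζ τ w = ∫ w, ζ w := by
  simp only [dilate]
  have hτd : 0 < |τ| ^ d := pow_pos (abs_pos.2 hτ) d
  rw [integral_smul, Measure.integral_comp_smul, finrank_euclideanSpace_fin, inv_pow, inv_inv,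
    abs_pow, smul_smul, inv_mul_cancel₀ hτd.ne', one_smul]

theorem integral_scaleKer (hτ : τ ≠ 0) (ζ : Rd d → ℂ) (ρ : ℝ) (z : Rd d) :
    ∫ w, scaleKer ζ ρ τ z w = ∫ w, ζ w := by
  simp only [scaleKer]
  rw [integral_sub_right_eq_self (fun w => dilate ζ τ w), integral_dilate hτ]

theorem lintegral_scaleKer (hτ : τ ≠ 0) (ζ : Rd d → ℂ) (ρ : ℝ) (z : Rd d) :
    ∫⁻ w, ‖scaleKer ζ ρ τ z w‖ₑ = ∫⁻ w, ‖ζ w‖ₑ := by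
  simp only [scaleKer]
  rw [lintegral_sub_right_eq_self (fun w => ‖dilate ζ τ w‖ₑ)]
  simp only [enorm_dilate]
  rw [lintegral_dilate_comp hτ fun w => ‖ζ w‖ₑ]

/-- Dilation by τ moves the scale from 1 to about 2^s, with a loss of at most 4. The translation
does not affect the L¹ norm or the modulus of continuity; it enlarges the first moment by at most
|τ| |z| since ρ ≤ 1. This accounts for the factor 1 + |z| and for the uniformity in ρ. -/
theorem isKer_scaleKer (hζ : IsKer 0 B ζ) {s : ℤ} (h1 : (2 : ℝ) ^ s ≤ |τ|)
    (h2 : |τ| ≤ 4 * 2 ^ s) (hρ : 0 < ρ) (hρ1 : ρ ≤ 1) (z : Rd d) :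
    IsKer s (4 * B * (1 + ‖z‖ₑ)) (scaleKer ζ ρ τ z) := by
  have hs : (0 : ℝ) < 2 ^ s := by positivity
  have hτ : τ ≠ 0 := fun h => by rw [h, abs_zero] at h1; linarith
  set C : ℝ≥0∞ := ENNReal.ofReal ((|τ| ^ d)⁻¹) with hC
  have hm : Measurable (scaleKer ζ ρ τ z) :=
    (measurable_dilate hζ.meas).comp (measurable_const.prodMk (measurable_id.sub_const _))
  have hB : B ≤ 4 * B * (1 + ‖z‖ₑ) := by
    calc B = 1 * B * 1 := by ring
      _ ≤ 4 * B * (1 + ‖z‖ₑ) := by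
        gcongr
        · norm_num
        · exact one_le_one_add_enorm z
  have hsh : ∀ g : Rd d → ℝ≥0∞, ∫⁻ w, g (w - (ρ * τ) • z) = ∫⁻ w, g w := fun g =>
    lintegral_sub_right_eq_self g _
  have hτe : ‖τ‖ₑ ≤ 4 * p2 s := by
    rw [← ofReal_norm, p2, Real.norm_eq_abs]
    refine (ENNReal.ofReal_le_ofReal h2).trans_eq ?_
    rw [ENNReal.ofReal_mul (by norm_num)]
    norm_num
  refine ⟨hm, ?_, ?_, fun h => ?_⟩
  · rw [lintegral_scaleKer hτ]
    exact hζ.lint.trans hB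
  · have e1 : ∀ w, ‖scaleKer ζ ρ τ z w‖ₑ * ‖w‖ₑ = (fun w => ‖dilate ζ τ w‖ₑ *
        ‖w + (ρ * τ) • z‖ₑ) (w - (ρ * τ) • z) := fun w => by simp [scaleKer]
    have e2 : ∀ w, ‖dilate ζ τ w‖ₑ * ‖w + (ρ * τ) • z‖ₑ ≤
        C * (fun u => ‖τ‖ₑ * (‖ζ u‖ₑ * ‖u‖ₑ + ‖ζ u‖ₑ * ‖z‖ₑ)) (τ⁻¹ • w) := fun w => by
      rw [enorm_dilate, mul_assoc]
      refine mul_le_mul_right ?_ _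
      have e3 : ‖w + (ρ * τ) • z‖ₑ ≤ ‖τ‖ₑ * (‖τ⁻¹ • w‖ₑ + ‖z‖ₑ) := by
        have : w = τ • (τ⁻¹ • w) := by rw [smul_smul, mul_inv_cancel₀ hτ, one_smul]
        calc ‖w + (ρ * τ) • z‖ₑ ≤ ‖w‖ₑ + ‖(ρ * τ) • z‖ₑ := enorm_add_le _ _
          _ ≤ ‖τ‖ₑ * ‖τ⁻¹ • w‖ₑ + ‖τ‖ₑ * ‖z‖ₑ := by
            refine add_le_add ?_ ?_
            · conv_lhs => rw [this, enorm_smul]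
            · rw [enorm_smul, enorm_mul]
              refine mul_le_mul_left (mul_le_of_le_one_left' ?_) _
              rw [← ofReal_norm, Real.norm_of_nonneg hρ.le]
              exact ENNReal.ofReal_le_one.2 hρ1
          _ = _ := by rw [mul_add]
      calc ‖ζ (τ⁻¹ • w)‖ₑ * ‖w + (ρ * τ) • z‖ₑ
          ≤ ‖ζ (τ⁻¹ • w)‖ₑ * (‖τ‖ₑ * (‖τ⁻¹ • w‖ₑ + ‖z‖ₑ)) := mul_le_mul_right e3 _
        _ = _ := by ring
    simp only [e1]
    rw [hsh fun w => ‖dilate ζ τ w‖ₑ * ‖w + (ρ * τ) • z‖ₑ]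
    refine (lintegral_mono e2).trans ?_
    rw [lintegral_dilate_comp hτ fun u => ‖τ‖ₑ * (‖ζ u‖ₑ * ‖u‖ₑ + ‖ζ u‖ₑ * ‖z‖ₑ), lintegral_const_mul' _ _ enorm_ne_top,
      lintegral_add_left (hζ.meas.enorm.fun_mul measurable_enorm),
      lintegral_mul_const' _ _ enorm_ne_top]
    calc ‖τ‖ₑ * ((∫⁻ w, ‖ζ w‖ₑ * ‖w‖ₑ) + (∫⁻ w, ‖ζ w‖ₑ) * ‖z‖ₑ)
        ≤ 4 * p2 s * (B * p2 0 + B * ‖z‖ₑ) := by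
          gcongr
          · exact hζ.moment
          · exact hζ.lint
      _ = _ := by rw [p2_zero]; ring
  · have e1 : ∀ w, ‖scaleKer ζ ρ τ z (w + h) - scaleKer ζ ρ τ z w‖ₑ =
        (fun w => C * (fun u => ‖ζ (u + τ⁻¹ • h) - ζ u‖ₑ) (τ⁻¹ • w)) (w - (ρ * τ) • z) :=
      fun w => by
        simp only [scaleKer, dilate]
        rw [← smul_sub, enorm_smul, Real.enorm_of_nonneg (by positivity),
          show w + h - (ρ * τ) • z = (w - (ρ * τ) • z) + h by abel, smul_add]
    simp only [e1]
    rw [hsh fun w => C * (fun u => ‖ζ (u + τ⁻¹ • h) - ζ u‖ₑ) (τ⁻¹ • w),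
      lintegral_dilate_comp hτ fun u => ‖ζ (u + τ⁻¹ • h) - ζ u‖ₑ]
    refine (hζ.shift _).trans ?_
    have hτi : ‖τ⁻¹‖ₑ ≤ p2 (-s) := by
      rw [← ofReal_norm, p2, norm_inv, zpow_neg, Real.norm_eq_abs]
      exact ENNReal.ofReal_le_ofReal (inv_anti₀ hs h1)
    rw [neg_zero, p2_zero, mul_one, enorm_smul, ← mul_assoc]
    gcongr

end Dilates

/-! ### The model operator as a superposition of kernel families. -/

section Family

variable {n : ℕ} {n₀ : Fin n} {Ψ : Rd d → ℂ} {Φ : Fin n → Rd d → ℂ} {B : Fin n → ℝ≥0∞}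
  {ρ lam : Fin n → ℝ}

/-- The conditions on the data of the model operator that the estimates use. -/
structure ModelData (n₀ : Fin n) (Ψ : Rd d → ℂ) (Φ : Fin n → Rd d → ℂ) (B : Fin n → ℝ≥0∞)
    (ρ lam : Fin n → ℝ) : Prop where
  measΨ : Measurable Ψ
  wtΨ : wt Ψ n ≠ ∞
  intΨ : ∫ z, Ψ z = 0
  ker : ∀ i, IsKer 0 (B i) (Φ i)
  ne_top : ∀ i, B i ≠ ∞
  rho_pos : ∀ i, 0 < ρ i
  rho_le : ∀ i, ρ i ≤ 1
  lam_ne : ∀ i, lam i ≠ 0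
  lam_le : ∀ i, |lam i| ≤ |lam n₀|

/-- The average at the scale `t`, written as an integral in `y / t`. -/
def scaleInt (Ψ : Rd d → ℂ) (Φ : Fin n → Rd d → ℂ) (ρ lam : Fin n → ℝ) (f : Fin n → Rd d → ℂ)
    (t : ℝ) (x : Rd d) : ℂ :=
  ∫ z, Ψ z * ∏ i, convOp (scaleKer (Φ i) (ρ i) (lam i * t) z) (f i) x

theorem convolution_dilate_eq (ζ f : Rd d → ℂ) (ρ lam t : ℝ) (x z : Rd d) :
    (dilate ζ (lam * t) ⋆[ContinuousLinearMap.mul ℂ ℂ, volume] f) (x - (ρ * lam) • (t • z)) =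
      convOp (scaleKer ζ ρ (lam * t) z) f x := by
  rw [convolution_def, convOp, kerOp]
  set v := (ρ * lam) • (t • z) with hv
  have hv' : v = (ρ * (lam * t)) • z := by rw [hv, smul_smul, mul_assoc]
  rw [← integral_sub_left_eq_self (fun w => scaleKer ζ ρ (lam * t) z (x - w) * f w) volume (x - v)]
  refine integral_congr_ae (Eventually.of_forall fun w => ?_)
  simp only [ContinuousLinearMap.mul_apply', scaleKer, ← hv']
  rw [show x - (x - v - w) - v = w by abel]

/-- The substitution y = t z, after which the translation ρ λ y is measured in units of the scale λ
t of the kernel. -/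
theorem scaleAverage_eq {t : ℝ} (ht : 0 < t) (Ψ : Rd d → ℂ) (Φ : Fin n → Rd d → ℂ)
    (ρ lam : Fin n → ℝ) (f : Fin n → Rd d → ℂ) (x : Rd d) :
    scaleAverage Ψ Φ ρ lam f t x = scaleInt Ψ Φ ρ lam f t x := by
  rw [scaleAverage, scaleInt]
  set F : Rd d → ℂ := fun z => Ψ z * ∏ i, convOp (scaleKer (Φ i) (ρ i) (lam i * t) z) (f i) x
    with hF
  rw [← integral_dilate ht.ne' F]
  refine integral_congr_ae (Eventually.of_forall fun y => ?_)
  have hy : y = t • (t⁻¹ • y) := by rw [smul_smul, mul_inv_cancel₀ ht.ne', one_smul]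
  simp only [dilate, hF, smul_mul_assoc]
  congr 2
  refine Finset.prod_congr rfl fun i _ => ?_
  conv_lhs => rw [hy]
  exact convolution_dilate_eq _ _ _ _ _ _ _

theorem measurable_scaleInt (hΨ : Measurable Ψ) (hΦ : ∀ i, Measurable (Φ i))
    (ρ lam : Fin n → ℝ) {f : Fin n → Rd d → ℂ} (hf : ∀ i, Measurable (f i)) :
    Measurable (Function.uncurry (scaleInt Ψ Φ ρ lam f)) := by
  have h1 : ∀ i, Measurable fun p : (ℝ × Rd d) × Rd d =>
      convOp (scaleKer (Φ i) (ρ i) (lam i * p.1.1) p.2) (f i) p.1.2 := fun i =>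
    (measurable_convOp (P := ℝ × Rd d)
      (H := fun p => scaleKer (Φ i) (ρ i) (lam i * p.1) p.2)
      (measurable_scaleKer (hΦ i) (ρ i) (lam i)) (hf i)).comp
      (((measurable_fst.comp measurable_fst).prodMk measurable_snd).prodMk
        (measurable_snd.comp measurable_fst))
  exact (StronglyMeasurable.integral_prod_right'
    (f := fun p : (ℝ × Rd d) × Rd d => Ψ p.2 *
      ∏ i, convOp (scaleKer (Φ i) (ρ i) (lam i * p.1.1) p.2) (f i) p.1.2)
    ((hΨ.comp measurable_snd).mul
      (Finset.measurable_fun_prod _ fun i _ => h1 i)).stronglyMeasurable).measurable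

/-- Rounding |λ i| down to a power of 2 and 1 ≤ θ ≤ 2 together leave a factor between 1 and 4 over
2^(q + a i). Monotonicity of the integer logarithm turns the maximality of |λ n₀| into `le_last`. -/
theorem ModelData.kerFamily (h : ModelData n₀ Ψ Φ B ρ lam) (N : ℤ) {θ : ℝ} (h1 : 1 ≤ θ)
    (h2 : θ ≤ 2) :
    KerFamily n₀ (fun i => Int.log 2 |lam i| - N) (fun i => 4 * B i) (fun i => ∫ w, Φ i w)
      (fun i q => scaleKer (Φ i) (ρ i) (lam i * (2 ^ ((q : ℤ) - N) * θ))) := by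
  refine ⟨fun i q => measurable_scaleKer_right (h.ker i).meas _ _, fun i q z => ?_,
    fun i q z => integral_scaleKer ?_ _ _ _, fun i => ?_, fun i => ?_⟩
  · have hl : 0 < |lam i| := abs_pos.2 (h.lam_ne i)
    have e1 := Int.zpow_log_le_self one_lt_two hl
    have e2 := Int.lt_zpow_succ_log_self one_lt_two |lam i|
    have e3 : |lam i * (2 ^ ((q : ℤ) - N) * θ)| = |lam i| * 2 ^ ((q : ℤ) - N) * θ := by
      rw [abs_mul, abs_of_nonneg (by positivity : (0 : ℝ) ≤ 2 ^ ((q : ℤ) - N) * θ), mul_assoc]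
    have hpos : (0 : ℝ) < 2 ^ ((q : ℤ) - N) := by positivity
    push_cast at e1 e2
    have e4 : (2 : ℝ) ^ ((q : ℤ) + (Int.log 2 |lam i| - N)) =
        2 ^ (Int.log 2 |lam i|) * 2 ^ ((q : ℤ) - N) := by
      rw [← zpow_add₀ two_ne_zero]; congr 1; ring
    refine isKer_scaleKer (h.ker i) ?_ ?_ (h.rho_pos i) (h.rho_le i) z
    · rw [e3, e4]
      calc (2 : ℝ) ^ (Int.log 2 |lam i|) * 2 ^ ((q : ℤ) - N)
          = 2 ^ (Int.log 2 |lam i|) * 2 ^ ((q : ℤ) - N) * 1 := (mul_one _).symm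
        _ ≤ _ := by gcongr
    · rw [e3, e4]
      rw [zpow_add₀ two_ne_zero, zpow_one] at e2
      calc |lam i| * 2 ^ ((q : ℤ) - N) * θ
          ≤ (2 ^ (Int.log 2 |lam i|) * 2) * 2 ^ ((q : ℤ) - N) * 2 := by gcongr
        _ = _ := by ring
  · have : (0 : ℝ) < 2 ^ ((q : ℤ) - N) * θ := by positivity
    exact mul_ne_zero (h.lam_ne i) this.ne'
  · have := Int.log_mono_right (b := 2) (abs_pos.2 (h.lam_ne i)) (h.lam_le i)
    lia
  · exact ENNReal.mul_ne_top (by norm_num) (h.ne_top i)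

end Family

/-! ### From integrals in dt/t to sums over dyadic scales. -/

section Scales

theorem ae_integrableOn_div {H : ℝ → Rd d → ℂ} (hH : Measurable (Function.uncurry H)) {A : ℝ≥0∞}
    (hA : A ≠ ∞) (h : ∀ t, 0 < t → eLpNorm (H t) 2 ≤ A) {a : ℝ} (ha : 0 < a) (b : ℝ) :
    ∀ᵐ x, IntegrableOn (fun t => H t x / (t : ℂ)) (Ioc a b) := by
  have hHt : Measurable fun p : Rd d × ℝ => H p.2 p.1 := hH.comp measurable_swap
  have hHx : ∀ x, Measurable fun t => H t x := fun x => hH.comp (measurable_id.prodMk measurable_const)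
  set V := (volume.restrict (Ioc a b)) univ with hV
  have hVt : V ≠ ∞ := by simp [hV]
  have h1 : ∫⁻ x, (∫⁻ t in Ioc a b, ‖H t x‖ₑ) ^ 2 ≤ V * (V * A ^ 2) := by
    calc ∫⁻ x, (∫⁻ t in Ioc a b, ‖H t x‖ₑ) ^ 2
        ≤ ∫⁻ x, V * ∫⁻ t in Ioc a b, ‖H t x‖ₑ ^ 2 :=
          lintegral_mono fun x => lintegral_sq_le (hHx x).enorm.aemeasurable
      _ = V * ∫⁻ t in Ioc a b, ∫⁻ x, ‖H t x‖ₑ ^ 2 := by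
          rw [lintegral_const_mul' _ _ hVt,
            lintegral_lintegral_swap (hHt.enorm.pow_const 2).aemeasurable]
      _ ≤ V * ∫⁻ t in Ioc a b, A ^ 2 := by
          refine mul_le_mul_right (setLIntegral_mono measurable_const fun t ht => ?_) _
          rw [← eLpNorm_two_sq]
          exact pow_le_pow_left' (h t (ha.trans ht.1)) 2
      _ = _ := by rw [lintegral_const, mul_comm (A ^ 2)]
  have hm : Measurable fun x => ∫⁻ t in Ioc a b, ‖H t x‖ₑ :=
    Measurable.lintegral_prod_right' (f := fun p : Rd d × ℝ => ‖H p.2 p.1‖ₑ) hHt.enorm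
  filter_upwards [ae_lt_top (hm.pow_const 2) (h1.trans_lt (by finiteness)).ne] with x hx
  have hx' := (ENNReal.pow_lt_top_iff.1 hx).resolve_right two_ne_zero
  refine ⟨((hHx x).div Complex.measurable_ofReal).aestronglyMeasurable, ?_⟩
  refine lt_of_le_of_lt (setLIntegral_mono' measurableSet_Ioc (g := fun t => ENNReal.ofReal a⁻¹ *
    ‖H t x‖ₑ) fun t ht => ?_) ?_
  · change ‖H t x / (t : ℂ)‖ₑ ≤ _
    rw [div_eq_mul_inv, enorm_mul, mul_comm]
    refine mul_le_mul_left ?_ _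
    rw [← ofReal_norm, norm_inv, Complex.norm_real, Real.norm_of_nonneg (ha.trans ht.1).le]
    exact ENNReal.ofReal_le_ofReal (inv_anti₀ ha ht.1.le)
  · rw [lintegral_const_mul' _ _ ENNReal.ofReal_ne_top]
    exact ENNReal.mul_lt_top ENNReal.ofReal_lt_top hx'

theorem zpow_two_mono {m n : ℤ} (h : m ≤ n) : (2 : ℝ) ^ m ≤ 2 ^ n := zpow_le_zpow_right₀ one_le_two h

/-- The measure dt/t is invariant under dilations, so each dyadic interval is rescaled to (1, 2]. -/
theorem setIntegral_div_eq_sum {H : ℝ → ℂ} (N : ℤ) (K : ℕ)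
    (h : IntegrableOn (fun t => H t / (t : ℂ)) (Ioc (2 ^ (-N)) (2 ^ ((K : ℤ) - N)))) :
    ∫ t in Ioc ((2 : ℝ) ^ (-N)) (2 ^ ((K : ℤ) - N)), H t / (t : ℂ) =
      ∫ θ in Ioc (1 : ℝ) 2, (∑ q ∈ Finset.range K, H (2 ^ ((q : ℤ) - N) * θ)) / (θ : ℂ) := by
  have hsub : ∀ q < K, Ioc ((2 : ℝ) ^ ((q : ℤ) - N)) (2 ^ (((q + 1 : ℕ) : ℤ) - N)) ⊆
      Ioc (2 ^ (-N)) (2 ^ ((K : ℤ) - N)) := fun q hq =>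
    Ioc_subset_Ioc (zpow_two_mono (by lia)) (zpow_two_mono (by lia))
  have hle : ∀ q : ℕ, (2 : ℝ) ^ ((q : ℤ) - N) ≤ 2 ^ (((q + 1 : ℕ) : ℤ) - N) := fun q =>
    zpow_two_mono (by lia)
  have hint : ∀ q < K, IntervalIntegrable (fun t => H t / (t : ℂ)) volume
      ((2 : ℝ) ^ ((q : ℤ) - N)) (2 ^ (((q + 1 : ℕ) : ℤ) - N)) := fun q hq =>
    (intervalIntegrable_iff_integrableOn_Ioc_of_le (hle q)).2 (h.mono_set (hsub q hq))
  have h1 := intervalIntegral.sum_integral_adjacent_intervals (n := K) hint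
  have h2 : ∀ q : ℕ, (2 : ℝ) ^ (((q + 1 : ℕ) : ℤ) - N) = 2 ^ ((q : ℤ) - N) * 2 := fun q => by
    rw [← zpow_add_one₀ two_ne_zero]; congr 1; push_cast; ring
  have hpos : ∀ q : ℕ, (0 : ℝ) < 2 ^ ((q : ℤ) - N) := fun q => by positivity
  have h3 : ∀ q : ℕ, ∫ t in (2 : ℝ) ^ ((q : ℤ) - N)..2 ^ (((q + 1 : ℕ) : ℤ) - N), H t / (t : ℂ) =
      ∫ θ in (1 : ℝ)..2, H (2 ^ ((q : ℤ) - N) * θ) / (θ : ℂ) := fun q => by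
    have := intervalIntegral.smul_integral_comp_mul_left (fun t => H t / (t : ℂ))
      ((2 : ℝ) ^ ((q : ℤ) - N)) (a := 1) (b := 2)
    rw [mul_one, ← h2] at this
    rw [← this, ← intervalIntegral.integral_smul]
    congr 1
    ext θ
    have hne : ((2 ^ ((q : ℤ) - N) : ℝ) : ℂ) ≠ 0 := Complex.ofReal_ne_zero.2 (hpos q).ne'
    rw [Complex.ofReal_mul, Complex.real_smul, mul_div_assoc', mul_div_mul_left _ _ hne]
  have h4 : ∀ q < K, IntervalIntegrable (fun θ : ℝ => H (2 ^ ((q : ℤ) - N) * θ) / (θ : ℂ)) volume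
      1 2 := fun q hq => by
    have := (hint q hq).comp_mul_left (c := (2 : ℝ) ^ ((q : ℤ) - N))
    rw [h2, div_self (hpos q).ne', mul_div_cancel_left₀ _ (hpos q).ne'] at this
    have := this.const_mul (((2 : ℝ) ^ ((q : ℤ) - N) : ℝ) : ℂ)
    refine this.congr ?_
    intro θ _
    have hne : ((2 ^ ((q : ℤ) - N) : ℝ) : ℂ) ≠ 0 := Complex.ofReal_ne_zero.2 (hpos q).ne'
    dsimp only
    rw [Complex.ofReal_mul, mul_div_assoc', mul_div_mul_left _ _ hne]
  rw [← intervalIntegral.integral_of_le (zpow_two_mono (by lia)),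
    ← intervalIntegral.integral_of_le one_le_two]
  simp only [Finset.sum_div]
  rw [intervalIntegral.integral_finsetSum fun q hq => h4 q (Finset.mem_range.1 hq),
    ← Finset.sum_congr rfl fun q _ => h3 q, h1]
  simp

/-- Cauchy–Schwarz on (1, 2], an interval of length one where 1/θ ≤ 1, and Tonelli transfer a bound
uniform in θ to the integral. The bound A' at single scales only serves to guarantee integrability
in t. -/
theorem eLpNorm_setIntegral_div_le {H : ℝ → Rd d → ℂ} (hH : Measurable (Function.uncurry H))
    {A A' : ℝ≥0∞} (hA' : A' ≠ ∞) (h1 : ∀ t, 0 < t → eLpNorm (H t) 2 ≤ A') (N : ℤ) (K : ℕ)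
    (h2 : ∀ θ : ℝ, 1 ≤ θ → θ ≤ 2 →
      eLpNorm (fun x => ∑ q ∈ Finset.range K, H (2 ^ ((q : ℤ) - N) * θ) x) 2 ≤ A) :
    eLpNorm (fun x => ∫ t in Ioc ((2 : ℝ) ^ (-N)) (2 ^ ((K : ℤ) - N)), H t x / (t : ℂ)) 2 ≤ A := by
  set S : ℝ → Rd d → ℂ := fun θ x => ∑ q ∈ Finset.range K, H (2 ^ ((q : ℤ) - N) * θ) x with hS
  have hSm : Measurable fun p : Rd d × ℝ => S p.2 p.1 :=
    Finset.measurable_fun_sum _ fun q _ => hH.comp ((measurable_snd.const_mul _).prodMk measurable_fst)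
  refine eLpNorm_two_le_of_sq_le ?_
  calc ∫⁻ x, ‖∫ t in Ioc ((2 : ℝ) ^ (-N)) (2 ^ ((K : ℤ) - N)), H t x / (t : ℂ)‖ₑ ^ 2
      ≤ ∫⁻ x, ∫⁻ θ in Ioc (1 : ℝ) 2, ‖S θ x‖ₑ ^ 2 := by
        refine lintegral_mono_ae ?_
        filter_upwards [ae_integrableOn_div hH hA' h1 (a := 2 ^ (-N)) (by positivity)
          (2 ^ ((K : ℤ) - N))] with x hx
        rw [setIntegral_div_eq_sum (H := fun t => H t x) N K hx]
        have hSx : Measurable fun θ => S θ x := hSm.comp (measurable_const.prodMk measurable_id)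
        have h3 : ‖∫ θ in Ioc (1 : ℝ) 2, S θ x / (θ : ℂ)‖ₑ ≤ ∫⁻ θ in Ioc (1 : ℝ) 2, ‖S θ x‖ₑ := by
          refine (enorm_integral_le_lintegral_enorm _).trans
            (setLIntegral_mono' measurableSet_Ioc fun θ hθ => ?_)
          rw [div_eq_mul_inv, enorm_mul]
          refine mul_le_of_le_one_right' ?_
          rw [← ofReal_norm, norm_inv, Complex.norm_real,
            Real.norm_of_nonneg (zero_le_one.trans hθ.1.le)]
          exact ENNReal.ofReal_le_one.2 (inv_le_one_of_one_le₀ hθ.1.le)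
        refine (pow_le_pow_left' h3 2).trans ((lintegral_sq_le hSx.enorm.aemeasurable).trans ?_)
        norm_num
    _ = ∫⁻ θ in Ioc (1 : ℝ) 2, ∫⁻ x, ‖S θ x‖ₑ ^ 2 :=
        lintegral_lintegral_swap (hSm.enorm.pow_const 2).aemeasurable
    _ ≤ ∫⁻ θ in Ioc (1 : ℝ) 2, A ^ 2 := by
        refine setLIntegral_mono measurable_const fun θ hθ => ?_
        rw [← eLpNorm_two_sq]
        exact pow_le_pow_left' (h2 θ hθ.1.le hθ.2) 2
    _ = A ^ 2 := by
        rw [lintegral_const, Measure.restrict_apply_univ, Real.volume_Ioc]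
        norm_num

end Scales

/-! ### The model operator with weights of compact support in the scale. -/

section Weights

variable {n : ℕ} {n₀ : Fin n} {Ψ : Rd d → ℂ} {Φ : Fin n → Rd d → ℂ} {B : Fin n → ℝ≥0∞}
  {ρ lam : Fin n → ℝ} {f : Fin n → Rd d → ℂ} {Λ M : ℝ≥0∞} {σ : ℝ → ℂ} {N : ℕ}

/-- A bounded function of the scale, supported in `(2^{-N}, 2^N]`. -/
structure Weight (Λ : ℝ≥0∞) (N : ℕ) (σ : ℝ → ℂ) : Prop where
  meas : Measurable σ
  bdd : ∀ t, ‖σ t‖ₑ ≤ Λ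
  supp : ∀ t ∉ Ioc ((2 : ℝ) ^ (-(N : ℤ))) (2 ^ (N : ℤ)), σ t = 0

theorem modelOp_eq (Ψ : Rd d → ℂ) (Φ : Fin n → Rd d → ℂ) (σ : ℝ → ℂ) (ρ lam : Fin n → ℝ)
    (f : Fin n → Rd d → ℂ) (x : Rd d) :
    modelOp Ψ Φ σ ρ lam f x = ∫ t in Ioi (0 : ℝ), σ t * scaleInt Ψ Φ ρ lam f t x / (t : ℂ) := by
  refine setIntegral_congr_fun measurableSet_Ioi fun t ht => ?_
  simp only [integrand]
  rw [scaleAverage_eq ht]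

theorem Weight.modelOp_eq (hσ : Weight Λ N σ) (x : Rd d) :
    modelOp Ψ Φ σ ρ lam f x = ∫ t in Ioc ((2 : ℝ) ^ (-(N : ℤ))) (2 ^ (N : ℤ)),
      σ t * scaleInt Ψ Φ ρ lam f t x / (t : ℂ) := by
  rw [ModelOperator.modelOp_eq]
  refine (setIntegral_eq_of_subset_of_forall_sdiff_eq_zero measurableSet_Ioi (fun t ht => ?_)
    fun t ht => ?_)
  · exact lt_trans (by positivity : (0 : ℝ) < 2 ^ (-(N : ℤ))) ht.1
  · rw [hσ.supp t ht.2, zero_mul, zero_div]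

/-- The constant in the bound for the model operator. -/
@[irreducible] def modelConst (Ψ : Rd d → ℂ) (B : Fin n → ℝ≥0∞) : ℝ≥0∞ :=
  coreConst d n * (wt Ψ n * ∏ i, (4 * B i))

theorem ModelData.modelConst_ne_top (h : ModelData n₀ Ψ Φ B ρ lam) : modelConst Ψ B ≠ ∞ := by
  rw [modelConst]
  exact ENNReal.mul_ne_top (coreConst_ne_top d n) (ENNReal.mul_ne_top h.wtΨ
    (ENNReal.prod_ne_top fun i _ => ENNReal.mul_ne_top (by norm_num) (h.ne_top i)))

theorem const_mul_rearrange (c Λ W P E : ℝ≥0∞) : c * (Λ * W * P * E) = c * (W * P) * (Λ * E) := by ring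

theorem ModelData.eLpNorm_sum_scaleInt_le (h : ModelData n₀ Ψ Φ B ρ lam) (hf : Inputs n₀ 1 f)
    (N : ℤ) {θ : ℝ} (h1 : 1 ≤ θ) (h2 : θ ≤ 2) {l : ℕ → ℂ} (hΛ : Λ ≠ ∞) (hl : ∀ q, ‖l q‖ₑ ≤ Λ)
    (K : ℕ) :
    eLpNorm (fun x => ∑ q ∈ Finset.range K,
      l q * scaleInt Ψ Φ ρ lam f (2 ^ ((q : ℤ) - N) * θ) x) 2 ≤
      modelConst Ψ B * (Λ * eLpNorm (f n₀) 2) := by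
  have hΨ : wt Ψ (Fintype.card (Fin n)) ≠ ∞ := by rw [Fintype.card_fin]; exact h.wtΨ
  have := (h.kerFamily N h1 h2).eLpNorm_sum_integral_prod_le hf h.measΨ hΨ h.intΨ hΛ hl K
  rw [Fintype.card_fin] at this
  rw [modelConst]
  exact this.trans_eq (const_mul_rearrange _ _ _ _ _)

/-- The case K = 1 of the sum over scales, with t = 2^⌊log₂ t⌋ θ. -/
theorem ModelData.eLpNorm_scaleInt_le (h : ModelData n₀ Ψ Φ B ρ lam) (hf : Inputs n₀ 1 f)
    {t : ℝ} (ht : 0 < t) :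
    eLpNorm (scaleInt Ψ Φ ρ lam f t) 2 ≤ modelConst Ψ B * eLpNorm (f n₀) 2 := by
  have e1 := Int.zpow_log_le_self one_lt_two ht
  have e2 := Int.lt_zpow_succ_log_self one_lt_two t
  push_cast at e1 e2
  have hpos : (0 : ℝ) < 2 ^ (Int.log 2 t) := by positivity
  rw [zpow_add_one₀ two_ne_zero] at e2
  have := h.eLpNorm_sum_scaleInt_le hf (-Int.log 2 t) (θ := t / 2 ^ (Int.log 2 t))
    ((one_le_div hpos).2 e1) ((div_le_iff₀ hpos).2 (by linarith)) (l := fun _ => 1)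
    (Λ := 1) (by norm_num) (fun _ => by simp) 1
  simpa [mul_div_cancel₀ _ hpos.ne'] using this

theorem Weight.measurable_mul_scaleInt (hσ : Weight Λ N σ) (h : ModelData n₀ Ψ Φ B ρ lam)
    (hf : ∀ i, Measurable (f i)) :
    Measurable (Function.uncurry fun t x => σ t * scaleInt Ψ Φ ρ lam f t x) :=
  (hσ.meas.comp measurable_fst).mul (measurable_scaleInt h.measΨ (fun i => (h.ker i).meas) ρ lam hf)

theorem Weight.eLpNorm_mul_scaleInt_le (hσ : Weight Λ N σ) {A : ℝ≥0∞}
    (h : ∀ t, 0 < t → eLpNorm (scaleInt Ψ Φ ρ lam f t) 2 ≤ A) {t : ℝ} (ht : 0 < t) :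
    eLpNorm (fun x => σ t * scaleInt Ψ Φ ρ lam f t x) 2 ≤ Λ * A := by
  have : (fun x => σ t * scaleInt Ψ Φ ρ lam f t x) = σ t • scaleInt Ψ Φ ρ lam f t := rfl
  rw [this, eLpNorm_const_smul]
  exact mul_le_mul' (hσ.bdd t) (h t ht)

/-- The bound for the model operator with finitely many scales and normalized functions. -/
theorem Weight.eLpNorm_modelOp_le_of_one (hσ : Weight Λ N σ) (hΛ : Λ ≠ ∞)
    (h : ModelData n₀ Ψ Φ B ρ lam) (hf : Inputs n₀ 1 f) :
    eLpNorm (modelOp Ψ Φ σ ρ lam f) 2 ≤ modelConst Ψ B * (Λ * eLpNorm (f n₀) 2) := by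
  have hE := hf.memLp.2.ne
  have hc := h.modelConst_ne_top
  have h1 := hσ.measurable_mul_scaleInt h hf.meas
  have h2 := fun (t : ℝ) (ht : 0 < t) =>
    hσ.eLpNorm_mul_scaleInt_le (fun t ht => h.eLpNorm_scaleInt_le hf ht) ht
  -- The 2N dyadic intervals that begin at 2^(-N) fill exactly (2^(-N), 2^N].
  have h3 := fun (θ : ℝ) (hθ : 1 ≤ θ) (hθ' : θ ≤ 2) => h.eLpNorm_sum_scaleInt_le hf N hθ hθ' hΛ
    (l := fun q => σ (2 ^ ((q : ℤ) - N) * θ)) (fun q => hσ.bdd _) (2 * N)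
  have h4 := eLpNorm_setIntegral_div_le h1 (by finiteness) h2 N (2 * N) h3
  have e : ((2 * N : ℕ) : ℤ) - N = N := by push_cast; ring
  have h5 : modelOp Ψ Φ σ ρ lam f = fun x => ∫ t in Ioc ((2 : ℝ) ^ (-(N : ℤ)))
      (2 ^ (((2 * N : ℕ) : ℤ) - N)), σ t * scaleInt Ψ Φ ρ lam f t x / (t : ℂ) := by
    rw [e]
    exact funext hσ.modelOp_eq
  rw [h5]
  exact h4

end Weights

/-! ### Linearity in the functions and in the weight. -/

section Linearity

variable {n : ℕ} {n₀ : Fin n} {Ψ : Rd d → ℂ} {Φ : Fin n → Rd d → ℂ} {B : Fin n → ℝ≥0∞}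
  {ρ lam : Fin n → ℝ} {f f' : Fin n → Rd d → ℂ} {Λ M : ℝ≥0∞} {σ σ' : ℝ → ℂ} {N : ℕ}

theorem scaleInt_congr_ae (h : ∀ i, f i =ᵐ[volume] f' i) :
    scaleInt Ψ Φ ρ lam f = scaleInt Ψ Φ ρ lam f' := by
  have h1 : ∀ i (k : Rd d → ℂ), convOp k (f i) = convOp k (f' i) := fun i k => by
    ext x
    refine integral_congr_ae ?_
    filter_upwards [h i] with y hy
    rw [hy]
  ext t x
  simp only [scaleInt, h1]

theorem modelOp_congr_ae (h : ∀ i, f i =ᵐ[volume] f' i) :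
    modelOp Ψ Φ σ ρ lam f = modelOp Ψ Φ σ ρ lam f' := by
  ext x
  rw [modelOp_eq, modelOp_eq, scaleInt_congr_ae h]

theorem scaleInt_mul (c : Fin n → ℂ) (f : Fin n → Rd d → ℂ) (t : ℝ) (x : Rd d) :
    scaleInt Ψ Φ ρ lam (fun i x => c i * f i x) t x = (∏ i, c i) * scaleInt Ψ Φ ρ lam f t x := by
  have h1 : ∀ i (k : Rd d → ℂ), convOp k (fun x => c i * f i x) x = c i * convOp k (f i) x :=
    fun i k => by
      simp only [convOp, kerOp]
      rw [← integral_const_mul]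
      exact integral_congr_ae (Eventually.of_forall fun y => mul_left_comm _ _ _)
  simp only [scaleInt, h1, Finset.prod_mul_distrib]
  rw [← integral_const_mul]
  exact integral_congr_ae (Eventually.of_forall fun y => mul_left_comm _ _ _)

theorem modelOp_mul (c : Fin n → ℂ) (f : Fin n → Rd d → ℂ) (x : Rd d) :
    modelOp Ψ Φ σ ρ lam (fun i x => c i * f i x) x = (∏ i, c i) * modelOp Ψ Φ σ ρ lam f x := by
  rw [modelOp_eq, modelOp_eq, ← integral_const_mul]
  refine integral_congr_ae (Eventually.of_forall fun t => ?_)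
  simp only [scaleInt_mul]
  ring

theorem modelOp_update_smul (f : Fin n → Rd d → ℂ) (i : Fin n) (c : ℂ) (g : Rd d → ℂ) :
    modelOp Ψ Φ σ ρ lam (Function.update f i (c • g)) =
      c • modelOp Ψ Φ σ ρ lam (Function.update f i g) := by
  have h1 : Function.update f i (c • g) =
      fun j x => (if j = i then c else 1) * Function.update f i g j x := by
    ext j x
    by_cases hj : j = i
    · subst hj; simp
    · simp [hj]
  ext x
  rw [h1, modelOp_mul]
  simp

theorem convOp_add {k g h : Rd d → ℂ} {x : Rd d} (hk : Measurable k) (hg : Measurable g)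
    (hh : Measurable h) (h1 : ∫⁻ y, ‖k (x - y)‖ₑ * ‖g y‖ₑ < ∞)
    (h2 : ∫⁻ y, ‖k (x - y)‖ₑ * ‖h y‖ₑ < ∞) :
    convOp k (g + h) x = convOp k g x + convOp k h x := by
  have hm : Measurable fun y => k (x - y) := hk.comp (measurable_const.sub measurable_id)
  simp only [convOp, kerOp, Pi.add_apply, mul_add]
  refine integral_add ⟨(hm.mul hg).aestronglyMeasurable, ?_⟩ ⟨(hm.mul hh).aestronglyMeasurable, ?_⟩
  · simpa only [HasFiniteIntegral, enorm_mul] using h1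
  · simpa only [HasFiniteIntegral, enorm_mul] using h2

theorem ModelData.exists_isKer (h : ModelData n₀ Ψ Φ B ρ lam) {t : ℝ} (ht : 0 < t) :
    ∃ s : Fin n → ℤ, ∀ i z, IsKer (s i) (4 * B i * (1 + ‖z‖ₑ))
      (scaleKer (Φ i) (ρ i) (lam i * t) z) := by
  have e1 := Int.zpow_log_le_self one_lt_two ht
  have e2 := Int.lt_zpow_succ_log_self one_lt_two t
  push_cast at e1 e2
  have hpos : (0 : ℝ) < 2 ^ (Int.log 2 t) := by positivity
  rw [zpow_add_one₀ two_ne_zero] at e2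
  have h1 := (h.kerFamily (-Int.log 2 t) (θ := t / 2 ^ (Int.log 2 t))
    ((one_le_div hpos).2 e1) ((div_le_iff₀ hpos).2 (by linarith))).isKer
  refine ⟨fun i => (0 : ℕ) + (Int.log 2 |lam i| - -Int.log 2 t), fun i z => ?_⟩
  have h2 := h1 i 0 z
  simpa [mul_div_cancel₀ _ hpos.ne'] using h2

theorem ae_absConv_lt_top_of_weighted {κ : Rd d → Rd d → ℂ} {g : Rd d → ℂ} {x : Rd d}
    (hΨ : Measurable Ψ) (hκ : Measurable (Function.uncurry κ)) (hg : Measurable g)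
    (h : ∫⁻ z, (‖Ψ z‖ₑ * (1 + ‖z‖ₑ) ^ N) * ∫⁻ y, ‖κ z (x - y)‖ₑ * ‖g y‖ₑ < ∞) :
    ∀ᵐ z, Ψ z ≠ 0 → ∫⁻ y, ‖κ z (x - y)‖ₑ * ‖g y‖ₑ < ∞ := by
  have hm : Measurable fun z => (‖Ψ z‖ₑ * (1 + ‖z‖ₑ) ^ N) *
      ∫⁻ y, ‖κ z (x - y)‖ₑ * ‖g y‖ₑ :=
    (hΨ.enorm.fun_mul (measurable_one_add_enorm_pow N)).mul
      ((measurable_absConv hκ hg).comp (measurable_id.prodMk measurable_const))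
  filter_upwards [ae_lt_top hm h.ne] with z hz hΨz
  have h0 : ‖Ψ z‖ₑ * (1 + ‖z‖ₑ) ^ N ≠ 0 :=
    mul_ne_zero (by simpa using hΨz) (pow_ne_zero _ (by simp))
  rcases ENNReal.mul_lt_top_iff.1 hz with h1 | h1 | h1
  · exact h1.2
  · exact absurd h1 h0
  · rw [h1]; exact ENNReal.zero_lt_top

/-- Additivity of the convolution needs absolutely convergent integrals. These are available for
almost every x and almost every z with Ψ z ≠ 0; the other z contribute nothing. -/
theorem ModelData.ae_scaleInt_update_add (h : ModelData n₀ Ψ Φ B ρ lam) {i : Fin n}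
    {g g' : Rd d → ℂ} (hM : M ≠ ∞) (hg : Inputs n₀ M (Function.update f i g))
    (hg' : Inputs n₀ M (Function.update f i g')) {t : ℝ} (ht : 0 < t) :
    ∀ᵐ x, scaleInt Ψ Φ ρ lam (Function.update f i (g + g')) t x =
      scaleInt Ψ Φ ρ lam (Function.update f i g) t x +
        scaleInt Ψ Φ ρ lam (Function.update f i g') t x := by
  obtain ⟨s, hs⟩ := h.exists_isKer ht
  obtain ⟨N, hN⟩ : ∃ N, n = N + 1 := Nat.exists_eq_succ_of_ne_zero (Fin.pos n₀).ne'
  have hΨ : wt Ψ (N + 1) ≠ ∞ := hN ▸ h.wtΨ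
  have hκ : ∀ j, Measurable (Function.uncurry (scaleKer (Φ j) (ρ j) (lam j * t))) := fun j =>
    measurable_scaleKer_right (h.ker j).meas _ _
  have hB : ∀ j, 4 * B j ≠ ∞ := fun j => ENNReal.mul_ne_top (by norm_num) (h.ne_top j)
  have key : ∀ {u : Fin n → Rd d → ℂ}, Inputs n₀ M u → ∀ᵐ x, ∀ j,
      ∫⁻ z, (‖Ψ z‖ₑ * (1 + ‖z‖ₑ) ^ N) *
        ∫⁻ y, ‖scaleKer (Φ j) (ρ j) (lam j * t) z (x - y)‖ₑ * ‖u j y‖ₑ < ∞ := fun hu =>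
    ae_all_iff.2 fun j => ae_lintegral_absConv_lt_top (hκ j) (hs j) (hB j) hM (hu.meas j)
      (hu.memLp_or j) h.measΨ hΨ
  have hgm : Measurable g := by simpa using hg.meas i
  have hgm' : Measurable g' := by simpa using hg'.meas i
  filter_upwards [key hg, key hg'] with x hx hx'
  have i1 := hg.integrable_mul_prod_convOp hM hκ hs hB h.measΨ
    ((Fintype.card_fin n).trans hN) (hx n₀)
  have i2 := hg'.integrable_mul_prod_convOp hM hκ hs hB h.measΨ
    ((Fintype.card_fin n).trans hN) (hx' n₀)
  simp only [scaleInt]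
  rw [← integral_add i1 i2]
  have hxi := hx i
  have hxi' := hx' i
  rw [Function.update_self] at hxi hxi'
  refine integral_congr_ae ?_
  filter_upwards [ae_absConv_lt_top_of_weighted h.measΨ (hκ i) hgm hxi,
    ae_absConv_lt_top_of_weighted h.measΨ (hκ i) hgm' hxi'] with z hz hz'
  by_cases h0 : Ψ z = 0
  · simp [h0]
  have hkm : Measurable (scaleKer (Φ i) (ρ i) (lam i * t) z) := (hs i z).meas
  have e : ∀ u : Rd d → ℂ, ∏ j, convOp (scaleKer (Φ j) (ρ j) (lam j * t) z)
      (Function.update f i u j) x = convOp (scaleKer (Φ i) (ρ i) (lam i * t) z) u x *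
        ∏ j ∈ Finset.univ.erase i, convOp (scaleKer (Φ j) (ρ j) (lam j * t) z) (f j) x := fun u => by
    rw [← Finset.mul_prod_erase _ _ (Finset.mem_univ i), Function.update_self]
    congr 1
    refine Finset.prod_congr rfl fun j hj => ?_
    rw [Function.update_of_ne (Finset.ne_of_mem_erase hj)]
  rw [e, e, e, convOp_add hkm hgm hgm' (hz h0) (hz' h0)]
  ring

theorem Inputs.scale (hf : Inputs n₀ M f) {c : ℂ} (hc : ‖c‖ₑ * M ≤ 1) :
    Inputs n₀ 1 fun i x => c * f i x := by
  refine ⟨fun i => (hf.meas i).const_mul c, fun i hi x => ?_, hf.memLp.const_mul c⟩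
  rw [enorm_mul]
  exact (mul_le_mul_right (hf.bdd i hi x) _).trans hc

theorem exists_enorm_mul_le_one (hM : M ≠ ∞) : ∃ c : ℂ, c ≠ 0 ∧ ‖c‖ₑ * M ≤ 1 := by
  have hp : 0 < M.toReal + 1 := by positivity
  refine ⟨((M.toReal + 1)⁻¹ : ℝ), Complex.ofReal_ne_zero.2 (inv_ne_zero hp.ne'), ?_⟩
  rw [← ofReal_norm, Complex.norm_real, Real.norm_of_nonneg (inv_nonneg.2 hp.le),
    ENNReal.ofReal_inv_of_pos hp]
  refine (ENNReal.inv_mul_le_iff (by positivity) ENNReal.ofReal_ne_top).2 ?_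
  rw [mul_one]
  exact (ENNReal.le_ofReal_iff_toReal_le hM hp.le).2 (by linarith)

/-- Multiplying all functions by one small constant reduces to inputs bounded by 1. Only finiteness
is wanted here, so the homogeneity is used crudely. -/
theorem ModelData.exists_eLpNorm_scaleInt_le (h : ModelData n₀ Ψ Φ B ρ lam) (hM : M ≠ ∞)
    (hf : Inputs n₀ M f) :
    ∃ A : ℝ≥0∞, A ≠ ∞ ∧ ∀ t, 0 < t → eLpNorm (scaleInt Ψ Φ ρ lam f t) 2 ≤ A := by
  obtain ⟨c, hc0, hc⟩ := exists_enorm_mul_le_one hM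
  have hf' := hf.scale hc
  have hE := hf'.memLp.2.ne
  have hK := h.modelConst_ne_top
  refine ⟨‖(∏ _i : Fin n, c)⁻¹‖ₑ * (modelConst Ψ B * eLpNorm (fun x => c * f n₀ x) 2),
    by finiteness, fun t ht => ?_⟩
  have h1 : scaleInt Ψ Φ ρ lam f t =
      (∏ _i : Fin n, c)⁻¹ • scaleInt Ψ Φ ρ lam (fun i x => c * f i x) t := by
    ext x
    rw [Pi.smul_apply, scaleInt_mul (fun _ => c), smul_eq_mul, inv_mul_cancel_left₀]
    exact Finset.prod_ne_zero_iff.2 fun _ _ => hc0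
  rw [h1, eLpNorm_const_smul]
  exact mul_le_mul_right (h.eLpNorm_scaleInt_le hf' ht) _

theorem Weight.ae_integrableOn (hσ : Weight Λ N σ) (hΛ : Λ ≠ ∞) (h : ModelData n₀ Ψ Φ B ρ lam)
    (hM : M ≠ ∞) (hf : Inputs n₀ M f) (N' : ℕ) :
    ∀ᵐ x, IntegrableOn (fun t => σ t * scaleInt Ψ Φ ρ lam f t x / (t : ℂ))
      (Ioc ((2 : ℝ) ^ (-(N' : ℤ))) (2 ^ (N' : ℤ))) := by
  obtain ⟨A, hA, hA'⟩ := h.exists_eLpNorm_scaleInt_le hM hf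
  exact ae_integrableOn_div (hσ.measurable_mul_scaleInt h hf.meas) (ENNReal.mul_ne_top hΛ hA)
    (fun t ht => hσ.eLpNorm_mul_scaleInt_le hA' ht) (by positivity) _

theorem Weight.mono (hσ : Weight Λ N σ) {N' : ℕ} (h : N ≤ N') : Weight Λ N' σ :=
  ⟨hσ.meas, hσ.bdd, fun t ht => hσ.supp t fun h' => ht
    (Ioc_subset_Ioc (zpow_two_mono (by lia)) (zpow_two_mono (by lia)) h')⟩

theorem Weight.ae_modelOp_update_add (hσ : Weight Λ N σ) (hΛ : Λ ≠ ∞)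
    (h : ModelData n₀ Ψ Φ B ρ lam) {i : Fin n} {g g' : Rd d → ℂ} (hM : M ≠ ∞)
    (hg : Inputs n₀ M (Function.update f i g)) (hg' : Inputs n₀ M (Function.update f i g')) :
    modelOp Ψ Φ σ ρ lam (Function.update f i (g + g')) =ᵐ[volume]
      modelOp Ψ Φ σ ρ lam (Function.update f i g) +
        modelOp Ψ Φ σ ρ lam (Function.update f i g') := by
  have hgm : Measurable g := by simpa using hg.meas i
  have hgm' : Measurable g' := by simpa using hg'.meas i
  have hm : ∀ j, Measurable (Function.update f i (g + g') j) := fun j => by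
    by_cases hj : j = i
    · subst hj; simpa using hgm.add hgm'
    · have := hg.meas j
      simpa [hj] using this
  have hS : ∀ {u : Fin n → Rd d → ℂ}, (∀ j, Measurable (u j)) →
      Measurable (Function.uncurry (scaleInt Ψ Φ ρ lam u)) := fun hu =>
    measurable_scaleInt h.measΨ (fun j => (h.ker j).meas) ρ lam hu
  -- Additivity is known at almost every x for each t; measurability of the exceptional set in the
  -- product allows the two quantifiers to be exchanged.
  have hae : ∀ᵐ x, ∀ᵐ t ∂volume.restrict (Ioi (0 : ℝ)),
      scaleInt Ψ Φ ρ lam (Function.update f i (g + g')) t x =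
      scaleInt Ψ Φ ρ lam (Function.update f i g) t x +
        scaleInt Ψ Φ ρ lam (Function.update f i g') t x := by
    have hset : MeasurableSet {p : ℝ × Rd d |
        scaleInt Ψ Φ ρ lam (Function.update f i (g + g')) p.1 p.2 =
        scaleInt Ψ Φ ρ lam (Function.update f i g) p.1 p.2 +
          scaleInt Ψ Φ ρ lam (Function.update f i g') p.1 p.2} :=
      measurableSet_eq_fun (hS hm) ((hS hg.meas).add (hS hg'.meas))
    refine (Measure.ae_ae_comm hset).1 ?_
    filter_upwards [ae_restrict_mem measurableSet_Ioi] with t ht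
    exact h.ae_scaleInt_update_add hM hg hg' ht
  filter_upwards [hae, hσ.ae_integrableOn hΛ h hM hg N, hσ.ae_integrableOn hΛ h hM hg' N]
    with x hx i1 i2
  rw [Pi.add_apply, hσ.modelOp_eq, hσ.modelOp_eq, hσ.modelOp_eq, ← integral_add i1 i2]
  refine integral_congr_ae ?_
  have hsub : Ioc ((2 : ℝ) ^ (-(N : ℤ))) (2 ^ (N : ℤ)) ⊆ Ioi 0 := fun t ht =>
    lt_trans (by positivity : (0 : ℝ) < 2 ^ (-(N : ℤ))) ht.1
  filter_upwards [ae_restrict_of_ae_restrict_of_subset hsub hx] with t ht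
  rw [ht]
  ring

theorem Weight.ae_modelOp_add_mul (hσ : Weight Λ N σ) (hσ' : Weight Λ N σ') (hΛ : Λ ≠ ∞)
    (h : ModelData n₀ Ψ Φ B ρ lam) (hM : M ≠ ∞) (hf : Inputs n₀ M f) (c : ℂ) :
    modelOp Ψ Φ (fun t => σ t + c * σ' t) ρ lam f =ᵐ[volume]
      modelOp Ψ Φ σ ρ lam f + c • modelOp Ψ Φ σ' ρ lam f := by
  filter_upwards [hσ.ae_integrableOn hΛ h hM hf N, hσ'.ae_integrableOn hΛ h hM hf N] with x i1 i2
  have hw : Weight (Λ + ‖c‖ₑ * Λ) N fun t => σ t + c * σ' t :=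
    ⟨hσ.meas.add (hσ'.meas.const_mul c), fun t => (enorm_add_le _ _).trans
      (add_le_add (hσ.bdd t) (by rw [enorm_mul]; exact mul_le_mul_right (hσ'.bdd t) _)),
      fun t ht => by simp [hσ.supp t ht, hσ'.supp t ht]⟩
  rw [Pi.add_apply, Pi.smul_apply, hσ.modelOp_eq, hσ'.modelOp_eq, hw.modelOp_eq, smul_eq_mul,
    ← integral_const_mul, ← integral_add i1 (i2.const_mul c)]
  refine integral_congr_ae (Eventually.of_forall fun t => ?_)
  ring

theorem Weight.measurable_modelOp (hσ : Weight Λ N σ) (h : ModelData n₀ Ψ Φ B ρ lam)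
    (hf : ∀ i, Measurable (f i)) : Measurable (modelOp Ψ Φ σ ρ lam f) := by
  have h1 : modelOp Ψ Φ σ ρ lam f = fun x => ∫ t in Ioi (0 : ℝ),
      σ t * scaleInt Ψ Φ ρ lam f t x / (t : ℂ) := funext fun x => ModelOperator.modelOp_eq _ _ _ _ _ _ _
  rw [h1]
  have hm : Measurable fun p : Rd d × ℝ => σ p.2 * scaleInt Ψ Φ ρ lam f p.2 p.1 / (p.2 : ℂ) :=
    ((hσ.measurable_mul_scaleInt h hf).comp measurable_swap).div
      (Complex.measurable_ofReal.comp measurable_snd)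
  exact (StronglyMeasurable.integral_prod_right' hm.stronglyMeasurable).measurable

end Linearity

/-! ### Convergence of the improper integral from uniform bounds alone. -/

section Limit

variable {E : Type*} [NormedAddCommGroup E] [InnerProductSpace ℂ E] {v : (ℝ → ℂ) → E} {Λ : ℝ≥0∞}

/-- Disjoint supports keep the same bound Λ, so adding a remote weight with either sign stays in the
class over which the supremum of the norms is taken. -/
theorem Weight.add_mul_of_disjoint {σ σ' : ℝ → ℂ} {N : ℕ} (hσ : Weight Λ N σ)
    (hσ' : Weight Λ N σ') (hd : ∀ t, σ t = 0 ∨ σ' t = 0) {c : ℂ} (hc : ‖c‖ₑ ≤ 1) :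
    Weight Λ N fun t => σ t + c * σ' t := by
  refine ⟨hσ.meas.add (hσ'.meas.const_mul c), fun t => ?_, fun t ht => by
    simp [hσ.supp t ht, hσ'.supp t ht]⟩
  rcases hd t with h | h
  · rw [h, zero_add, enorm_mul]
    exact (mul_le_of_le_one_left' hc).trans (hσ'.bdd t)
  · rw [h, mul_zero, add_zero]
    exact hσ.bdd t

/-- A bounded linear function of the weights is small at weights with remote supports. -/
theorem exists_norm_le_of_remote {C : ℝ} (hC : ∀ N σ, Weight Λ N σ → ‖v σ‖ ≤ C)
    (hv : ∀ N σ σ' (c : ℂ), Weight Λ N σ → Weight Λ N σ' →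
      v (fun t => σ t + c * σ' t) = v σ + c • v σ') {η : ℝ} (hη : 0 < η) :
    ∃ N : ℕ, ∀ N' σ, Weight Λ N' σ → (∀ t ∈ Ioc ((2 : ℝ) ^ (-(N : ℤ))) (2 ^ (N : ℤ)), σ t = 0) →
      ‖v σ‖ ≤ η := by
  -- Choose σ whose squared norm is within η² of the supremum. If σ' lives off the support of σ,
  -- both σ + σ' and σ - σ' are admissible, and the parallelogram law leaves at most η² for the
  -- squared norm of v σ'.
  set S : Set ℝ := {r | ∃ N σ, Weight Λ N σ ∧ r = ‖v σ‖ ^ 2} with hS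
  have hbdd : BddAbove S := by
    refine ⟨C ^ 2, ?_⟩
    rintro r ⟨N, σ, hσ, rfl⟩
    exact pow_le_pow_left₀ (norm_nonneg _) (hC N σ hσ) 2
  have hne : S.Nonempty := ⟨_, 0, fun _ => 0, ⟨measurable_const, fun _ => by simp, fun _ _ => rfl⟩, rfl⟩
  obtain ⟨r, ⟨N, σ, hσ, rfl⟩, hr⟩ := exists_lt_of_lt_csSup hne
    (show sSup S - η ^ 2 < sSup S by linarith [pow_pos hη 2])
  refine ⟨N, fun N' σ' hσ' h0 => ?_⟩
  have hd : ∀ t, σ t = 0 ∨ σ' t = 0 := fun t => by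
    by_cases ht : t ∈ Ioc ((2 : ℝ) ^ (-(N : ℤ))) (2 ^ (N : ℤ))
    · exact .inr (h0 t ht)
    · exact .inl (hσ.supp t ht)
  have w1 := hσ.mono (le_max_left N N')
  have w2 := hσ'.mono (le_max_right N N')
  have e1 : ‖v σ + v σ'‖ ^ 2 ≤ sSup S := by
    have := hv _ _ _ 1 w1 w2
    rw [one_smul] at this
    rw [← this]
    exact le_csSup hbdd ⟨_, _, w1.add_mul_of_disjoint w2 hd (by simp), rfl⟩
  have e2 : ‖v σ - v σ'‖ ^ 2 ≤ sSup S := by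
    have := hv _ _ _ (-1) w1 w2
    rw [neg_one_smul, ← sub_eq_add_neg] at this
    rw [← this]
    exact le_csSup hbdd ⟨_, _, w1.add_mul_of_disjoint w2 hd (by simp), rfl⟩
  have e3 := parallelogram_law_with_norm ℂ (v σ) (v σ')
  have e4 : ‖v σ'‖ ^ 2 ≤ η ^ 2 := by nlinarith
  exact (pow_le_pow_iff_left₀ (norm_nonneg _) hη.le two_ne_zero).1 e4

theorem exists_zpow_two_bounds {a : ℝ} (ha : 0 < a) (b : ℝ) :
    ∃ N : ℕ, (2 : ℝ) ^ (-(N : ℤ)) < a ∧ b < 2 ^ (N : ℤ) := by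
  obtain ⟨N₁, h₁⟩ := pow_unbounded_of_one_lt a⁻¹ (one_lt_two (α := ℝ))
  obtain ⟨N₂, h₂⟩ := pow_unbounded_of_one_lt b (one_lt_two (α := ℝ))
  refine ⟨max N₁ N₂, ?_, ?_⟩
  · rw [zpow_neg, zpow_natCast]
    refine inv_lt_of_inv_lt₀ ha (h₁.trans_le ?_)
    exact pow_le_pow_right₀ one_le_two (le_max_left _ _)
  · rw [zpow_natCast]
    exact h₂.trans_le (pow_le_pow_right₀ one_le_two (le_max_right _ _))

theorem weight_indicator_Ioo {L : ℝ → ℂ} (hL : Measurable L) (hLΛ : ∀ t, ‖L t‖ₑ ≤ Λ) {a b : ℝ}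
    {N : ℕ} (ha : (2 : ℝ) ^ (-(N : ℤ)) < a) (hb : b < 2 ^ (N : ℤ)) :
    Weight Λ N ((Ioo a b).indicator L) := by
  refine ⟨hL.indicator measurableSet_Ioo, fun t => ?_, fun t ht => ?_⟩
  · exact (enorm_indicator_le_enorm_self _ _).trans (hLΛ t)
  · exact indicator_of_notMem (fun h => ht ⟨ha.trans h.1, (h.2.trans hb).le⟩) _

/-- Cauchy's criterion: a truncation that contains (2^(-N), 2^N] differs from the truncation to that
interval by a weight of remote support, so all such truncations have values near one point. -/
theorem exists_tendsto_of_weights [CompleteSpace E] {C : ℝ}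
    (hC : ∀ N σ, Weight Λ N σ → ‖v σ‖ ≤ C)
    (hv : ∀ N σ σ' (c : ℂ), Weight Λ N σ → Weight Λ N σ' →
      v (fun t => σ t + c * σ' t) = v σ + c • v σ')
    {L : ℝ → ℂ} (hL : Measurable L) (hLΛ : ∀ t, ‖L t‖ₑ ≤ Λ) :
    ∃ y, Tendsto (fun s : ℝ × ℝ => v ((Ioo s.1 s.2).indicator L)) (𝓝[>] 0 ×ˢ atTop) (𝓝 y) := by
  have key : ∀ η > 0, ∃ b : E, ∀ᶠ s : ℝ × ℝ in 𝓝[>] 0 ×ˢ atTop,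
      ‖v ((Ioo s.1 s.2).indicator L) - b‖ ≤ η := by
    intro η hη
    obtain ⟨N, hN⟩ := exists_norm_le_of_remote hC hv hη
    set I := Ioc ((2 : ℝ) ^ (-(N : ℤ))) (2 ^ (N : ℤ)) with hI
    refine ⟨v (I.indicator L), ?_⟩
    have h1 : ∀ᶠ ε : ℝ in 𝓝[>] 0, ε ∈ Ioo (0 : ℝ) (2 ^ (-(N : ℤ))) :=
      Ioo_mem_nhdsGT (by positivity)
    filter_upwards [h1.prod_mk (eventually_gt_atTop ((2 : ℝ) ^ (N : ℤ)))] with s hs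
    obtain ⟨⟨hs0, hs1⟩, hs2⟩ := hs
    obtain ⟨N', h3, h4⟩ := exists_zpow_two_bounds hs0 s.2
    have hsub : I ⊆ Ioo s.1 s.2 := fun t ht => ⟨hs1.trans ht.1, ht.2.trans_lt hs2⟩
    have w1 := weight_indicator_Ioo hL hLΛ h3 h4
    have w2 : Weight Λ N' (I.indicator L) := by
      refine ⟨hL.indicator measurableSet_Ioc, fun t => ?_, fun t ht => ?_⟩
      · exact (enorm_indicator_le_enorm_self _ _).trans (hLΛ t)
      · exact indicator_of_notMem (fun h => ht ⟨h3.trans (hsub h).1, ((hsub h).2.trans h4).le⟩) _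
    have w3 : Weight Λ N' ((Ioo s.1 s.2 \ I).indicator L) := by
      refine ⟨hL.indicator (measurableSet_Ioo.diff measurableSet_Ioc), fun t => ?_, fun t ht => ?_⟩
      · exact (enorm_indicator_le_enorm_self _ _).trans (hLΛ t)
      · exact indicator_of_notMem (fun h => ht ⟨h3.trans h.1.1, (h.1.2.trans h4).le⟩) _
    have e : (Ioo s.1 s.2).indicator L =
        fun t => I.indicator L t + 1 * (Ioo s.1 s.2 \ I).indicator L t := by
      ext t
      rw [one_mul]
      by_cases h5 : t ∈ I
      · rw [indicator_of_mem (hsub h5), indicator_of_mem h5,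
          indicator_of_notMem (fun h => h.2 h5), add_zero]
      · rw [indicator_of_notMem h5, zero_add]
        by_cases h6 : t ∈ Ioo s.1 s.2
        · rw [indicator_of_mem h6, indicator_of_mem (show t ∈ Ioo s.1 s.2 \ I from ⟨h6, h5⟩)]
        · rw [indicator_of_notMem h6, indicator_of_notMem (fun h => h6 h.1)]
    rw [e, hv _ _ _ 1 w2 w3, one_smul, add_sub_cancel_left]
    exact hN _ _ w3 fun t ht => indicator_of_notMem (fun h => h.2 ht) _
  refine cauchy_map_iff_exists_tendsto.1 (Metric.cauchy_iff.2 ⟨inferInstance, fun ε hε => ?_⟩)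
  obtain ⟨b, hb⟩ := key (ε / 3) (by positivity)
  refine ⟨{y | ‖y - b‖ ≤ ε / 3}, hb, fun x hx y hy => ?_⟩
  rw [dist_eq_norm, show x - y = (x - b) - (y - b) by abel]
  have hx' : ‖x - b‖ ≤ ε / 3 := hx
  have hy' : ‖y - b‖ ≤ ε / 3 := hy
  linarith [norm_sub_le (x - b) (y - b)]

end Limit

/-! ### The bound for functions in (L^∞)^(n-1) × L², given almost everywhere. -/

section Families

variable {m : ℕ} {Ψ : Rd d → ℂ} {Φ : Fin (m + 1) → Rd d → ℂ} {B : Fin (m + 1) → ℝ≥0∞}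
  {ρ lam : Fin (m + 1) → ℝ} {f : Fin (m + 1) → Rd d → ℂ} {Λ : ℝ≥0∞} {σ σ' : ℝ → ℂ} {N : ℕ}

theorem expo_last (m : ℕ) : expo m (Fin.last m) = 2 := if_pos rfl

theorem expo_of_ne {i : Fin (m + 1)} (hi : i ≠ Fin.last m) : expo m i = ∞ := if_neg hi

/-- Put the value 0 where the norm exceeds the essential supremum. The dyadic estimates use bounds
at every point. -/
theorem exists_bounded_representative {α : Type*} [MeasurableSpace α] {μ : Measure α}
    {g : α → ℂ} (hg : MemLp g ∞ μ) :
    ∃ g' : α → ℂ, Measurable g' ∧ g' =ᵐ[μ] g ∧ ∀ x, ‖g' x‖ₑ ≤ eLpNorm g ∞ μ := by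
  have hm := hg.1.stronglyMeasurable_mk.measurable
  refine ⟨{x | ‖hg.1.mk g x‖ₑ ≤ eLpNorm g ∞ μ}.indicator (hg.1.mk g),
    hm.indicator (measurableSet_le hm.enorm measurable_const), ?_, fun x => ?_⟩
  · have h1 : ∀ᵐ x ∂μ, ‖g x‖ₑ ≤ eLpNorm g ∞ μ := by
      rw [eLpNorm_exponent_top]
      exact ae_le_eLpNormEssSup
    filter_upwards [h1, hg.1.ae_eq_mk] with x hx hx'
    rw [indicator_of_mem (by rw [mem_ofPred_eq, ← hx']; exact hx), hx']
  · by_cases hx : ‖hg.1.mk g x‖ₑ ≤ eLpNorm g ∞ μ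
    · rw [indicator_of_mem (by exact hx)]
      exact hx
    · rw [indicator_of_notMem (by exact hx)]
      simp

theorem exists_representatives (hf : ∀ i, MemLp (f i) (expo m i)) :
    ∃ g : Fin (m + 1) → Rd d → ℂ, (∀ i, Measurable (g i)) ∧ (∀ i, g i =ᵐ[volume] f i) ∧
      ∀ i ≠ Fin.last m, ∀ x, ‖g i x‖ₑ ≤ eLpNorm (f i) (expo m i) := by
  have h1 : ∀ i, ∃ g : Rd d → ℂ, Measurable g ∧ g =ᵐ[volume] f i ∧
      (i ≠ Fin.last m → ∀ x, ‖g x‖ₑ ≤ eLpNorm (f i) (expo m i)) := fun i => by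
    by_cases hi : i = Fin.last m
    · exact ⟨(hf i).1.mk _, (hf i).1.stronglyMeasurable_mk.measurable, (hf i).1.ae_eq_mk.symm,
        fun h => absurd hi h⟩
    · have h2 := hf i
      rw [expo_of_ne hi] at h2 ⊢
      obtain ⟨g, h3, h4, h5⟩ := exists_bounded_representative h2
      exact ⟨g, h3, h4, fun _ => h5⟩
  choose g h2 h3 h4 using h1
  exact ⟨g, h2, h3, h4⟩

theorem exists_inputs (hf : ∀ i, MemLp (f i) (expo m i)) :
    ∃ (g : Fin (m + 1) → Rd d → ℂ) (M : ℝ≥0∞), M ≠ ∞ ∧ (∀ i, g i =ᵐ[volume] f i) ∧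
      Inputs (Fin.last m) M g := by
  obtain ⟨g, h1, h2, h3⟩ := exists_representatives hf
  have hM : ∑ i, eLpNorm (f i) (expo m i) ≠ ∞ := ENNReal.sum_ne_top.2 fun i _ => (hf i).2.ne
  have hle : ∀ i, eLpNorm (f i) (expo m i) ≤ ∑ i, eLpNorm (f i) (expo m i) := fun i =>
    Finset.single_le_sum (f := fun i => eLpNorm (f i) (expo m i) volume) (fun _ _ => zero_le)
      (Finset.mem_univ i)
  have hl : MemLp (g (Fin.last m)) 2 := by
    have := hf (Fin.last m)
    rw [expo_last] at this
    exact this.ae_eq (h2 _).symm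
  have hI : Inputs (Fin.last m) (∑ i, eLpNorm (f i) (expo m i)) g :=
    { meas := h1, bdd := fun i hi x => (h3 i hi x).trans (hle i), memLp := hl }
  exact ⟨g, _, hM, h2, hI⟩

theorem modelOp_eq_zero_of_ae {i : Fin (m + 1)} (hi : f i =ᵐ[volume] 0) :
    modelOp Ψ Φ σ ρ lam f = 0 := by
  have h1 : ∀ j, f j =ᵐ[volume] (fun j x => (if j = i then (0 : ℂ) else 1) * f j x) j := fun j => by
    by_cases hj : j = i
    · subst hj
      simp only [if_true, zero_mul]
      exact hi
    · simp [hj]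
  ext x
  rw [modelOp_congr_ae h1, modelOp_mul, Finset.prod_eq_zero (Finset.mem_univ i) (by simp), zero_mul,
    Pi.zero_apply]

theorem mul_const_rearrange (P K Λ E : ℝ≥0∞) : P * (K * (Λ * E)) = K * (Λ * (E * P)) := by ring

/-- The bound for the model operator with finitely many scales. -/
theorem Weight.eLpNorm_modelOp_le (hσ : Weight Λ N σ) (hΛ : Λ ≠ ∞)
    (h : ModelData (Fin.last m) Ψ Φ B ρ lam) (hf : ∀ i, MemLp (f i) (expo m i)) :
    eLpNorm (modelOp Ψ Φ σ ρ lam f) 2 ≤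
      modelConst Ψ B * (Λ * ∏ i, eLpNorm (f i) (expo m i)) := by
  -- Normalization divides by the norms, so a vanishing norm is treated apart: then one function is
  -- zero almost everywhere and so is the operator.
  by_cases h0 : ∃ i, eLpNorm (f i) (expo m i) = 0
  · obtain ⟨i, hi⟩ := h0
    have hp : expo m i ≠ 0 := (zero_lt_one.trans_le (factOneLeExpo m i).out).ne'
    rw [modelOp_eq_zero_of_ae ((eLpNorm_eq_zero_iff (hf i).1 hp).1 hi), eLpNorm_zero]
    exact zero_le
  push Not at h0
  obtain ⟨g, h1, h2, h3⟩ := exists_representatives hf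
  -- Only the bounded functions are normalized; the bound is already homogeneous in the L² function.
  set c : Fin (m + 1) → ℂ := fun i =>
    if i = Fin.last m then 1 else ((eLpNorm (f i) (expo m i)).toReal : ℂ) with hc
  have hc0 : ∀ i, c i ≠ 0 := fun i => by
    by_cases hi : i = Fin.last m
    · simp [hc, hi]
    · simp only [hc, if_neg hi]
      exact Complex.ofReal_ne_zero.2 (ENNReal.toReal_ne_zero.2 ⟨h0 i, (hf i).2.ne⟩)
  have hce : ∀ i ≠ Fin.last m, ‖c i‖ₑ = eLpNorm (f i) (expo m i) := fun i hi => by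
    simp only [hc, if_neg hi]
    rw [← ofReal_norm, Complex.norm_real, Real.norm_of_nonneg ENNReal.toReal_nonneg,
      ENNReal.ofReal_toReal (hf i).2.ne]
  have hcl : c (Fin.last m) = 1 := if_pos rfl
  have hin : Inputs (Fin.last m) 1 fun i x => (c i)⁻¹ * g i x := by
    refine ⟨fun i => (h1 i).const_mul _, fun i hi x => ?_, ?_⟩
    · rw [enorm_mul, enorm_inv (hc0 i), hce i hi]
      exact (mul_le_mul_right (h3 i hi x) _).trans_eq (ENNReal.inv_mul_cancel (h0 i) (hf i).2.ne)
    · have := hf (Fin.last m)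
      rw [expo_last] at this
      simpa [hcl] using this.ae_eq (h2 _).symm
  have e1 : modelOp Ψ Φ σ ρ lam f =
      (∏ i, c i) • modelOp Ψ Φ σ ρ lam fun i x => (c i)⁻¹ * g i x := by
    rw [← modelOp_congr_ae h2]
    ext x
    rw [Pi.smul_apply, smul_eq_mul, ← modelOp_mul]
    simp only [mul_inv_cancel_left₀ (hc0 _)]
  have e2 : eLpNorm (fun x => (c (Fin.last m))⁻¹ * g (Fin.last m) x) 2 =
      eLpNorm (f (Fin.last m)) (expo m (Fin.last m)) := by
    rw [expo_last, ← eLpNorm_congr_ae (h2 _)]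
    simp [hcl]
  have e3 := hσ.eLpNorm_modelOp_le_of_one hΛ h hin
  rw [e2] at e3
  rw [e1, eLpNorm_const_smul, enorm_finset_prod,
    ← Finset.mul_prod_erase _ (fun i => eLpNorm (f i) (expo m i) volume) (Finset.mem_univ (Fin.last m)),
    ← Finset.mul_prod_erase _ (fun i => ‖c i‖ₑ) (Finset.mem_univ (Fin.last m)), hcl, enorm_one,
    one_mul, Finset.prod_congr rfl fun i hi => hce i (Finset.ne_of_mem_erase hi)]
  exact (mul_le_mul_right e3 _).trans_eq (mul_const_rearrange _ _ _ _)

theorem Weight.memLp_modelOp (hσ : Weight Λ N σ) (hΛ : Λ ≠ ∞)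
    (h : ModelData (Fin.last m) Ψ Φ B ρ lam) (hf : ∀ i, MemLp (f i) (expo m i)) :
    MemLp (modelOp Ψ Φ σ ρ lam f) 2 := by
  refine ⟨?_, (hσ.eLpNorm_modelOp_le hΛ h hf).trans_lt (ENNReal.mul_lt_top
    h.modelConst_ne_top.lt_top (ENNReal.mul_lt_top hΛ.lt_top
      (ENNReal.prod_lt_top fun i _ => (hf i).2)))⟩
  obtain ⟨g, h1, h2, -⟩ := exists_representatives hf
  rw [← modelOp_congr_ae h2]
  exact (hσ.measurable_modelOp h h1).aestronglyMeasurable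

theorem Weight.modelOp_add_mul (hσ : Weight Λ N σ) (hσ' : Weight Λ N σ') (hΛ : Λ ≠ ∞)
    (h : ModelData (Fin.last m) Ψ Φ B ρ lam) (hf : ∀ i, MemLp (f i) (expo m i)) (c : ℂ) :
    modelOp Ψ Φ (fun t => σ t + c * σ' t) ρ lam f =ᵐ[volume]
      modelOp Ψ Φ σ ρ lam f + c • modelOp Ψ Φ σ' ρ lam f := by
  obtain ⟨g, M, hM, h1, h2⟩ := exists_inputs hf
  simp only [← modelOp_congr_ae h1]
  exact hσ.ae_modelOp_add_mul hσ' hΛ h hM h2 c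

theorem Weight.modelOp_update_add (hσ : Weight Λ N σ) (hΛ : Λ ≠ ∞)
    (h : ModelData (Fin.last m) Ψ Φ B ρ lam) {i : Fin (m + 1)} {g g' : Rd d → ℂ}
    (hg : ∀ j, MemLp (Function.update f i g j) (expo m j))
    (hg' : ∀ j, MemLp (Function.update f i g' j) (expo m j)) :
    modelOp Ψ Φ σ ρ lam (Function.update f i (g + g')) =ᵐ[volume]
      modelOp Ψ Φ σ ρ lam (Function.update f i g) +
        modelOp Ψ Φ σ ρ lam (Function.update f i g') := by
  obtain ⟨u, M, hM, h1, h2⟩ := exists_inputs hg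
  obtain ⟨u', M', hM', h1', h2'⟩ := exists_inputs hg'
  have ei : u i =ᵐ[volume] g := by simpa using h1 i
  have ei' : u' i =ᵐ[volume] g' := by simpa using h1' i
  have ej : ∀ j ≠ i, u j =ᵐ[volume] f j := fun j hj => by simpa [hj] using h1 j
  have key : ∀ {w w' : Rd d → ℂ}, w =ᵐ[volume] w' → ∀ j,
      Function.update u i w j =ᵐ[volume] Function.update f i w' j := fun hw j => by
    by_cases hj : j = i
    · subst hj; simpa using hw
    · simpa [hj] using ej j hj
  have hI : Inputs (Fin.last m) (max M M') (Function.update u i (u i)) := by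
    rw [Function.update_eq_self]
    exact ⟨h2.meas, fun j hj x => (h2.bdd j hj x).trans (le_max_left _ _), h2.memLp⟩
  have hI' : Inputs (Fin.last m) (max M M') (Function.update u i (u' i)) := by
    refine ⟨fun j => ?_, fun j hj x => ?_, ?_⟩
    · by_cases hji : j = i
      · subst hji; simpa using h2'.meas j
      · simpa [hji] using h2.meas j
    · by_cases hji : j = i
      · subst hji; simpa using .inr (h2'.bdd j hj x)
      · simpa [hji] using .inl (h2.bdd j hj x)
    · by_cases hji : Fin.last m = i
      · subst hji; simpa using h2'.memLp
      · simpa [hji] using h2.memLp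
  rw [← modelOp_congr_ae (key (ei.add ei')), ← modelOp_congr_ae (key ei),
    ← modelOp_congr_ae (key ei')]
  exact hσ.ae_modelOp_update_add hΛ h (by simp [hM, hM']) hI hI'

end Families

/-! ### The continuous multilinear extension. -/

section Extension

variable {m : ℕ} {Ψ : Rd d → ℂ} {Φ : Fin (m + 1) → Rd d → ℂ} {B : Fin (m + 1) → ℝ≥0∞}
  {ρ lam : Fin (m + 1) → ℝ} {f f' : Fin (m + 1) → Rd d → ℂ} {Λ : ℝ≥0∞} {σ σ' : ℝ → ℂ} {N : ℕ}

open Classical in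
/-- The model operator as an element of `L²`. -/
def modelLp (Ψ : Rd d → ℂ) (Φ : Fin (m + 1) → Rd d → ℂ) (ρ lam : Fin (m + 1) → ℝ)
    (f : Fin (m + 1) → Rd d → ℂ) (σ : ℝ → ℂ) : Lp ℂ 2 (volume : Measure (Rd d)) :=
  -- The value 0 is a default only: for weights of compact support and admissible f, membership in
  -- L² is given by `Weight.memLp_modelOp`.
  if h : MemLp (modelOp Ψ Φ σ ρ lam f) 2 volume then h.toLp else 0

theorem Weight.coeFn_modelLp (hσ : Weight Λ N σ) (hΛ : Λ ≠ ∞)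
    (h : ModelData (Fin.last m) Ψ Φ B ρ lam) (hf : ∀ i, MemLp (f i) (expo m i)) :
    modelLp Ψ Φ ρ lam f σ =ᵐ[volume] modelOp Ψ Φ σ ρ lam f := by
  rw [modelLp, dif_pos (hσ.memLp_modelOp hΛ h hf)]
  exact MemLp.coeFn_toLp _

theorem Weight.norm_modelLp_le (hσ : Weight Λ N σ) (hΛ : Λ ≠ ∞)
    (h : ModelData (Fin.last m) Ψ Φ B ρ lam) (hf : ∀ i, MemLp (f i) (expo m i)) :
    ‖modelLp Ψ Φ ρ lam f σ‖ ≤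
      (modelConst Ψ B * Λ).toReal * ∏ i, (eLpNorm (f i) (expo m i)).toReal := by
  have h1 := hσ.eLpNorm_modelOp_le hΛ h hf
  rw [Lp.norm_def, eLpNorm_congr_ae (hσ.coeFn_modelLp hΛ h hf), ← ENNReal.toReal_prod,
    ← ENNReal.toReal_mul]
  refine ENNReal.toReal_mono ?_ (h1.trans_eq (mul_assoc _ _ _).symm)
  exact ENNReal.mul_ne_top (ENNReal.mul_ne_top h.modelConst_ne_top hΛ)
    (ENNReal.prod_ne_top fun i _ => (hf i).2.ne)

theorem Weight.modelLp_add_mul (hσ : Weight Λ N σ) (hσ' : Weight Λ N σ') (hΛ : Λ ≠ ∞)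
    (h : ModelData (Fin.last m) Ψ Φ B ρ lam) (hf : ∀ i, MemLp (f i) (expo m i)) (c : ℂ) :
    modelLp Ψ Φ ρ lam f (fun t => σ t + c * σ' t) =
      modelLp Ψ Φ ρ lam f σ + c • modelLp Ψ Φ ρ lam f σ' := by
  have hw : Weight (Λ + ‖c‖ₑ * Λ) N fun t => σ t + c * σ' t :=
    ⟨hσ.meas.add (hσ'.meas.const_mul c), fun t => (enorm_add_le _ _).trans
      (add_le_add (hσ.bdd t) (by rw [enorm_mul]; exact mul_le_mul_right (hσ'.bdd t) _)),
      fun t ht => by simp [hσ.supp t ht, hσ'.supp t ht]⟩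
  refine Lp.ext ?_
  filter_upwards [hw.coeFn_modelLp (by finiteness) h hf, hσ.coeFn_modelLp hΛ h hf,
    hσ'.coeFn_modelLp hΛ h hf, hσ.modelOp_add_mul hσ' hΛ h hf c,
    Lp.coeFn_add (modelLp Ψ Φ ρ lam f σ) (c • modelLp Ψ Φ ρ lam f σ'),
    Lp.coeFn_smul c (modelLp Ψ Φ ρ lam f σ')] with x h1 h2 h3 h4 h5 h6
  rw [h1, h4, h5, Pi.add_apply, Pi.add_apply, h6, h2, Pi.smul_apply, Pi.smul_apply, h3]

theorem modelLp_congr_ae (h : ∀ i, f i =ᵐ[volume] f' i) :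
    modelLp Ψ Φ ρ lam f σ = modelLp Ψ Φ ρ lam f' σ := by
  unfold modelLp
  rw [modelOp_congr_ae h]

theorem Weight.modelLp_update_add (hσ : Weight Λ N σ) (hΛ : Λ ≠ ∞)
    (h : ModelData (Fin.last m) Ψ Φ B ρ lam) {i : Fin (m + 1)} {g g' : Rd d → ℂ}
    (hg : ∀ j, MemLp (Function.update f i g j) (expo m j))
    (hg' : ∀ j, MemLp (Function.update f i g' j) (expo m j)) :
    modelLp Ψ Φ ρ lam (Function.update f i (g + g')) σ =
      modelLp Ψ Φ ρ lam (Function.update f i g) σ +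
        modelLp Ψ Φ ρ lam (Function.update f i g') σ := by
  have hs : ∀ j, MemLp (Function.update f i (g + g') j) (expo m j) := fun j => by
    by_cases hj : j = i
    · subst hj
      have h1 := (hg j).add (hg' j)
      simpa using h1
    · simpa [hj] using hg j
  refine Lp.ext ?_
  filter_upwards [hσ.coeFn_modelLp hΛ h hs, hσ.coeFn_modelLp hΛ h hg, hσ.coeFn_modelLp hΛ h hg',
    hσ.modelOp_update_add hΛ h hg hg', Lp.coeFn_add (modelLp Ψ Φ ρ lam (Function.update f i g) σ)
      (modelLp Ψ Φ ρ lam (Function.update f i g') σ)] with x h1 h2 h3 h4 h5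
  rw [h1, h4, h5, Pi.add_apply, Pi.add_apply, h2, h3]

theorem Weight.modelLp_update_smul (hσ : Weight Λ N σ) (hΛ : Λ ≠ ∞)
    (h : ModelData (Fin.last m) Ψ Φ B ρ lam) {i : Fin (m + 1)} {g : Rd d → ℂ}
    (hg : ∀ j, MemLp (Function.update f i g j) (expo m j)) (c : ℂ) :
    modelLp Ψ Φ ρ lam (Function.update f i (c • g)) σ =
      c • modelLp Ψ Φ ρ lam (Function.update f i g) σ := by
  have hs : ∀ j, MemLp (Function.update f i (c • g) j) (expo m j) := fun j => by
    by_cases hj : j = i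
    · subst hj
      have h1 := (hg j).const_smul c
      simpa using h1
    · simpa [hj] using hg j
  refine Lp.ext ?_
  filter_upwards [hσ.coeFn_modelLp hΛ h hs, hσ.coeFn_modelLp hΛ h hg,
    Lp.coeFn_smul c (modelLp Ψ Φ ρ lam (Function.update f i g) σ)] with x h1 h2 h3
  rw [h1, h3, Pi.smul_apply, h2, modelOp_update_smul, Pi.smul_apply]

theorem modelOpOn_Ioo_eq {a : ℝ} (ha : 0 < a) (b : ℝ) (L : ℝ → ℂ) :
    modelOpOn (Ioo a b) Ψ Φ L ρ lam f = modelOp Ψ Φ ((Ioo a b).indicator L) ρ lam f := by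
  ext x
  have hsub : Ioo a b ⊆ Ioi 0 := fun t ht => ha.trans ht.1
  have h1 : ∀ t, integrand Ψ Φ ((Ioo a b).indicator L) ρ lam f x t =
      (Ioo a b).indicator (integrand Ψ Φ L ρ lam f x) t := fun t => by
    by_cases ht : t ∈ Ioo a b
    · rw [indicator_of_mem ht, integrand, integrand, indicator_of_mem ht]
    · rw [indicator_of_notMem ht, integrand, indicator_of_notMem ht, zero_mul, zero_div]
  rw [modelOp, modelOpOn, modelOpOn]
  simp only [h1]
  rw [setIntegral_indicator measurableSet_Ioo, inter_eq_right.2 hsub]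

/-- The functions underlying a tuple of elements of the spaces `L^p`. -/
def coeLp (F : (i : Fin (m + 1)) → Lp ℂ (expo m i) (volume : Measure (Rd d))) (i : Fin (m + 1)) :
    Rd d → ℂ := F i

theorem memLp_coeLp (F : (i : Fin (m + 1)) → Lp ℂ (expo m i) (volume : Measure (Rd d)))
    (i : Fin (m + 1)) : MemLp (coeLp F i) (expo m i) := Lp.memLp (F i)

theorem coeLp_update (F : (i : Fin (m + 1)) → Lp ℂ (expo m i) (volume : Measure (Rd d)))
    (i : Fin (m + 1)) (g : Lp ℂ (expo m i) (volume : Measure (Rd d))) :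
    coeLp (Function.update F i g) = Function.update (coeLp F) i g := by
  ext j x
  by_cases hj : j = i
  · subst hj; simp [coeLp]
  · simp [coeLp, hj]

theorem memLp_update_coeLp (F : (i : Fin (m + 1)) → Lp ℂ (expo m i) (volume : Measure (Rd d)))
    (i : Fin (m + 1)) (g : Lp ℂ (expo m i) (volume : Measure (Rd d))) (j : Fin (m + 1)) :
    MemLp (Function.update (coeLp F) i g j) (expo m j) := by
  rw [← coeLp_update]
  exact memLp_coeLp _ _

theorem update_ae_eq {g g' : Rd d → ℂ} {i : Fin (m + 1)} (h : g =ᵐ[volume] g') (j : Fin (m + 1)) :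
    Function.update f i g j =ᵐ[volume] Function.update f i g' j := by
  by_cases hj : j = i
  · subst hj; simpa using h
  · simp [hj]

theorem eventually_weight {L : ℝ → ℂ} (hL : Measurable L) (hLΛ : ∀ t, ‖L t‖ₑ ≤ Λ) :
    ∀ᶠ s : ℝ × ℝ in 𝓝[>] 0 ×ˢ atTop, 0 < s.1 ∧ ∃ N, Weight Λ N ((Ioo s.1 s.2).indicator L) := by
  have h1 : ∀ᶠ ε : ℝ in 𝓝[>] 0, 0 < ε := self_mem_nhdsWithin
  filter_upwards [h1.prod_inl (atTop : Filter ℝ)] with s hs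
  obtain ⟨N, h3, h4⟩ := exists_zpow_two_bounds hs s.2
  exact ⟨hs, N, weight_indicator_Ioo hL hLΛ h3 h4⟩

/-- The model operator extends to a continuous multilinear operator, and the extension is an
improper integral over the scales. -/
theorem ModelData.exists_extension (h : ModelData (Fin.last m) Ψ Φ B ρ lam) {L : ℝ → ℂ}
    (hL : Measurable L) (hLΛ : ∀ t, ‖L t‖ₑ ≤ Λ) (hΛ : Λ ≠ ∞) :
    ∃ T : ContinuousMultilinearMap ℂ
        (fun i : Fin (m + 1) => Lp ℂ (expo m i) (volume : Measure (Rd d)))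
        (Lp ℂ 2 (volume : Measure (Rd d))),
      (∀ F : (i : Fin (m + 1)) → Lp ℂ (expo m i) (volume : Measure (Rd d)),
        Tendsto (fun s : ℝ × ℝ => modelLp Ψ Φ ρ lam (coeLp F) ((Ioo s.1 s.2).indicator L))
          (𝓝[>] 0 ×ˢ atTop) (𝓝 (T F))) ∧
      ‖T‖ ≤ (modelConst Ψ B * Λ).toReal := by
  have hex : ∀ F : (i : Fin (m + 1)) → Lp ℂ (expo m i) (volume : Measure (Rd d)), ∃ y,
      Tendsto (fun s : ℝ × ℝ => modelLp Ψ Φ ρ lam (coeLp F) ((Ioo s.1 s.2).indicator L))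
        (𝓝[>] 0 ×ˢ atTop) (𝓝 y) := fun F =>
    exists_tendsto_of_weights (fun N σ hσ => hσ.norm_modelLp_le hΛ h (memLp_coeLp F))
      (fun N σ σ' c hσ hσ' => hσ.modelLp_add_mul hσ' hΛ h (memLp_coeLp F) c) hL hLΛ
  -- T is defined as the limit of the truncations. Multilinearity and the norm bound hold for each
  -- truncation near the limit and pass to T.
  choose T hT using hex
  have hw := eventually_weight hL hLΛ
  have hadd : ∀ (F : (i : Fin (m + 1)) → Lp ℂ (expo m i) (volume : Measure (Rd d)))
      (i : Fin (m + 1)) (g g' : Lp ℂ (expo m i) (volume : Measure (Rd d))),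
      T (Function.update F i (g + g')) = T (Function.update F i g) + T (Function.update F i g') :=
    fun F i g g' => by
      refine tendsto_nhds_unique (hT _) (((hT _).add (hT _)).congr' ?_)
      filter_upwards [hw] with s hs
      obtain ⟨-, N, hN⟩ := hs
      rw [coeLp_update, coeLp_update, coeLp_update,
        modelLp_congr_ae (update_ae_eq (Lp.coeFn_add g g'))]
      exact (hN.modelLp_update_add hΛ h (memLp_update_coeLp F i g)
        (memLp_update_coeLp F i g')).symm
  have hsmul : ∀ (F : (i : Fin (m + 1)) → Lp ℂ (expo m i) (volume : Measure (Rd d)))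
      (i : Fin (m + 1)) (c : ℂ) (g : Lp ℂ (expo m i) (volume : Measure (Rd d))),
      T (Function.update F i (c • g)) = c • T (Function.update F i g) :=
    fun F i c g => by
      refine tendsto_nhds_unique (hT _) (((hT _).const_smul c).congr' ?_)
      filter_upwards [hw] with s hs
      obtain ⟨-, N, hN⟩ := hs
      rw [coeLp_update, coeLp_update, modelLp_congr_ae (update_ae_eq (Lp.coeFn_smul c g))]
      exact (hN.modelLp_update_smul hΛ h (memLp_update_coeLp F i g) c).symm
  have hbound : ∀ F, ‖T F‖ ≤ (modelConst Ψ B * Λ).toReal * ∏ i, ‖F i‖ := fun F => by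
    refine le_of_tendsto (hT F).norm ?_
    filter_upwards [hw] with s hs
    obtain ⟨-, N, hN⟩ := hs
    have h1 := hN.norm_modelLp_le hΛ h (memLp_coeLp F)
    simpa only [Lp.norm_def, coeLp] using h1
  let T' : MultilinearMap ℂ (fun i : Fin (m + 1) => Lp ℂ (expo m i) (volume : Measure (Rd d)))
      (Lp ℂ 2 (volume : Measure (Rd d))) :=
    { toFun := T
      map_update_add' := fun F i g g' => by
        convert hadd F i g g'
      map_update_smul' := fun F i c g => by
        convert hsmul F i c g }
  exact ⟨T'.mkContinuous _ hbound, hT, T'.mkContinuous_norm_le ENNReal.toReal_nonneg hbound⟩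

theorem ModelData.tendsto_eLpNorm_sub (h : ModelData (Fin.last m) Ψ Φ B ρ lam) {L : ℝ → ℂ}
    (hL : Measurable L) (hLΛ : ∀ t, ‖L t‖ₑ ≤ Λ) (hΛ : Λ ≠ ∞)
    (hf : ∀ i, MemLp (f i) (expo m i)) {y : Lp ℂ 2 (volume : Measure (Rd d))}
    (hy : Tendsto (fun s : ℝ × ℝ => modelLp Ψ Φ ρ lam f ((Ioo s.1 s.2).indicator L))
      (𝓝[>] 0 ×ˢ atTop) (𝓝 y)) :
    Tendsto (fun s : ℝ × ℝ => eLpNorm (modelOpOn (Ioo s.1 s.2) Ψ Φ L ρ lam f - ⇑y) 2 volume)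
      (𝓝[>] 0 ×ˢ atTop) (𝓝 0) := by
  have h1 := (tendsto_iff_edist_tendsto_0.1 hy)
  refine h1.congr' ?_
  filter_upwards [eventually_weight hL hLΛ] with s hs
  obtain ⟨hs0, N, hN⟩ := hs
  rw [modelOpOn_Ioo_eq hs0, Lp.edist_def]
  exact eLpNorm_congr_ae ((hN.coeFn_modelLp hΛ h hf).sub EventuallyEq.rfl)

end Extension

/-! ### Kernel bounds for Schwartz functions in terms of c_M. -/

section SchwartzNorms

variable {M : ℕ}

/-- The supremum of the partial derivatives of order at most `K` at the point `x`. -/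
def derivSup (K : ℕ) (ζ : Rd d → ℂ) (x : Rd d) : ℝ :=
  ⨆ k : Fin (K + 1), ⨆ j : Fin k → Fin d,
    ‖iteratedFDeriv ℝ (k : ℕ) ζ x (fun i => EuclideanSpace.single (j i) (1 : ℝ))‖

theorem le_derivSup (K : ℕ) (ζ : Rd d → ℂ) (x : Rd d) (k : Fin (K + 1)) (j : Fin k → Fin d) :
    ‖iteratedFDeriv ℝ (k : ℕ) ζ x (fun i => EuclideanSpace.single (j i) (1 : ℝ))‖ ≤
      derivSup K ζ x := by
  have h1 := le_ciSup (f := fun j : Fin k → Fin d =>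
    ‖iteratedFDeriv ℝ (k : ℕ) ζ x (fun i => EuclideanSpace.single (j i) (1 : ℝ))‖)
    (finite_range _).bddAbove j
  exact h1.trans (le_ciSup (f := fun k : Fin (K + 1) => ⨆ j : Fin k → Fin d,
    ‖iteratedFDeriv ℝ (k : ℕ) ζ x (fun i => EuclideanSpace.single (j i) (1 : ℝ))‖)
    (finite_range _).bddAbove k)

theorem derivSup_nonneg (K : ℕ) (ζ : Rd d → ℂ) (x : Rd d) : 0 ≤ derivSup K ζ x :=
  Real.iSup_nonneg fun _ => Real.iSup_nonneg fun _ => norm_nonneg _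

theorem cNorm_nonneg (K : ℕ) (ζ : Rd d → ℂ) : 0 ≤ cNorm K ζ :=
  Real.iSup_nonneg fun x => mul_nonneg (by positivity) (derivSup_nonneg K ζ x)

/-- The real supremum of an unbounded family is 0 by convention, so boundedness must be checked; it
follows from finitely many Schwartz seminorms. -/
theorem mul_derivSup_le_cNorm (K : ℕ) (ζ : 𝓢(Rd d, ℂ)) (x : Rd d) :
    (1 + ‖x‖) ^ K * derivSup K ζ x ≤ cNorm K ζ := by
  refine le_ciSup (f := fun x => (1 + ‖x‖) ^ K * derivSup K ζ x) ?_ x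
  set C := 2 ^ K * (Finset.Iic (K, K)).sup (fun m => SchwartzMap.seminorm ℝ m.1 m.2) ζ with hC
  have hC0 : 0 ≤ C := mul_nonneg (by positivity) (apply_nonneg _ _)
  refine ⟨C, ?_⟩
  rintro r ⟨y, rfl⟩
  have hy : 0 < (1 + ‖y‖) ^ K := by positivity
  dsimp only
  rw [← le_div_iff₀' hy]
  refine Real.iSup_le (fun k => Real.iSup_le (fun j => ?_) (by positivity)) (by positivity)
  rw [le_div_iff₀' hy]
  refine le_trans ?_ (SchwartzMap.one_add_le_sup_seminorm_apply (𝕜 := ℝ) (m := (K, K)) (k := K)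
    (n := k) le_rfl (Nat.lt_succ_iff.1 k.2) ζ y)
  refine mul_le_mul_of_nonneg_left ?_ hy.le
  refine (ContinuousMultilinearMap.le_opNorm _ _).trans_eq ?_
  simp

theorem pow_mul_norm_le_cNorm (K : ℕ) (ζ : 𝓢(Rd d, ℂ)) (x : Rd d) :
    (1 + ‖x‖) ^ K * ‖ζ x‖ ≤ cNorm K ζ := by
  refine le_trans (mul_le_mul_of_nonneg_left ?_ (by positivity)) (mul_derivSup_le_cNorm K ζ x)
  have h := le_derivSup K ζ x ⟨0, by lia⟩ (fun i => i.elim0)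
  rwa [iteratedFDeriv_zero_apply] at h

/-- Expanding h in the standard basis produces the factor d. -/
theorem pow_mul_norm_fderiv_le_cNorm {K : ℕ} (hK : 1 ≤ K) (ζ : 𝓢(Rd d, ℂ)) (x h : Rd d) :
    (1 + ‖x‖) ^ K * ‖fderiv ℝ ζ x h‖ ≤ d * cNorm K ζ * ‖h‖ := by
  have h1 : ∀ j : Fin d, (1 + ‖x‖) ^ K * ‖fderiv ℝ ζ x (EuclideanSpace.single j 1)‖ ≤
      cNorm K ζ := fun j => by
    refine le_trans (mul_le_mul_of_nonneg_left ?_ (by positivity)) (mul_derivSup_le_cNorm K ζ x)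
    have h2 := le_derivSup K ζ x ⟨1, by lia⟩ (fun _ => j)
    rwa [iteratedFDeriv_one_apply] at h2
  have h2 : h = ∑ j, h j • EuclideanSpace.single j (1 : ℝ) := by
    ext i
    simp [Finset.sum_apply, Pi.single_apply]
  calc (1 + ‖x‖) ^ K * ‖fderiv ℝ ζ x h‖
      ≤ (1 + ‖x‖) ^ K * ∑ j, ‖h‖ * ‖fderiv ℝ ζ x (EuclideanSpace.single j 1)‖ := by
        refine mul_le_mul_of_nonneg_left ?_ (by positivity)
        conv_lhs => rw [h2, map_sum]
        refine (norm_sum_le _ _).trans (Finset.sum_le_sum fun j _ => ?_)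
        rw [map_smul, norm_smul]
        exact mul_le_mul_of_nonneg_right (PiLp.norm_apply_le h j) (norm_nonneg _)
    _ = ∑ j, ‖h‖ * ((1 + ‖x‖) ^ K * ‖fderiv ℝ ζ x (EuclideanSpace.single j 1)‖) := by
        rw [Finset.mul_sum]
        exact Finset.sum_congr rfl fun j _ => by ring
    _ ≤ ∑ _j : Fin d, ‖h‖ * cNorm K ζ :=
        Finset.sum_le_sum fun j _ => mul_le_mul_of_nonneg_left (h1 j) (norm_nonneg _)
    _ = _ := by
        rw [Finset.sum_const, Finset.card_univ, Fintype.card_fin, nsmul_eq_mul]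
        ring

/-- The integral of `(1 + |x|)^{-d-1}`. -/
def tailInt (d : ℕ) : ℝ≥0∞ := ∫⁻ x : Rd d, ENNReal.ofReal ((1 + ‖x‖) ^ (-((d : ℝ) + 1)))

theorem tailInt_ne_top (d : ℕ) : tailInt d ≠ ∞ :=
  (finite_integral_one_add_norm (by rw [finrank_euclideanSpace_fin]; linarith)).ne

/-- After P powers are spent on the weight, at least d + 1 remain, enough for integrability on ℝ^d.
-/
theorem lintegral_mul_pow_le_of_decay {F : Rd d → ℂ} {c : ℝ} {P : ℕ} (hP : P + (d + 1) ≤ M)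
    (h : ∀ x, (1 + ‖x‖) ^ M * ‖F x‖ ≤ c) :
    ∫⁻ x, ‖F x‖ₑ * (1 + ‖x‖ₑ) ^ P ≤ ENNReal.ofReal c * tailInt d := by
  rw [tailInt, ← lintegral_const_mul' _ _ ENNReal.ofReal_ne_top]
  refine lintegral_mono fun x => ?_
  have h1 : (1 : ℝ) ≤ 1 + ‖x‖ := le_add_of_nonneg_right (norm_nonneg x)
  have h0 : (0 : ℝ) < 1 + ‖x‖ := by linarith
  have hc : 0 ≤ c := le_trans (by positivity) (h x)
  have e1 : ‖F x‖ₑ * (1 + ‖x‖ₑ) ^ P = ENNReal.ofReal (‖F x‖ * (1 + ‖x‖) ^ P) := by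
    rw [ENNReal.ofReal_mul (norm_nonneg _), ENNReal.ofReal_pow h0.le,
      ENNReal.ofReal_add zero_le_one (norm_nonneg _), ENNReal.ofReal_one, ofReal_norm, ofReal_norm]
  rw [e1, ← ENNReal.ofReal_mul hc]
  refine ENNReal.ofReal_le_ofReal ?_
  rw [Real.rpow_neg h0.le, ← Nat.cast_add_one, Real.rpow_natCast, ← div_eq_mul_inv,
    le_div_iff₀ (by positivity), mul_assoc, ← pow_add, mul_comm]
  exact le_trans (mul_le_mul_of_nonneg_right (pow_le_pow_right₀ h1 hP) (norm_nonneg _)) (h x)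

/-- The fundamental theorem of calculus on the segment from w to w + h, followed by Tonelli and
translation invariance. -/
theorem lintegral_shift_sub_le (ζ : 𝓢(Rd d, ℂ)) {c : ℝ≥0∞} (h : Rd d)
    (hc : ∫⁻ x, ‖fderiv ℝ ζ x h‖ₑ ≤ c) : ∫⁻ w, ‖ζ (w + h) - ζ w‖ₑ ≤ c := by
  have hcd : Continuous (fderiv ℝ ζ) := (ζ.smooth 1).continuous_fderiv (by norm_num)
  have hcont : Continuous fun p : Rd d × ℝ => fderiv ℝ ζ (p.1 + p.2 • h) h :=
    (hcd.comp (continuous_fst.add (continuous_snd.smul continuous_const))).clm_apply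
      continuous_const
  have h1 : ∀ w, ‖ζ (w + h) - ζ w‖ₑ ≤ ∫⁻ s in Ioc (0 : ℝ) 1, ‖fderiv ℝ ζ (w + s • h) h‖ₑ := by
    intro w
    have hd : ∀ s : ℝ, HasDerivAt (fun s : ℝ => ζ (w + s • h)) (fderiv ℝ ζ (w + s • h) h) s := by
      intro s
      have e1 : HasDerivAt (fun s : ℝ => w + s • h) h s := by
        simpa using ((hasDerivAt_id s).smul_const h).const_add w
      exact ((ζ.differentiable _).hasFDerivAt).comp_hasDerivAt s e1
    have e2 := intervalIntegral.integral_eq_sub_of_hasDerivAt (a := 0) (b := 1)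
      (fun s _ => hd s) ((hcont.comp (continuous_const.prodMk continuous_id)).intervalIntegrable _ _)
    rw [one_smul, zero_smul, add_zero, intervalIntegral.integral_of_le zero_le_one] at e2
    rw [← e2]
    exact enorm_integral_le_lintegral_enorm _
  calc ∫⁻ w, ‖ζ (w + h) - ζ w‖ₑ
      ≤ ∫⁻ w, ∫⁻ s in Ioc (0 : ℝ) 1, ‖fderiv ℝ ζ (w + s • h) h‖ₑ := lintegral_mono h1
    _ = ∫⁻ s in Ioc (0 : ℝ) 1, ∫⁻ w, ‖fderiv ℝ ζ (w + s • h) h‖ₑ :=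
        lintegral_lintegral_swap hcont.enorm.measurable.aemeasurable
    _ ≤ ∫⁻ s in Ioc (0 : ℝ) 1, c := by
        refine lintegral_mono fun s => ?_
        rw [lintegral_add_right_eq_self (fun w => ‖fderiv ℝ ζ w h‖ₑ)]
        exact hc
    _ = c := by
        rw [lintegral_const, Measure.restrict_apply_univ, Real.volume_Ioc]
        norm_num

/-- The factor between `c_M` and the bounds of a kernel. -/
def kerNormConst (d : ℕ) : ℝ≥0∞ := (d + 1) * tailInt d

theorem kerNormConst_ne_top (d : ℕ) : kerNormConst d ≠ ∞ :=
  ENNReal.mul_ne_top (by finiteness) (tailInt_ne_top d)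

theorem tailInt_le_kerNormConst (d : ℕ) : tailInt d ≤ kerNormConst d :=
  le_mul_of_one_le_left' le_add_self

/-- d + 1 powers of decay are needed for integrability and one more for the first moment; the
modulus of continuity uses first derivatives. -/
theorem isKer_schwartz (hM : d + 2 ≤ M) (ζ : 𝓢(Rd d, ℂ)) :
    IsKer 0 (ENNReal.ofReal (cNorm M ζ) * kerNormConst d) ζ := by
  have hm : Measurable ζ := ζ.continuous.measurable
  have hc := pow_mul_norm_le_cNorm M ζ
  refine ⟨hm, ?_, ?_, fun h => ?_⟩
  · have h1 := lintegral_mul_pow_le_of_decay (P := 0) (by lia) hc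
    simp only [pow_zero, mul_one] at h1
    exact h1.trans (mul_le_mul_right (tailInt_le_kerNormConst d) _)
  · have h1 := lintegral_mul_pow_le_of_decay (P := 1) (by lia) hc
    rw [p2_zero, mul_one]
    refine le_trans (lintegral_mono fun w => ?_)
      (h1.trans (mul_le_mul_right (tailInt_le_kerNormConst d) _))
    rw [pow_one]
    exact mul_le_mul_right le_add_self _
  · have h1 := lintegral_mul_pow_le_of_decay (M := M) (P := 0) (by lia)
      (pow_mul_norm_fderiv_le_cNorm (by lia) ζ · h)
    simp only [pow_zero, mul_one] at h1
    refine (lintegral_shift_sub_le ζ h h1).trans ?_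
    rw [neg_zero, p2_zero, mul_one, ENNReal.ofReal_mul (mul_nonneg d.cast_nonneg (cNorm_nonneg _ _)),
      ENNReal.ofReal_mul d.cast_nonneg, ofReal_norm, ENNReal.ofReal_natCast, kerNormConst]
    calc (d : ℝ≥0∞) * ENNReal.ofReal (cNorm M ζ) * ‖h‖ₑ * tailInt d
        = ENNReal.ofReal (cNorm M ζ) * (d * tailInt d) * ‖h‖ₑ := by ring
      _ ≤ _ := by
        gcongr
        exact le_self_add

theorem wt_schwartz_le {n : ℕ} (hM : n + (d + 1) ≤ M) (ζ : 𝓢(Rd d, ℂ)) :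
    wt ζ n ≤ ENNReal.ofReal (cNorm M ζ) * tailInt d :=
  lintegral_mul_pow_le_of_decay hM (pow_mul_norm_le_cNorm M ζ)

/-- The integral is the value of the Fourier transform at 0, a point outside the corona. -/
theorem integral_eq_zero_of_spectrumInCorona {ζ : Rd d → ℂ} (h : SpectrumInCorona ζ) :
    ∫ x, ζ x = 0 := by
  obtain ⟨a, b, ha, -, hsub⟩ := h
  have h0 : (0 : Rd d) ∉ tsupport (𝓕 ζ) := fun h0 => by
    have := (hsub h0).1
    rw [norm_zero] at this
    linarith
  have h1 := image_eq_zero_of_notMem_tsupport h0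
  rw [Real.fourier_eq'] at h1
  simpa using h1

end SchwartzNorms

/-! ### Schwartz data satisfy the hypotheses of the estimates. -/

section SchwartzData

variable {m : ℕ} {Ψ : 𝓢(Rd d, ℂ)} {Φ : Fin (m + 1) → 𝓢(Rd d, ℂ)} {ρ lam : Fin (m + 1) → ℝ}

/-- The order m + d + 2 is n + (d + 1) with n = m + 1: the weight (1 + |z|)^n against Ψ, and d + 1
powers for integrability. -/
theorem modelData_schwartz (hΨ : SpectrumInCorona (⇑Ψ)) (hρ : ∀ i, 0 < ρ i ∧ ρ i ≤ 1)
    (hlam : ∀ i, lam i ≠ 0) (hle : ∀ i, |lam i| ≤ |lam (Fin.last m)|) :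
    ModelData (Fin.last m) Ψ (fun i => ⇑(Φ i))
      (fun i => ENNReal.ofReal (cNorm (m + d + 2) (Φ i)) * kerNormConst d) ρ lam where
  measΨ := Ψ.continuous.measurable
  wtΨ := ne_top_of_le_ne_top (ENNReal.mul_ne_top ENNReal.ofReal_ne_top (tailInt_ne_top d))
    (wt_schwartz_le (M := m + d + 2) (by lia) Ψ)
  intΨ := integral_eq_zero_of_spectrumInCorona hΨ
  ker i := isKer_schwartz (by lia) (Φ i)
  ne_top i := ENNReal.mul_ne_top ENNReal.ofReal_ne_top (kerNormConst_ne_top d)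
  rho_pos i := (hρ i).1
  rho_le i := (hρ i).2
  lam_ne := hlam
  lam_le := hle

/-- The constant of the theorem. -/
def finalConst (d m : ℕ) : ℝ≥0∞ :=
  coreConst d (m + 1) * tailInt d * (4 * kerNormConst d) ^ (m + 1)

theorem finalConst_ne_top (d m : ℕ) : finalConst d m ≠ ∞ :=
  ENNReal.mul_ne_top (ENNReal.mul_ne_top (coreConst_ne_top d _) (tailInt_ne_top d))
    (ENNReal.pow_ne_top (ENNReal.mul_ne_top (by norm_num) (kerNormConst_ne_top d)))

theorem const_mul_le_of_le (c t k q W w P Λ : ℝ≥0∞) (h : w ≤ W * t) :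
    c * (w * (q * (P * k))) * Λ ≤ c * t * (q * k) * Λ * W * P := by
  calc c * (w * (q * (P * k))) * Λ ≤ c * ((W * t) * (q * (P * k))) * Λ := by gcongr
    _ = _ := by ring

theorem toReal_modelConst_le (Λ : ℝ≥0∞) (hΛ : Λ ≠ ∞) :
    (modelConst Ψ (fun i => ENNReal.ofReal (cNorm (m + d + 2) (Φ i)) * kerNormConst d) * Λ).toReal ≤
      (finalConst d m).toReal * Λ.toReal * cNorm (m + d + 2) Ψ *
        ∏ i, cNorm (m + d + 2) (Φ i) := by
  have h1 := const_mul_le_of_le (coreConst d (m + 1)) (tailInt d) (kerNormConst d ^ (m + 1))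
    (4 ^ (m + 1)) (ENNReal.ofReal (cNorm (m + d + 2) Ψ)) (wt Ψ (m + 1))
    (∏ i, ENNReal.ofReal (cNorm (m + d + 2) (Φ i))) Λ (wt_schwartz_le (by lia) Ψ)
  have e1 : modelConst Ψ (fun i => ENNReal.ofReal (cNorm (m + d + 2) (Φ i)) * kerNormConst d) * Λ ≤
      finalConst d m * Λ * ENNReal.ofReal (cNorm (m + d + 2) Ψ) *
        ∏ i, ENNReal.ofReal (cNorm (m + d + 2) (Φ i)) := by
    refine le_trans (le_of_eq ?_) (h1.trans_eq ?_)
    · rw [modelConst, Finset.prod_mul_distrib, Finset.prod_mul_distrib, Finset.prod_const,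
        Finset.prod_const, Finset.card_univ, Fintype.card_fin]
    · rw [finalConst, mul_pow]
  have e2 := ENNReal.toReal_mono (ENNReal.mul_ne_top (ENNReal.mul_ne_top
    (ENNReal.mul_ne_top (finalConst_ne_top d m) hΛ) ENNReal.ofReal_ne_top)
    (ENNReal.prod_ne_top fun i _ => ENNReal.ofReal_ne_top)) e1
  simpa only [ENNReal.toReal_mul, ENNReal.toReal_prod,
    ENNReal.toReal_ofReal (cNorm_nonneg _ _)] using e2

end SchwartzData

/-! ### Absolute convergence of the integral over the scales for Schwartz functions. -/

section AbsoluteConvergence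

theorem enorm_convOp_le_lintegral {k f : Rd d → ℂ} {A : ℝ≥0∞} (hA : A ≠ ∞)
    (hf : ∀ y, ‖f y‖ₑ ≤ A) (x : Rd d) : ‖convOp k f x‖ₑ ≤ (∫⁻ w, ‖k w‖ₑ) * A := by
  refine (enorm_convOp_le_absConv k f x).trans ?_
  refine (lintegral_mono fun y => mul_le_mul_right (hf y) _).trans_eq ?_
  rw [lintegral_mul_const' _ _ hA, lintegral_sub_left_eq_self (fun w => ‖k w‖ₑ) x]

theorem enorm_convOp_le_lintegral' {k f : Rd d → ℂ} {A : ℝ≥0∞} (hA : A ≠ ∞)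
    (hk : ∀ y, ‖k y‖ₑ ≤ A) (x : Rd d) : ‖convOp k f x‖ₑ ≤ A * ∫⁻ w, ‖f w‖ₑ := by
  refine (enorm_convOp_le_absConv k f x).trans ?_
  refine (lintegral_mono fun y => mul_le_mul_left (hk (x - y)) _).trans_eq ?_
  rw [lintegral_const_mul' _ _ hA]

theorem integrable_mul_of_enorm_le {k g : Rd d → ℂ} (hk : Integrable k) (hg : Measurable g)
    {A : ℝ≥0∞} (hA : A ≠ ∞) (h : ∀ y, ‖g y‖ₑ ≤ A) : Integrable fun y => k y * g y := by
  refine ⟨hk.1.mul hg.aestronglyMeasurable, ?_⟩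
  refine lt_of_le_of_lt (lintegral_mono fun y => (enorm_mul (k y) (g y)).trans_le
    (mul_le_mul_right (h y) _)) ?_
  rw [lintegral_mul_const' _ _ hA]
  exact ENNReal.mul_lt_top hk.2 hA.lt_top

/-- The translation is moved from the output onto f, where the Lipschitz bound applies. -/
theorem enorm_convOp_sub_le {k f : Rd d → ℂ} (hk : Integrable k) (hf : Measurable f)
    {A : ℝ≥0∞} (hA : A ≠ ∞) (hfA : ∀ y, ‖f y‖ₑ ≤ A)
    (hLip : ∀ y y', ‖f y - f y'‖ₑ ≤ A * ‖y - y'‖ₑ) (x v : Rd d) :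
    ‖convOp k f (x - v) - convOp k f x‖ₑ ≤ (∫⁻ w, ‖k w‖ₑ) * (A * ‖v‖ₑ) := by
  have e1 : convOp k f (x - v) = convOp k (fun y => f (y - v)) x := by
    simp only [convOp, kerOp]
    rw [← integral_sub_right_eq_self (fun y => k (x - v - y) * f y) v]
    refine integral_congr_ae (Eventually.of_forall fun y => ?_)
    dsimp only
    rw [show x - v - (y - v) = x - y by abel]
  have hki : Integrable fun y => k (x - y) := hk.comp_sub_left x
  have e2 : convOp k (fun y => f (y - v)) x - convOp k f x =
      convOp k (fun y => f (y - v) - f y) x := by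
    simp only [convOp, kerOp, mul_sub]
    exact (integral_sub (integrable_mul_of_enorm_le hki (hf.comp (measurable_id.sub_const v)) hA
      fun y => hfA _) (integrable_mul_of_enorm_le hki hf hA hfA)).symm
  rw [e1, e2]
  refine enorm_convOp_le_lintegral (ENNReal.mul_ne_top hA enorm_ne_top) (fun y => ?_) x
  refine (hLip _ _).trans_eq ?_
  rw [show y - v - y = -v by abel, enorm_neg]

theorem convOp_scaleKer (ζ f : Rd d → ℂ) (ρ τ : ℝ) (z x : Rd d) :
    convOp (scaleKer ζ ρ τ z) f x = convOp (dilate ζ τ) f (x - (ρ * τ) • z) := by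
  simp only [convOp, kerOp, scaleKer]
  refine integral_congr_ae (Eventually.of_forall fun y => ?_)
  dsimp only
  rw [show x - y - (ρ * τ) • z = x - (ρ * τ) • z - y by abel]

theorem enorm_prod_sub_prod_le {ι : Type*} [DecidableEq ι] (s : Finset ι) {a b : ι → ℂ}
    {R δ : ℝ≥0∞} (hR : 1 ≤ R) (ha : ∀ i, ‖a i‖ₑ ≤ R) (hb : ∀ i, ‖b i‖ₑ ≤ R)
    (h : ∀ i, ‖a i - b i‖ₑ ≤ δ) :
    ‖∏ i ∈ s, a i - ∏ i ∈ s, b i‖ₑ ≤ s.card * R ^ s.card * δ := by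
  induction s using Finset.induction_on with
  | empty => simp
  | insert i s hi ih =>
    rw [Finset.prod_insert hi, Finset.prod_insert hi, Finset.card_insert_of_notMem hi,
      show a i * ∏ j ∈ s, a j - b i * ∏ j ∈ s, b j =
        (a i - b i) * ∏ j ∈ s, a j + b i * (∏ j ∈ s, a j - ∏ j ∈ s, b j) by ring]
    have h1 : ‖∏ j ∈ s, a j‖ₑ ≤ R ^ s.card := by
      rw [enorm_finset_prod]
      exact Finset.prod_le_pow_card _ _ _ fun j _ => ha j
    calc ‖(a i - b i) * ∏ j ∈ s, a j + b i * (∏ j ∈ s, a j - ∏ j ∈ s, b j)‖ₑ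
        ≤ ‖a i - b i‖ₑ * ‖∏ j ∈ s, a j‖ₑ + ‖b i‖ₑ * ‖∏ j ∈ s, a j - ∏ j ∈ s, b j‖ₑ := by
          refine (enorm_add_le _ _).trans ?_
          rw [enorm_mul, enorm_mul]
      _ ≤ δ * (R ^ s.card * R) + R * (s.card * R ^ s.card * δ) :=
          add_le_add (mul_le_mul' (h i) (h1.trans (le_mul_of_one_le_right' hR)))
            (mul_le_mul' (hb i) ih)
      _ = _ := by
          push_cast
          ring

variable {n : ℕ} {n₀ : Fin n} {Ψ : Rd d → ℂ} {Φ : Fin n → Rd d → ℂ} {B : Fin n → ℝ≥0∞}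
  {ρ lam : Fin n → ℝ} {f : Fin n → Rd d → ℂ} {A Λ : ℝ≥0∞} {L : ℝ → ℂ}

theorem enorm_real_mul_pos (lam : ℝ) {t : ℝ} (ht : 0 < t) :
    ‖lam * t‖ₑ = ‖lam‖ₑ * ENNReal.ofReal t := by
  rw [enorm_mul, Real.enorm_of_nonneg ht.le]

/-- Bounded Lipschitz functions, one of them integrable. -/
structure LipInputs (n₀ : Fin n) (A : ℝ≥0∞) (f : Fin n → Rd d → ℂ) : Prop where
  meas : ∀ i, Measurable (f i)
  ne_top : A ≠ ∞
  bdd : ∀ i y, ‖f i y‖ₑ ≤ A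
  lip : ∀ i y y', ‖f i y - f i y'‖ₑ ≤ A * ‖y - y'‖ₑ
  int : ∫⁻ y, ‖f n₀ y‖ₑ ≠ ∞

/-- Dilates keep their L¹ norm, so the factors are bounded uniformly in t. The translation by ρ λ t
z is linear in t and in z, hence so is its effect on a Lipschitz function. -/
theorem ModelData.exists_factor_bound (h : ModelData n₀ Ψ Φ B ρ lam) (hf : LipInputs n₀ A f) :
    ∃ R : ℝ≥0∞, R ≠ ∞ ∧ 1 ≤ R ∧ (∀ i (t : ℝ), 0 < t → ∀ z x,
      ‖convOp (scaleKer (Φ i) (ρ i) (lam i * t) z) (f i) x‖ₑ ≤ R) ∧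
      ∀ i (t : ℝ), 0 < t → ∀ z x, ‖convOp (scaleKer (Φ i) (ρ i) (lam i * t) z) (f i) x -
        convOp (scaleKer (Φ i) (ρ i) (lam i * t) 0) (f i) x‖ₑ ≤ R * ENNReal.ofReal t * ‖z‖ₑ := by
  have hA := hf.ne_top
  set b : Fin n → ℝ≥0∞ := fun i => B i * A * (1 + ‖lam i‖ₑ) with hb
  have hbt : ∀ i, b i ≠ ∞ := fun i => by
    have := h.ne_top i
    simp only [hb]
    finiteness
  have hbs : ∀ i, b i ≤ 1 + ∑ j, b j := fun i =>
    (Finset.single_le_sum (f := b) (fun _ _ => zero_le) (Finset.mem_univ i)).trans le_add_self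
  have hlam : ∀ i (t : ℝ), 0 < t → lam i * t ≠ 0 := fun i t ht => mul_ne_zero (h.lam_ne i) ht.ne'
  have hlint : ∀ i, ∫⁻ w, ‖Φ i w‖ₑ ≤ B i := fun i => (h.ker i).lint
  refine ⟨1 + ∑ i, b i, ENNReal.add_ne_top.2 ⟨ENNReal.one_ne_top,
    ENNReal.sum_ne_top.2 fun i _ => hbt i⟩, le_self_add, fun i t ht z x => ?_,
    fun i t ht z x => ?_⟩
  · refine (enorm_convOp_le_lintegral hA (hf.bdd i) x).trans (le_trans ?_ (hbs i))
    rw [lintegral_scaleKer (hlam i t ht)]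
    calc (∫⁻ w, ‖Φ i w‖ₑ) * A ≤ B i * A * 1 := by
          rw [mul_one]
          exact mul_le_mul_left (hlint i) _
      _ ≤ b i := mul_le_mul_right le_self_add _
  · rw [convOp_scaleKer, convOp_scaleKer, smul_zero, sub_zero]
    have hint : Integrable (dilate (Φ i) (lam i * t)) := by
      refine ⟨((measurable_dilate (h.ker i).meas).comp
        (measurable_const.prodMk measurable_id)).aestronglyMeasurable, ?_⟩
      have e := lintegral_scaleKer (hlam i t ht) (Φ i) (ρ i) 0
      simp only [scaleKer, smul_zero, sub_zero] at e
      exact e.trans_lt ((hlint i).trans_lt (h.ne_top i).lt_top)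
    have e := lintegral_scaleKer (hlam i t ht) (Φ i) (ρ i) 0
    simp only [scaleKer, smul_zero, sub_zero] at e
    refine (enorm_convOp_sub_le hint (hf.meas i) hA (hf.bdd i) (hf.lip i) x _).trans ?_
    have h1 : ‖(ρ i * (lam i * t)) • z‖ₑ ≤ ‖lam i‖ₑ * ENNReal.ofReal t * ‖z‖ₑ := by
      rw [enorm_smul, enorm_mul, enorm_real_mul_pos _ ht]
      refine mul_le_mul_left (mul_le_of_le_one_left' ?_) _
      rw [Real.enorm_of_nonneg (h.rho_pos i).le]
      exact ENNReal.ofReal_le_one.2 (h.rho_le i)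
    rw [e]
    calc (∫⁻ w, ‖Φ i w‖ₑ) * (A * ‖(ρ i * (lam i * t)) • z‖ₑ)
        ≤ B i * (A * (‖lam i‖ₑ * ENNReal.ofReal t * ‖z‖ₑ)) :=
          mul_le_mul' (hlint i) (mul_le_mul_right h1 _)
      _ = (B i * A * ‖lam i‖ₑ) * ENNReal.ofReal t * ‖z‖ₑ := by ring
      _ ≤ _ := by
        gcongr
        exact (mul_le_mul_right le_add_self _).trans (hbs i)

theorem measurable_convOp_left {H : Rd d → Rd d → ℂ} {g : Rd d → ℂ}
    (hH : Measurable (Function.uncurry H)) (hg : Measurable g) (x : Rd d) :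
    Measurable fun z => convOp (H z) g x :=
  (measurable_convOp hH hg).comp (measurable_id.prodMk measurable_const)

theorem measurable_prod_convOp (hΦ : ∀ i, Measurable (Φ i)) (hf : ∀ i, Measurable (f i)) (t : ℝ)
    (x : Rd d) : Measurable fun z =>
      ∏ i, convOp (scaleKer (Φ i) (ρ i) (lam i * t) z) (f i) x :=
  Finset.measurable_fun_prod _ fun i _ =>
    measurable_convOp_left (measurable_scaleKer_right (hΦ i) (ρ i) (lam i * t)) (hf i) x

theorem ModelData.integrable (h : ModelData n₀ Ψ Φ B ρ lam) : Integrable Ψ := by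
  refine ⟨h.measΨ.aestronglyMeasurable, lt_of_le_of_lt (lintegral_mono fun z => ?_) h.wtΨ.lt_top⟩
  exact le_mul_of_one_le_right' (one_le_pow₀ (one_le_one_add_enorm z))

/-- Small scales contribute little, since `Ψ` has mean zero. -/
theorem ModelData.exists_enorm_scaleInt_le_mul (h : ModelData n₀ Ψ Φ B ρ lam)
    (hf : LipInputs n₀ A f) (x : Rd d) :
    ∃ C : ℝ≥0∞, C ≠ ∞ ∧ ∀ t, 0 < t → ‖scaleInt Ψ Φ ρ lam f t x‖ₑ ≤ C * ENNReal.ofReal t := by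
  obtain ⟨R, hR, hR1, h1, h2⟩ := h.exists_factor_bound hf
  have hn : 1 ≤ n := Fin.pos n₀
  have hw := h.wtΨ
  refine ⟨n * R ^ n * R * wt Ψ n, by finiteness, fun t ht => ?_⟩
  set P : Rd d → ℂ := fun z => ∏ i, convOp (scaleKer (Φ i) (ρ i) (lam i * t) z) (f i) x with hP
  have hPm : Measurable P := measurable_prod_convOp (fun i => (h.ker i).meas) hf.meas t x
  have hPR : ∀ z, ‖P z‖ₑ ≤ R ^ n := fun z => by
    rw [hP, enorm_finset_prod]
    refine (Finset.prod_le_pow_card _ _ _ fun i _ => h1 i t ht z x).trans_eq ?_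
    rw [Finset.card_univ, Fintype.card_fin]
  -- Since ∫ Ψ = 0, the untranslated product may be subtracted, and every difference of factors is
  -- O(t |z|).
  have e1 : scaleInt Ψ Φ ρ lam f t x = ∫ z, Ψ z * (P z - P 0) := by
    simp only [mul_sub]
    rw [integral_sub (integrable_mul_of_enorm_le h.integrable hPm (ENNReal.pow_ne_top hR) hPR)
      (h.integrable.mul_const _), integral_mul_const, h.intΨ, zero_mul, sub_zero, scaleInt]
  have h3 : ∀ z, ‖P z - P 0‖ₑ ≤ n * R ^ n * (R * ENNReal.ofReal t * ‖z‖ₑ) := fun z => by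
    have := enorm_prod_sub_prod_le Finset.univ hR1 (fun i => h1 i t ht z x)
      (fun i => h1 i t ht 0 x) (fun i => h2 i t ht z x)
    rwa [Finset.card_univ, Fintype.card_fin] at this
  rw [e1]
  refine (enorm_integral_le_lintegral_enorm _).trans ?_
  have h4 : ∀ z, ‖Ψ z * (P z - P 0)‖ₑ ≤
      (n * R ^ n * R * ENNReal.ofReal t) * (‖Ψ z‖ₑ * (1 + ‖z‖ₑ) ^ n) := fun z => by
    rw [enorm_mul]
    have h5 : ‖z‖ₑ ≤ (1 + ‖z‖ₑ) ^ n := le_add_self.trans (le_self_pow₀ (one_le_one_add_enorm z) (by lia))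
    calc ‖Ψ z‖ₑ * ‖P z - P 0‖ₑ
        ≤ ‖Ψ z‖ₑ * (n * R ^ n * (R * ENNReal.ofReal t * (1 + ‖z‖ₑ) ^ n)) := by
          refine mul_le_mul_right ((h3 z).trans ?_) _
          gcongr
      _ = _ := by ring
  refine (lintegral_mono h4).trans_eq ?_
  rw [lintegral_const_mul' _ _ (by finiteness), wt]
  ring

/-- Large scales contribute little, since the dilates of `Φ n₀` are small. -/
theorem ModelData.exists_enorm_scaleInt_le_inv (h : ModelData n₀ Ψ Φ B ρ lam)
    (hf : LipInputs n₀ A f) (hΦ : ∀ y, ‖Φ n₀ y‖ₑ ≤ A) (x : Rd d) :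
    ∃ C : ℝ≥0∞, C ≠ ∞ ∧ ∀ t, 1 ≤ t → ‖scaleInt Ψ Φ ρ lam f t x‖ₑ ≤ C * ENNReal.ofReal t⁻¹ := by
  -- In dimension 0 dilates do not decay, but then the product is independent of z and the integral
  -- is a multiple of ∫ Ψ = 0.
  rcases Nat.eq_zero_or_pos d with hd | hd
  · subst hd
    refine ⟨0, by simp, fun t _ => ?_⟩
    have : scaleInt Ψ Φ ρ lam f t x = (∫ z, Ψ z) *
        ∏ i, convOp (scaleKer (Φ i) (ρ i) (lam i * t) 0) (f i) x := by
      rw [scaleInt, ← integral_mul_const]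
      refine integral_congr_ae (Eventually.of_forall fun z => ?_)
      rw [Subsingleton.elim z 0]
    rw [this, h.intΨ]
    simp
  obtain ⟨R, hR, hR1, h1, -⟩ := h.exists_factor_bound hf
  have hA := hf.ne_top
  have hI := hf.int
  set I := ∫⁻ y, ‖f n₀ y‖ₑ with hIdef
  have hl : 0 < |lam n₀| := abs_pos.2 (h.lam_ne n₀)
  set κ : ℝ≥0∞ := ENNReal.ofReal ((|lam n₀| ^ d)⁻¹) with hκ
  have hκt : κ ≠ ∞ := ENNReal.ofReal_ne_top
  have hw := h.integrable.2.ne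
  refine ⟨R ^ n * (κ * A * I) * ∫⁻ z, ‖Ψ z‖ₑ, by finiteness, fun t ht => ?_⟩
  have ht0 : 0 < t := by linarith
  have h2 : ∀ z, ‖convOp (scaleKer (Φ n₀) (ρ n₀) (lam n₀ * t) z) (f n₀) x‖ₑ ≤
      κ * A * I * ENNReal.ofReal t⁻¹ := fun z => by
    refine (enorm_convOp_le_lintegral' (A := κ * ENNReal.ofReal t⁻¹ * A) (by finiteness)
      (fun w => ?_) x).trans_eq (by ring)
    rw [scaleKer, enorm_dilate, hκ, ← ENNReal.ofReal_mul (by positivity)]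
    refine mul_le_mul' (ENNReal.ofReal_le_ofReal ?_) (hΦ _)
    rw [abs_mul, abs_of_pos ht0, mul_pow, mul_inv]
    -- For t ≥ 1 and d ≥ 1, t^(-d) ≤ 1/t.
    refine mul_le_mul_of_nonneg_left (inv_anti₀ ht0 (le_self_pow₀ ht hd.ne')) (by positivity)
  have h3 : ∀ z, ‖Ψ z * ∏ i, convOp (scaleKer (Φ i) (ρ i) (lam i * t) z) (f i) x‖ₑ ≤
      R ^ n * (κ * A * I) * ENNReal.ofReal t⁻¹ * ‖Ψ z‖ₑ := fun z => by
    rw [enorm_mul, enorm_finset_prod, ← Finset.mul_prod_erase _ _ (Finset.mem_univ n₀)]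
    have h4 : ∏ i ∈ Finset.univ.erase n₀,
        ‖convOp (scaleKer (Φ i) (ρ i) (lam i * t) z) (f i) x‖ₑ ≤ R ^ n := by
      refine (Finset.prod_le_pow_card _ _ R fun i _ => h1 i t ht0 z x).trans ?_
      refine pow_le_pow_right₀ hR1 ?_
      have := Finset.card_le_univ (Finset.univ.erase n₀)
      rwa [Fintype.card_fin] at this
    calc _ ≤ ‖Ψ z‖ₑ * ((κ * A * I * ENNReal.ofReal t⁻¹) * R ^ n) :=
          mul_le_mul_right (mul_le_mul' (h2 z) h4) _
      _ = _ := by ring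
  refine (enorm_integral_le_lintegral_enorm _).trans ((lintegral_mono h3).trans_eq ?_)
  rw [lintegral_const_mul' _ _ (by finiteness)]
  ring

/-- Together with dt/t, the O(t) bound leaves a bounded integrand on (0, 1], and the O(1/t) bound
leaves t^(-2) on (1, ∞). -/
theorem ModelData.integrableOn_integrand (h : ModelData n₀ Ψ Φ B ρ lam) (hf : LipInputs n₀ A f)
    (hΦ : ∀ y, ‖Φ n₀ y‖ₑ ≤ A) (hL : Measurable L) (hLΛ : ∀ t, ‖L t‖ₑ ≤ Λ) (hΛ : Λ ≠ ∞)
    (x : Rd d) : IntegrableOn (integrand Ψ Φ L ρ lam f x) (Ioi 0) := by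
  have hcongr : EqOn (fun t => L t * scaleInt Ψ Φ ρ lam f t x / (t : ℂ))
      (integrand Ψ Φ L ρ lam f x) (Ioi 0) := fun t ht => by
    simp only [integrand]
    rw [scaleAverage_eq ht]
  refine IntegrableOn.congr_fun ?_ hcongr measurableSet_Ioi
  have hm : Measurable fun t => L t * scaleInt Ψ Φ ρ lam f t x / (t : ℂ) :=
    (hL.mul ((measurable_scaleInt h.measΨ (fun i => (h.ker i).meas) ρ lam hf.meas).comp
      (measurable_id.prodMk measurable_const))).div Complex.measurable_ofReal
  obtain ⟨C, hC, h1⟩ := h.exists_enorm_scaleInt_le_mul hf x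
  obtain ⟨C', hC', h2⟩ := h.exists_enorm_scaleInt_le_inv hf hΦ x
  have hinv : ∀ t : ℝ, 0 < t → ‖((t : ℂ))⁻¹‖ₑ = ENNReal.ofReal t⁻¹ := fun t ht => by
    rw [← ofReal_norm, norm_inv, Complex.norm_real, Real.norm_of_nonneg ht.le]
  rw [← Ioc_union_Ioi_eq_Ioi (zero_le_one (α := ℝ))]
  refine IntegrableOn.union ⟨hm.aestronglyMeasurable, ?_⟩ ⟨hm.aestronglyMeasurable, ?_⟩
  · refine lt_of_le_of_lt (setLIntegral_mono' measurableSet_Ioc (g := fun _ => Λ * C)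
      fun t ht => ?_) ?_
    · change ‖L t * scaleInt Ψ Φ ρ lam f t x / (t : ℂ)‖ₑ ≤ _
      rw [div_eq_mul_inv, enorm_mul, enorm_mul, hinv t ht.1]
      calc _ ≤ Λ * (C * ENNReal.ofReal t) * ENNReal.ofReal t⁻¹ :=
            mul_le_mul_left (mul_le_mul' (hLΛ t) (h1 t ht.1)) _
        _ = Λ * C * ENNReal.ofReal (t * t⁻¹) := by rw [ENNReal.ofReal_mul ht.1.le]; ring
        _ = _ := by rw [mul_inv_cancel₀ ht.1.ne', ENNReal.ofReal_one, mul_one]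
    · rw [lintegral_const, Measure.restrict_apply_univ, Real.volume_Ioc]
      finiteness
  · refine lt_of_le_of_lt (setLIntegral_mono' measurableSet_Ioi
      (g := fun t => Λ * C' * ENNReal.ofReal (t ^ (-2 : ℝ))) fun t ht => ?_) ?_
    · have ht' : (1 : ℝ) < t := ht
      have ht0 : 0 < t := by linarith
      change ‖L t * scaleInt Ψ Φ ρ lam f t x / (t : ℂ)‖ₑ ≤ _
      rw [div_eq_mul_inv, enorm_mul, enorm_mul, hinv t ht0]
      calc _ ≤ Λ * (C' * ENNReal.ofReal t⁻¹) * ENNReal.ofReal t⁻¹ :=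
            mul_le_mul_left (mul_le_mul' (hLΛ t) (h2 t ht'.le)) _
        _ = Λ * C' * ENNReal.ofReal (t⁻¹ * t⁻¹) := by
            rw [ENNReal.ofReal_mul (inv_nonneg.2 ht0.le)]; ring
        _ = _ := by
            congr 2
            rw [Real.rpow_neg ht0.le, ← mul_inv]
            norm_num [sq]
    · rw [lintegral_const_mul' _ _ (ENNReal.mul_ne_top hΛ hC')]
      refine ENNReal.mul_lt_top (ENNReal.mul_lt_top hΛ.lt_top hC'.lt_top) ?_
      have h3 := integrableOn_Ioi_rpow_of_lt (a := -2) (by norm_num) one_pos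
      have h4 := h3.2
      rwa [hasFiniteIntegral_iff_ofReal] at h4
      filter_upwards [ae_restrict_mem measurableSet_Ioi] with t ht
      exact Real.rpow_nonneg (zero_le_one.trans (le_of_lt ht)) _

theorem exists_lipInputs (f : Fin n → 𝓢(Rd d, ℂ)) (ζ : 𝓢(Rd d, ℂ)) (n₀ : Fin n) :
    ∃ A, LipInputs n₀ A (fun i => ⇑(f i)) ∧ ∀ y, ‖ζ y‖ₑ ≤ A := by
  have key : ∀ g : 𝓢(Rd d, ℂ), ∃ a : ℝ≥0∞, a ≠ ∞ ∧ (∀ y, ‖g y‖ₑ ≤ a) ∧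
      ∀ y y', ‖g y - g y'‖ₑ ≤ a * ‖y - y'‖ₑ := fun g => by
    have hc := cNorm_nonneg 1 (⇑g)
    have h1 : ∀ y, ‖g y‖ ≤ cNorm 1 g := fun y =>
      le_trans (le_mul_of_one_le_left (norm_nonneg _)
        (one_le_pow₀ (le_add_of_nonneg_right (norm_nonneg y)))) (pow_mul_norm_le_cNorm 1 g y)
    have h2 : ∀ y, ‖fderiv ℝ g y‖ ≤ d * cNorm 1 g := fun y =>
      ContinuousLinearMap.opNorm_le_bound _ (by positivity) fun v =>
        le_trans (le_mul_of_one_le_left (norm_nonneg _)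
          (one_le_pow₀ (le_add_of_nonneg_right (norm_nonneg y))))
          (pow_mul_norm_fderiv_le_cNorm le_rfl g y v)
    refine ⟨ENNReal.ofReal ((d + 1) * cNorm 1 g), ENNReal.ofReal_ne_top, fun y => ?_,
      fun y y' => ?_⟩
    · rw [← ofReal_norm]
      refine ENNReal.ofReal_le_ofReal ((h1 y).trans (le_mul_of_one_le_left hc ?_))
      linarith [(Nat.cast_nonneg d : (0 : ℝ) ≤ d)]
    · rw [← ofReal_norm, ← ofReal_norm, ← ENNReal.ofReal_mul (by positivity)]
      refine ENNReal.ofReal_le_ofReal ?_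
      have := convex_univ.norm_image_sub_le_of_norm_fderiv_le
        (fun w _ => g.differentiable w) (fun w _ => h2 w) (mem_univ y') (mem_univ y)
      refine this.trans (mul_le_mul_of_nonneg_right ?_ (norm_nonneg _))
      linarith
  choose a ha0 ha1 ha2 using key
  have hle : ∀ i, a (f i) ≤ a ζ + ∑ j, a (f j) := fun i =>
    (Finset.single_le_sum (f := fun j => a (f j)) (fun _ _ => zero_le)
      (Finset.mem_univ i)).trans le_add_self
  refine ⟨a ζ + ∑ j, a (f j), ⟨fun i => (f i).continuous.measurable,
    ENNReal.add_ne_top.2 ⟨ha0 ζ, ENNReal.sum_ne_top.2 fun j _ => ha0 _⟩,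
    fun i y => (ha1 _ y).trans (hle i), fun i y y' => (ha2 _ y y').trans
      (mul_le_mul_left (hle i) _), (f n₀).integrable.2.ne⟩, fun y => (ha1 ζ y).trans le_self_add⟩

end AbsoluteConvergence

/-! ### The L² limit agrees with the absolutely convergent integral. -/

section Agreement

variable {m : ℕ} {Ψ : Rd d → ℂ} {Φ : Fin (m + 1) → Rd d → ℂ} {B : Fin (m + 1) → ℝ≥0∞}
  {ρ lam : Fin (m + 1) → ℝ} {f : Fin (m + 1) → Rd d → ℂ} {Λ : ℝ≥0∞} {L L' : ℝ → ℂ}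

theorem tendsto_modelOpOn_Ioo {x : Rd d} (h : IntegrableOn (integrand Ψ Φ L ρ lam f x) (Ioi 0)) :
    Tendsto (fun k : ℕ => modelOpOn (Ioo ((k : ℝ) + 1)⁻¹ (k + 1)) Ψ Φ L ρ lam f x) atTop
      (𝓝 (modelOp Ψ Φ L ρ lam f x)) := by
  have hU : ⋃ k : ℕ, Ioo ((k : ℝ) + 1)⁻¹ (k + 1) = Ioi 0 := by
    ext t
    simp only [mem_iUnion, mem_Ioo, mem_Ioi]
    refine ⟨fun ⟨k, hk, _⟩ => lt_trans (by positivity) hk, fun ht => ?_⟩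
    obtain ⟨k, hk⟩ := exists_nat_gt (max t t⁻¹)
    refine ⟨k, inv_lt_of_inv_lt₀ ht ?_, ?_⟩
    · linarith [le_max_right t t⁻¹]
    · linarith [le_max_left t t⁻¹]
  have h1 := tendsto_setIntegral_of_monotone (μ := volume)
    (f := integrand Ψ Φ L ρ lam f x) (s := fun k : ℕ => Ioo ((k : ℝ) + 1)⁻¹ ((k : ℝ) + 1))
    (fun _ => measurableSet_Ioo) (fun k l hkl => by
      have hkl' : (k : ℝ) ≤ l := Nat.cast_le.2 hkl
      exact Ioo_subset_Ioo (inv_anti₀ (by positivity) (by linarith)) (by linarith))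
    (by rw [hU]; exact h)
  rwa [hU] at h1

theorem tendsto_inv_prod_atTop : Tendsto (fun k : ℕ => (((k : ℝ) + 1)⁻¹, (k : ℝ) + 1)) atTop
    (𝓝[>] 0 ×ˢ atTop) := by
  have h1 : Tendsto (fun k : ℕ => (k : ℝ) + 1) atTop atTop :=
    tendsto_atTop_add_const_right _ _ tendsto_natCast_atTop_atTop
  exact (tendsto_inv_atTop_nhdsGT_zero.comp h1).prodMk h1

/-- The limit in `L²` is the absolutely convergent integral where the latter exists. -/
theorem ModelData.ae_eq_modelOp (h : ModelData (Fin.last m) Ψ Φ B ρ lam)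
    (hL : Measurable L) (hLΛ : ∀ t, ‖L t‖ₑ ≤ Λ) (hΛ : Λ ≠ ∞)
    (hf : ∀ i, MemLp (f i) (expo m i)) {y : Lp ℂ 2 (volume : Measure (Rd d))}
    (hy : Tendsto (fun s : ℝ × ℝ => modelLp Ψ Φ ρ lam f ((Ioo s.1 s.2).indicator L))
      (𝓝[>] 0 ×ˢ atTop) (𝓝 y))
    (hint : ∀ x, IntegrableOn (integrand Ψ Φ L ρ lam f x) (Ioi 0)) :
    y =ᵐ[volume] modelOp Ψ Φ L ρ lam f := by
  have h1 := (h.tendsto_eLpNorm_sub hL hLΛ hΛ hf hy).comp tendsto_inv_prod_atTop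
  have hm : ∀ k : ℕ, AEStronglyMeasurable
      (modelOpOn (Ioo ((k : ℝ) + 1)⁻¹ (k + 1)) Ψ Φ L ρ lam f) volume := fun k => by
    have hk : (0 : ℝ) < ((k : ℝ) + 1)⁻¹ := by positivity
    obtain ⟨N, h3, h4⟩ := exists_zpow_two_bounds hk ((k : ℝ) + 1)
    rw [modelOpOn_Ioo_eq hk]
    exact ((weight_indicator_Ioo hL hLΛ h3 h4).memLp_modelOp hΛ h hf).1
  -- L² convergence yields a subsequence converging almost everywhere; pointwise, the truncations
  -- converge to the absolutely convergent integral, so the limits coincide.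
  obtain ⟨φ, hφ, h2⟩ := (tendstoInMeasure_of_tendsto_eLpNorm two_ne_zero hm
    (Lp.aestronglyMeasurable y) h1).exists_seq_tendsto_ae
  filter_upwards [h2] with x hx
  exact tendsto_nhds_unique hx ((tendsto_modelOpOn_Ioo (hint x)).comp hφ.tendsto_atTop)

theorem integrand_ae_eq (h : L =ᵐ[volume.restrict (Ioi 0)] L') (x : Rd d) :
    integrand Ψ Φ L ρ lam f x =ᵐ[volume.restrict (Ioi 0)] integrand Ψ Φ L' ρ lam f x := by
  filter_upwards [h] with t ht
  simp only [integrand]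
  rw [ht]

theorem modelOpOn_congr_ae {S : Set ℝ} (hS : S ⊆ Ioi 0) (h : L =ᵐ[volume.restrict (Ioi 0)] L') :
    modelOpOn S Ψ Φ L ρ lam f = modelOpOn S Ψ Φ L' ρ lam f :=
  funext fun x => integral_congr_ae (ae_restrict_of_ae_restrict_of_subset hS (integrand_ae_eq h x))

end Agreement

end ModelOperator

end

/-! ### The extension theorem for the model operator. -/

theorem theorem5p1 (d m : ℕ) :
    ∃ (M : ℕ) (C : ℝ), 0 ≤ C ∧
      ∀ (Ψ : 𝓢(ModelOperator.Rd d, ℂ)) (Φ : Fin (m + 1) → 𝓢(ModelOperator.Rd d, ℂ)),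
        ModelOperator.SpectrumInCorona (⇑Ψ) →
        (∀ i, ModelOperator.BoundedSpectrum (⇑(Φ i))) →
      ∀ L : ℝ → ℂ, MemLp L ∞ (volume.restrict (Ioi 0)) →
      ∀ ρ lam : Fin (m + 1) → ℝ,
        (∀ i, 0 < ρ i ∧ ρ i ≤ 1) →
        (∀ i, lam i ≠ 0) →
        (∀ i, |lam i| ≤ |lam (Fin.last m)|) →
        -- on Schwartz functions the integral over the scales converges absolutely
        (∀ (f : Fin (m + 1) → 𝓢(ModelOperator.Rd d, ℂ)) (x : ModelOperator.Rd d),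
          IntegrableOn
            (ModelOperator.integrand Ψ (fun i => ⇑(Φ i)) L ρ lam (fun i => ⇑(f i)) x) (Ioi 0)) ∧
        ∃ T : ContinuousMultilinearMap ℂ
            (fun i : Fin (m + 1) =>
              Lp ℂ (ModelOperator.expo m i) (volume : Measure (ModelOperator.Rd d)))
            (Lp ℂ 2 (volume : Measure (ModelOperator.Rd d))),
          -- `T` extends the model operator
          (∀ f : Fin (m + 1) → 𝓢(ModelOperator.Rd d, ℂ),
            T (fun i => (f i).toLp (ModelOperator.expo m i)) =ᵐ[volume]
              ModelOperator.modelOp Ψ (fun i => ⇑(Φ i)) L ρ lam (fun i => ⇑(f i))) ∧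
          -- on the whole space `T` is given by the improper integral over the scales, in `L²`
          (∀ f : (i : Fin (m + 1)) →
              Lp ℂ (ModelOperator.expo m i) (volume : Measure (ModelOperator.Rd d)),
            Tendsto
              (fun s : ℝ × ℝ => eLpNorm
                (ModelOperator.modelOpOn (Ioo s.1 s.2) Ψ (fun i => ⇑(Φ i)) L ρ lam
                  (fun i => ⇑(f i)) - ⇑(T f)) 2 volume)
              (𝓝[>] 0 ×ˢ atTop) (𝓝 0)) ∧
          -- with a bound that depends only on `‖L‖_∞`, `c_M(Ψ)` and the `c_M(Φ^i)`
          ‖T‖ ≤ C * (eLpNorm L ∞ (volume.restrict (Ioi 0))).toReal *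
            ModelOperator.cNorm M (⇑Ψ) * ∏ i, ModelOperator.cNorm M (⇑(Φ i)) := by
  refine ⟨m + d + 2, (ModelOperator.finalConst d m).toReal, ENNReal.toReal_nonneg, ?_⟩
  intro Ψ Φ hΨ _ L hL ρ lam hρ hlam hle
  have h := ModelOperator.modelData_schwartz (Φ := Φ) hΨ hρ hlam hle
  have hΛ := hL.2.ne
  -- The estimates need L Borel measurable and bounded everywhere. Changing L on a null set of
  -- scales alters none of the integrals.
  obtain ⟨L', hLm', hLL', hLΛ⟩ := ModelOperator.exists_bounded_representative hL
  have hint' : ∀ (f : Fin (m + 1) → 𝓢(ModelOperator.Rd d, ℂ)) (x : ModelOperator.Rd d),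
      IntegrableOn (ModelOperator.integrand Ψ (fun i => ⇑(Φ i)) L' ρ lam (fun i => ⇑(f i)) x)
        (Ioi 0) := fun f x => by
    obtain ⟨A, hf, hA⟩ := ModelOperator.exists_lipInputs f (Φ (Fin.last m)) (Fin.last m)
    exact h.integrableOn_integrand hf hA hLm' hLΛ hΛ x
  obtain ⟨T, hT, hTn⟩ := h.exists_extension hLm' hLΛ hΛ
  refine ⟨fun f x => (hint' f x).congr (ModelOperator.integrand_ae_eq hLL' x), T, fun f => ?_,
    fun F => ?_, hTn.trans (ModelOperator.toReal_modelConst_le _ hΛ)⟩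
  · have hcoe : ∀ i, ModelOperator.coeLp (fun i => (f i).toLp (ModelOperator.expo m i) volume) i
        =ᵐ[volume] f i := fun i => (f i).coeFn_toLp _ _
    have hf : ∀ i, MemLp (f i) (ModelOperator.expo m i) volume := fun i => (f i).memLp _ _
    have h1 := hT fun i => (f i).toLp (ModelOperator.expo m i) volume
    simp only [ModelOperator.modelLp_congr_ae hcoe] at h1
    have h2 := h.ae_eq_modelOp hLm' hLΛ hΛ hf h1 (hint' f)
    rwa [ModelOperator.modelOp, ModelOperator.modelOpOn_congr_ae subset_rfl hLL'] at h2
  · refine (h.tendsto_eLpNorm_sub hLm' hLΛ hΛ (ModelOperator.memLp_coeLp F) (hT F)).congr' ?_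
    have h1 : ∀ᶠ ε : ℝ in 𝓝[>] 0, 0 < ε := self_mem_nhdsWithin
    filter_upwards [h1.prod_inl (atTop : Filter ℝ)] with s hs
    have hsub : Ioo s.1 s.2 ⊆ Ioi 0 := fun t ht => lt_trans hs ht.1
    rw [ModelOperator.modelOpOn_congr_ae hsub hLL']
    rfl
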